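/- Small-goods guarantee for submodular max-min allocation. An instance consists of $n\ge 1$ agents, $m$ indivisible items, and for each agent $i$ a monotone submodular valuation $v_i:2^{[m]}\to\mathbb{R}_{\ge 0}$ with $v_i(\emptyset)=0$, accessible through a value oracle. Let $$\mathrm{OPT}=\max_{(A_1,\dots,A_n)}\ \min_{i} v_i(A_i),$$ the maximum being over all partitions of the items into $n$ (possibly empty) sets. There are a single randomized value-oracle algorithm and a fixed polynomial $p$ such that, for every instance and every integer $k\ge 1$ given to the algorithm along with $n$ and $m$, the following hold. (1) For every outcome of its random bits the algorithm halts in time at most $p(n+m+k)$ and outputs an allocation $(A_1,\dots,A_n)$. (2) For every $\varepsilon\ge 0$: if $v_i(\{j\})\le \varepsilon\cdot\mathrm{OPT}$ for all agents $i$ and items $j$, then with probability at least $1-1/k$ the output satisfies $$\min_i v_i(A_i)\ \ge\ \Bigl(1-\frac1e-\varepsilon-\frac1k\Bigr)\cdot\mathrm{OPT}.$$ Thus, for small goods, a $(1-\frac1e-\varepsilon-o(1))$-approximation is obtained in randomized polynomial time. Time is counted on a random access machine with fair coin flips, where a natural-number operation is charged by the bit lengths of the numbers involved, a real operation (addition,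 subtraction, comparison, multiplication or division by a natural number) costs $1$ plus the cost of any natural number it uses, and an oracle query costs $m+1$ plus the cost of evaluating its arguments. -/

import Mathlib

namespace MaxMin

/-! ### Valuations, allocations and the max-min objective -/

/-- Normalized, monotone, submodular valuations on the subsets of the `m` items.
Values are nonnegative because of `empty` and `mono`. -/
structure IsValuation {m : ℕ} (f : Finset (Fin m) → ℝ) : Prop where
  empty : f ∅ = 0
  mono : ∀ A B : Finset (Fin m), A ⊆ B → f A ≤ f B
  submodular : ∀ A B : Finset (Fin m), A ⊆ B → ∀ g : Fin m, g ∉ B →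
    f (insert g B) - f B ≤ f (insert g A) - f A

/-- An allocation is a map from items to agents; `bundle A i` is the set that agent `i` gets. -/
def bundle {n m : ℕ} (A : Fin m → Fin n) (i : Fin n) : Finset (Fin m) :=
  Finset.univ.filter (fun j => A j = i)

/-- The value of the worst-off agent (a minimum over finitely many agents). -/
noncomputable def minValue {n m : ℕ} (v : Fin n → Finset (Fin m) → ℝ) (A : Fin m → Fin n) : ℝ :=
  ⨅ i : Fin n, v i (bundle A i)

/-- The optimal max-min value (a maximum over finitely many allocations). -/
noncomputable def OPT {n m : ℕ} (v : Fin n → Finset (Fin m) → ℝ) : ℝ :=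
  ⨆ A : Fin m → Fin n, minValue v A

/-! ### Randomized programs with a value oracle

A random access machine in the form of a small imperative language.  Natural numbers are charged
by their bit length.  Real numbers (the values that the oracle returns) can be added, subtracted,
compared, and multiplied or divided by natural numbers; a product of two reals is not available,
so that on rational oracle values a computation of `t` steps needs only polynomially many bits. -/

/-- Memory: natural-number registers, arrays of natural numbers, arrays of real numbers. -/
structure State where
  reg : ℕ → ℕ
  arr : ℕ → ℕ → ℕ
  real : ℕ → ℕ → ℝ

/-- Expressions with natural-number values. -/
inductive NExp where
  | const (c : ℕ)
  | reg (x : ℕ)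
  | arr (a : ℕ) (i : NExp)
  | add (e₁ e₂ : NExp)
  | sub (e₁ e₂ : NExp)
  | mul (e₁ e₂ : NExp)
  | div (e₁ e₂ : NExp)

/-- Value of an expression; subtraction is truncated, division rounds down, `x / 0 = 0`. -/
def NExp.eval (s : State) : NExp → ℕ
  | .const c => c
  | .reg x => s.reg x
  | .arr a i => s.arr a (i.eval s)
  | .add e₁ e₂ => e₁.eval s + e₂.eval s
  | .sub e₁ e₂ => e₁.eval s - e₂.eval s
  | .mul e₁ e₂ => e₁.eval s * e₂.eval s
  | .div e₁ e₂ => e₁.eval s / e₂.eval s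

/-- Cost of evaluation: every node costs one plus the number of bits of its value. -/
def NExp.cost (s : State) : NExp → ℕ
  | .const c => 1 + Nat.size c
  | .reg x => 1 + Nat.size (s.reg x)
  | .arr a i => i.cost s + 1 + Nat.size (s.arr a (i.eval s))
  | .add e₁ e₂ => e₁.cost s + e₂.cost s + 1 + Nat.size (e₁.eval s + e₂.eval s)
  | .sub e₁ e₂ => e₁.cost s + e₂.cost s + 1 + Nat.size (e₁.eval s - e₂.eval s)
  | .mul e₁ e₂ => e₁.cost s + e₂.cost s + 1 + Nat.size (e₁.eval s * e₂.eval s)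
  | .div e₁ e₂ => e₁.cost s + e₂.cost s + 1 + Nat.size (e₁.eval s / e₂.eval s)

/-- Expressions with real values. -/
inductive RExp where
  | ofNat (e : NExp)
  | get (a : ℕ) (i : NExp)
  | add (r₁ r₂ : RExp)
  | sub (r₁ r₂ : RExp)
  | scale (e : NExp) (r : RExp)
  | divNat (r : RExp) (e : NExp)

/-- Value of a real expression; division by zero gives zero. -/
noncomputable def RExp.eval (s : State) : RExp → ℝ
  | .ofNat e => (e.eval s : ℝ)
  | .get a i => s.real a (i.eval s)
  | .add r₁ r₂ => r₁.eval s + r₂.eval s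
  | .sub r₁ r₂ => r₁.eval s - r₂.eval s
  | .scale e r => (e.eval s : ℝ) * r.eval s
  | .divNat r e => r.eval s / (e.eval s : ℝ)

/-- Cost of evaluation: every real operation costs one, on top of the natural-number costs. -/
def RExp.cost (s : State) : RExp → ℕ
  | .ofNat e => e.cost s + 1
  | .get _ i => i.cost s + 1
  | .add r₁ r₂ => r₁.cost s + r₂.cost s + 1
  | .sub r₁ r₂ => r₁.cost s + r₂.cost s + 1
  | .scale e r => e.cost s + r.cost s + 1
  | .divNat r e => r.cost s + e.cost s + 1

/-- Tests: comparison of natural numbers or of reals. -/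
inductive Test where
  | natLe (e₁ e₂ : NExp)
  | realLe (r₁ r₂ : RExp)

def Test.holds (s : State) : Test → Prop
  | .natLe e₁ e₂ => e₁.eval s ≤ e₂.eval s
  | .realLe r₁ r₂ => r₁.eval s ≤ r₂.eval s

def Test.cost (s : State) : Test → ℕ
  | .natLe e₁ e₂ => e₁.cost s + e₂.cost s + 1
  | .realLe r₁ r₂ => r₁.cost s + r₂.cost s + 1

/-- Programs. `flip x` writes a fair random bit into register `x`; `query a i e b` asks the value
oracle for the value, to agent number `e`, of the set of items marked by a nonzero entry in array
`b`, and stores the answer in entry `i` of the real array `a`. -/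
inductive Cmd where
  | skip
  | setReg (x : ℕ) (e : NExp)
  | setArr (a : ℕ) (i e : NExp)
  | setReal (a : ℕ) (i : NExp) (r : RExp)
  | flip (x : ℕ)
  | query (a : ℕ) (i e : NExp) (b : ℕ)
  | seq (c₁ c₂ : Cmd)
  | ite (b : Test) (c₁ c₂ : Cmd)
  | while (b : Test) (c : Cmd)

def State.setReg (s : State) (x y : ℕ) : State :=
  { s with reg := Function.update s.reg x y }

def State.setArr (s : State) (a i y : ℕ) : State :=
  { s with arr := Function.update s.arr a (Function.update (s.arr a) i y) }

def State.setReal (s : State) (a i : ℕ) (y : ℝ) : State :=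
  { s with real := Function.update s.real a (Function.update (s.real a) i y) }

/-- The set of items marked by array `b`. -/
def State.itemSet (m : ℕ) (s : State) (b : ℕ) : Finset (Fin m) :=
  Finset.univ.filter (fun j => s.arr b j ≠ 0)

/-- The answer of the value oracle (zero if there is no agent with number `e`). -/
def oracle {n m : ℕ} (v : Fin n → Finset (Fin m) → ℝ) (e : ℕ) (S : Finset (Fin m)) : ℝ :=
  if h : e < n then v ⟨e, h⟩ S else 0

/-- `Exec v c s l s' t`: with value oracle `v`, program `c` started in memory `s` halts in memory
`s'` after time `t`, having read exactly the random bits `l`. -/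
inductive Exec {n m : ℕ} (v : Fin n → Finset (Fin m) → ℝ) :
    Cmd → State → List Bool → State → ℕ → Prop where
  | skip (s : State) : Exec v .skip s [] s 1
  | setReg (s : State) (x : ℕ) (e : NExp) :
      Exec v (.setReg x e) s [] (s.setReg x (e.eval s)) (e.cost s + 1)
  | setArr (s : State) (a : ℕ) (i e : NExp) :
      Exec v (.setArr a i e) s [] (s.setArr a (i.eval s) (e.eval s)) (i.cost s + e.cost s + 1)
  | setReal (s : State) (a : ℕ) (i : NExp) (r : RExp) :
      Exec v (.setReal a i r) s [] (s.setReal a (i.eval s) (r.eval s)) (i.cost s + r.cost s + 1)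
  | flip (s : State) (x : ℕ) (b : Bool) :
      Exec v (.flip x) s [b] (s.setReg x b.toNat) 1
  | query (s : State) (a : ℕ) (i e : NExp) (b : ℕ) :
      Exec v (.query a i e b) s []
        (s.setReal a (i.eval s) (oracle v (e.eval s) (s.itemSet m b)))
        (i.cost s + e.cost s + m + 1)
  | seq {c₁ c₂ : Cmd} {s s₁ s₂ : State} {l₁ l₂ : List Bool} {t₁ t₂ : ℕ} :
      Exec v c₁ s l₁ s₁ t₁ → Exec v c₂ s₁ l₂ s₂ t₂ →
      Exec v (.seq c₁ c₂) s (l₁ ++ l₂) s₂ (t₁ + t₂)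
  | ite_true {b : Test} {c₁ c₂ : Cmd} {s s' : State} {l : List Bool} {t : ℕ} :
      b.holds s → Exec v c₁ s l s' t → Exec v (.ite b c₁ c₂) s l s' (b.cost s + t)
  | ite_false {b : Test} {c₁ c₂ : Cmd} {s s' : State} {l : List Bool} {t : ℕ} :
      ¬ b.holds s → Exec v c₂ s l s' t → Exec v (.ite b c₁ c₂) s l s' (b.cost s + t)
  | while_true {b : Test} {c : Cmd} {s s₁ s₂ : State} {l₁ l₂ : List Bool} {t₁ t₂ : ℕ} :
      b.holds s → Exec v c s l₁ s₁ t₁ → Exec v (.while b c) s₁ l₂ s₂ t₂ →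
      Exec v (.while b c) s (l₁ ++ l₂) s₂ (b.cost s + t₁ + t₂)
  | while_false {b : Test} {c : Cmd} {s : State} :
      ¬ b.holds s → Exec v (.while b c) s [] s (b.cost s)

/-- Initial memory: the number of agents, the number of items and the accuracy parameter are in
the registers 0, 1, 2; everything else is zero. -/
def initState (n m k : ℕ) : State where
  reg x := if x = 0 then n else if x = 1 then m else if x = 2 then k else 0
  arr _ _ := 0
  real _ _ := 0

/-- With value oracle `v`, accuracy parameter `k` and random bits `r`, the program halts within
time `T` and leaves the allocation `A` in array 0. (A run of time at most `T` reads at most `T`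
random bits, so that `T` of them suffice; the bits left over are ignored.) -/
def Outputs {n m : ℕ} (c : Cmd) (k : ℕ) (v : Fin n → Finset (Fin m) → ℝ) {T : ℕ}
    (r : Fin T → Bool) (A : Fin m → Fin n) : Prop :=
  ∃ (l : List Bool) (s : State) (t : ℕ), l <+: List.ofFn r ∧ t ≤ T ∧
    Exec v c (initState n m k) l s t ∧ ∀ j : Fin m, s.arr 0 j = A j

/-- Probability of an event over `T` independent fair random bits. -/
noncomputable def coinProb {T : ℕ} (E : Set (Fin T → Bool)) : ℝ :=
  (E.ncard : ℝ) / 2 ^ T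

end MaxMin

/-!
The approximation guarantee comes from a continuous-greedy argument in which all quantities are
natural numbers, followed by a rounding that moves fractions of items along closed walks.

Fix a target `T ≤ OPT`, truncate the valuations to `f_i = min (v_i / T) 1`, and write `F_i` for the
multilinear extension of `f_i`, restricted to the grid `{0, …, Q} ^ m` (`mext`). Every `F_i` is
estimated at all grid points by one family of random thresholds: a sample marks the items whose
threshold is below their level, and the value of the marked set is counted in units of `T / M`. By
Hoeffding's inequality and a union bound, all estimates are accurate at once with high probability
(`card_bad_le`, `failure_le`), so that from here on the argument is deterministic (`Approx`).

*Greedy phase.* In `Q` rounds one unit of every item at a time goes to the agent for whom it lowers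
the potential `∑ i, exp (-η F_i)` most. Compared with an optimal allocation, a round is an implicit
Euler step for `y' = 1 - y`, and after `Q` rounds every agent has `F_i ≥ 1 - 1 / e` up to small
errors (`RoundsDone.estimate_ge`).

*Rounding.* As long as items are split, consider the bipartite graph of agents and their split
items. An agent with a single split item gives its part away; this costs at most the value of one
item, and happens only once to an agent (`leafMove_step`). Otherwise there is a closed walk. If every
agent on it hands a part of one item to the next agent, then in one of the two directions the product
of the exchange rates is favourable (`Walk.prod_le_or`), and then amounts exist for which nobody loses
and some part is used up (`Cyc.exists_full`); the extension is convex along an exchange of two items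
(`mext_exchange`), so first-order estimates are on the safe side. The program finds the amounts by
handing on as much as each agent can afford, for two turns. Every step decreases the number of
nonzero entries, so that `n * m` steps suffice (`StepsDone.integral`).

*Target.* The optimum is attained by some agent, whose bundle contains an item worth between `OPT / m`
and `OPT`; a multiple of this value is just below `OPT` (`IsValuation.exists_target`). The algorithm
tries all such multiples and keeps the best allocation. Estimates need to be good only for the right
target, because the true value of every candidate is computed.

*Running time.* The deterministic part is written in a language whose only loops are counting loops
with bounds that are never changed (`Prog`). Its programs halt, and their running time is bounded by
a static step count (`Prog.exec`), which is a polynomial in the loop bounds. Correctness proofs then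
refer to the function `Prog.run` only.
-/

namespace MaxMin

/-! ### A structured language with bounded loops -/

/-- Boolean combinations of comparisons. -/
inductive BTest where
  | le (e₁ e₂ : NExp)
  | rle (r₁ r₂ : RExp)
  | and (b₁ b₂ : BTest)
  | not (b : BTest)

/-- The meaning of a test. -/
def BTest.holds (s : State) : BTest → Prop
  | .le e₁ e₂ => e₁.eval s ≤ e₂.eval s
  | .rle r₁ r₂ => r₁.eval s ≤ r₂.eval s
  | .and b₁ b₂ => b₁.holds s ∧ b₂.holds s
  | .not b => ¬ b.holds s

/-- The command that runs `c` if the test succeeds and `d` otherwise. Conjunctions duplicate `d`. -/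
def BTest.toCmd : BTest → Cmd → Cmd → Cmd
  | .le e₁ e₂, c, d => .ite (.natLe e₁ e₂) c d
  | .rle r₁ r₂, c, d => .ite (.realLe r₁ r₂) c d
  | .and b₁ b₂, c, d => b₁.toCmd (b₂.toCmd c d) d
  | .not b, c, d => b.toCmd d c

/-- Deterministic programs whose only loops are counting loops: `loop x p c` runs `c` for
`x = 0, 1, …, s.reg p - 1`. -/
inductive Prog where
  | skip
  | setReg (x : ℕ) (e : NExp)
  | setArr (a : ℕ) (i e : NExp)
  | setReal (a : ℕ) (i : NExp) (r : RExp)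
  | query (a : ℕ) (i e : NExp) (b : ℕ)
  | seq (c₁ c₂ : Prog)
  | ite (b : BTest) (c₁ c₂ : Prog)
  | loop (x p : ℕ) (c : Prog)

/-- The while loop into which a counting loop is translated. -/
def loopCmd (x p : ℕ) (c : Cmd) : Cmd :=
  .while (.natLe (.add (.reg x) (.const 1)) (.reg p))
    (.seq c (.setReg x (.add (.reg x) (.const 1))))

/-- The translation of a program into a command. -/
def Prog.toCmd : Prog → Cmd
  | .skip => .skip
  | .setReg x e => .setReg x e
  | .setArr a i e => .setArr a i e
  | .setReal a i r => .setReal a i r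
  | .query a i e b => .query a i e b
  | .seq c₁ c₂ => .seq c₁.toCmd c₂.toCmd
  | .ite b c₁ c₂ => b.toCmd c₁.toCmd c₂.toCmd
  | .loop x p c => .seq (.setReg x (.const 0)) (loopCmd x p c.toCmd)

/-- The memory after `i` rounds of a loop with counter `x` and body `f`. -/
def iter (f : State → State) (x : ℕ) : ℕ → State → State
  | 0, s => s.setReg x 0
  | i + 1, s => (f (iter f x i s)).setReg x (i + 1)

open Classical in
/-- The memory in which a program halts. -/
noncomputable def Prog.run {n m : ℕ} (v : Fin n → Finset (Fin m) → ℝ) : Prog → State → State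
  | .skip => fun s => s
  | .setReg x e => fun s => s.setReg x (e.eval s)
  | .setArr a i e => fun s => s.setArr a (i.eval s) (e.eval s)
  | .setReal a i r => fun s => s.setReal a (i.eval s) (r.eval s)
  | .query a i e b => fun s => s.setReal a (i.eval s) (oracle v (e.eval s) (s.itemSet m b))
  | .seq c₁ c₂ => fun s => c₂.run v (c₁.run v s)
  | .ite b c₁ c₂ => fun s => if b.holds s then c₁.run v s else c₂.run v s
  | .loop x p c => fun s => iter (c.run v) x (s.reg p) s

/-- The registers that a program may write, loop counters included. -/
def Prog.wr : Prog → List ℕ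
  | .setReg x _ => [x]
  | .seq c₁ c₂ => c₁.wr ++ c₂.wr
  | .ite _ c₁ c₂ => c₁.wr ++ c₂.wr
  | .loop x _ c => x :: c.wr
  | _ => []

/-- The arrays of natural numbers that a program may write. -/
def Prog.wa : Prog → List ℕ
  | .setArr a _ _ => [a]
  | .seq c₁ c₂ => c₁.wa ++ c₂.wa
  | .ite _ c₁ c₂ => c₁.wa ++ c₂.wa
  | .loop _ _ c => c.wa
  | _ => []

/-- The arrays of real numbers that a program may write. -/
def Prog.wl : Prog → List ℕ
  | .setReal a _ _ => [a]
  | .query a _ _ _ => [a]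
  | .seq c₁ c₂ => c₁.wl ++ c₂.wl
  | .ite _ c₁ c₂ => c₁.wl ++ c₂.wl
  | .loop _ _ c => c.wl
  | _ => []

/-- `s'` agrees with `s` on everything that `P` does not write. -/
structure Agree (P : Prog) (s s' : State) : Prop where
  reg : ∀ r, r ∉ P.wr → s'.reg r = s.reg r
  arr : ∀ a, a ∉ P.wa → s'.arr a = s.arr a
  real : ∀ a, a ∉ P.wl → s'.real a = s.real a

section StateLemmas

variable (s : State)

@[simp] theorem reg_setReg (x y z : ℕ) :
    (s.setReg x y).reg z = if z = x then y else s.reg z := by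
  simp [State.setReg, Function.update_apply]

@[simp] theorem arr_setReg (x y : ℕ) : (s.setReg x y).arr = s.arr := rfl
@[simp] theorem real_setReg (x y : ℕ) : (s.setReg x y).real = s.real := rfl
@[simp] theorem real_setArr (a i y : ℕ) : (s.setArr a i y).real = s.real := rfl
@[simp] theorem reg_setArr (a i y : ℕ) : (s.setArr a i y).reg = s.reg := rfl
@[simp] theorem reg_setReal (a i : ℕ) (y : ℝ) : (s.setReal a i y).reg = s.reg := rfl
@[simp] theorem arr_setReal (a i : ℕ) (y : ℝ) : (s.setReal a i y).arr = s.arr := rfl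

@[simp] theorem arr_setArr (a i y b : ℕ) :
    (s.setArr a i y).arr b = if b = a then Function.update (s.arr a) i y else s.arr b := by
  simp [State.setArr, Function.update_apply]

@[simp] theorem real_setReal (a i : ℕ) (y : ℝ) (b : ℕ) :
    (s.setReal a i y).real b = if b = a then Function.update (s.real a) i y else s.real b := by
  simp [State.setReal, Function.update_apply]

end StateLemmas

section Frame

variable {n m : ℕ} (v : Fin n → Finset (Fin m) → ℝ)

theorem agree_iter {c : Prog} (h : ∀ s, Agree c s (c.run v s)) (x p : ℕ) (s : State) (i : ℕ) :
    Agree (.loop x p c) s (iter (c.run v) x i s) := by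
  induction i with
  | zero =>
    refine ⟨fun r hr => ?_, fun a _ => rfl, fun a _ => rfl⟩
    simp only [Prog.wr, List.mem_cons, not_or] at hr
    simp [iter, hr.1]
  | succ i ih =>
    have h' := h (iter (c.run v) x i s)
    refine ⟨fun r hr => ?_, fun a ha => ?_, fun a ha => ?_⟩
    · have hr' := hr
      simp only [Prog.wr, List.mem_cons, not_or] at hr'
      simp [iter, hr'.1, h'.reg r hr'.2, ih.reg r hr]
    · simp only [iter, arr_setReg]
      rw [h'.arr a ha, ih.arr a ha]
    · simp only [iter, real_setReg]
      rw [h'.real a ha, ih.real a ha]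

theorem run_agree (P : Prog) (s : State) : Agree P s (P.run v s) := by
  induction P generalizing s with
  | skip => exact ⟨fun _ _ => rfl, fun _ _ => rfl, fun _ _ => rfl⟩
  | setReg x e =>
    refine ⟨fun r hr => ?_, fun _ _ => rfl, fun _ _ => rfl⟩
    simp only [Prog.wr, List.mem_singleton] at hr
    simp [Prog.run, hr]
  | setArr a i e =>
    refine ⟨fun _ _ => rfl, fun b hb => ?_, fun _ _ => rfl⟩
    simp only [Prog.wa, List.mem_singleton] at hb
    simp [Prog.run, hb]
  | setReal a i e =>
    refine ⟨fun _ _ => rfl, fun _ _ => rfl, fun b hb => ?_⟩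
    simp only [Prog.wl, List.mem_singleton] at hb
    simp [Prog.run, hb]
  | query a i e b =>
    refine ⟨fun _ _ => rfl, fun _ _ => rfl, fun b hb => ?_⟩
    simp only [Prog.wl, List.mem_singleton] at hb
    simp [Prog.run, hb]
  | seq c d hc hd =>
    have h1 := hc s
    have h2 := hd (c.run v s)
    refine ⟨fun r hr => ?_, fun r hr => ?_, fun r hr => ?_⟩
    · simp only [Prog.wr, List.mem_append, not_or] at hr
      exact (h2.reg r hr.2).trans (h1.reg r hr.1)
    · simp only [Prog.wa, List.mem_append, not_or] at hr
      exact (h2.arr r hr.2).trans (h1.arr r hr.1)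
    · simp only [Prog.wl, List.mem_append, not_or] at hr
      exact (h2.real r hr.2).trans (h1.real r hr.1)
  | ite b c d hc hd =>
    have h1 := hc s
    have h2 := hd s
    refine ⟨fun r hr => ?_, fun r hr => ?_, fun r hr => ?_⟩
    · simp only [Prog.wr, List.mem_append, not_or] at hr
      simp only [Prog.run]; split_ifs
      exacts [h1.reg r hr.1, h2.reg r hr.2]
    · simp only [Prog.wa, List.mem_append, not_or] at hr
      simp only [Prog.run]; split_ifs
      exacts [h1.arr r hr.1, h2.arr r hr.2]
    · simp only [Prog.wl, List.mem_append, not_or] at hr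
      simp only [Prog.run]; split_ifs
      exacts [h1.real r hr.1, h2.real r hr.2]
  | loop x p c hc => exact agree_iter v hc x p s _

/-- Invariants of counting loops. The invariant need not mention what the loop leaves alone: agreement
with the initial memory is available in each round. -/
theorem run_loop_inv {x p : ℕ} {c : Prog} {s : State} (I : ℕ → State → Prop)
    (h0 : I 0 (s.setReg x 0))
    (hs : ∀ i < s.reg p, ∀ st, st.reg x = i → Agree (.loop x p c) s st → I i st →
      I (i + 1) ((c.run v st).setReg x (i + 1))) :
    I (s.reg p) ((Prog.loop x p c).run v s) := by
  have key : ∀ i ≤ s.reg p, I i (iter (c.run v) x i s) := by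
    intro i
    induction i with
    | zero => intro _; exact h0
    | succ i ih =>
      intro hi
      refine hs i hi _ ?_ (agree_iter v (run_agree v c) x p s i) (ih (by omega))
      cases i <;> simp [iter]
  exact key _ le_rfl

end Frame

/-! ### Running times -/

/-- Natural-number expressions whose value has only boundedly more bits than the memory:
products may occur only in array indices. -/
def NExp.plain : NExp → Bool
  | .const _ => true
  | .reg _ => true
  | .arr _ _ => true
  | .add e₁ e₂ => e₁.plain && e₂.plain
  | .sub e₁ e₂ => e₁.plain && e₂.plain
  | .mul _ _ => false
  | .div e₁ e₂ => e₁.plain && e₂.plain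

/-- Every stored natural number has at most `S` bits. -/
def State.Bits (s : State) (S : ℕ) : Prop :=
  (∀ x, Nat.size (s.reg x) ≤ S) ∧ ∀ a i, Nat.size (s.arr a i) ≤ S

theorem State.Bits.mono {s : State} {S S' : ℕ} (h : s.Bits S) (hS : S ≤ S') : s.Bits S' :=
  ⟨fun x => (h.1 x).trans hS, fun a i => (h.2 a i).trans hS⟩

theorem State.Bits.setReg {s : State} {S x y : ℕ} (h : s.Bits S) (hy : Nat.size y ≤ S) :
    (s.setReg x y).Bits S := by
  refine ⟨fun z => ?_, h.2⟩
  rw [reg_setReg]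
  split_ifs
  exacts [hy, h.1 z]

theorem State.Bits.setArr {s : State} {S a i y : ℕ} (h : s.Bits S) (hy : Nat.size y ≤ S) :
    (s.setArr a i y).Bits S := by
  refine ⟨h.1, fun b z => ?_⟩
  rw [arr_setArr]
  split_ifs
  · rw [Function.update_apply]
    split_ifs
    exacts [hy, h.2 a z]
  · exact h.2 b z

theorem State.Bits.setReal {s : State} {S a i : ℕ} {y : ℝ} (h : s.Bits S) :
    (s.setReal a i y).Bits S := h

theorem size_add_le (a b : ℕ) {A B : ℕ} (ha : Nat.size a ≤ A) (hb : Nat.size b ≤ B) :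
    Nat.size (a + b) ≤ max A B + 1 := by
  rw [Nat.size_le] at *
  have h1 : 2 ^ A ≤ 2 ^ max A B := Nat.pow_le_pow_right (by norm_num) (le_max_left _ _)
  have h2 : 2 ^ B ≤ 2 ^ max A B := Nat.pow_le_pow_right (by norm_num) (le_max_right _ _)
  rw [pow_succ]
  omega

theorem size_mul_le (a b : ℕ) {A B : ℕ} (ha : Nat.size a ≤ A) (hb : Nat.size b ≤ B) :
    Nat.size (a * b) ≤ A + B := by
  rw [Nat.size_le] at *
  rw [pow_add]
  exact Nat.mul_lt_mul'' ha hb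

/-- Value and cost of an expression are linear in the number of bits of the memory; the constant
depends on the expression alone. -/
theorem NExp.exists_bound (e : NExp) : ∃ E, ∀ s S, State.Bits s S →
    Nat.size (e.eval s) ≤ E * (S + 1) ∧ e.cost s ≤ E * (S + 1) := by
  have lin : ∀ (E₁ E₂ S : ℕ) {a b c a' b' : ℕ}, a ≤ E₁ * (S + 1) → a' ≤ E₁ * (S + 1) →
      b ≤ E₂ * (S + 1) → b' ≤ E₂ * (S + 1) → c ≤ a + b + 1 →
      c ≤ (2 * E₁ + 2 * E₂ + 2) * (S + 1) ∧
        a' + b' + 1 + c ≤ (2 * E₁ + 2 * E₂ + 2) * (S + 1) := by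
    intro E₁ E₂ S a b c a' b' h1 h2 h3 h4 h5
    constructor <;> nlinarith
  induction e with
  | const c =>
    refine ⟨1 + Nat.size c, fun s S _ => ⟨?_, ?_⟩⟩ <;> simp only [NExp.eval, NExp.cost] <;> nlinarith
  | reg x =>
    refine ⟨1, fun s S h => ⟨?_, ?_⟩⟩ <;> simp only [NExp.eval, NExp.cost] <;> linarith [h.1 x]
  | arr a i hi =>
    obtain ⟨E, hE⟩ := hi
    refine ⟨E + 1, fun s S h => ⟨?_, ?_⟩⟩ <;> simp only [NExp.eval, NExp.cost] <;>
      nlinarith [h.2 a (i.eval s), hE s S h]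
  | add e f he hf =>
    obtain ⟨E, hE⟩ := he
    obtain ⟨F, hF⟩ := hf
    refine ⟨2 * E + 2 * F + 2, fun s S h => lin E F S (hE s S h).1 (hE s S h).2 (hF s S h).1
      (hF s S h).2 ?_⟩
    have := size_add_le (e.eval s) (f.eval s) le_rfl le_rfl
    simp only [NExp.eval]
    omega
  | sub e f he hf =>
    obtain ⟨E, hE⟩ := he
    obtain ⟨F, hF⟩ := hf
    refine ⟨2 * E + 2 * F + 2, fun s S h => lin E F S (hE s S h).1 (hE s S h).2 (hF s S h).1
      (hF s S h).2 ?_⟩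
    exact (Nat.size_le_size (Nat.sub_le _ _)).trans (by omega)
  | mul e f he hf =>
    obtain ⟨E, hE⟩ := he
    obtain ⟨F, hF⟩ := hf
    refine ⟨2 * E + 2 * F + 2, fun s S h => lin E F S (hE s S h).1 (hE s S h).2 (hF s S h).1
      (hF s S h).2 ?_⟩
    exact (size_mul_le _ _ le_rfl le_rfl).trans (by omega)
  | div e f he hf =>
    obtain ⟨E, hE⟩ := he
    obtain ⟨F, hF⟩ := hf
    refine ⟨2 * E + 2 * F + 2, fun s S h => lin E F S (hE s S h).1 (hE s S h).2 (hF s S h).1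
      (hF s S h).2 ?_⟩
    exact (Nat.size_le_size (Nat.div_le_self _ _)).trans (by omega)

/-- A plain expression adds boundedly many bits. With products, the bits could double in every round
of a loop. -/
theorem NExp.exists_size_bound (e : NExp) (hp : e.plain = true) :
    ∃ E, ∀ s S, State.Bits s S → Nat.size (e.eval s) ≤ S + E := by
  induction e with
  | const c => exact ⟨Nat.size c, fun s S _ => Nat.le_add_left _ _⟩
  | reg x => exact ⟨0, fun s S h => h.1 x⟩
  | arr a i _ => exact ⟨0, fun s S h => h.2 a _⟩
  | add e f he hf =>
    simp only [NExp.plain, Bool.and_eq_true] at hp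
    obtain ⟨E, hE⟩ := he hp.1
    obtain ⟨F, hF⟩ := hf hp.2
    refine ⟨E + F + 1, fun s S h => ?_⟩
    exact (size_add_le _ _ (hE s S h) (hF s S h)).trans (by omega)
  | sub e f he hf =>
    simp only [NExp.plain, Bool.and_eq_true] at hp
    obtain ⟨E, hE⟩ := he hp.1
    exact ⟨E, fun s S h => (Nat.size_le_size (Nat.sub_le _ _)).trans (hE s S h)⟩
  | mul e f he hf => simp [NExp.plain] at hp
  | div e f he hf =>
    simp only [NExp.plain, Bool.and_eq_true] at hp
    obtain ⟨E, hE⟩ := he hp.1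
    exact ⟨E, fun s S h => (Nat.size_le_size (Nat.div_le_self _ _)).trans (hE s S h)⟩

theorem RExp.exists_bound (r : RExp) : ∃ E, ∀ s S, State.Bits s S → r.cost s ≤ E * (S + 1) := by
  induction r with
  | ofNat e =>
    obtain ⟨E, hE⟩ := e.exists_bound
    exact ⟨E + 1, fun s S h => by simp only [RExp.cost]; nlinarith [hE s S h]⟩
  | get a e =>
    obtain ⟨E, hE⟩ := e.exists_bound
    exact ⟨E + 1, fun s S h => by simp only [RExp.cost]; nlinarith [hE s S h]⟩
  | add r q hr hq =>
    obtain ⟨E, hE⟩ := hr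
    obtain ⟨F, hF⟩ := hq
    exact ⟨E + F + 1, fun s S h => by simp only [RExp.cost]; nlinarith [hE s S h, hF s S h]⟩
  | sub r q hr hq =>
    obtain ⟨E, hE⟩ := hr
    obtain ⟨F, hF⟩ := hq
    exact ⟨E + F + 1, fun s S h => by simp only [RExp.cost]; nlinarith [hE s S h, hF s S h]⟩
  | scale e r hr =>
    obtain ⟨E, hE⟩ := hr
    obtain ⟨F, hF⟩ := e.exists_bound
    exact ⟨E + F + 1, fun s S h => by simp only [RExp.cost]; nlinarith [hE s S h, hF s S h]⟩
  | divNat r e hr =>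
    obtain ⟨E, hE⟩ := hr
    obtain ⟨F, hF⟩ := e.exists_bound
    exact ⟨E + F + 1, fun s S h => by simp only [RExp.cost]; nlinarith [hE s S h, hF s S h]⟩

section Exec

variable {n m : ℕ}

/-- Evaluation of a test costs linear time. -/
theorem BTest.exec (b : BTest) : ∃ E, ∀ {n m : ℕ} (v : Fin n → Finset (Fin m) → ℝ) s S,
    State.Bits s S → ∀ c d s' t,
      (b.holds s → Exec v c s [] s' t →
        ∃ t', Exec v (b.toCmd c d) s [] s' t' ∧ t' ≤ t + E * (S + 1)) ∧
      (¬ b.holds s → Exec v d s [] s' t →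
        ∃ t', Exec v (b.toCmd c d) s [] s' t' ∧ t' ≤ t + E * (S + 1)) := by
  induction b with
  | le e f =>
    obtain ⟨E, hE⟩ := e.exists_bound
    obtain ⟨F, hF⟩ := f.exists_bound
    refine ⟨E + F + 1, fun v s S h c d s' t => ⟨fun hb hx => ⟨_, Exec.ite_true hb hx, ?_⟩,
      fun hb hx => ⟨_, Exec.ite_false hb hx, ?_⟩⟩⟩ <;>
    · simp only [Test.cost]
      nlinarith [hE s S h, hF s S h]
  | rle e f =>
    obtain ⟨E, hE⟩ := e.exists_bound
    obtain ⟨F, hF⟩ := f.exists_bound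
    refine ⟨E + F + 1, fun v s S h c d s' t => ⟨fun hb hx => ⟨_, Exec.ite_true hb hx, ?_⟩,
      fun hb hx => ⟨_, Exec.ite_false hb hx, ?_⟩⟩⟩ <;>
    · simp only [Test.cost]
      nlinarith [hE s S h, hF s S h]
  | and b₁ b₂ h₁ h₂ =>
    obtain ⟨E, hE⟩ := h₁
    obtain ⟨F, hF⟩ := h₂
    refine ⟨E + F, fun v s S h c d s' t => ⟨fun hb hx => ?_, fun hb hx => ?_⟩⟩
    · obtain ⟨t', h', ht'⟩ := (hF v s S h c d s' t).1 hb.2 hx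
      obtain ⟨t'', h'', ht''⟩ := (hE v s S h (b₂.toCmd c d) d s' t').1 hb.1 h'
      exact ⟨t'', h'', by linarith⟩
    · by_cases hb1 : b₁.holds s
      · obtain ⟨t', h', ht'⟩ := (hF v s S h c d s' t).2 (fun h2 => hb ⟨hb1, h2⟩) hx
        obtain ⟨t'', h'', ht''⟩ := (hE v s S h (b₂.toCmd c d) d s' t').1 hb1 h'
        exact ⟨t'', h'', by linarith⟩
      · obtain ⟨t'', h'', ht''⟩ := (hE v s S h (b₂.toCmd c d) d s' t).2 hb1 hx
        exact ⟨t'', h'', by nlinarith⟩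
  | not b hb =>
    obtain ⟨E, hE⟩ := hb
    exact ⟨E, fun v s S h c d s' t => ⟨fun hb hx => (hE v s S h d c s' t).2 hb hx,
      fun hb hx => (hE v s S h d c s' t).1 (not_not.mp hb) hx⟩⟩

end Exec

/-- Well-formedness relative to a list `bd` of registers that bound loops: they are never written,
a loop body does not write the loop counter, and stored expressions are plain. -/
def Prog.okIn (bd : List ℕ) : Prog → Bool
  | .skip => true
  | .setReg x e => !bd.contains x && e.plain
  | .setArr _ _ e => e.plain
  | .setReal _ _ _ => true
  | .query _ _ _ _ => true
  | .seq c₁ c₂ => c₁.okIn bd && c₂.okIn bd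
  | .ite _ c₁ c₂ => c₁.okIn bd && c₂.okIn bd
  | .loop x p c => bd.contains p && !bd.contains x && !c.wr.contains x && c.okIn bd

/-- A bound for the number of steps when all loops have at most `B` rounds. -/
def Prog.stat (B : ℕ) : Prog → ℕ
  | .seq c₁ c₂ => c₁.stat B + c₂.stat B
  | .ite _ c₁ c₂ => 1 + c₁.stat B + c₂.stat B
  | .loop _ _ c => 2 + B * (c.stat B + 2)
  | _ => 1

/-- The static step bound is a polynomial in the loop bound. -/
theorem Prog.exists_stat_le (P : Prog) : ∃ K, ∀ B, P.stat B ≤ K * (B + 1) ^ K := by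
  have triv : ∃ K, ∀ B, 1 ≤ K * (B + 1) ^ K := ⟨1, fun B => by simp⟩
  have comb : ∀ (K L B a b : ℕ), a ≤ K * (B + 1) ^ K → b ≤ L * (B + 1) ^ L →
      1 + a + b ≤ (K + L + 1) * (B + 1) ^ (K + L + 1) := by
    intro K L B a b ha hb
    have h1 : (B + 1) ^ K ≤ (B + 1) ^ (K + L + 1) := Nat.pow_le_pow_right (by omega) (by omega)
    have h2 : (B + 1) ^ L ≤ (B + 1) ^ (K + L + 1) := Nat.pow_le_pow_right (by omega) (by omega)
    have h3 : 1 ≤ (B + 1) ^ (K + L + 1) := Nat.one_le_pow _ _ (by omega)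
    nlinarith
  induction P with
  | skip => exact triv
  | setReg => exact triv
  | setArr => exact triv
  | setReal => exact triv
  | query => exact triv
  | seq c d hc hd =>
    obtain ⟨K, hK⟩ := hc
    obtain ⟨L, hL⟩ := hd
    exact ⟨K + L + 1, fun B => le_trans (by simp only [Prog.stat]; omega) (comb K L B _ _ (hK B) (hL B))⟩
  | ite b c d hc hd =>
    obtain ⟨K, hK⟩ := hc
    obtain ⟨L, hL⟩ := hd
    exact ⟨K + L + 1, fun B => comb K L B _ _ (hK B) (hL B)⟩
  | loop x p c hc =>
    obtain ⟨K, hK⟩ := hc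
    refine ⟨K + 4, fun B => ?_⟩
    have h := hK B
    have h1 : (B + 1) ^ (K + 4) = (B + 1) ^ K * (B + 1) ^ 3 * (B + 1) := by ring
    have h0 : 1 ≤ (B + 1) ^ K := Nat.one_le_pow _ _ (by omega)
    have h3 : 1 ≤ (B + 1) ^ 3 := Nat.one_le_pow _ _ (by omega)
    simp only [Prog.stat]
    calc 2 + B * (c.stat B + 2) ≤ 2 + B * (K * (B + 1) ^ K + 2) := by gcongr
      _ ≤ (K + 4) * ((B + 1) ^ K * (B + 1)) := by nlinarith
      _ ≤ (K + 4) * ((B + 1) ^ K * (B + 1) ^ 3 * (B + 1)) := by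
          gcongr
          nlinarith
      _ = _ := by rw [h1]

theorem Prog.notMem_wr_of_okIn {bd : List ℕ} {P : Prog} (h : P.okIn bd = true) {p : ℕ}
    (hp : p ∈ bd) : p ∉ P.wr := by
  induction P with
  | setReg x e =>
    simp only [Prog.okIn, Bool.and_eq_true, Bool.not_eq_true', List.contains_eq_mem,
      decide_eq_false_iff_not] at h
    simp only [Prog.wr, List.mem_singleton]
    rintro rfl
    exact h.1 hp
  | seq c d hc hd =>
    simp only [Prog.okIn, Bool.and_eq_true] at h
    simp [Prog.wr, hc h.1, hd h.2]
  | ite b c d hc hd =>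
    simp only [Prog.okIn, Bool.and_eq_true] at h
    simp [Prog.wr, hc h.1, hd h.2]
  | loop x q c hc =>
    simp only [Prog.okIn, Bool.and_eq_true, Bool.not_eq_true', List.contains_eq_mem,
      decide_eq_false_iff_not] at h
    simp only [Prog.wr, List.mem_cons, not_or]
    refine ⟨?_, hc h.2⟩
    rintro rfl
    exact h.1.1.2 hp
  | _ => simp [Prog.wr]

/-- A bound for the time of `u` steps from a memory with `S`-bit numbers: each step costs a constant
times the current number of bits, or the `m + 1` of an oracle query, and adds boundedly many bits. -/
def timeBound (E u S m : ℕ) : ℕ := E * u * (S + E * u + m + 1)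

/-- The time of a loop from round `i` on, where `V` bounds the cost of the test and of the increment,
and `t₂` the time of a whole round. -/
theorem exec_loopCmd {n m : ℕ} (v : Fin n → Finset (Fin m) → ℝ) {x p : ℕ} {c : Prog} {s : State}
    (hxp : x ≠ p) (hx : x ∉ c.wr) (hp : p ∉ c.wr) {V t₁ t₂ : ℕ}
    (hbody : ∀ i < s.reg p, ∃ t, Exec v c.toCmd (iter (c.run v) x i s) []
      (c.run v (iter (c.run v) x i s)) t ∧ t ≤ t₁)
    (hV : ∀ i ≤ s.reg p, (NExp.add (.reg x) (.const 1)).cost (iter (c.run v) x i s) ≤ V ∧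
      (NExp.reg p).cost (iter (c.run v) x i s) ≤ V)
    (hV' : ∀ i < s.reg p, (NExp.add (.reg x) (.const 1)).cost
      (c.run v (iter (c.run v) x i s)) ≤ V) (ht₂ : t₁ + 3 * V + 2 ≤ t₂) :
    ∀ k i, i + k = s.reg p → ∃ t, Exec v (loopCmd x p c.toCmd) (iter (c.run v) x i s) []
      (iter (c.run v) x (s.reg p) s) t ∧ t ≤ k * t₂ + (2 * V + 1) := by
  have hreg : ∀ i, (iter (c.run v) x i s).reg x = i ∧ (iter (c.run v) x i s).reg p = s.reg p := by
    intro i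
    constructor
    · cases i <;> simp [iter]
    · refine (agree_iter v (run_agree v c) x p s i).reg p ?_
      simp [Prog.wr, hxp.symm, hp]
  intro k
  induction k with
  | zero =>
    intro i hi
    obtain rfl : i = s.reg p := by omega
    refine ⟨_, Exec.while_false ?_, ?_⟩
    · simp [Test.holds, NExp.eval, hreg]
    · have := hV _ le_rfl
      simp only [Test.cost]
      omega
  | succ k ih =>
    intro i hi
    obtain ⟨t, ht, htle⟩ := hbody i (by omega)
    obtain ⟨t', ht', htle'⟩ := ih (i + 1) (by omega)
    have hset : Exec v (.setReg x (.add (.reg x) (.const 1))) (c.run v (iter (c.run v) x i s)) []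
        (iter (c.run v) x (i + 1) s)
        ((NExp.add (.reg x) (.const 1)).cost (c.run v (iter (c.run v) x i s)) + 1) := by
      have := Exec.setReg (v := v) (c.run v (iter (c.run v) x i s)) x (.add (.reg x) (.const 1))
      have he : (NExp.add (.reg x) (.const 1)).eval (c.run v (iter (c.run v) x i s)) = i + 1 := by
        simp only [NExp.eval]
        rw [(run_agree v c _).reg x hx, (hreg i).1]
      rw [he] at this
      exact this
    have hw := Exec.while_true (v := v) (b := .natLe (.add (.reg x) (.const 1)) (.reg p))
      (c := .seq c.toCmd (.setReg x (.add (.reg x) (.const 1))))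
      (by simp only [Test.holds, NExp.eval, hreg]; omega) (Exec.seq ht hset) ht'
    refine ⟨_, hw, ?_⟩
    have h1 := hV i (by omega)
    have h2 := hV' i (by omega)
    simp only [Test.cost]
    rw [Nat.succ_mul]
    omega

theorem loop_growth {S G E u i : ℕ} (h : E ≤ G) :
    S + G * (1 + i * (u + 2)) + E * u + G ≤ S + G * (1 + (i + 1) * (u + 2)) := by
  have : E * u ≤ G * u := by gcongr
  calc S + G * (1 + i * (u + 2)) + E * u + G ≤ S + G * (1 + i * (u + 2)) + G * u + G := by omega
    _ ≤ S + G * (1 + i * (u + 2)) + G * u + G + G := by omega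
    _ = _ := by ring

/-- A program halts in the memory given by `run`, within the time of its static step bound; in
each step the numbers grow by boundedly many bits. -/
theorem Prog.exec (bd : List ℕ) (P : Prog) (hP : P.okIn bd = true) :
    ∃ E, ∀ {n m : ℕ} (v : Fin n → Finset (Fin m) → ℝ) (B S : ℕ) (s : State),
      (∀ p ∈ bd, s.reg p ≤ B) → s.Bits S →
      (∃ t, Exec v P.toCmd s [] (P.run v s) t ∧ t ≤ timeBound E (P.stat B) S m) ∧
        (P.run v s).Bits (S + E * P.stat B) := by
  induction P with
  | skip =>
    refine ⟨1, fun v B S s _ h => ⟨⟨_, Exec.skip s, ?_⟩, h.mono (by omega)⟩⟩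
    simp only [timeBound, Prog.stat]; omega
  | setReg x e =>
    simp only [Prog.okIn, Bool.and_eq_true] at hP
    obtain ⟨E, hE⟩ := e.exists_bound
    obtain ⟨F, hF⟩ := e.exists_size_bound hP.2
    refine ⟨E + F + 1, fun v B S s _ h => ⟨⟨_, Exec.setReg s x e, ?_⟩, ?_⟩⟩
    · simp only [timeBound, Prog.stat]; nlinarith [hE s S h]
    · refine (h.mono (by omega)).setReg ((hF s S h).trans ?_)
      simp only [Prog.stat]; omega
  | setArr a i e =>
    simp only [Prog.okIn] at hP
    obtain ⟨E, hE⟩ := e.exists_bound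
    obtain ⟨F, hF⟩ := e.exists_size_bound hP
    obtain ⟨D, hD⟩ := i.exists_bound
    refine ⟨E + F + D + 1, fun v B S s _ h => ⟨⟨_, Exec.setArr s a i e, ?_⟩, ?_⟩⟩
    · simp only [timeBound, Prog.stat]; nlinarith [hE s S h, hD s S h]
    · refine (h.mono (by omega)).setArr ((hF s S h).trans ?_)
      simp only [Prog.stat]; omega
  | setReal a i r =>
    obtain ⟨E, hE⟩ := r.exists_bound
    obtain ⟨D, hD⟩ := i.exists_bound
    refine ⟨E + D + 1, fun v B S s _ h => ⟨⟨_, Exec.setReal s a i r, ?_⟩, h.mono (by omega)⟩⟩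
    simp only [timeBound, Prog.stat]; nlinarith [hE s S h, hD s S h]
  | query a i e b =>
    obtain ⟨E, hE⟩ := e.exists_bound
    obtain ⟨D, hD⟩ := i.exists_bound
    refine ⟨E + D + 1, fun v B S s _ h => ⟨⟨_, Exec.query s a i e b, ?_⟩, h.mono (by omega)⟩⟩
    simp only [timeBound, Prog.stat]; nlinarith [hE s S h, hD s S h]
  | seq c d hc hd =>
    simp only [Prog.okIn, Bool.and_eq_true] at hP
    obtain ⟨E, hE⟩ := hc hP.1
    obtain ⟨F, hF⟩ := hd hP.2
    refine ⟨E + F, fun {n m} v B S s hB h => ?_⟩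
    obtain ⟨⟨t, ht, hle⟩, hb⟩ := hE v B S s hB h
    have hB' : ∀ p ∈ bd, (c.run v s).reg p ≤ B := fun p hp => by
      rw [(run_agree v c s).reg p (c.notMem_wr_of_okIn hP.1 hp)]
      exact hB p hp
    obtain ⟨⟨t', ht', hle'⟩, hb'⟩ := hF v B _ _ hB' hb
    refine ⟨⟨_, Exec.seq ht ht', ?_⟩, hb'.mono ?_⟩
    · refine (add_le_add hle hle').trans ?_
      simp only [timeBound, Prog.stat]
      have h1 : S + E * c.stat B ≤ S + (E + F) * (c.stat B + d.stat B) := by nlinarith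
      have h2 : S + E * c.stat B + F * d.stat B ≤ S + (E + F) * (c.stat B + d.stat B) := by
        nlinarith
      calc E * c.stat B * (S + E * c.stat B + m + 1) +
            F * d.stat B * (S + E * c.stat B + F * d.stat B + m + 1)
          ≤ (E + F) * c.stat B * (S + (E + F) * (c.stat B + d.stat B) + m + 1) +
            (E + F) * d.stat B * (S + (E + F) * (c.stat B + d.stat B) + m + 1) := by
            gcongr <;> omega
        _ = _ := by ring
    · simp only [Prog.stat]; nlinarith
  | ite b c d hc hd =>
    simp only [Prog.okIn, Bool.and_eq_true] at hP
    obtain ⟨E, hE⟩ := hc hP.1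
    obtain ⟨F, hF⟩ := hd hP.2
    obtain ⟨D, hD⟩ := b.exec
    refine ⟨E + F + D, fun {n m} v B S s hB h => ?_⟩
    obtain ⟨⟨t, ht, hle⟩, hb⟩ := hE v B S s hB h
    obtain ⟨⟨t', ht', hle'⟩, hb'⟩ := hF v B S s hB h
    simp only [Prog.run, Prog.toCmd]
    split_ifs with hbs
    · obtain ⟨t'', h'', hle''⟩ := (hD v s S h c.toCmd d.toCmd _ _).1 hbs ht
      refine ⟨⟨t'', h'', hle''.trans ?_⟩, hb.mono ?_⟩
      · refine (Nat.add_le_add_right hle _).trans ?_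
        simp only [timeBound, Prog.stat]
        calc E * c.stat B * (S + E * c.stat B + m + 1) + D * (S + 1)
            ≤ (E + F + D) * (c.stat B) * (S + (E + F + D) * (1 + c.stat B + d.stat B) + m + 1) +
              (E + F + D) * (1 + d.stat B) *
                (S + (E + F + D) * (1 + c.stat B + d.stat B) + m + 1) := by
              gcongr <;> nlinarith
          _ = _ := by ring
      · simp only [Prog.stat]; nlinarith
    · obtain ⟨t'', h'', hle''⟩ := (hD v s S h c.toCmd d.toCmd _ _).2 hbs ht'
      refine ⟨⟨t'', h'', hle''.trans ?_⟩, hb'.mono ?_⟩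
      · refine (Nat.add_le_add_right hle' _).trans ?_
        simp only [timeBound, Prog.stat]
        calc F * d.stat B * (S + F * d.stat B + m + 1) + D * (S + 1)
            ≤ (E + F + D) * (d.stat B) * (S + (E + F + D) * (1 + c.stat B + d.stat B) + m + 1) +
              (E + F + D) * (1 + c.stat B) *
                (S + (E + F + D) * (1 + c.stat B + d.stat B) + m + 1) := by
              gcongr <;> nlinarith
          _ = _ := by ring
      · simp only [Prog.stat]; nlinarith
  | loop x p c hc =>
    simp only [Prog.okIn, Bool.and_eq_true, Bool.not_eq_true', List.contains_eq_mem,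
      decide_eq_false_iff_not, decide_eq_true_eq] at hP
    obtain ⟨⟨⟨hp, hx⟩, hxc⟩, hok⟩ := hP
    obtain ⟨E, hE⟩ := hc hok
    obtain ⟨E₁, hE₁⟩ := (NExp.add (.reg x) (.const 1)).exists_bound
    obtain ⟨E₂, hE₂⟩ := (NExp.add (.reg x) (.const 1)).exists_size_bound rfl
    obtain ⟨E₃, hE₃⟩ := (NExp.reg p).exists_bound
    obtain ⟨E₄, hE₄⟩ := (NExp.const 0).exists_bound
    have hpc : p ∉ c.wr := c.notMem_wr_of_okIn hok hp
    have hxp : x ≠ p := by rintro rfl; exact hx hp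
    refine ⟨E + 3 * E₁ + E₂ + 3 * E₃ + E₄ + 3, fun {n m} v B S s hB h => ?_⟩
    set G := E + 3 * E₁ + E₂ + 3 * E₃ + E₄ + 3 with hG
    set u := c.stat B with hu
    have hBi : ∀ i, ∀ q ∈ bd, (iter (c.run v) x i s).reg q ≤ B := by
      intro i q hq
      rw [(agree_iter v (run_agree v c) x p s i).reg q]
      · exact hB q hq
      · simp only [Prog.wr, List.mem_cons, not_or]
        exact ⟨fun h => hx (h ▸ hq), c.notMem_wr_of_okIn hok hq⟩
    have hEG : E ≤ G := by omega
    have hrunx : ∀ i, (c.run v (iter (c.run v) x i s)).reg x = i := by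
      intro i
      rw [(run_agree v c _).reg x hxc]
      cases i <;> simp [iter]
    have hmono : ∀ i, i < s.reg p → S + G * (1 + (i + 1) * (u + 2)) ≤
        S + G * (1 + s.reg p * (u + 2)) := by
      intro i hi
      gcongr
      omega
    -- after `i` rounds, each of which adds at most `G * (u + 2)` bits
    have hbits : ∀ i, (iter (c.run v) x i s).Bits (S + G * (1 + i * (u + 2))) := by
      intro i
      induction i with
      | zero => exact (h.mono (by omega)).setReg (by simp)
      | succ i ih =>
        have h1 := (hE v B _ _ (hBi i) ih).2
        have h2 := hE₂ _ _ h1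
        simp only [NExp.eval, hrunx, ← hu] at h1 h2
        have h3 := loop_growth (S := S) (u := u) (i := i) hEG
        exact (h1.mono (by omega)).setReg (h2.trans (by omega))
    set N := s.reg p with hN
    have hNB : N ≤ B := hB p hp
    -- `V` bounds the numbers of bits throughout the loop
    obtain ⟨V, hV⟩ : ∃ V, V = S + G * (2 + B * (u + 2)) := ⟨_, rfl⟩
    have hNV : S + G * (1 + N * (u + 2)) ≤ V := by
      rw [hV]
      gcongr
      omega
    have hbV : ∀ i ≤ N, (iter (c.run v) x i s).Bits V := by
      intro i hi
      refine (hbits i).mono (le_trans ?_ hNV)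
      gcongr
    have hrun : ∀ i < N, S + G * (1 + i * (u + 2)) + E * u ≤ V := by
      intro i hi
      have h3 := loop_growth (S := S) (u := u) (i := i) hEG
      have := hmono i hi
      omega
    have hbV' : ∀ i < N, (c.run v (iter (c.run v) x i s)).Bits V := fun i hi =>
      ((hE v B _ _ (hBi i) (hbits i)).2).mono (hrun i hi)
    have hbody : ∀ i < N, ∃ t, Exec v c.toCmd (iter (c.run v) x i s) []
        (c.run v (iter (c.run v) x i s)) t ∧ t ≤ G * u * (V + m + 1) := by
      intro i hi
      obtain ⟨t, ht, hle⟩ := (hE v B _ _ (hBi i) (hbits i)).1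
      refine ⟨t, ht, hle.trans ?_⟩
      have := hrun i hi
      simp only [timeBound]
      gcongr
    obtain ⟨W, hW⟩ : ∃ W, W = V + m + 1 := ⟨_, rfl⟩
    have hVW : V + 1 ≤ W := by omega
    rw [← hW] at hbody
    have hX : (E₁ + E₃) * (V + 1) ≤ (E₁ + E₃) * W := by gcongr
    have hstep : G * u * W + 3 * ((E₁ + E₃) * (V + 1)) + 2 ≤ G * (u + 1) * W := by
      have h3 : (3 * (E₁ + E₃) + 2) * W ≤ G * W := by gcongr; omega
      have h4 : G * (u + 1) * W = G * u * W + G * W := by ring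
      have h5 : (3 * (E₁ + E₃) + 2) * W = 3 * ((E₁ + E₃) * W) + 2 * W := by ring
      omega
    have hE1V : E₁ * (V + 1) ≤ (E₁ + E₃) * (V + 1) := by gcongr; omega
    have hE3V : E₃ * (V + 1) ≤ (E₁ + E₃) * (V + 1) := by gcongr; omega
    obtain ⟨t, ht, hle⟩ := exec_loopCmd v hxp hxc hpc hbody (V := (E₁ + E₃) * (V + 1))
      (fun i hi => ⟨(hE₁ _ _ (hbV i hi)).2.trans hE1V, (hE₃ _ _ (hbV i hi)).2.trans hE3V⟩)
      (fun i hi => (hE₁ _ _ (hbV' i hi)).2.trans hE1V) hstep N 0 (by omega)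
    have h0 : Exec v (.setReg x (.const 0)) s [] (iter (c.run v) x 0 s)
        ((NExp.const 0).cost s + 1) := Exec.setReg s x (.const 0)
    refine ⟨⟨_, Exec.seq h0 ht, ?_⟩, (hbits N).mono ?_⟩
    · have h4 := (hE₄ s S h).2
      have h4' : E₄ * (S + 1) ≤ E₄ * W := by gcongr; omega
      have h5 : N * (G * (u + 1) * W) ≤ B * (G * (u + 1) * W) := by gcongr
      have h6 : (E₄ + 2 * (E₁ + E₃) + 2) * W ≤ G * W := by gcongr; omega
      have h7 : (E₄ + 2 * (E₁ + E₃) + 2) * W = E₄ * W + 2 * ((E₁ + E₃) * W) + 2 * W := by ring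
      have h8 : B * (G * (u + 1) * W) + G * W ≤ G * (2 + B * (u + 2)) * W := by
        have h9 : G * (2 + B * (u + 2)) * W =
          B * (G * (u + 1) * W) + G * W + (B * (G * W) + G * W) := by ring
        omega
      simp only [timeBound, Prog.stat]
      rw [← hu, ← hV, ← hW]
      omega
    · simp only [Prog.stat]
      rw [← hu, ← hV]
      exact hNV

/-! ### Valuations and their multilinear extensions -/

section Multilinear

variable {m : ℕ}

theorem IsValuation.nonneg {f : Finset (Fin m) → ℝ} (h : IsValuation f) (S : Finset (Fin m)) :
    0 ≤ f S := h.empty ▸ h.mono ∅ S (Finset.empty_subset S)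

/-- The marginal value of `j`, written so that `j` may lie in the set. -/
theorem IsValuation.insert_sub_erase_le {f : Finset (Fin m) → ℝ} (h : IsValuation f)
    {A B : Finset (Fin m)} (hAB : A ⊆ B) (j : Fin m) :
    f (insert j B) - f (B.erase j) ≤ f (insert j A) - f (A.erase j) := by
  have := h.submodular (A.erase j) (B.erase j) (Finset.erase_subset_erase j hAB) j (by simp)
  have hi : ∀ S : Finset (Fin m), insert j (S.erase j) = insert j S := fun S => by
    ext i
    by_cases hij : i = j <;> simp [hij]
  rwa [hi, hi] at this

/-- Submodularity for sets: a union gains at most the sum of the marginal values. -/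
theorem IsValuation.union_sub_le {f : Finset (Fin m) → ℝ} (h : IsValuation f)
    (A B : Finset (Fin m)) : f (A ∪ B) - f B ≤ ∑ j ∈ A, (f (insert j B) - f B) := by
  induction A using Finset.induction_on with
  | empty => simp
  | insert a A ha ih =>
    rw [Finset.sum_insert ha, Finset.insert_union]
    by_cases hm : a ∈ A ∪ B
    · rw [Finset.insert_eq_of_mem hm]
      have := h.mono B (insert a B) (Finset.subset_insert _ _)
      linarith
    · have := h.submodular B (A ∪ B) Finset.subset_union_right a hm
      linarith

theorem IsValuation.le_sum {f : Finset (Fin m) → ℝ} (h : IsValuation f) (A : Finset (Fin m)) :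
    f A ≤ ∑ j ∈ A, f {j} := by
  have := h.union_sub_le A ∅
  simpa [h.empty] using this

/-- Truncation preserves submodularity. -/
theorem IsValuation.div_min_one {f : Finset (Fin m) → ℝ} (h : IsValuation f) {T : ℝ} (hT : 0 < T) :
    IsValuation (fun S => min (f S / T) 1) where
  empty := by simp [h.empty]
  mono A B hAB := min_le_min_right _ (by have := h.mono A B hAB; gcongr)
  submodular A B hAB g hg := by
    have h1 : f (insert g B) / T - f B / T ≤ f (insert g A) / T - f A / T := by
      rw [← sub_div, ← sub_div]
      have := h.submodular A B hAB g hg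
      gcongr
    have h2 : f A / T ≤ f B / T := by have := h.mono A B hAB; gcongr
    have h3 : f A / T ≤ f (insert g A) / T := by
      have := h.mono A (insert g A) (Finset.subset_insert _ _); gcongr
    have h4 : f B / T ≤ f (insert g B) / T := by
      have := h.mono B (insert g B) (Finset.subset_insert _ _); gcongr
    have h5 : f (insert g A) / T ≤ f (insert g B) / T := by
      have := h.mono _ _ (Finset.insert_subset_insert g hAB); gcongr
    simp only [min_def]
    split_ifs <;> linarith

/-- The items whose threshold is below their level. -/
def thr (τ y : Fin m → ℕ) : Finset (Fin m) := Finset.univ.filter fun j => τ j < y j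

theorem thr_mono (τ : Fin m → ℕ) {y y' : Fin m → ℕ} (h : y ≤ y') : thr τ y ⊆ thr τ y' := by
  intro j
  simp only [thr, Finset.mem_filter, Finset.mem_univ, true_and]
  exact fun hj => hj.trans_le (h j)

/-- The multilinear extension of `g` at the point `y / Q`: the average of `g` over the random set
that contains item `j` with probability `y j / Q`, realized by thresholds in `{0, …, Q - 1}`. -/
noncomputable def mext (Q : ℕ) (g : Finset (Fin m) → ℝ) (y : Fin m → ℕ) : ℝ :=
  (∑ τ : Fin m → Fin Q, g (thr (fun j => (τ j : ℕ)) y)) / (Q : ℝ) ^ m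

/-- The partial derivative of the multilinear extension in direction `j`. -/
noncomputable def mder (Q : ℕ) (g : Finset (Fin m) → ℝ) (y : Fin m → ℕ) (j : Fin m) : ℝ :=
  (∑ τ : Fin m → Fin Q, (g (insert j (thr (fun j => (τ j : ℕ)) y)) -
    g ((thr (fun j => (τ j : ℕ)) y).erase j))) / (Q : ℝ) ^ m

variable {Q : ℕ} {g : Finset (Fin m) → ℝ}

/-- Redrawing one threshold does not change the distribution of the thresholds. -/
theorem sum_update_eq (h : (Fin m → Fin Q) → ℝ) (j : Fin m) :
    ∑ τ, ∑ c, h (Function.update τ j c) = Q * ∑ τ, h τ := by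
  -- `(τ, c) ↦ (update τ j c, τ j)` is an involution
  have hinv : Function.Involutive
      (fun p : (Fin m → Fin Q) × Fin Q => (Function.update p.1 j p.2, p.1 j)) := by
    rintro ⟨τ, c⟩
    simp
  have := Equiv.sum_comp hinv.toPerm (fun p => h p.1)
  simp only [Fintype.sum_prod_type] at this
  simp only [Function.Involutive.coe_toPerm, Finset.sum_const, Finset.card_univ, Fintype.card_fin,
    nsmul_eq_mul] at this
  rw [this, Finset.mul_sum]

theorem thr_update (τ : Fin m → ℕ) (y : Fin m → ℕ) (j : Fin m) (c a : ℕ) :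
    thr (Function.update τ j c) (Function.update y j a) =
      if c < a then insert j (thr τ y) else (thr τ y).erase j := by
  ext i
  by_cases hij : i = j
  · subst hij
    split_ifs with h <;> simp [thr, h]
  · split_ifs with h <;> simp [thr, hij]

/-- The value after coordinate `j` is set to `a`, in terms of data that do not depend on it. -/
theorem mext_update (j : Fin m) (y : Fin m → ℕ) {a : ℕ} (ha : a ≤ Q) (hQ : 0 < Q) :
    mext Q g (Function.update y j a) =
      (∑ τ : Fin m → Fin Q, g ((thr (fun j => (τ j : ℕ)) y).erase j)) / (Q : ℝ) ^ m +
        a / Q * mder Q g y j := by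
  have hQ' : (Q : ℝ) ≠ 0 := by positivity
  have h1 := sum_update_eq (fun τ : Fin m → Fin Q =>
    g (thr (fun j => (τ j : ℕ)) (Function.update y j a))) j
  have h2 : ∀ τ : Fin m → Fin Q, ∑ c : Fin Q, g (thr (fun i => ((Function.update τ j c) i : ℕ))
      (Function.update y j a)) = a * g (insert j (thr (fun j => (τ j : ℕ)) y)) +
        (Q - a) * g ((thr (fun j => (τ j : ℕ)) y).erase j) := by
    intro τ
    have h3 : ∀ c : Fin Q, (fun i => ((Function.update τ j c) i : ℕ)) =
        Function.update (fun i => (τ i : ℕ)) j (c : ℕ) := by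
      intro c
      ext i
      by_cases hij : i = j
      · subst hij; simp
      · simp [hij]
    simp only [h3, thr_update]
    have h4 : ∀ c : Fin Q, g (if (c : ℕ) < a then insert j (thr (fun i => (τ i : ℕ)) y)
        else (thr (fun i => (τ i : ℕ)) y).erase j) =
        (if (c : ℕ) < a then g (insert j (thr (fun i => (τ i : ℕ)) y)) -
          g ((thr (fun i => (τ i : ℕ)) y).erase j) else 0) +
          g ((thr (fun i => (τ i : ℕ)) y).erase j) := by
      intro c
      split_ifs <;> ring
    simp only [h4]
    rw [Finset.sum_add_distrib, ← Finset.sum_filter, Finset.sum_const, Finset.sum_const]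
    have h5 : (Finset.univ.filter fun c : Fin Q => (c : ℕ) < a).card = a := by
      rw [Fin.card_filter_val_lt]
      omega
    rw [h5]
    simp only [Finset.card_univ, Fintype.card_fin, nsmul_eq_mul]
    ring
  simp only [h2] at h1
  rw [Finset.sum_add_distrib, ← Finset.mul_sum, ← Finset.mul_sum] at h1
  unfold mext mder
  rw [Finset.sum_sub_distrib]
  have h6 : ∑ τ : Fin m → Fin Q, g (thr (fun j => (τ j : ℕ)) (Function.update y j a)) =
    (a * ∑ τ : Fin m → Fin Q, g (insert j (thr (fun j => (τ j : ℕ)) y)) +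
      (Q - a) * ∑ τ : Fin m → Fin Q, g ((thr (fun j => (τ j : ℕ)) y).erase j)) / Q := by
    rw [h1]; field_simp
  rw [h6]
  field_simp
  ring

/-- The multilinear extension is affine in each coordinate. -/
theorem mext_update_sub (j : Fin m) (y : Fin m → ℕ) {a : ℕ} (ha : a ≤ Q) (hy : y j ≤ Q)
    (hQ : 0 < Q) :
    mext Q g (Function.update y j a) - mext Q g y = ((a : ℝ) - y j) / Q * mder Q g y j := by
  have h1 := mext_update (g := g) j y ha hQ
  have h2 := mext_update (g := g) j y hy hQ
  rw [Function.update_eq_self] at h2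
  rw [h1, h2]
  ring

theorem mext_mono (hg : IsValuation g) {y y' : Fin m → ℕ} (h : y ≤ y') :
    mext Q g y ≤ mext Q g y' := by
  unfold mext
  gcongr with τ
  exact hg.mono _ _ (thr_mono _ h)

theorem mder_anti (hg : IsValuation g) {y y' : Fin m → ℕ} (h : y ≤ y') (j : Fin m) :
    mder Q g y' j ≤ mder Q g y j := by
  unfold mder
  apply div_le_div_of_nonneg_right _ (by positivity)
  exact Finset.sum_le_sum fun τ _ => hg.insert_sub_erase_le (thr_mono _ h) j

theorem mder_nonneg (hg : IsValuation g) (y : Fin m → ℕ) (j : Fin m) : 0 ≤ mder Q g y j := by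
  unfold mder
  refine div_nonneg (Finset.sum_nonneg fun τ _ => ?_) (by positivity)
  rw [sub_nonneg]
  exact hg.mono _ _ ((Finset.erase_subset _ _).trans (Finset.subset_insert _ _))

theorem avg_le (hQ : 0 < Q) {h : (Fin m → Fin Q) → ℝ} {c : ℝ} (hc : ∀ τ, h τ ≤ c) :
    (∑ τ, h τ) / (Q : ℝ) ^ m ≤ c := by
  rw [div_le_iff₀ (by positivity)]
  refine (Finset.sum_le_card_nsmul _ _ c fun τ _ => hc τ).trans (le_of_eq ?_)
  simp [mul_comm]

theorem mder_le (hg : IsValuation g) (hQ : 0 < Q) (y : Fin m → ℕ) (j : Fin m) :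
    mder Q g y j ≤ g {j} := by
  refine avg_le hQ fun τ => ?_
  have := hg.insert_sub_erase_le (Finset.empty_subset (thr (fun j => (τ j : ℕ)) y)) j
  simpa [hg.empty] using this

/-- The partial derivatives in the directions of a set `A` promise at least the gap to `g A`. -/
theorem sum_mder_ge (hg : IsValuation g) (hQ : 0 < Q) (y : Fin m → ℕ) (A : Finset (Fin m)) :
    g A - mext Q g y ≤ ∑ j ∈ A, mder Q g y j := by
  have hc : (0 : ℝ) < (Q : ℝ) ^ m := by positivity
  have h1 : g A = (∑ _τ : Fin m → Fin Q, g A) / (Q : ℝ) ^ m := by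
    rw [eq_div_iff hc.ne']
    simp [mul_comm]
  unfold mder mext
  rw [← Finset.sum_div, h1, ← sub_div, ← Finset.sum_sub_distrib, Finset.sum_comm]
  gcongr with τ
  set B := thr (fun j => (τ j : ℕ)) y
  calc g A - g B ≤ g (A ∪ B) - g B := by
        have := hg.mono A (A ∪ B) Finset.subset_union_left
        linarith
    _ ≤ ∑ j ∈ A, (g (insert j B) - g B) := hg.union_sub_le A B
    _ ≤ _ := Finset.sum_le_sum fun j _ => by
        have := hg.mono _ _ (Finset.erase_subset j B)
        linarith

/-- At integral points the extension agrees with the valuation. -/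
theorem mext_integral (hQ : 0 < Q) {y : Fin m → ℕ} (hy : ∀ j, y j = 0 ∨ y j = Q) :
    mext Q g y = g (Finset.univ.filter fun j => 0 < y j) := by
  have h1 : ∀ τ : Fin m → Fin Q, thr (fun j => (τ j : ℕ)) y =
      Finset.univ.filter fun j => 0 < y j := by
    intro τ
    ext j
    simp only [thr, Finset.mem_filter, Finset.mem_univ, true_and]
    have := (τ j).2
    rcases hy j with h | h <;> omega
  unfold mext
  simp only [h1]
  have hc : (0 : ℝ) < (Q : ℝ) ^ m := by positivity
  rw [div_eq_iff hc.ne']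
  simp [mul_comm]

/-- Raising `a` by `p` and lowering `b` by `q`: the extension is convex in such directions, so the
first-order estimate is a lower bound. -/
theorem mext_exchange (hg : IsValuation g) (hQ : 0 < Q) {y : Fin m → ℕ} {a b : Fin m}
    (hab : a ≠ b) {p q : ℕ} (hp : y a + p ≤ Q) (hb : y b ≤ Q) (hq : q ≤ y b) :
    mext Q g y + p / Q * mder Q g y a - q / Q * mder Q g y b ≤
      mext Q g (Function.update (Function.update y a (y a + p)) b (y b - q)) := by
  set y' := Function.update y b (y b - q) with hy'
  have hle : y' ≤ y := by
    intro i
    by_cases hi : i = b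
    · subst hi; simp [y']
    · simp [y', hi]
  have h1 := mext_update_sub (g := g) (Q := Q) b y (a := y b - q) (by omega) hb hQ
  have h2 : y' a = y a := by simp [y', hab]
  have h3 := mext_update_sub (g := g) (Q := Q) a y' (a := y a + p) hp (by omega) hQ
  rw [h2, hy', Function.update_comm hab.symm] at h3
  rw [← hy'] at h1 h3
  have h4 := mder_anti (Q := Q) hg hle a
  push_cast [Nat.cast_sub hq] at h1 h3
  have h5 : (p : ℝ) / Q * mder Q g y a ≤ (p : ℝ) / Q * mder Q g y' a := by gcongr
  have e1 : ((y b : ℝ) - q - y b) / Q * mder Q g y b = - (q / Q * mder Q g y b) := by ring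
  have e2 : ((y a : ℝ) + p - y a) / Q * mder Q g y' a = p / Q * mder Q g y' a := by ring
  rw [e1] at h1
  rw [e2] at h3
  linarith

end Multilinear

/-! ### Sampling -/

section Hoeffding

variable {Ω : Type*} [Fintype Ω]

/-- Chernoff bound for sums of independent uniform samples of a centered function. -/
theorem card_sum_ge_le (g : Ω → ℝ) (hg : ∀ a, |g a| ≤ 1) (h0 : ∑ a, g a = 0) (N : ℕ) {δ : ℝ}
    (hδ : 0 ≤ δ) (hδ' : δ ≤ 2) :
    ((Finset.univ.filter fun ω : Fin N → Ω => N * δ ≤ ∑ s, g (ω s)).card : ℝ) ≤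
      Real.exp (-(N * δ ^ 2 / 4)) * (Fintype.card Ω : ℝ) ^ N := by
  -- the exponential moment with parameter `δ / 2`
  set l := δ / 2 with hl
  have hl0 : 0 ≤ l := by positivity
  have hl1 : l ≤ 1 := by linarith
  have hpt : ∀ a, Real.exp (l * g a) ≤ 1 + l * g a + l ^ 2 := by
    intro a
    have h1 : |l * g a| ≤ 1 := by
      rw [abs_mul, abs_of_nonneg hl0]
      nlinarith [hg a, abs_nonneg (g a)]
    have h2 := (abs_le.mp (Real.abs_exp_sub_one_sub_id_le h1)).2
    have h3 : (l * g a) ^ 2 ≤ l ^ 2 := by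
      rw [mul_pow]
      have : g a ^ 2 ≤ 1 := by
        rw [← sq_abs]
        nlinarith [hg a, abs_nonneg (g a)]
      nlinarith [sq_nonneg l]
    linarith
  have hone : ∑ a, Real.exp (l * g a) ≤ Real.exp (l ^ 2) * Fintype.card Ω := by
    calc ∑ a, Real.exp (l * g a) ≤ ∑ a, (1 + l * g a + l ^ 2) :=
          Finset.sum_le_sum fun a _ => hpt a
      _ = (l ^ 2 + 1) * Fintype.card Ω := by
          rw [Finset.sum_add_distrib, Finset.sum_add_distrib, ← Finset.mul_sum, h0]
          simp only [Finset.sum_const, Finset.card_univ, nsmul_eq_mul]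
          ring
      _ ≤ _ := by
          gcongr
          exact Real.add_one_le_exp _
  have hprod : ∑ ω : Fin N → Ω, Real.exp (l * ∑ s, g (ω s)) = (∑ a, Real.exp (l * g a)) ^ N := by
    rw [Fintype.sum_pow]
    refine Finset.sum_congr rfl fun ω _ => ?_
    rw [Finset.mul_sum, Real.exp_sum]
  -- Markov's inequality
  have hmark : ((Finset.univ.filter fun ω : Fin N → Ω => N * δ ≤ ∑ s, g (ω s)).card : ℝ) *
      Real.exp (l * (N * δ)) ≤ ∑ ω : Fin N → Ω, Real.exp (l * ∑ s, g (ω s)) := by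
    rw [← nsmul_eq_mul, ← Finset.sum_const]
    refine (Finset.sum_le_sum fun ω hω => ?_).trans (Finset.sum_le_sum_of_subset_of_nonneg
      (Finset.filter_subset _ _) fun _ _ _ => (Real.exp_pos _).le)
    rw [Finset.mem_filter] at hω
    exact Real.exp_le_exp.mpr (mul_le_mul_of_nonneg_left hω.2 hl0)
  have hexp : Real.exp (-(N * δ ^ 2 / 4)) * Real.exp (l * (N * δ)) = Real.exp (l ^ 2) ^ N := by
    rw [← Real.exp_add, ← Real.exp_nat_mul]
    congr 1
    rw [hl]
    ring
  refine le_of_mul_le_mul_right ?_ (Real.exp_pos (l * (N * δ)))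
  calc _ ≤ _ := hmark
    _ ≤ (Real.exp (l ^ 2) * Fintype.card Ω) ^ N := by
        rw [hprod]
        exact pow_le_pow_left₀ (Finset.sum_nonneg fun _ _ => (Real.exp_pos _).le) hone N
    _ = _ := by
        rw [mul_pow, ← hexp]
        ring

/-- Hoeffding's inequality, two-sided, for functions with values in `[0, 1]`. -/
theorem card_abs_sub_avg_gt_le (h : Ω → ℝ) (h0 : ∀ a, 0 ≤ h a) (h1 : ∀ a, h a ≤ 1)
    (N : ℕ) (hN : 0 < N) {δ : ℝ} (hδ : 0 ≤ δ) (hδ' : δ ≤ 2) :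
    ((Finset.univ.filter fun ω : Fin N → Ω =>
      δ < |(∑ s, h (ω s)) / N - (∑ a, h a) / Fintype.card Ω|).card : ℝ) ≤
      2 * Real.exp (-(N * δ ^ 2 / 4)) * (Fintype.card Ω : ℝ) ^ N := by
  classical
  rcases isEmpty_or_nonempty Ω with hE | hE
  · have : Nonempty (Fin N) := ⟨⟨0, hN⟩⟩
    rw [Finset.card_eq_zero.mpr]
    · simp only [Nat.cast_zero]; positivity
    · exact Finset.eq_empty_of_isEmpty _
  have hc : (0 : ℝ) < Fintype.card Ω := by exact_mod_cast Fintype.card_pos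
  set μ := (∑ a, h a) / Fintype.card Ω with hμ
  have hμ0 : 0 ≤ μ := div_nonneg (Finset.sum_nonneg fun a _ => h0 a) hc.le
  have hμ1 : μ ≤ 1 := by
    rw [hμ, div_le_one hc]
    exact (Finset.sum_le_card_nsmul _ _ 1 fun a _ => h1 a).trans (by simp)
  have hcen : ∑ a, (h a - μ) = 0 := by
    rw [Finset.sum_sub_distrib, Finset.sum_const, Finset.card_univ, nsmul_eq_mul, hμ]
    field_simp
    ring
  have hA := card_sum_ge_le (fun a => h a - μ)
    (fun a => abs_le.mpr ⟨by linarith [h0 a], by linarith [h1 a]⟩) hcen N hδ hδ'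
  have hB := card_sum_ge_le (fun a => -(h a - μ))
    (fun a => by rw [abs_neg]; exact abs_le.mpr ⟨by linarith [h0 a], by linarith [h1 a]⟩)
    (by rw [Finset.sum_neg_distrib, hcen, neg_zero]) N hδ hδ'
  have hsub : (Finset.univ.filter fun ω : Fin N → Ω => δ < |(∑ s, h (ω s)) / N - μ|) ⊆
      (Finset.univ.filter fun ω : Fin N → Ω => N * δ ≤ ∑ s, (h (ω s) - μ)) ∪
      (Finset.univ.filter fun ω : Fin N → Ω => N * δ ≤ ∑ s, -(h (ω s) - μ)) := by
    intro ω hω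
    simp only [Finset.mem_union, Finset.mem_filter, Finset.mem_univ, true_and] at hω ⊢
    have hN' : (0 : ℝ) < N := by exact_mod_cast hN
    have hs : ∑ s, (h (ω s) - μ) = N * ((∑ s, h (ω s)) / N - μ) := by
      rw [Finset.sum_sub_distrib, Finset.sum_const, Finset.card_univ, Fintype.card_fin,
        nsmul_eq_mul]
      field_simp
    rw [Finset.sum_neg_distrib, hs]
    rcases lt_abs.mp hω with h | h
    · left; gcongr
    · right; rw [← mul_neg]; gcongr
  have := (Nat.cast_le (α := ℝ)).mpr ((Finset.card_le_card hsub).trans (Finset.card_union_le _ _))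
  push_cast at this
  linarith

end Hoeffding

/-- The number with binary digits `β st, …, β (st + b - 1)`, most significant first. -/
def dec (β : ℕ → ℕ) (st : ℕ) : ℕ → ℕ
  | 0 => 0
  | b + 1 => dec β st b + dec β st b + β (st + b)

theorem dec_lt {β : ℕ → ℕ} (hβ : ∀ i, β i ≤ 1) (st b : ℕ) : dec β st b < 2 ^ b := by
  induction b with
  | zero => simp [dec]
  | succ b ih =>
    have := hβ (st + b)
    rw [dec, pow_succ]
    omega

/-- A number determines its binary digits. -/
theorem dec_inj {β β' : ℕ → ℕ} (hβ : ∀ i, β i ≤ 1) (hβ' : ∀ i, β' i ≤ 1) {st q : ℕ}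
    (h : dec β st q = dec β' st q) : ∀ b < q, β (st + b) = β' (st + b) := by
  induction q with
  | zero => intro b hb; omega
  | succ q ih =>
    have h1 := hβ (st + q)
    have h2 := hβ' (st + q)
    simp only [dec] at h
    intro b hb
    rcases Nat.lt_succ_iff_lt_or_eq.mp hb with hb | rfl
    · exact ih (by omega) b hb
    · omega

/-- The bits of a finite bit string, padded by zeros. -/
def bitsOf {T : ℕ} (r : Fin T → Bool) (i : ℕ) : ℕ := if h : i < T then (r ⟨i, h⟩).toNat else 0

theorem bitsOf_le {T : ℕ} (r : Fin T → Bool) (i : ℕ) : bitsOf r i ≤ 1 := by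
  unfold bitsOf
  split_ifs
  · exact Bool.toNat_le _
  · omega

/-- The threshold of item `j` in sample `s`, read off from the bit sequence. -/
def threshold (β : ℕ → ℕ) (m q s j : ℕ) : ℕ := dec β ((s * m + j) * q) q

/-- Enough samples estimate all multilinear extensions at all grid points simultaneously, except
for a small fraction of the random bit strings. -/
theorem card_bad_le {n m N q T : ℕ} (h : ℕ → Finset (Fin m) → ℝ) (h0 : ∀ i S, 0 ≤ h i S)
    (h1 : ∀ i S, h i S ≤ 1) (hN : 0 < N) (hT : N * m * q ≤ T) {δ : ℝ} (hδ : 0 ≤ δ) (hδ' : δ ≤ 2) :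
    (({r : Fin T → Bool | ¬ ∀ i < n, ∀ y : Fin m → ℕ, (∀ j, y j ≤ 2 ^ q) →
      |(∑ s ∈ Finset.range N, h i (thr (fun j => threshold (bitsOf r) m q s j) y)) / N -
        mext (2 ^ q) (h i) y| ≤ δ}.ncard : ℕ) : ℝ) ≤
      n * (2 ^ q + 1) ^ m * (2 * Real.exp (-(N * δ ^ 2 / 4))) * 2 ^ T := by
  classical
  set Q := 2 ^ q with hQ
  let Ω := Fin m → Fin Q
  let bad : Fin n × (Fin m → Fin (Q + 1)) → Finset (Fin N → Ω) := fun p =>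
    Finset.univ.filter fun ω : Fin N → Ω =>
      δ < |(∑ s, h p.1 (thr (fun j => (ω s j : ℕ)) (fun j => (p.2 j : ℕ)))) / N -
        (∑ a : Ω, h p.1 (thr (fun j => (a j : ℕ)) (fun j => (p.2 j : ℕ)))) / Fintype.card Ω|
  -- bit strings correspond to pairs of decoded thresholds and unused bits
  let D : (Fin T → Bool) → (Fin N → Ω) := fun r s j =>
    ⟨threshold (bitsOf r) m q s j, dec_lt (bitsOf_le r) _ _⟩
  let tail : (Fin T → Bool) → (Fin (T - N * m * q) → Bool) := fun r i =>
    r ⟨N * m * q + i, by omega⟩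
  have hinj : Function.Injective fun r => (D r, tail r) := by
    intro r r' hr
    simp only [Prod.mk.injEq] at hr
    funext i
    by_cases hi : (i : ℕ) < N * m * q
    · have hq : 0 < q := Nat.pos_of_ne_zero (by rintro rfl; simp at hi)
      have hm : 0 < m := Nat.pos_of_ne_zero (by rintro rfl; simp at hi)
      have hidx : (i : ℕ) / q < N * m := Nat.div_lt_of_lt_mul (by rwa [mul_comm])
      have hs : (i : ℕ) / q / m < N := Nat.div_lt_of_lt_mul (by rwa [mul_comm])
      have hj : (i : ℕ) / q % m < m := Nat.mod_lt _ hm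
      have e1 : (i : ℕ) / q / m * m + (i : ℕ) / q % m = (i : ℕ) / q := Nat.div_add_mod' _ _
      have e2 : (i : ℕ) / q * q + (i : ℕ) % q = i := Nat.div_add_mod' _ _
      have h2 := congrFun (congrFun hr.1 ⟨_, hs⟩) ⟨_, hj⟩
      simp only [D, threshold, Fin.mk.injEq, e1] at h2
      have h3 := dec_inj (bitsOf_le r) (bitsOf_le r') h2 _ (Nat.mod_lt i hq)
      rw [e2] at h3
      simp only [bitsOf, i.2, dif_pos] at h3
      revert h3
      cases r i <;> cases r' i <;> simp
    · have h2 := congrFun hr.2 ⟨i - N * m * q, by omega⟩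
      simp only [tail] at h2
      have e : N * m * q + ((i : ℕ) - N * m * q) = i := by omega
      simp only [e, Fin.eta] at h2
      rw [h2]
  have hsub : {r : Fin T → Bool | ¬ ∀ i < n, ∀ y : Fin m → ℕ, (∀ j, y j ≤ Q) →
      |(∑ s ∈ Finset.range N, h i (thr (fun j => threshold (bitsOf r) m q s j) y)) / N -
        mext Q (h i) y| ≤ δ} ⊆ (fun r => (D r, tail r)) ⁻¹'
        (((Finset.univ.biUnion bad) ×ˢ (Finset.univ : Finset (Fin (T - N * m * q) → Bool)) :
          Finset ((Fin N → Ω) × (Fin (T - N * m * q) → Bool))) :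
            Set ((Fin N → Ω) × (Fin (T - N * m * q) → Bool))) := by
    intro r hr
    simp only [Set.mem_ofPred_eq, not_forall, not_le] at hr
    obtain ⟨i, hi, y, hy, hlt⟩ := hr
    simp only [Set.mem_preimage, Finset.mem_coe, Finset.mem_product, Finset.mem_univ, and_true,
      Finset.mem_biUnion, true_and]
    refine ⟨(⟨i, hi⟩, fun j => ⟨y j, by have := hy j; omega⟩), ?_⟩
    simp only [bad, Finset.mem_filter, Finset.mem_univ, true_and]
    rw [Finset.sum_range] at hlt
    simpa [D, Ω, mext] using hlt
  have hcard : ({r : Fin T → Bool | ¬ ∀ i < n, ∀ y : Fin m → ℕ, (∀ j, y j ≤ Q) →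
      |(∑ s ∈ Finset.range N, h i (thr (fun j => threshold (bitsOf r) m q s j) y)) / N -
        mext Q (h i) y| ≤ δ}).ncard ≤
        ((Finset.univ.biUnion bad) ×ˢ (Finset.univ : Finset (Fin (T - N * m * q) → Bool))).card := by
    refine (Set.ncard_le_ncard hsub (Set.toFinite _)).trans ?_
    rw [← Set.ncard_coe_finset]
    exact Set.ncard_le_ncard_of_injOn (fun r => (D r, tail r)) (fun r hr => hr) hinj.injOn
      (Finset.finite_toSet _)
  have hΩ : (Fintype.card Ω : ℝ) ^ N = 2 ^ (N * m * q) := by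
    simp only [Ω, Fintype.card_pi, Fintype.card_fin, Finset.prod_const, Finset.card_univ, hQ]
    push_cast
    rw [← pow_mul, ← pow_mul]
    congr 1
    ring
  have hbad : ∀ p, ((bad p).card : ℝ) ≤ 2 * Real.exp (-(N * δ ^ 2 / 4)) * 2 ^ (N * m * q) := by
    intro p
    rw [← hΩ]
    exact card_abs_sub_avg_gt_le (fun a : Ω => h p.1 (thr (fun j => (a j : ℕ)) fun j => (p.2 j : ℕ)))
      (fun _ => h0 _ _) (fun _ => h1 _ _) N hN hδ hδ'
  have hU : ((Finset.univ.biUnion bad).card : ℝ) ≤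
      n * (Q + 1) ^ m * (2 * Real.exp (-(N * δ ^ 2 / 4)) * 2 ^ (N * m * q)) := by
    have h2 : ((Finset.univ.biUnion bad).card : ℝ) ≤ ∑ p, ((bad p).card : ℝ) := by
      exact_mod_cast Finset.card_biUnion_le
    refine h2.trans ((Finset.sum_le_card_nsmul _ _ _ fun p _ => hbad p).trans (le_of_eq ?_))
    simp
  have hfin := (Nat.cast_le (α := ℝ)).mpr hcard
  rw [Finset.card_product, Nat.cast_mul] at hfin
  refine hfin.trans ?_
  have e : (2 : ℝ) ^ T = 2 ^ (N * m * q) * 2 ^ (T - N * m * q) := by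
    rw [← pow_add]; congr 1; omega
  rw [e]
  calc _ ≤ n * (Q + 1) ^ m * (2 * Real.exp (-(N * δ ^ 2 / 4)) * 2 ^ (N * m * q)) *
        2 ^ (T - N * m * q) := by
        gcongr
        simp
    _ = _ := by
        rw [hQ]; push_cast; ring

/-! ### The multiplicative-weights greedy phase -/

/-- The integer oracle `G`, divided by `W`, estimates the multilinear extensions of the valuations
`g` at all points of the grid `{0, …, Q} ^ m` up to an error `δ`. -/
structure Approx (n m Q : ℕ) (g : ℕ → Finset (Fin m) → ℝ) (G : ℕ → (Fin m → ℕ) → ℕ)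
    (W δ : ℝ) : Prop where
  Q_pos : 0 < Q
  W_pos : 0 < W
  val : ∀ i < n, IsValuation (g i)
  le_one : ∀ i < n, ∀ S, g i S ≤ 1
  mono : ∀ i < n, ∀ y y' : Fin m → ℕ, y ≤ y' → G i y ≤ G i y'
  close : ∀ i < n, ∀ y : Fin m → ℕ, (∀ j, y j ≤ Q) → |G i y / W - mext Q (g i) y| ≤ δ

section Greedy

variable {m : ℕ}

/-- Raise the level of item `j` by one unit. -/
def bumpRow (y : Fin m → ℕ) (j : Fin m) : Fin m → ℕ := Function.update y j (y j + 1)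

/-- Give one unit of item `j` to agent `i`. -/
def bump (x : ℕ → Fin m → ℕ) (i : ℕ) (j : Fin m) : ℕ → Fin m → ℕ :=
  Function.update x i (bumpRow (x i) j)

/-- The decrease of the potential when an agent with estimate `G` gets one more unit of `j`. -/
noncomputable def gain (G : (Fin m → ℕ) → ℕ) (ρ : ℝ) (y : Fin m → ℕ) (j : Fin m) : ℝ :=
  ρ ^ G y - ρ ^ G (bumpRow y j)

/-- One unit of item `j` goes to an agent for whom it lowers the potential most. -/
def GreedyPick (n : ℕ) (G : ℕ → (Fin m → ℕ) → ℕ) (ρ : ℝ) (x : ℕ → Fin m → ℕ) (j : Fin m)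
    (x' : ℕ → Fin m → ℕ) : Prop :=
  ∃ i < n, x' = bump x i j ∧ ∀ i' < n, gain (G i') ρ (x i') j ≤ gain (G i) ρ (x i) j

/-- Units of the first `c` items have been assigned greedily. -/
def ItemsDone (n : ℕ) (G : ℕ → (Fin m → ℕ) → ℕ) (ρ : ℝ) :
    ℕ → (ℕ → Fin m → ℕ) → (ℕ → Fin m → ℕ) → Prop
  | 0, x, x' => x' = x
  | c + 1, x, x' => ∃ x₁, ItemsDone n G ρ c x x₁ ∧ ∃ h : c < m, GreedyPick n G ρ x₁ ⟨c, h⟩ x'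

/-- `t` greedy rounds, each of which assigns one unit of every item. -/
def RoundsDone (n : ℕ) (G : ℕ → (Fin m → ℕ) → ℕ) (ρ : ℝ) : ℕ → (ℕ → Fin m → ℕ) → Prop
  | 0, x => x = fun _ _ => 0
  | t + 1, x => ∃ x₁, RoundsDone n G ρ t x₁ ∧ ItemsDone n G ρ m x₁ x

variable {n : ℕ} {G : ℕ → (Fin m → ℕ) → ℕ} {ρ : ℝ}

theorem le_bumpRow (y : Fin m → ℕ) (j : Fin m) : y ≤ bumpRow y j := by
  intro i
  unfold bumpRow
  by_cases h : i = j
  · subst h; simp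
  · simp [h]

theorem bump_apply (x : ℕ → Fin m → ℕ) (i : ℕ) (j : Fin m) (i' : ℕ) (j' : Fin m) :
    bump x i j i' j' = x i' j' + if i' = i ∧ j' = j then 1 else 0 := by
  unfold bump bumpRow
  by_cases hi : i' = i
  · subst hi
    by_cases hj : j' = j
    · subst hj; simp
    · simp [hj]
  · simp [hi]

theorem ItemsDone.props {c : ℕ} {x x' : ℕ → Fin m → ℕ} (h : ItemsDone n G ρ c x x') :
    x ≤ x' ∧ (∀ i (j : Fin m), x' i j ≤ x i j + if (j : ℕ) < c then 1 else 0) ∧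
      ∀ j : Fin m, ∑ i ∈ Finset.range n, x' i j =
        ∑ i ∈ Finset.range n, x i j + if (j : ℕ) < c then 1 else 0 := by
  induction c generalizing x' with
  | zero => obtain rfl := h; simp
  | succ c ih =>
    obtain ⟨x₁, h₁, hc, i, hi, rfl, -⟩ := h
    obtain ⟨a1, a2, a3⟩ := ih h₁
    refine ⟨fun i' j' => (a1 i' j').trans ?_, fun i' j' => ?_, fun j' => ?_⟩
    · rw [bump_apply]; exact Nat.le_add_right _ _
    · have := a2 i' j'
      rw [bump_apply]
      by_cases hj : j' = ⟨c, hc⟩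
      · subst hj
        simp only [lt_self_iff_false, if_false] at this
        simp only [lt_add_iff_pos_right, zero_lt_one, if_true]
        split_ifs <;> omega
      · have : (j' : ℕ) ≠ c := fun h => hj (Fin.ext h)
        simp only [hj, and_false, if_false]
        split_ifs at * <;> omega
    · simp only [bump_apply, Finset.sum_add_distrib, a3 j']
      by_cases hj : j' = ⟨c, hc⟩
      · subst hj
        simp [Finset.sum_ite_eq', hi]
      · have : (j' : ℕ) ≠ c := fun h => hj (Fin.ext h)
        have h2 : (j' : ℕ) < c + 1 ↔ (j' : ℕ) < c := by omega
        simp [hj, h2]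

theorem RoundsDone.props {t : ℕ} {x : ℕ → Fin m → ℕ} (h : RoundsDone n G ρ t x) :
    (∀ i j, x i j ≤ t) ∧ ∀ j, ∑ i ∈ Finset.range n, x i j = t := by
  induction t generalizing x with
  | zero => obtain rfl := h; simp
  | succ t ih =>
    obtain ⟨x₁, h₁, h₂⟩ := h
    obtain ⟨a1, a2⟩ := ih h₁
    obtain ⟨-, b2, b3⟩ := h₂.props
    refine ⟨fun i j => (b2 i j).trans ?_, fun j => ?_⟩
    · have := a1 i j
      simp only [j.2, if_true]; omega
    · rw [b3 j, a2 j]; simp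

variable {Q : ℕ} {g : ℕ → Finset (Fin m) → ℝ} {W δ : ℝ}

/-- A gain at `y` is at least what the data of any later point `z` promise, because the multilinear
extensions are monotone and their derivatives decrease. -/
theorem le_gain (ha : Approx n m Q g G W δ) (hρ : 0 < ρ) (hρ1 : ρ < 1) {η : ℝ}
    (hη : η = -Real.log ρ * W) {i : ℕ} (hi : i < n) {y z : Fin m → ℕ} (hyz : y ≤ z)
    (hz : ∀ j, z j ≤ Q) {j : Fin m} (hj : y j + 1 ≤ Q) :
    ρ ^ G i z * (1 - Real.exp (-(η * (mder Q (g i) z j / Q - 2 * δ)))) ≤ gain (G i) ρ y j := by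
  have hQ : (0 : ℝ) < Q := by exact_mod_cast ha.Q_pos
  have hW := ha.W_pos
  have hlog : Real.log ρ < 0 := Real.log_neg hρ hρ1
  have hy : ∀ j, y j ≤ Q := fun j => (hyz j).trans (hz j)
  have hb : ∀ j', bumpRow y j j' ≤ Q := by
    intro j'
    unfold bumpRow
    by_cases h : j' = j
    · subst h; simpa using hj
    · simpa [h] using hy j'
  have hG : G i y ≤ G i (bumpRow y j) := ha.mono i hi _ _ (le_bumpRow y j)
  have h1 := abs_le.mp (ha.close i hi y hy)
  have h2 := abs_le.mp (ha.close i hi _ hb)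
  have h3 := mext_update_sub (g := g i) j y hj (hy j) ha.Q_pos
  have h4 := mder_anti (Q := Q) (ha.val i hi) hyz j
  have h5 : mder Q (g i) z j / Q - 2 * δ ≤ ((G i (bumpRow y j) : ℝ) - G i y) / W := by
    push_cast at h3
    have e : ((y j : ℝ) + 1 - y j) / Q * mder Q (g i) y j = mder Q (g i) y j / Q := by ring
    rw [e] at h3
    have h6 : mder Q (g i) z j / Q ≤ mder Q (g i) y j / Q := by gcongr
    rw [sub_div]
    unfold bumpRow at h2 ⊢
    linarith
  have hgain : gain (G i) ρ y j =
      ρ ^ G i y * (1 - Real.exp (-(η * (((G i (bumpRow y j) : ℝ) - G i y) / W)))) := by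
    unfold gain
    have e1 : -(η * (((G i (bumpRow y j) : ℝ) - G i y) / W)) =
        ((G i (bumpRow y j) - G i y : ℕ) : ℝ) * Real.log ρ := by
      rw [hη, Nat.cast_sub hG]
      field_simp
    rw [e1, Real.exp_nat_mul, Real.exp_log hρ, mul_sub, mul_one, ← pow_add,
      Nat.add_sub_cancel' hG]
  have hηp : 0 < η := by rw [hη]; nlinarith
  rw [hgain]
  -- both factors shrink when passing to `z`, unless the promised gain is negative
  by_cases hc : 0 ≤ mder Q (g i) z j / Q - 2 * δ
  · refine mul_le_mul ?_ ?_ ?_ (by positivity)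
    · exact pow_le_pow_of_le_one hρ.le hρ1.le (ha.mono i hi _ _ hyz)
    · gcongr
    · rw [sub_nonneg, Real.exp_le_one_iff]
      nlinarith
  · refine le_trans (mul_nonpos_of_nonneg_of_nonpos (by positivity) ?_) (mul_nonneg (by positivity) ?_)
    · rw [sub_nonpos, Real.one_le_exp_iff]
      push Not at hc
      nlinarith
    · rw [sub_nonneg, Real.exp_le_one_iff]
      have : (0 : ℝ) ≤ ((G i (bumpRow y j) : ℝ) - G i y) / W := by
        apply div_nonneg _ hW.le
        rw [sub_nonneg]
        exact_mod_cast hG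
      nlinarith

/-- The potential of the greedy phase. -/
noncomputable def pot (n : ℕ) (G : ℕ → (Fin m → ℕ) → ℕ) (ρ : ℝ) (x : ℕ → Fin m → ℕ) : ℝ :=
  ∑ i ∈ Finset.range n, ρ ^ G i (x i)

theorem pot_bump (x : ℕ → Fin m → ℕ) {i : ℕ} (hi : i < n) (j : Fin m) :
    pot n G ρ (bump x i j) + gain (G i) ρ (x i) j = pot n G ρ x := by
  have h : ∀ i' ∈ Finset.range n, ρ ^ G i' (bump x i j i') =
      ρ ^ G i' (x i') - if i' = i then gain (G i) ρ (x i) j else 0 := by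
    intro i' _
    unfold bump gain
    by_cases h : i' = i
    · subst h; simp
    · simp [h]
  unfold pot
  rw [Finset.sum_congr rfl h, Finset.sum_sub_distrib]
  simp [hi]

/-- During a round the potential drops at least by what the reference allocation `A` promises at
the end of the round. -/
theorem ItemsDone.pot_drop (ha : Approx n m Q g G W δ) (hρ : 0 < ρ) (hρ1 : ρ < 1) {η : ℝ}
    (hη : η = -Real.log ρ * W) (A : Fin m → Fin n) {c : ℕ} {x x' : ℕ → Fin m → ℕ}
    (h : ItemsDone n G ρ c x x') (hx : ∀ i j, x i j + 1 ≤ Q) {z : ℕ → Fin m → ℕ} (hz : x' ≤ z)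
    (hzQ : ∀ i j, z i j ≤ Q) :
    (∑ j ∈ Finset.univ.filter (fun j : Fin m => (j : ℕ) < c), ρ ^ G (A j) (z (A j)) *
      (1 - Real.exp (-(η * (mder Q (g (A j)) (z (A j)) j / Q - 2 * δ))))) + pot n G ρ x' ≤
      pot n G ρ x := by
  induction c generalizing x' with
  | zero => obtain rfl := h; simp
  | succ c ih =>
    obtain ⟨x₁, h₁, hc, i, hi, rfl, hmax⟩ := h
    have hx₁ : x₁ ≤ bump x₁ i ⟨c, hc⟩ := by
      intro i' j'; rw [bump_apply]; exact Nat.le_add_right _ _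
    have ih' := ih h₁ (hx₁.trans hz)
    have hfilter : (Finset.univ.filter fun j : Fin m => (j : ℕ) < c + 1) =
        insert ⟨c, hc⟩ (Finset.univ.filter fun j : Fin m => (j : ℕ) < c) := by
      ext j
      simp only [Finset.mem_filter, Finset.mem_univ, true_and, Finset.mem_insert, Fin.ext_iff]
      omega
    rw [hfilter, Finset.sum_insert (by simp)]
    have hp := pot_bump (G := G) (ρ := ρ) x₁ hi ⟨c, hc⟩
    have hA := (A ⟨c, hc⟩).2
    have hcol : x₁ (A ⟨c, hc⟩) ⟨c, hc⟩ + 1 ≤ Q := by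
      have := h₁.props.2.1 (A ⟨c, hc⟩) ⟨c, hc⟩
      simp only [lt_self_iff_false, if_false] at this
      have := hx (A ⟨c, hc⟩) ⟨c, hc⟩
      omega
    have hg := le_gain ha hρ hρ1 hη hA ((hx₁.trans hz) _) (hzQ _) hcol
    have := hmax _ hA
    linarith

theorem exp_neg_le_quadratic {u b : ℝ} (hu : |u| ≤ b) (hb : b ≤ 1) :
    Real.exp (-u) ≤ 1 - u + b ^ 2 := by
  have h1 := (abs_le.mp (Real.abs_exp_sub_one_sub_id_le (x := -u) (by rw [abs_neg]; linarith))).2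
  have h2 : (-u) ^ 2 ≤ b ^ 2 := by
    rw [neg_sq, ← sq_abs]
    exact pow_le_pow_left₀ (abs_nonneg _) hu 2
  linarith

/-- An implicit Euler step for the potential: its decrease is controlled by the deficits at the end
of the round. -/
theorem ItemsDone.pot_round (ha : Approx n m Q g G W δ) (hρ : 0 < ρ) (hρ1 : ρ < 1) {η κ : ℝ}
    (hη : η = -Real.log ρ * W) (A : Fin m → Fin n) (hA : ∀ i : Fin n, g i (bundle A i) = 1)
    (hδ : 0 ≤ δ) (hb : η * (1 / Q + 2 * δ) ≤ 1)
    (hκ : δ + m * (2 * δ * Q + η * Q * (1 / Q + 2 * δ) ^ 2) ≤ κ)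
    {x x' : ℕ → Fin m → ℕ} (h : ItemsDone n G ρ m x x') (hx : ∀ i j, x i j + 1 ≤ Q) :
    pot n G ρ x' + η / Q * ∑ i ∈ Finset.range n, ρ ^ G i (x' i) * (1 - G i (x' i) / W - κ) ≤
      pot n G ρ x := by
  have hQ : (0 : ℝ) < Q := by exact_mod_cast ha.Q_pos
  have hηp : 0 < η := by
    have := Real.log_neg hρ hρ1
    have := ha.W_pos
    rw [hη]; nlinarith
  have hx' : ∀ i j, x' i j ≤ Q := by
    intro i j
    have h1 := h.props.2.1 i j
    have h2 := hx i j
    split_ifs at h1 <;> omega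
  have hdrop := h.pot_drop ha hρ hρ1 hη A hx le_rfl hx'
  have hfilter : (Finset.univ.filter fun j : Fin m => (j : ℕ) < m) = Finset.univ := by
    ext j; simp
  rw [hfilter] at hdrop
  refine le_trans ?_ hdrop
  rw [add_comm, Finset.mul_sum, Finset.sum_range]
  gcongr ?_ + _
  set b := η * (1 / Q + 2 * δ) with hbdef
  -- linearize the exponentials, and sum the derivatives over the bundle of each agent
  calc ∑ i : Fin n, η / Q * (ρ ^ G i (x' i) * (1 - G i (x' i) / W - κ))
      ≤ ∑ i : Fin n, ∑ j ∈ bundle A i, ρ ^ G (A j) (x' (A j)) *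
          (1 - Real.exp (-(η * (mder Q (g (A j)) (x' (A j)) j / Q - 2 * δ)))) := by
        refine Finset.sum_le_sum fun i _ => ?_
        have hval := ha.val i i.2
        have hcl := abs_le.mp (ha.close i i.2 (x' i) (hx' i))
        have hpt : ∀ j ∈ bundle A i, ρ ^ G i (x' i) *
            (η / Q * mder Q (g i) (x' i) j - (2 * η * δ + b ^ 2)) ≤ ρ ^ G (A j) (x' (A j)) *
            (1 - Real.exp (-(η * (mder Q (g (A j)) (x' (A j)) j / Q - 2 * δ)))) := by
          intro j hj
          simp only [bundle, Finset.mem_filter, Finset.mem_univ, true_and] at hj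
          rw [hj]
          refine mul_le_mul_of_nonneg_left ?_ (by positivity)
          have hD0 := mder_nonneg (Q := Q) hval (x' i) j
          have hD1 : mder Q (g i) (x' i) j ≤ 1 :=
            (mder_le hval ha.Q_pos _ j).trans (ha.le_one i i.2 _)
          have hu : |η * (mder Q (g i) (x' i) j / Q - 2 * δ)| ≤ b := by
            rw [abs_mul, abs_of_pos hηp, hbdef]
            gcongr
            rw [abs_le]
            have h1 : mder Q (g i) (x' i) j / Q ≤ 1 / Q := by gcongr
            have h2 : 0 ≤ mder Q (g i) (x' i) j / Q := by positivity
            have h3 : (0 : ℝ) ≤ 1 / Q := by positivity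
            constructor <;> linarith
          have := exp_neg_le_quadratic hu hb
          have e : η * (mder Q (g i) (x' i) j / Q - 2 * δ) =
            η / Q * mder Q (g i) (x' i) j - 2 * η * δ := by ring
          linarith
        refine le_trans ?_ (Finset.sum_le_sum hpt)
        rw [← Finset.mul_sum, Finset.sum_sub_distrib, ← Finset.mul_sum, Finset.sum_const,
          nsmul_eq_mul]
        have hsum := sum_mder_ge hval ha.Q_pos (x' i) (bundle A i)
        rw [hA i] at hsum
        have hcard : ((bundle A i).card : ℝ) ≤ m := by
          exact_mod_cast (Finset.card_le_univ _).trans (by simp)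
        have h1 : η / Q * (1 - mext Q (g i) (x' i)) ≤
          η / Q * ∑ j ∈ bundle A i, mder Q (g i) (x' i) j := by gcongr
        have h2 : ((bundle A i).card : ℝ) * (2 * η * δ + b ^ 2) ≤ m * (2 * η * δ + b ^ 2) := by
          gcongr
        have h3 : η / Q * (δ + m * (2 * δ * Q + η * Q * (1 / Q + 2 * δ) ^ 2)) ≤ η / Q * κ := by
          gcongr
        have h4 : η / Q * (δ + m * (2 * δ * Q + η * Q * (1 / Q + 2 * δ) ^ 2)) =
            η / Q * δ + m * (2 * η * δ + b ^ 2) := by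
          rw [hbdef]
          field_simp
        have h5 : η / Q * (1 - G i (x' i) / W - δ) ≤ η / Q * (1 - mext Q (g i) (x' i)) := by
          refine mul_le_mul_of_nonneg_left ?_ (by positivity)
          linarith
        have h6 : η / Q * (1 - G i (x' i) / W - κ) ≤
            η / Q * (1 - G i (x' i) / W - δ) - m * (2 * η * δ + b ^ 2) := by
          have e1 : η / Q * (1 - G i (x' i) / W - κ) =
            η / Q * (1 - G i (x' i) / W) - η / Q * κ := by ring
          have e2 : η / Q * (1 - G i (x' i) / W - δ) =
            η / Q * (1 - G i (x' i) / W) - η / Q * δ := by ring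
          linarith
        calc η / Q * (ρ ^ G i (x' i) * (1 - G i (x' i) / W - κ))
            = ρ ^ G i (x' i) * (η / Q * (1 - G i (x' i) / W - κ)) := by ring
          _ ≤ _ := by
            refine mul_le_mul_of_nonneg_left ?_ (by positivity)
            linarith
    _ = _ := by
        exact Finset.sum_fiberwise_of_maps_to (fun _ _ => Finset.mem_univ _) _

theorem exp_sub_sq_le {b : ℝ} (h1 : -(1 / 3) ≤ b) (h2 : b ≤ 1) : Real.exp (b - b ^ 2) ≤ 1 + b := by
  rcases le_total 0 b with h | h
  · have hx : |b - b ^ 2| ≤ 1 := by rw [abs_le]; constructor <;> nlinarith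
    have h3 := (abs_le.mp (Real.abs_exp_sub_one_sub_id_le hx)).2
    have h4 : (b - b ^ 2) ^ 2 ≤ b ^ 2 := by
      have : 0 ≤ b - b ^ 2 := by nlinarith
      apply pow_le_pow_left₀ this
      nlinarith
    linarith
  · have h3 : 1 + (b ^ 2 - b) + (b ^ 2 - b) ^ 2 / 2 ≤ Real.exp (b ^ 2 - b) :=
      Real.quadratic_le_exp_of_nonneg (by nlinarith)
    have h4 : 1 ≤ (1 + b) * (1 + (b ^ 2 - b) + (b ^ 2 - b) ^ 2 / 2) := by
      have h5 : (1 + b) * (1 + (b ^ 2 - b) + (b ^ 2 - b) ^ 2 / 2) =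
        1 + b ^ 2 * (1 / 2 + b / 2 - b ^ 2 / 2 + b ^ 3 / 2) := by ring
      rw [h5]
      have h6 : 0 ≤ 1 / 2 + b / 2 - b ^ 2 / 2 + b ^ 3 / 2 := by
        have : b ^ 2 ≤ 1 / 9 := by nlinarith
        nlinarith
      nlinarith [mul_nonneg (sq_nonneg b) h6]
    have h5 : 1 ≤ (1 + b) * Real.exp (b ^ 2 - b) :=
      h4.trans (mul_le_mul_of_nonneg_left h3 (by linarith))
    have h6 : Real.exp (b - b ^ 2) * Real.exp (b ^ 2 - b) = 1 := by
      rw [← Real.exp_add]; simp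
    exact le_of_mul_le_mul_right (by rw [h6]; exact h5) (Real.exp_pos (b ^ 2 - b))

/-- The induction step of `RoundsDone.pot_le`: the additive error `s * N` is absorbed by the growth of
the factor `1 + 2 * τ`. -/
theorem le_of_mul_one_add_le {P γ s N a b τ : ℝ}
    (hmain : P * (1 + b) ≤ Real.exp a * (Real.exp (γ * τ) * (N * (1 + 2 * τ))) + s * N)
    (hea : Real.exp a ≤ (1 + b) * Real.exp (γ * s)) (h1b : 1 / 2 ≤ 1 + b) (hγ : 0 ≤ γ)
    (hs : 0 ≤ s) (hτ : 0 ≤ τ) (hN : 0 ≤ N) :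
    P ≤ Real.exp (γ * (τ + s)) * (N * (1 + 2 * (τ + s))) := by
  refine le_of_mul_le_mul_right (hmain.trans ?_) (show 0 < 1 + b by linarith)
  rw [mul_add γ, Real.exp_add]
  set u := Real.exp (γ * τ)
  set w := Real.exp (γ * s)
  have hu : 1 ≤ u := Real.one_le_exp (by positivity)
  have hw : 1 ≤ w := Real.one_le_exp (by positivity)
  have h8 : Real.exp a * (u * (N * (1 + 2 * τ))) ≤ (1 + b) * w * (u * (N * (1 + 2 * τ))) := by
    gcongr
  have h9 : s * N ≤ (1 + b) * (u * w) * (N * (2 * s)) := by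
    have hu1 : 1 ≤ u * w := by nlinarith
    have h10 : 1 ≤ 2 * ((1 + b) * (u * w)) := by nlinarith
    have h11 : 0 ≤ s * N := by positivity
    nlinarith
  calc _ ≤ (1 + b) * w * (u * (N * (1 + 2 * τ))) + (1 + b) * (u * w) * (N * (2 * s)) := by
        linarith
    _ = _ := by ring

/-- The potential after `t` rounds, against the curve `1 - (1 + 1 / Q) ^ (-t)`, which is the implicit
Euler solution of `y' = 1 - y`. -/
theorem RoundsDone.pot_le (ha : Approx n m Q g G W δ) (hρ : 0 < ρ) (hρ1 : ρ < 1) {η κ : ℝ}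
    (hη : η = -Real.log ρ * W) (A : Fin m → Fin n) (hA : ∀ i : Fin n, g i (bundle A i) = 1)
    (hδ : 0 ≤ δ) (hb : η * (1 / Q + 2 * δ) ≤ 1 / 3)
    (hκ : δ + m * (2 * δ * Q + η * Q * (1 / Q + 2 * δ) ^ 2) ≤ κ) (hκ1 : κ ≤ 1)
    {t : ℕ} (ht : t ≤ Q) {x : ℕ → Fin m → ℕ} (h : RoundsDone n G ρ t x) :
    Real.exp (η * (1 - ((1 + 1 / (Q : ℝ)) ^ t)⁻¹)) * pot n G ρ x ≤
      Real.exp ((η * κ + η ^ 2 / Q) * (t / Q)) * (n * (1 + 2 * (t / Q))) := by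
  have hQ : (0 : ℝ) < Q := by exact_mod_cast ha.Q_pos
  have hηp : 0 < η := by
    have := Real.log_neg hρ hρ1
    have := ha.W_pos
    rw [hη]; nlinarith
  induction t generalizing x with
  | zero =>
    obtain rfl := h
    have : pot n G ρ (fun _ _ => 0) ≤ n := by
      unfold pot
      refine (Finset.sum_le_card_nsmul _ _ 1 fun i _ => ?_).trans (by simp)
      exact pow_le_one₀ hρ.le hρ1.le
    simpa using this
  | succ t ih =>
    obtain ⟨x₁, h₁, h₂⟩ := h
    have hx : ∀ i j, x₁ i j + 1 ≤ Q := by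
      intro i j
      have := h₁.props.1 i j
      omega
    have hih := ih (by omega) h₁
    have hround := h₂.pot_round ha hρ hρ1 hη A hA hδ (hb.trans (by norm_num)) hκ hx
    set s : ℝ := 1 / Q with hs
    have hs0 : 0 < s := by positivity
    set p := ((1 + s) ^ (t + 1))⁻¹ with hp
    have hp0 : 0 < p := by positivity
    have hp1 : p ≤ 1 := inv_le_one_of_one_le₀ (one_le_pow₀ (by linarith))
    have hpt : ((1 + s) ^ t)⁻¹ = p * (1 + s) := by
      rw [hp, pow_succ]; field_simp
    rw [hpt] at hih
    set γ := η * κ + η ^ 2 / Q with hγ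
    set F := fun i => (G i (x i) : ℝ) / W with hF
    have hlam : ∀ i, ρ ^ G i (x i) = Real.exp (-(η * F i)) := by
      intro i
      have hW := ha.W_pos
      have : -(η * F i) = (G i (x i) : ℝ) * Real.log ρ := by
        rw [hη, hF]; field_simp
      rw [this, Real.exp_nat_mul, Real.exp_log hρ]
    have hηs : η * s ≤ 1 / 3 := by
      refine le_trans ?_ hb
      gcongr
      linarith
    have hκ0 : 0 ≤ κ := le_trans (by positivity) hκ
    -- multiply the Euler step by `exp (η (1 - p))`
    set E := Real.exp (η * (1 - p)) with hE
    have hE0 : 0 < E := Real.exp_pos _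
    have hsum : E * pot n G ρ x * (1 + η * s * (p - κ)) - s * n ≤
        E * (pot n G ρ x + η / Q * ∑ i ∈ Finset.range n, ρ ^ G i (x i) * (1 - F i - κ)) := by
      have hterm : ∀ i ∈ Finset.range n, E * ρ ^ G i (x i) * (1 + η * s * (p - κ)) - s ≤
          E * ρ ^ G i (x i) + η * s * (E * (ρ ^ G i (x i) * (1 - F i - κ))) := by
        intro i _
        -- the distance to the curve; `u * exp (-u) ≤ 1` bounds its contribution
        set Y := F i - (1 - p) with hY
        have h1 : E * ρ ^ G i (x i) = Real.exp (-(η * Y)) := by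
          rw [hlam, hE, ← Real.exp_add, hY]; ring_nf
        have h2 : η * Y * Real.exp (-(η * Y)) ≤ 1 := by
          have h3 := Real.add_one_le_exp (η * Y)
          have h4 : Real.exp (η * Y) * Real.exp (-(η * Y)) = 1 := by
            rw [← Real.exp_add]; simp
          nlinarith [Real.exp_pos (-(η * Y))]
        have h3 : E * (ρ ^ G i (x i) * (1 - F i - κ)) =
            Real.exp (-(η * Y)) * (p - κ - Y) := by
          rw [← mul_assoc, h1, hY]; ring
        rw [h3, h1]
        nlinarith
      have h4 := Finset.sum_le_sum hterm
      rw [Finset.sum_sub_distrib, Finset.sum_add_distrib, ← Finset.sum_mul, ← Finset.mul_sum,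
        ← Finset.mul_sum, ← Finset.mul_sum, Finset.sum_const, Finset.card_range,
        nsmul_eq_mul] at h4
      have h5 : η / Q = η * s := by rw [hs]; ring
      rw [h5]
      unfold pot
      linarith
    -- the factor `exp a` by which the normalization changes is nearly `1 + b`
    set a := η * s * p with ha'
    set b := a - η * s * κ with hbdef
    have hEe : E = Real.exp a * Real.exp (η * (1 - p * (1 + s))) := by
      rw [hE, ← Real.exp_add, ha']; ring_nf
    set R := Real.exp (γ * (t / Q)) * (n * (1 + 2 * (t / Q))) with hR
    have hmain : E * pot n G ρ x * (1 + b) ≤ Real.exp a * R + s * n := by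
      have h6 : E * (pot n G ρ x + η / Q * ∑ i ∈ Finset.range n, ρ ^ G i (x i) * (1 - F i - κ)) ≤
          E * pot n G ρ x₁ := by gcongr
      have h7 : E * pot n G ρ x₁ ≤ Real.exp a * R := by
        rw [hEe, mul_assoc]
        gcongr
      have e : 1 + η * s * (p - κ) = 1 + b := by rw [hbdef, ha']; ring
      rw [e] at hsum
      linarith
    have hηs0 : 0 < η * s := by positivity
    have hb1 : |b| ≤ η * s := by
      have e : b = η * s * (p - κ) := by rw [hbdef, ha']; ring
      have h8 : |p - κ| ≤ 1 := by rw [abs_le]; constructor <;> linarith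
      rw [e, abs_mul, abs_of_pos hηs0]
      exact mul_le_of_le_one_right hηs0.le h8
    have hb2 := abs_le.mp hb1
    have hexpb := exp_sub_sq_le (b := b) (by linarith) (by linarith)
    have hbsq : b ^ 2 ≤ (η * s) ^ 2 := by
      rw [← sq_abs b]
      exact pow_le_pow_left₀ (abs_nonneg _) hb1 2
    have hsγ : γ * s = η * s * κ + (η * s) ^ 2 := by rw [hγ, hs]; ring
    have hea : Real.exp a ≤ (1 + b) * Real.exp (γ * s) := by
      calc Real.exp a ≤ Real.exp ((b - b ^ 2) + γ * s) := by
            gcongr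
            rw [hsγ, hbdef] at *
            linarith
        _ = Real.exp (b - b ^ 2) * Real.exp (γ * s) := Real.exp_add _ _
        _ ≤ _ := by gcongr
    have hγ0 : 0 ≤ γ := by positivity
    have hcast : ((t + 1 : ℕ) : ℝ) / Q = t / Q + s := by push_cast; rw [hs]; ring
    rw [hcast]
    exact le_of_mul_one_add_le hmain hea (by linarith) hγ0 hs0.le (by positivity)
      (Nat.cast_nonneg n)

/-- After `Q` greedy rounds all agents have almost a `1 - 1 / e` fraction. -/
theorem RoundsDone.estimate_ge (ha : Approx n m Q g G W δ) (hρ : 0 < ρ) (hρ1 : ρ < 1) {η κ : ℝ}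
    (hη : η = -Real.log ρ * W) (A : Fin m → Fin n) (hA : ∀ i : Fin n, g i (bundle A i) = 1)
    (hδ : 0 ≤ δ) (hb : η * (1 / Q + 2 * δ) ≤ 1 / 3)
    (hκ : δ + m * (2 * δ * Q + η * Q * (1 / Q + 2 * δ) ^ 2) ≤ κ) (hκ1 : κ ≤ 1)
    (hγ : η * κ + η ^ 2 / Q ≤ 1) {x : ℕ → Fin m → ℕ} (h : RoundsDone n G ρ Q x) {i : ℕ}
    (hi : i < n) :
    1 - 1 / Real.exp 1 - 1 / Q - Real.log (9 * n) / η ≤ G i (x i) / W := by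
  have hQ : (0 : ℝ) < Q := by exact_mod_cast ha.Q_pos
  have hQ1 : (1 : ℝ) ≤ Q := by exact_mod_cast ha.Q_pos
  have hW := ha.W_pos
  have hηp : 0 < η := by
    have := Real.log_neg hρ hρ1
    rw [hη]; nlinarith
  have hpot := h.pot_le ha hρ hρ1 hη A hA hδ hb hκ hκ1 le_rfl
  rw [div_self hQ.ne', mul_one] at hpot
  have hn : (0 : ℝ) < n := by exact_mod_cast (Nat.zero_le i).trans_lt hi
  have hterm : ρ ^ G i (x i) ≤ pot n G ρ x :=
    Finset.single_le_sum (f := fun i => ρ ^ G i (x i)) (fun _ _ => by positivity)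
      (Finset.mem_range.mpr hi)
  have hlam : ρ ^ G i (x i) = Real.exp (-(η * (G i (x i) / W))) := by
    have : -(η * (G i (x i) / W)) = (G i (x i) : ℝ) * Real.log ρ := by
      rw [hη]; field_simp
    rw [this, Real.exp_nat_mul, Real.exp_log hρ]
  set p := ((1 + 1 / (Q : ℝ)) ^ Q)⁻¹ with hp
  have he : Real.exp (η * κ + η ^ 2 / Q) ≤ 3 :=
    (Real.exp_le_exp.mpr hγ).trans (Real.exp_one_lt_d9.le.trans (by norm_num))
  -- one term is at most the whole potential, and `9 = 3 * 3` bounds both factors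
  have h1 : Real.exp (η * (1 - p) - η * (G i (x i) / W)) ≤ 9 * n := by
    rw [sub_eq_add_neg, Real.exp_add, ← hlam]
    calc _ ≤ Real.exp (η * (1 - p)) * pot n G ρ x := by gcongr
      _ ≤ _ := hpot
      _ ≤ 3 * (n * (1 + 2 * 1)) := by gcongr
      _ = _ := by ring
  have h2 := (Real.le_log_iff_exp_le (by positivity)).mpr h1
  have h3 : 1 - p - Real.log (9 * n) / η ≤ G i (x i) / W := by
    rw [sub_le_comm, ← sub_nonneg]
    have : 0 ≤ (Real.log (9 * n) - (η * (1 - p) - η * (G i (x i) / W))) * η⁻¹ :=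
      mul_nonneg (by linarith) (by positivity)
    have e : (Real.log (9 * n) - (η * (1 - p) - η * (G i (x i) / W))) * η⁻¹ =
      Real.log (9 * n) / η - (1 - p - G i (x i) / W) := by field_simp
    linarith
  -- the Euler value is close to `1 / e`
  have h4 : p ≤ 1 / Real.exp 1 + 1 / Q := by
    set s : ℝ := 1 / Q with hs
    have hs0 : 0 < s := by positivity
    have hs1 : s ≤ 1 := by rw [hs, div_le_one hQ]; exact hQ1
    have h5 : Real.exp (1 - s) ≤ (1 + s) ^ Q := by
      have h6 : Real.exp (s - s ^ 2) ^ Q ≤ (1 + s) ^ Q :=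
        pow_le_pow_left₀ (Real.exp_pos _).le (exp_sub_sq_le (by linarith) hs1) Q
      rw [← Real.exp_nat_mul] at h6
      have e : (Q : ℝ) * (s - s ^ 2) = 1 - s := by rw [hs]; field_simp
      rwa [e] at h6
    have h6 : p ≤ Real.exp (s - 1) := by
      rw [hp, show s - 1 = -(1 - s) by ring, Real.exp_neg]
      exact inv_anti₀ (Real.exp_pos _) h5
    have h7 : Real.exp s ≤ 1 + s + s ^ 2 := by
      have := (abs_le.mp (Real.abs_exp_sub_one_sub_id_le (x := s)
        (by rw [abs_of_pos hs0]; exact hs1))).2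
      linarith
    have h8 : Real.exp (s - 1) = Real.exp s / Real.exp 1 := Real.exp_sub _ _
    have h9 : (2 : ℝ) ≤ Real.exp 1 := by
      have := Real.exp_one_gt_d9
      linarith
    have h10 : Real.exp s / Real.exp 1 ≤ (1 + s * Real.exp 1) / Real.exp 1 := by
      gcongr
      nlinarith
    have h11 : (1 + s * Real.exp 1) / Real.exp 1 = 1 / Real.exp 1 + s := by
      field_simp
    linarith
  linarith

end Greedy

/-! ### Rounding a fractional assignment -/

section Rounding

variable {m n Q : ℕ}

/-- Item `j` is split and agent `i` has a part of it. -/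
def Frac (Q : ℕ) (x : ℕ → Fin m → ℕ) (i : ℕ) (j : Fin m) : Prop := 0 < x i j ∧ x i j < Q

/-- All `Q` units of every item are assigned. -/
def ColSum (n Q : ℕ) (x : ℕ → Fin m → ℕ) : Prop := ∀ j, ∑ i ∈ Finset.range n, x i j = Q

/-- The number of pairs of an agent and an item of which the agent has a part. -/
def supp (n : ℕ) (x : ℕ → Fin m → ℕ) : ℕ :=
  ((Finset.range n ×ˢ Finset.univ).filter fun p : ℕ × Fin m => 0 < x p.1 p.2).card

/-- Every agent is worth at least `b`, except that agents without split items may have lost `e`. -/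
def Level (n Q : ℕ) (g : ℕ → Finset (Fin m) → ℝ) (e b : ℝ) (x : ℕ → Fin m → ℕ) : Prop :=
  ∀ i < n, b ≤ mext Q (g i) (x i) ∨ ((∀ j, ¬ Frac Q x i j) ∧ b - e ≤ mext Q (g i) (x i))

/-- A step that keeps the item totals and the level up to `d`, and makes progress as long as items
are split. -/
structure RoundStep (n Q : ℕ) (g : ℕ → Finset (Fin m) → ℝ) (e d : ℝ)
    (x x' : ℕ → Fin m → ℕ) : Prop where
  colSum : ColSum n Q x'
  progress : (supp n x' < supp n x ∧ ∃ i < n, ∃ j, Frac Q x i j) ∨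
    (x' = x ∧ ∀ i < n, ∀ j, ¬ Frac Q x i j)
  level : ∀ b, Level n Q g e b x → Level n Q g e (b - d) x'

theorem ColSum.le {x : ℕ → Fin m → ℕ} (h : ColSum n Q x) {i : ℕ} (hi : i < n) (j : Fin m) :
    x i j ≤ Q := by
  rw [← h j]
  exact Finset.single_le_sum (f := fun i => x i j) (fun _ _ => Nat.zero_le _)
    (Finset.mem_range.mpr hi)

theorem ColSum.add_le {x : ℕ → Fin m → ℕ} (h : ColSum n Q x) {i i' : ℕ} (hi : i < n) (hi' : i' < n)
    (hne : i ≠ i') (j : Fin m) : x i j + x i' j ≤ Q := by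
  rw [← h j, ← Finset.sum_pair (f := fun i => x i j) hne]
  refine Finset.sum_le_sum_of_subset fun k hk => ?_
  simp only [Finset.mem_insert, Finset.mem_singleton] at hk
  rcases hk with rfl | rfl <;> simpa

theorem ColSum.exists_other {x : ℕ → Fin m → ℕ} (h : ColSum n Q x) {i : ℕ} {j : Fin m}
    (hlt : x i j < Q) : ∃ i' < n, i' ≠ i ∧ 0 < x i' j := by
  by_contra hcon
  push Not at hcon
  have : ∑ i' ∈ Finset.range n, x i' j ≤ x i j := by
    by_cases hi : i ∈ Finset.range n
    · rw [Finset.sum_eq_single_of_mem i hi]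
      intro k hk hki
      have := hcon k (Finset.mem_range.mp hk) hki
      omega
    · rw [Finset.sum_eq_zero]
      · omega
      intro k hk
      have := hcon k (Finset.mem_range.mp hk) (fun h => hi (h ▸ hk))
      omega
  rw [h j] at this
  omega

theorem supp_lt {x x' : ℕ → Fin m → ℕ} (h : ∀ i < n, ∀ j, 0 < x' i j → 0 < x i j) {i : ℕ}
    (hi : i < n) {j : Fin m} (h1 : 0 < x i j) (h2 : x' i j = 0) : supp n x' < supp n x := by
  refine Finset.card_lt_card (Finset.ssubset_iff_of_subset ?_ |>.mpr ⟨(i, j), ?_, ?_⟩)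
  · rintro ⟨k, l⟩ hkl
    simp only [Finset.mem_filter, Finset.mem_product, Finset.mem_range, Finset.mem_univ,
      and_true] at hkl ⊢
    exact ⟨hkl.1, h k hkl.1 l hkl.2⟩
  · simp [hi, h1]
  · simp [h2]

theorem supp_le (x : ℕ → Fin m → ℕ) : supp n x ≤ n * m := by
  refine (Finset.card_filter_le _ _).trans ?_
  simp

/-- An agent with a single split item gives up its part of it in favour of another owner. -/
def leafMove (x : ℕ → Fin m → ℕ) (i : ℕ) (j : Fin m) (i' : ℕ) : ℕ → Fin m → ℕ :=
  Function.update (Function.update x i' (Function.update (x i') j (x i' j + x i j))) i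
    (Function.update (x i) j 0)

variable {g : ℕ → Finset (Fin m) → ℝ} {e d : ℝ}

/-- The agent `i` loses at most the value `e` of one item, and then has no split items any more; the
other owner `i'` only gains. -/
theorem leafMove_step (hQ : 0 < Q) (hval : ∀ i < n, IsValuation (g i))
    (hd : 0 ≤ d) (he : ∀ i < n, ∀ j, g i {j} ≤ e)
    {x : ℕ → Fin m → ℕ} (hx : ColSum n Q x) {i i' : ℕ} {j : Fin m} (hi : i < n)
    (hi' : i' < n) (hne : i' ≠ i) (hf : Frac Q x i j) (honly : ∀ j', j' ≠ j → ¬ Frac Q x i j')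
    (hpos : 0 < x i' j) : RoundStep n Q g e d x (leafMove x i j i') := by
  have hri : leafMove x i j i' i = Function.update (x i) j 0 := by simp [leafMove]
  have hri' : leafMove x i j i' i' = Function.update (x i') j (x i' j + x i j) := by
    simp [leafMove, hne]
  have hro : ∀ k, k ≠ i → k ≠ i' → leafMove x i j i' k = x k := by
    intro k h1 h2
    simp [leafMove, h1, h2]
  have hsum := hx.add_le hi hi' hne.symm j
  have hcol : ∀ j', ∑ k ∈ Finset.range n, leafMove x i j i' k j' =
      ∑ k ∈ Finset.range n, x k j' := by
    intro j'
    -- only two rows change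
    have hpair : ∀ f : ℕ → ℕ, ∑ k ∈ Finset.range n, f k =
        f i + f i' + ∑ k ∈ ((Finset.range n).erase i).erase i', f k := by
      intro f
      rw [← Finset.add_sum_erase _ f (Finset.mem_range.mpr hi),
        ← Finset.add_sum_erase _ f (a := i') (by simp [hne, hi'])]
      ring
    rw [hpair, hpair]
    congr 1
    · rw [hri, hri']
      by_cases hj : j' = j
      · subst hj; simp; omega
      · simp [hj]
    · refine Finset.sum_congr rfl fun k hk => ?_
      simp only [Finset.mem_erase] at hk
      rw [hro k hk.2.1 hk.1]
  refine ⟨fun j' => (hcol j').trans (hx j'), Or.inl ⟨?_, i, hi, j, hf⟩, ?_⟩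
  · refine supp_lt ?_ hi hf.1 (by simp [hri])
    intro k _ l hl
    by_cases h1 : k = i
    · subst h1
      rw [hri] at hl
      by_cases h2 : l = j
      · subst h2; exact hf.1
      · simpa [h2] using hl
    · by_cases h2 : k = i'
      · subst h2
        rw [hri'] at hl
        by_cases h3 : l = j
        · subst h3; exact hpos
        · simpa [h3] using hl
      · rwa [hro k h1 h2] at hl
  · intro b hb k hk
    by_cases h1 : k = i
    · subst h1
      right
      rcases hb k hk with h | h
      · refine ⟨fun l hl => ?_, ?_⟩
        · rw [Frac, hri] at hl
          by_cases h2 : l = j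
          · subst h2; simp at hl
          · rw [Function.update_of_ne h2] at hl
            exact honly l h2 hl
        · rw [hri]
          have h3 := mext_update_sub (g := g k) j (x k) (Nat.zero_le Q) hf.2.le hQ
          have h4 := (mder_le (hval k hk) hQ (x k) j).trans (he k hk j)
          have h5 := mder_nonneg (Q := Q) (hval k hk) (x k) j
          have hQ' : (0 : ℝ) < Q := by exact_mod_cast hQ
          have h6 : (x k j : ℝ) / Q ≤ 1 := by
            rw [div_le_one hQ']
            exact_mod_cast hf.2.le
          have h7 : (x k j : ℝ) / Q * mder Q (g k) (x k) j ≤ e := by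
            have : 0 ≤ (x k j : ℝ) / Q := by positivity
            nlinarith
          have e1 : (((0 : ℕ) : ℝ) - x k j) / Q * mder Q (g k) (x k) j =
            -((x k j : ℝ) / Q * mder Q (g k) (x k) j) := by push_cast; ring
          rw [e1] at h3
          linarith
      · exact absurd hf (h.1 j)
    · by_cases h2 : k = i'
      · subst h2
        left
        rcases hb k hk with h | h
        · rw [hri']
          have := mext_mono (Q := Q) (hval k hk)
            (y := x k) (y' := Function.update (x k) j (x k j + x i j)) (by
              intro l
              by_cases hl : l = j
              · subst hl; simp
              · simp [hl])
          linarith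
        · refine absurd ⟨hpos, ?_⟩ (h.1 j)
          have := hf.1
          omega
      · have h3 := hro k h1 h2
        simp only [Frac, h3]
        rcases hb k hk with h | h
        · left; linarith
        · right; exact ⟨h.1, by linarith [h.2]⟩

/-- A closed walk through agents `a l` and items `b l`, repeated with period `L`; agent `a l` and
agent `a (l + 1)` share item `b l`. -/
structure Cyc (n : ℕ) (x : ℕ → Fin m → ℕ) (L : ℕ) (a : ℕ → ℕ) (b : ℕ → Fin m) : Prop where
  L_pos : 0 < L
  a_per : ∀ l, a (l + L) = a l
  b_per : ∀ l, b (l + L) = b l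
  a_lt : ∀ l, a l < n
  a_inj : ∀ l l', l < l' → l' < l + L → a l ≠ a l'
  b_ne : ∀ l, b l ≠ b (l + 1)
  pos_left : ∀ l, 0 < x (a l) (b l)
  pos_right : ∀ l, 0 < x (a (l + 1)) (b l)

/-- Add `s` units of item `p` and remove `u` units of item `q`. -/
def shift (y : Fin m → ℕ) (p : Fin m) (s : ℕ) (q : Fin m) (u : ℕ) : Fin m → ℕ :=
  Function.update (Function.update y p (y p + s)) q (y q - u)

/-- Agent `a (l + 1)` can afford to give `u` units of `b (l + 1)` in exchange for `s` of `b l`. -/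
def Affords (G : ℕ → (Fin m → ℕ) → ℕ) (tol : ℕ) (x : ℕ → Fin m → ℕ) (a : ℕ → ℕ) (b : ℕ → Fin m)
    (s l u : ℕ) : Prop :=
  u ≤ x (a (l + 1)) (b (l + 1)) ∧ G (a (l + 1)) (x (a (l + 1))) ≤
    G (a (l + 1)) (shift (x (a (l + 1))) (b l) s (b (l + 1)) u) + tol

/-- Transfers along the walk: the first agent gives all it has, every later agent gives the most
that it can afford. -/
structure Chain (G : ℕ → (Fin m → ℕ) → ℕ) (tol : ℕ) (x : ℕ → Fin m → ℕ) (a : ℕ → ℕ)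
    (b : ℕ → Fin m) (K : ℕ) (S : ℕ → ℕ) : Prop where
  zero : S 0 = x (a 0) (b 0)
  affords : ∀ l < K, Affords G tol x a b (S l) l (S (l + 1))
  max : ∀ l < K, ∀ u, Affords G tol x a b (S l) l u → u ≤ S (l + 1)

theorem Chain.le {G : ℕ → (Fin m → ℕ) → ℕ} {tol : ℕ} {x : ℕ → Fin m → ℕ} {a : ℕ → ℕ}
    {b : ℕ → Fin m} {K : ℕ} {S : ℕ → ℕ} (h : Chain G tol x a b K S) {l : ℕ} (hl : l ≤ K) :
    S l ≤ x (a l) (b l) := by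
  cases l with
  | zero => exact h.zero.le
  | succ l => exact (h.affords l (by omega)).1

/-- The matrix after the agents `a (p + 1), …, a (p + c)` have received and given. -/
def applyChain (x : ℕ → Fin m → ℕ) (a : ℕ → ℕ) (b : ℕ → Fin m) (S : ℕ → ℕ) (p : ℕ) :
    ℕ → ℕ → Fin m → ℕ
  | 0 => x
  | c + 1 => Function.update (applyChain x a b S p c) (a (p + c + 1))
      (shift (applyChain x a b S p c (a (p + c + 1))) (b (p + c)) (S (p + c)) (b (p + c + 1))
        (S (p + c + 1)))

section Cycle

variable {L : ℕ} {x : ℕ → Fin m → ℕ} {a : ℕ → ℕ} {b : ℕ → Fin m} {S : ℕ → ℕ} {p : ℕ}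

theorem Cyc.two_le (hc : Cyc n x L a b) : 2 ≤ L := by
  by_contra h
  have h1 : L = 1 := by have := hc.L_pos; omega
  subst h1
  exact hc.b_ne 0 (hc.b_per 0).symm

theorem Cyc.a_ne (hc : Cyc n x L a b) (l : ℕ) : a l ≠ a (l + 1) :=
  hc.a_inj l (l + 1) (by omega) (by have := hc.two_le; omega)

theorem applyChain_row (hc : Cyc n x L a b) {c : ℕ} (hcL : c ≤ L) :
    (∀ l < c, applyChain x a b S p c (a (p + l + 1)) =
      shift (x (a (p + l + 1))) (b (p + l)) (S (p + l)) (b (p + l + 1)) (S (p + l + 1))) ∧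
    ∀ i, (∀ l < c, i ≠ a (p + l + 1)) → applyChain x a b S p c i = x i := by
  induction c with
  | zero => exact ⟨fun l hl => by omega, fun i _ => rfl⟩
  | succ c ih =>
    obtain ⟨h1, h2⟩ := ih (by omega)
    have hnew : applyChain x a b S p c (a (p + c + 1)) = x (a (p + c + 1)) :=
      h2 _ fun l hl => (hc.a_inj (p + l + 1) (p + c + 1) (by omega) (by omega)).symm
    refine ⟨fun l hl => ?_, fun i hi => ?_⟩
    · rcases Nat.lt_succ_iff_lt_or_eq.mp hl with hl | rfl
      · rw [applyChain, Function.update_of_ne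
          (hc.a_inj (p + l + 1) (p + c + 1) (by omega) (by omega)), h1 l hl]
      · rw [applyChain, Function.update_self, hnew]
    · rw [applyChain, Function.update_of_ne (hi c (by omega)),
        h2 i fun l hl => hi l (by omega)]

/-- A full turn of transfers that starts and ends with the whole part of `a p` in item `b p` is a
rounding step. -/
theorem applyChain_step {G : ℕ → (Fin m → ℕ) → ℕ} {tol : ℕ} {W δ : ℝ}
    (ha : Approx n m Q g G W δ) (hδ : 0 ≤ δ)
    (hd : tol / W + 2 * δ ≤ d) (hx : ColSum n Q x) (hc : Cyc n x L a b) {K : ℕ}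
    (hS : Chain G tol x a b K S) (hp : p < L) (hK : 2 * L ≤ K) (h1 : S p = x (a p) (b p))
    (h2 : S (p + L) = x (a p) (b p)) :
    RoundStep n Q g e d x (applyChain x a b S p L) := by
  obtain ⟨hrow, hother⟩ := applyChain_row (S := S) (p := p) hc (le_refl L)
  have hSle : ∀ l ≤ K, S l ≤ x (a l) (b l) := fun l hl => hS.le hl
  -- after `c` transfers the sums are off by what the first agent still has to give and by what is
  -- being handed on
  have hcolc : ∀ c ≤ L, ∀ j, (∑ i ∈ Finset.range n, applyChain x a b S p c i j) +
      (if j = b (p + c) then S (p + c) else 0) =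
      (∑ i ∈ Finset.range n, x i j) + if j = b p then S p else 0 := by
    intro c
    induction c with
    | zero => intro _ j; simp [applyChain]
    | succ c ih =>
      intro hcL j
      rw [← ih (by omega) j]
      have hmem : a (p + c + 1) ∈ Finset.range n := Finset.mem_range.mpr (hc.a_lt _)
      rw [← Finset.add_sum_erase _ _ hmem, ← Finset.add_sum_erase _ (fun i => _) hmem]
      have hrest : ∑ i ∈ (Finset.range n).erase (a (p + c + 1)),
          applyChain x a b S p (c + 1) i j =
          ∑ i ∈ (Finset.range n).erase (a (p + c + 1)), applyChain x a b S p c i j := by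
        refine Finset.sum_congr rfl fun i hi => ?_
        rw [applyChain, Function.update_of_ne (Finset.ne_of_mem_erase hi)]
      rw [hrest]
      have hnew : applyChain x a b S p c (a (p + c + 1)) = x (a (p + c + 1)) :=
        (applyChain_row (S := S) (p := p) hc (show c ≤ L by omega)).2 _ fun l hl =>
          (hc.a_inj (p + l + 1) (p + c + 1) (by omega) (by omega)).symm
      have hle := hSle (p + c + 1) (by omega)
      have hbne := hc.b_ne (p + c)
      simp only [applyChain, Function.update_self, hnew, shift]
      rw [← add_assoc p c 1]
      by_cases hj1 : j = b (p + c + 1)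
      · subst hj1
        simp only [Function.update_self, if_true, hbne.symm, if_false]
        omega
      · by_cases hj2 : j = b (p + c)
        · subst hj2
          simp only [ne_eq, hbne, not_false_eq_true, Function.update_of_ne, Function.update_self,
            if_true, if_false]
          omega
        · simp [hj1, hj2]
  have hcol : ColSum n Q (applyChain x a b S p L) := by
    intro j
    have := hcolc L le_rfl j
    rw [hc.b_per, h2, h1, hx j] at this
    omega
  have hshift : ∀ l, ∀ j s u, 0 < shift (x (a (l + 1))) (b l) s (b (l + 1)) u j →
      0 < x (a (l + 1)) j := by
    intro l j s u hj
    unfold shift at hj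
    by_cases hj1 : j = b (l + 1)
    · subst hj1; exact hc.pos_left _
    · rw [Function.update_of_ne hj1] at hj
      by_cases hj2 : j = b l
      · subst hj2; exact hc.pos_right _
      · rwa [Function.update_of_ne hj2] at hj
  -- two owners of an item both have a proper part
  have hfrac : ∀ l, Frac Q x (a l) (b l) := by
    intro l
    refine ⟨hc.pos_left l, ?_⟩
    have := hx.add_le (hc.a_lt l) (hc.a_lt (l + 1)) (hc.a_ne l) (b l)
    have := hc.pos_right l
    omega
  refine ⟨hcol, Or.inl ⟨?_, a p, hc.a_lt p, b p, hfrac p⟩, ?_⟩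
  · refine supp_lt (i := a p) (j := b p) ?_ (hc.a_lt p) (hc.pos_left p) ?_
    · intro i _ j hij
      by_cases h : ∃ l < L, i = a (p + l + 1)
      · obtain ⟨l, hl, rfl⟩ := h
        rw [hrow l hl] at hij
        exact hshift _ _ _ _ hij
      · push Not at h
        rwa [hother i h] at hij
    · have e1 : p + (L - 1) + 1 = p + L := by omega
      have := hrow (L - 1) (by omega)
      rw [e1, hc.a_per, hc.b_per, h2] at this
      rw [this]
      simp [shift]
  · intro β hβ i hi
    by_cases h : ∃ l < L, i = a (p + l + 1)
    · obtain ⟨l, hl, rfl⟩ := h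
      left
      rcases hβ _ hi with h3 | h3
      · have h4 := (hS.affords (p + l) (by omega)).2
        have h5 := abs_le.mp (ha.close _ hi _ (fun j => hx.le hi j))
        have h6 := abs_le.mp (ha.close _ hi _ (fun j => hcol.le hi j))
        rw [← hrow l hl] at h4
        have h7 : (G (a (p + l + 1)) (x (a (p + l + 1))) : ℝ) / W ≤
            G (a (p + l + 1)) (applyChain x a b S p L (a (p + l + 1))) / W + tol / W := by
          rw [← add_div]
          have := ha.W_pos
          gcongr
          exact_mod_cast h4
        linarith
      · exact absurd (hfrac _) (h3.1 _)
    · push Not at h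
      have h3 := hother i h
      have hd0 : 0 ≤ d := by
        have := ha.W_pos
        have : (0 : ℝ) ≤ tol / W := by positivity
        linarith
      simp only [Frac, h3]
      rcases hβ i hi with h4 | h4
      · left; linarith
      · right; exact ⟨h4.1, by linarith [h4.2]⟩

end Cycle

/-- If giving around a closed walk does not lose value in total, there are amounts of transfer, one
of them the largest possible, such that every agent is compensated up to one unit. -/
theorem exists_flow {L : ℕ} (hL : 0 < L) (α β : ℕ → ℝ) (X : ℕ → ℕ) (hα : ∀ l, 0 ≤ α l)
    (hα1 : ∀ l, α l ≤ 1) (hβ : ∀ l, 0 ≤ β l)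
    (hprod : ∏ l ∈ Finset.range L, β l ≤ ∏ l ∈ Finset.range L, α l) :
    ∃ t : ℕ → ℕ, (∀ l < L, t l ≤ X l) ∧ (∃ l < L, t l = X l) ∧
      (∀ l, l + 1 < L → t (l + 1) * β (l + 1) ≤ t l * α l + 1) ∧
      t 0 * β 0 ≤ t (L - 1) * α (L - 1) + 1 := by
  by_cases hzero : ∃ l < L, β l = 0
  -- an agent that does not value its part gives all of it, and nobody else gives anything
  · obtain ⟨l₀, hl₀, h0⟩ := hzero
    refine ⟨fun l => if l = l₀ then X l else 0, fun l _ => ?_, ⟨l₀, hl₀, by simp⟩, fun l hl => ?_, ?_⟩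
    · dsimp only
      split_ifs <;> simp
    · have h1 : 0 ≤ ((if l = l₀ then X l else 0 : ℕ) : ℝ) * α l := mul_nonneg (by positivity) (hα l)
      by_cases h : l + 1 = l₀
      · rw [h, h0]; simp only [mul_zero]; linarith
      · simp only [h, if_false, Nat.cast_zero, zero_mul]; linarith
    · have h1 : 0 ≤ ((if L - 1 = l₀ then X (L - 1) else 0 : ℕ) : ℝ) * α (L - 1) :=
        mul_nonneg (by positivity) (hα _)
      by_cases h : 0 = l₀
      · subst h
        rw [h0, mul_zero]
        linarith
      · simp only [h, if_false, Nat.cast_zero, zero_mul]; linarith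
  · push Not at hzero
    have hβ' : ∀ l < L, 0 < β l := fun l hl => lt_of_le_of_ne (hβ l) (hzero l hl).symm
    have hprodβ : 0 < ∏ l ∈ Finset.range L, β l :=
      Finset.prod_pos fun l hl => hβ' l (Finset.mem_range.mp hl)
    have hα' : ∀ l < L, 0 < α l := by
      intro l hl
      refine lt_of_le_of_ne (hα l) fun h => ?_
      have := Finset.prod_eq_zero (f := α) (Finset.mem_range.mpr hl) h.symm
      linarith
    -- the exactly compensated flow
    let r : ℕ → ℝ := fun l => ∏ k ∈ Finset.range l, α k / β (k + 1)
    have hr0 : r 0 = 1 := by simp [r]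
    have hr : ∀ l, l + 1 < L → r (l + 1) * β (l + 1) = r l * α l := by
      intro l hl
      simp only [r, Finset.prod_range_succ]
      have := (hβ' (l + 1) hl).ne'
      field_simp
    have hrpos : ∀ l < L, 0 < r l := by
      intro l hl
      refine Finset.prod_pos fun k hk => ?_
      rw [Finset.mem_range] at hk
      exact div_pos (hα' k (by omega)) (hβ' (k + 1) (by omega))
    have hclose : ∀ l, l < L →
        (∏ k ∈ Finset.range (l + 1), β k) * (r l * α l) = β 0 * ∏ k ∈ Finset.range (l + 1), α k := by
      intro l
      induction l with
      | zero => intro _; simp [hr0]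
      | succ l ih =>
        intro hl
        have h1 := ih (by omega)
        have h2 := hr l hl
        rw [Finset.prod_range_succ, Finset.prod_range_succ α]
        calc _ = (∏ k ∈ Finset.range (l + 1), β k) * (r (l + 1) * β (l + 1)) * α (l + 1) := by ring
          _ = (∏ k ∈ Finset.range (l + 1), β k) * (r l * α l) * α (l + 1) := by rw [h2]
          _ = _ := by rw [h1]; ring
    have hfinal : r 0 * β 0 ≤ r (L - 1) * α (L - 1) := by
      have h1 := hclose (L - 1) (by omega)
      rw [Nat.sub_add_cancel hL] at h1
      rw [hr0, one_mul]
      refine le_of_mul_le_mul_left ?_ hprodβ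
      rw [h1, mul_comm]
      exact mul_le_mul_of_nonneg_left hprod (hβ 0)
    -- scale it until the first part is used up, and round down
    obtain ⟨p, hp, hmin⟩ := Finset.exists_min_image (Finset.range L) (fun l => (X l : ℝ) / r l)
      ⟨0, Finset.mem_range.mpr hL⟩
    rw [Finset.mem_range] at hp
    set c := (X p : ℝ) / r p with hc
    have hc0 : 0 ≤ c := div_nonneg (Nat.cast_nonneg _) (hrpos p hp).le
    have hfloor : ∀ l < L, ((⌊c * r l⌋₊ : ℕ) : ℝ) ≤ c * r l := fun l hl =>
      Nat.floor_le (mul_nonneg hc0 (hrpos l hl).le)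
    have hstep : ∀ l k, l < L → k < L → r k * β k ≤ r l * α l →
        (⌊c * r k⌋₊ : ℝ) * β k ≤ ⌊c * r l⌋₊ * α l + 1 := by
      intro l k hl hk hlk
      have h1 := Nat.lt_floor_add_one (c * r l)
      have h2 : (⌊c * r k⌋₊ : ℝ) * β k ≤ c * r k * β k :=
        mul_le_mul_of_nonneg_right (hfloor k hk) (hβ k)
      have h3 : c * (r k * β k) ≤ c * (r l * α l) := mul_le_mul_of_nonneg_left hlk hc0
      have h4 : c * r l * α l ≤ (⌊c * r l⌋₊ + 1) * α l :=
        mul_le_mul_of_nonneg_right h1.le (hα l)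
      have := hα1 l
      linarith
    refine ⟨fun l => ⌊c * r l⌋₊, fun l hl => ?_, ⟨p, hp, ?_⟩, fun l hl => ?_, ?_⟩
    · apply Nat.floor_le_of_le
      rw [← le_div_iff₀ (hrpos l hl)]
      exact hmin l (Finset.mem_range.mpr hl)
    · simp only [hc]
      rw [div_mul_cancel₀ _ (hrpos p hp).ne', Nat.floor_natCast]
    · exact hstep l (l + 1) (by omega) hl (hr l hl).le
    · exact hstep (L - 1) 0 (by omega) hL hfinal

theorem succ_mod_eq {L : ℕ} (hL : 0 < L) (l : ℕ) :
    (l % L + 1 < L ∧ (l + 1) % L = l % L + 1) ∨ (l % L = L - 1 ∧ (l + 1) % L = 0) := by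
  have h1 := Nat.mod_lt l hL
  by_cases h : l % L + 1 < L
  · left
    refine ⟨h, ?_⟩
    rw [Nat.add_mod]
    have : 1 % L = 1 := Nat.mod_eq_of_lt (by omega)
    rw [this, Nat.mod_eq_of_lt h]
  · right
    have h2 : l % L + 1 = L := by omega
    refine ⟨by omega, ?_⟩
    rw [← Nat.mod_add_mod, h2, Nat.mod_self]

/-- The value that agent `a (l + 1)` attaches to item `b l`. -/
noncomputable def recv (Q : ℕ) (g : ℕ → Finset (Fin m) → ℝ) (x : ℕ → Fin m → ℕ) (a : ℕ → ℕ)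
    (b : ℕ → Fin m) (l : ℕ) : ℝ := mder Q (g (a (l + 1))) (x (a (l + 1))) (b l)

/-- The value that agent `a l` attaches to item `b l`. -/
noncomputable def give (Q : ℕ) (g : ℕ → Finset (Fin m) → ℝ) (x : ℕ → Fin m → ℕ) (a : ℕ → ℕ)
    (b : ℕ → Fin m) (l : ℕ) : ℝ := mder Q (g (a l)) (x (a l)) (b l)

/-- Two turns of transfers suffice: the maximal transfers dominate the compensated flow of
`exists_flow`, which uses up some agent's part completely. -/
theorem Cyc.exists_full {L : ℕ} {x : ℕ → Fin m → ℕ} {a : ℕ → ℕ} {b : ℕ → Fin m} {S : ℕ → ℕ}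
    {G : ℕ → (Fin m → ℕ) → ℕ} {tol : ℕ} {W δ : ℝ} (ha : Approx n m Q g G W δ)
    (htol : W * (2 * δ + 1 / Q) ≤ tol) (hx : ColSum n Q x) (hc : Cyc n x L a b) {K : ℕ}
    (hS : Chain G tol x a b K S) (hK : 2 * L ≤ K)
    (hprod : ∏ l ∈ Finset.range L, give Q g x a b l ≤ ∏ l ∈ Finset.range L, recv Q g x a b l) :
    ∃ p < L, S p = x (a p) (b p) ∧ S (p + L) = x (a p) (b p) := by
  have hQ : (0 : ℝ) < Q := by exact_mod_cast ha.Q_pos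
  have hL := hc.L_pos
  have hnn : ∀ i < n, ∀ j, 0 ≤ mder Q (g i) (x i) j := fun i hi j => mder_nonneg (ha.val i hi) _ _
  obtain ⟨t, ht1, ⟨p, hp, hpX⟩, ht2, ht3⟩ := exists_flow hL (recv Q g x a b) (give Q g x a b)
    (fun l => x (a l) (b l)) (fun l => hnn _ (hc.a_lt _) _)
    (fun l => (mder_le (ha.val _ (hc.a_lt _)) ha.Q_pos _ _).trans (ha.le_one _ (hc.a_lt _) _))
    (fun l => hnn _ (hc.a_lt _) _) hprod
  have hamod : ∀ l, a l = a (l % L) := fun l => (Function.Periodic.map_mod_nat hc.a_per l).symm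
  have hbmod : ∀ l, b l = b (l % L) := fun l => (Function.Periodic.map_mod_nat hc.b_per l).symm
  have hgmod : ∀ l, give Q g x a b l = give Q g x a b (l % L) := by
    intro l; unfold give; rw [hamod l, hbmod l]
  have hrmod : ∀ l, recv Q g x a b l = recv Q g x a b (l % L) := by
    intro l
    unfold recv
    have : a (l + 1) = a (l % L + 1) := by
      rw [hamod (l + 1), hamod (l % L + 1), Nat.mod_add_mod]
    rw [this, hbmod l]
  -- by induction, what the flow asks for is affordable
  have hdom : ∀ l ≤ K, t (l % L) ≤ S l := by
    intro l
    induction l with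
    | zero =>
      intro _
      rw [Nat.zero_mod, hS.zero]
      exact ht1 0 hL
    | succ l ih =>
      intro hl
      refine hS.max l (by omega) _ ?_
      have hle : t ((l + 1) % L) ≤ x (a (l + 1)) (b (l + 1)) := by
        rw [hamod (l + 1), hbmod (l + 1)]
        exact ht1 _ (Nat.mod_lt _ hL)
      refine ⟨hle, ?_⟩
      have hai := hc.a_lt (l + 1)
      have hSl := hS.le (l := l) (by omega)
      have hadd := hx.add_le (hc.a_lt l) hai (hc.a_ne l) (b l)
      have hex := mext_exchange (ha.val _ hai) ha.Q_pos (y := x (a (l + 1))) (hc.b_ne l)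
        (p := S l) (by omega) (hx.le hai _) hle
      have hflow : (t ((l + 1) % L) : ℝ) * give Q g x a b (l + 1) ≤
          S l * recv Q g x a b l + 1 := by
        have h1 : (t ((l + 1) % L) : ℝ) * give Q g x a b (l + 1) ≤
            t (l % L) * recv Q g x a b l + 1 := by
          rw [hgmod (l + 1), hrmod l]
          rcases succ_mod_eq hL l with ⟨h, h'⟩ | ⟨h, h'⟩
          · rw [h']; exact ht2 _ h
          · rw [h', h]; exact ht3
        have h2 : (t (l % L) : ℝ) ≤ S l := by exact_mod_cast ih (by omega)
        have h3 := mul_le_mul_of_nonneg_right h2 (hnn _ hai (b l))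
        unfold recv at *
        linarith
      have hsh : ∀ j, shift (x (a (l + 1))) (b l) (S l) (b (l + 1)) (t ((l + 1) % L)) j ≤ Q := by
        intro j
        have h0 := hx.le hai j
        unfold shift
        by_cases hj : j = b (l + 1)
        · subst hj; simp only [Function.update_self]; omega
        · rw [Function.update_of_ne hj]
          by_cases hj' : j = b l
          · subst hj'; simp only [Function.update_self]; omega
          · rwa [Function.update_of_ne hj']
      have h5 := abs_le.mp (ha.close _ hai _ (fun j => hx.le hai j))
      have h6 := abs_le.mp (ha.close _ hai _ hsh)
      have hW := ha.W_pos
      have h7 : (t ((l + 1) % L) : ℝ) / Q * give Q g x a b (l + 1) ≤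
          S l / Q * recv Q g x a b l + 1 / Q := by
        have := div_le_div_of_nonneg_right hflow hQ.le
        have e1 : (t ((l + 1) % L) : ℝ) / Q * give Q g x a b (l + 1) =
          t ((l + 1) % L) * give Q g x a b (l + 1) / Q := by ring
        have e2 : (S l : ℝ) / Q * recv Q g x a b l + 1 / Q =
          (S l * recv Q g x a b l + 1) / Q := by ring
        rw [e1, e2]; exact this
      unfold give recv at h7
      have h8 : (G (a (l + 1)) (x (a (l + 1))) : ℝ) / W -
          G (a (l + 1)) (shift (x (a (l + 1))) (b l) (S l) (b (l + 1)) (t ((l + 1) % L))) / W ≤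
          2 * δ + 1 / Q := by
        unfold shift at *
        linarith
      rw [← sub_div, div_le_iff₀ hW] at h8
      have h9 : (G (a (l + 1)) (x (a (l + 1))) : ℝ) ≤
          G (a (l + 1)) (shift (x (a (l + 1))) (b l) (S l) (b (l + 1)) (t ((l + 1) % L))) + tol := by
        linarith
      exact_mod_cast h9
  -- the maximal transfers are also bounded by the parts, so that at `p` there is equality
  have hmodp : p % L = p := Nat.mod_eq_of_lt hp
  refine ⟨p, hp, le_antisymm (hS.le (by omega)) ?_, le_antisymm ?_ ?_⟩
  · have := hdom p (by omega)
    rwa [hmodp, hpX] at this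
  · have := hS.le (l := p + L) (by omega)
    rwa [hc.a_per, hc.b_per] at this
  · have := hdom (p + L) (by omega)
    rwa [Nat.add_mod_right, hmodp, hpX] at this

/-- A closed walk: agents `w 0, …, w L = w 0` and items `c 0, …, c (L - 1)`, where `c l` is shared by
`w l` and `w (l + 1)`. -/
structure Walk (n : ℕ) (x : ℕ → Fin m → ℕ) (L : ℕ) (w : ℕ → ℕ) (c : ℕ → Fin m) : Prop where
  L_pos : 0 < L
  closed : w L = w 0
  lt : ∀ l ≤ L, w l < n
  inj : ∀ l l', l < l' → l' < L → w l ≠ w l'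
  ne : ∀ l, l + 1 < L → c l ≠ c (l + 1)
  ne_last : c (L - 1) ≠ c 0
  pos_left : ∀ l < L, 0 < x (w l) (c l)
  pos_right : ∀ l < L, 0 < x (w (l + 1)) (c l)

section Walk

variable {x : ℕ → Fin m → ℕ} {L : ℕ} {w : ℕ → ℕ} {c : ℕ → Fin m}

theorem mod_ne_mod {L l l' : ℕ} (h : l < l') (h' : l' < l + L) : l % L ≠ l' % L := by
  intro he
  have h1 : L ∣ l' - l := (Nat.modEq_iff_dvd' h.le).mp he
  have h2 := Nat.le_of_dvd (by omega) h1
  omega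

theorem Walk.cyc (h : Walk n x L w c) : Cyc n x L (fun l => w (l % L)) (fun l => c (l % L)) where
  L_pos := h.L_pos
  a_per l := by simp
  b_per l := by simp
  a_lt l := h.lt _ (Nat.mod_lt _ h.L_pos).le
  a_inj l l' h1 h2 := by
    have hne := mod_ne_mod h1 h2
    have b1 := Nat.mod_lt l h.L_pos
    have b2 := Nat.mod_lt l' h.L_pos
    rcases lt_or_gt_of_ne hne with h3 | h3
    · exact h.inj _ _ h3 b2
    · exact (h.inj _ _ h3 b1).symm
  b_ne l := by
    rcases succ_mod_eq h.L_pos l with ⟨h1, h2⟩ | ⟨h1, h2⟩ <;> simp only [h2]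
    · exact h.ne _ h1
    · rw [h1]; exact h.ne_last
  pos_left l := h.pos_left _ (Nat.mod_lt _ h.L_pos)
  pos_right l := by
    have := h.pos_right _ (Nat.mod_lt l h.L_pos)
    rcases succ_mod_eq h.L_pos l with ⟨h1, h2⟩ | ⟨h1, h2⟩ <;> simp only [h2]
    · exact this
    · rwa [h1, Nat.sub_add_cancel h.L_pos, h.closed, ← h1] at this

/-- The closed walk in the opposite direction. -/
theorem Walk.reverse (h : Walk n x L w c) :
    Walk n x L (fun l => w (L - l)) (fun l => c (L - 1 - l)) where
  L_pos := h.L_pos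
  closed := by simp [h.closed]
  lt l _ := h.lt _ (Nat.sub_le _ _)
  inj l l' h1 h2 := by
    rcases Nat.eq_zero_or_pos l with rfl | h3
    · rw [Nat.sub_zero, h.closed]
      exact h.inj 0 (L - l') (by omega) (by omega)
    · exact (h.inj (L - l') (L - l) (by omega) (by omega)).symm
  ne l h1 := by
    have := h.ne (L - 1 - (l + 1)) (by omega)
    rw [show L - 1 - (l + 1) + 1 = L - 1 - l by omega] at this
    exact this.symm
  ne_last := by simpa using h.ne_last.symm
  pos_left l h1 := by
    have := h.pos_right (L - 1 - l) (by omega)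
    rwa [show L - 1 - l + 1 = L - l by omega] at this
  pos_right l h1 := by
    have := h.pos_left (L - 1 - l) (by omega)
    rwa [show L - 1 - l = L - (l + 1) by omega] at this ⊢

/-- In one of the two directions a closed walk does not lose value. -/
theorem Walk.prod_le_or (h : Walk n x L w c) :
    (∏ l ∈ Finset.range L, give Q g x (fun l => w (l % L)) (fun l => c (l % L)) l ≤
      ∏ l ∈ Finset.range L, recv Q g x (fun l => w (l % L)) (fun l => c (l % L)) l) ∨
    (∏ l ∈ Finset.range L, give Q g x (fun l => w (L - l % L)) (fun l => c (L - 1 - l % L)) l ≤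
      ∏ l ∈ Finset.range L, recv Q g x (fun l => w (L - l % L)) (fun l => c (L - 1 - l % L)) l) := by
  have hw : ∀ l < L, w ((l + 1) % L) = w (l + 1) := by
    intro l hl
    rcases succ_mod_eq h.L_pos l with ⟨h1, h2⟩ | ⟨h1, h2⟩ <;> simp only [Nat.mod_eq_of_lt hl] at h1 h2
    · rw [h2]
    · rw [h2, h1, Nat.sub_add_cancel h.L_pos, h.closed]
  have hw' : ∀ l < L, w (L - (l + 1) % L) = w (L - 1 - l) := by
    intro l hl
    rcases succ_mod_eq h.L_pos l with ⟨h1, h2⟩ | ⟨h1, h2⟩ <;> simp only [Nat.mod_eq_of_lt hl] at h1 h2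
    · rw [h2]; congr 1; omega
    · rw [h2, h1, Nat.sub_zero, h.closed]; simp
  -- reversal exchanges the two products
  set A : ℕ → ℝ := fun l => mder Q (g (w (l + 1))) (x (w (l + 1))) (c l)
  set B : ℕ → ℝ := fun l => mder Q (g (w l)) (x (w l)) (c l)
  have e1 : ∏ l ∈ Finset.range L, give Q g x (fun l => w (l % L)) (fun l => c (l % L)) l =
      ∏ l ∈ Finset.range L, B l := by
    refine Finset.prod_congr rfl fun l hl => ?_
    simp only [give, Nat.mod_eq_of_lt (Finset.mem_range.mp hl), B]
  have e2 : ∏ l ∈ Finset.range L, recv Q g x (fun l => w (l % L)) (fun l => c (l % L)) l =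
      ∏ l ∈ Finset.range L, A l := by
    refine Finset.prod_congr rfl fun l hl => ?_
    rw [Finset.mem_range] at hl
    simp only [recv, Nat.mod_eq_of_lt hl, A, hw l hl]
  have e3 : ∏ l ∈ Finset.range L, give Q g x (fun l => w (L - l % L)) (fun l => c (L - 1 - l % L)) l =
      ∏ l ∈ Finset.range L, A l := by
    rw [← Finset.prod_range_reflect A]
    refine Finset.prod_congr rfl fun l hl => ?_
    rw [Finset.mem_range] at hl
    simp only [give, Nat.mod_eq_of_lt hl, A]
    rw [show L - 1 - l + 1 = L - l by omega]
  have e4 : ∏ l ∈ Finset.range L, recv Q g x (fun l => w (L - l % L)) (fun l => c (L - 1 - l % L)) l =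
      ∏ l ∈ Finset.range L, B l := by
    rw [← Finset.prod_range_reflect B]
    refine Finset.prod_congr rfl fun l hl => ?_
    rw [Finset.mem_range] at hl
    simp only [recv, Nat.mod_eq_of_lt hl, B, hw' l hl]
  rw [e1, e2, e3, e4]
  exact le_total _ _

end Walk

/-- Rounding steps, one after the other. -/
def StepsDone (n Q : ℕ) (g : ℕ → Finset (Fin m) → ℝ) (e d : ℝ) :
    ℕ → (ℕ → Fin m → ℕ) → (ℕ → Fin m → ℕ) → Prop
  | 0, x, x' => x' = x
  | t + 1, x, x' => ∃ x₁, StepsDone n Q g e d t x x₁ ∧ RoundStep n Q g e d x₁ x'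

/-- The losses of the steps add up; the number of nonzero entries decreases until nothing is split. -/
theorem StepsDone.final {x x' : ℕ → Fin m → ℕ} {t : ℕ} (h : StepsDone n Q g e d t x x')
    (hx : ColSum n Q x) :
    ColSum n Q x' ∧ (∀ b, Level n Q g e b x → Level n Q g e (b - t * d) x') ∧
      ((∀ i < n, ∀ j, ¬ Frac Q x' i j) ∨ supp n x' + t ≤ supp n x) := by
  induction t generalizing x' with
  | zero => obtain rfl := h; exact ⟨hx, fun b hb => by simpa using hb, Or.inr (by simp)⟩
  | succ t ih =>
    obtain ⟨x₁, h₁, h₂⟩ := h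
    obtain ⟨a1, a2, a3⟩ := ih h₁
    refine ⟨h₂.colSum, fun b hb => ?_, ?_⟩
    · have := h₂.level _ (a2 b hb)
      have e1 : b - ((t + 1 : ℕ) : ℝ) * d = b - t * d - d := by push_cast; ring
      rwa [e1]
    · rcases h₂.progress with ⟨h3, i, hi, j, h4⟩ | ⟨rfl, h3⟩
      · rcases a3 with h5 | h5
        · exact absurd h4 (h5 i hi j)
        · right; omega
      · exact Or.inl h3

/-- After `n * m` steps nothing is split, and the loss is bounded. -/
theorem StepsDone.integral {x x' : ℕ → Fin m → ℕ} {t : ℕ} (h : StepsDone n Q g e d t x x')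
    (hx : ColSum n Q x) (ht : n * m ≤ t) (he : 0 ≤ e) {b : ℝ}
    (hb : ∀ i < n, b ≤ mext Q (g i) (x i)) :
    ColSum n Q x' ∧ (∀ i < n, ∀ j, x' i j = 0 ∨ x' i j = Q) ∧
      ∀ i < n, b - t * d - e ≤ mext Q (g i) (x' i) := by
  obtain ⟨h1, h2, h3⟩ := h.final hx
  have hint : ∀ i < n, ∀ j, x' i j = 0 ∨ x' i j = Q := by
    intro i hi j
    have hle := h1.le hi j
    rcases h3 with h4 | h4
    · have := h4 i hi j
      unfold Frac at this
      omega
    · left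
      have h5 := supp_le (n := n) x
      have h6 : supp n x' = 0 := by omega
      unfold supp at h6
      rw [Finset.card_eq_zero, Finset.filter_eq_empty_iff] at h6
      have h7 : ¬ 0 < x' i j := h6 (x := (i, j)) (by simp [hi])
      omega
  refine ⟨h1, hint, fun i hi => ?_⟩
  rcases h2 b (fun i hi => Or.inl (hb i hi)) i hi with h4 | h4
  · linarith
  · exact h4.2

end Rounding

/-! ### The program -/

/- Registers that are only read by the main part of the program: numbers of agents and of items,
accuracy, scale `z = n + m + k`; grid size `Q = 2 ^ q` and `q`; number `N` of samples, number `M` of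
units of value, denominator `D` for the potential, tolerance; `Q + 1`, `n + 1`, `2 * n + 1`, `2 * n`;
number of rounding steps, number `N * m` of thresholds, unit and number of targets per item, number
of random bits, lower bound for `Q`. -/
local notation "rn" => (0 : ℕ)
local notation "rm" => (1 : ℕ)
local notation "rk" => (2 : ℕ)
local notation "rz" => (3 : ℕ)
local notation "rQ" => (4 : ℕ)
local notation "rq" => (5 : ℕ)
local notation "rN" => (6 : ℕ)
local notation "rM" => (7 : ℕ)
local notation "rD" => (8 : ℕ)
local notation "rTol" => (9 : ℕ)
local notation "rQ1" => (10 : ℕ)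
local notation "rn1" => (11 : ℕ)
local notation "rn2" => (12 : ℕ)
local notation "rK" => (13 : ℕ)
local notation "rSteps" => (14 : ℕ)
local notation "rNm" => (15 : ℕ)
local notation "rU" => (16 : ℕ)
local notation "rCand" => (17 : ℕ)
local notation "rLen" => (18 : ℕ)
local notation "rQ0" => (19 : ℕ)

/- Working registers: current agent, estimate, sample, and counters; results of searches; the current
walk with its period `rPer`, between the positions `rLo` and `rHi`; transfers; the current target. -/
local notation "re" => (20 : ℕ)
local notation "rg" => (21 : ℕ)
local notation "rs" => (22 : ℕ)
local notation "rb" => (23 : ℕ)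
local notation "rc" => (24 : ℕ)
local notation "rl" => (25 : ℕ)
local notation "rt" => (26 : ℕ)
local notation "rj" => (27 : ℕ)
local notation "rBest" => (28 : ℕ)
local notation "ri" => (31 : ℕ)
local notation "rh" => (32 : ℕ)
local notation "rLeaf" => (33 : ℕ)
local notation "rLeafItem" => (34 : ℕ)
local notation "rCnt" => (35 : ℕ)
local notation "rLast" => (36 : ℕ)
local notation "rOwner" => (37 : ℕ)
local notation "rStart" => (38 : ℕ)
local notation "rw1" => (39 : ℕ)
local notation "rNextItem" => (40 : ℕ)
local notation "rNextAgent" => (41 : ℕ)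
local notation "rLo" => (43 : ℕ)
local notation "rHi" => (44 : ℕ)
local notation "rPer" => (45 : ℕ)
local notation "rx" => (46 : ℕ)
local notation "ry" => (47 : ℕ)
local notation "rG0" => (48 : ℕ)
local notation "rMax" => (49 : ℕ)
local notation "ru" => (50 : ℕ)
local notation "rFull" => (51 : ℕ)
local notation "rAg" => (52 : ℕ)
local notation "rIt" => (53 : ℕ)
local notation "rNum" => (54 : ℕ)
local notation "rStep" => (55 : ℕ)

/- Arrays of natural numbers: output, random bits, thresholds, fractional assignment, levels, marked
items; agents and items of the walk, and of its periodic repetition; transfers, allocation. -/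
local notation "aOut" => (0 : ℕ)
local notation "aBits" => (1 : ℕ)
local notation "aTau" => (2 : ℕ)
local notation "aX" => (3 : ℕ)
local notation "aY" => (4 : ℕ)
local notation "aB" => (5 : ℕ)
local notation "aW" => (6 : ℕ)
local notation "aWI" => (7 : ℕ)
local notation "aC" => (8 : ℕ)
local notation "aCI" => (9 : ℕ)
local notation "aS" => (10 : ℕ)
local notation "aA" => (11 : ℕ)

/- Real numbers, each in entry `0` of its array: target, oracle answer, potential of an agent and its
former value, largest gain, value of the allocation and its best value, value of a single item. -/
local notation "lT" => (0 : ℕ)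
local notation "lVal" => (1 : ℕ)
local notation "lLam" => (2 : ℕ)
local notation "lLam0" => (3 : ℕ)
local notation "lGain" => (4 : ℕ)
local notation "lMin" => (5 : ℕ)
local notation "lBest" => (6 : ℕ)
local notation "lBase" => (7 : ℕ)

local infixr:60 " ;; " => Prog.seq

/-- Equality of natural numbers. -/
def BTest.eq (e f : NExp) : BTest := .and (.le e f) (.le f e)

/-- Strict inequality of natural numbers. -/
def BTest.lt (e f : NExp) : BTest := .le (.add e (.const 1)) f

/-- The position of the matrix entry with row `e` and column `f`. -/
def idx (e f : NExp) : NExp := .add (.mul e (.reg rm)) f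

/-- An entry of the fractional assignment. -/
def entry (e f : NExp) : NExp := .arr aX (idx e f)

/-- Read a real number. -/
def rget (a : ℕ) : RExp := .get a (.const 0)

/-- Write a real number. -/
def rset (a : ℕ) (r : RExp) : Prog := .setReal a (.const 0) r

/-- Mark in `aB` the items whose threshold in the current sample is below their level. -/
def markP : Prog :=
  .loop rb rm (.ite (.lt (.arr aTau (idx (.reg rs) (.reg rb))) (.arr aY (.reg rb)))
    (.setArr aB (.reg rb) (.const 1)) (.setArr aB (.reg rb) (.const 0)))

/-- Add the oracle answer, in units of `T / M` and truncated at `M` units, to register `rg`. For each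
unit the number `lLam` is multiplied by `D / (D + 1)`: exponentials are not available. -/
def countP : Prog :=
  .loop rc rM (.ite (.rle (.scale (.add (.reg rc) (.const 1)) (rget lT))
      (.scale (.reg rM) (rget lVal)))
    (.setReg rg (.add (.reg rg) (.const 1)) ;;
      rset lLam (.divNat (.scale (.reg rD) (rget lLam)) (.add (.reg rD) (.const 1)))) .skip)

/-- Estimate the value of agent `re` at the levels in `aY`, and compute its potential `lLam`. -/
def evalP : Prog :=
  .setReg rg (.const 0) ;; rset lLam (.ofNat (.const 1)) ;;
    .loop rs rN (markP ;; .query lVal (.const 0) (.reg re) aB ;; countP)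

/-- Copy the levels of agent `re` to `aY`. -/
def loadP : Prog := .loop rl rm (.setArr aY (.reg rl) (entry (.reg re) (.reg rl)))

/-- Find an agent that profits most from a unit of item `rj`. -/
def pickP : Prog :=
  .loop re rn (loadP ;; evalP ;; rset lLam0 (rget lLam) ;;
    .setArr aY (.reg rj) (.add (.arr aY (.reg rj)) (.const 1)) ;; evalP ;;
    .ite (.and (.rle (.sub (rget lLam0) (rget lLam)) (rget lGain)) (.le (.const 1) (.reg re)))
      .skip (rset lGain (.sub (rget lLam0) (rget lLam)) ;; .setReg rBest (.reg re)))

/-- Set the fractional assignment to zero. -/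
def clearP : Prog := .loop rt rn (.loop rj rm (.setArr aX (idx (.reg rt) (.reg rj)) (.const 0)))

/-- One greedy round. -/
def itemsP : Prog :=
  .loop rj rm (pickP ;; .setArr aX (idx (.reg rBest) (.reg rj))
    (.add (entry (.reg rBest) (.reg rj)) (.const 1)))

/-- The greedy phase. -/
def greedyP : Prog := clearP ;; .loop rt rQ itemsP

/-- The parameters of the algorithm, and the thresholds. -/
structure Par where
  /-- number of units into which an item is divided -/
  Q : ℕ
  /-- number of samples -/
  N : ℕ
  /-- number of units of value -/
  M : ℕ
  /-- denominator for the decay of the potential -/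
  D : ℕ
  /-- loss of the integer estimate that an agent accepts in an exchange -/
  tol : ℕ
  /-- thresholds, for all samples one after the other -/
  tau : ℕ → ℕ

/-- The memory contains the parameters, and the target `T`. -/
structure Ctx (n m : ℕ) (par : Par) (T : ℝ) (s : State) : Prop where
  n_eq : s.reg rn = n
  m_eq : s.reg rm = m
  Q_eq : s.reg rQ = par.Q
  N_eq : s.reg rN = par.N
  M_eq : s.reg rM = par.M
  D_eq : s.reg rD = par.D
  tol_eq : s.reg rTol = par.tol
  Q1_eq : s.reg rQ1 = par.Q + 1
  n1_eq : s.reg rn1 = n + 1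
  n2_eq : s.reg rn2 = 2 * n + 1
  K_eq : s.reg rK = 2 * n
  tau_eq : s.arr aTau = par.tau
  T_eq : s.real lT 0 = T

/-- A program that does not write the parameters. -/
def Prog.safe (P : Prog) : Bool :=
  [rn, rm, rQ, rN, rM, rD, rTol, rQ1, rn1, rn2, rK].all (fun r => !P.wr.contains r) &&
    !P.wa.contains aTau && !P.wl.contains lT

section

variable {n m : ℕ} {par : Par} {T : ℝ} {s s' : State} {P : Prog}

theorem Ctx.agree (hc : Ctx n m par T s) (h : Agree P s s') (hP : P.safe = true) :
    Ctx n m par T s' := by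
  simp only [Prog.safe, List.all_cons, List.all_nil, Bool.and_eq_true, Bool.not_eq_true',
    List.contains_eq_mem, decide_eq_false_iff_not, Bool.and_true] at hP
  obtain ⟨⟨⟨h0, h1, h2, h3, h4, h5, h6, h7, h8, h9, h10⟩, ha⟩, hl⟩ := hP
  refine ⟨?_, ?_, ?_, ?_, ?_, ?_, ?_, ?_, ?_, ?_, ?_, ?_, ?_⟩
  · rw [h.reg _ h0, hc.n_eq]
  · rw [h.reg _ h1, hc.m_eq]
  · rw [h.reg _ h2, hc.Q_eq]
  · rw [h.reg _ h3, hc.N_eq]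
  · rw [h.reg _ h4, hc.M_eq]
  · rw [h.reg _ h5, hc.D_eq]
  · rw [h.reg _ h6, hc.tol_eq]
  · rw [h.reg _ h7, hc.Q1_eq]
  · rw [h.reg _ h8, hc.n1_eq]
  · rw [h.reg _ h9, hc.n2_eq]
  · rw [h.reg _ h10, hc.K_eq]
  · rw [h.arr _ ha, hc.tau_eq]
  · rw [h.real _ hl, hc.T_eq]

theorem Ctx.run (v : Fin n → Finset (Fin m) → ℝ) (hc : Ctx n m par T s) (hP : P.safe = true) :
    Ctx n m par T (P.run v s) := hc.agree (run_agree v P s) hP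

/-- The integer estimate of the value of agent `i` at the levels `y`. -/
noncomputable def Gh (v : Fin n → Finset (Fin m) → ℝ) (par : Par) (T : ℝ) (i : ℕ)
    (y : Fin m → ℕ) : ℕ :=
  ∑ s ∈ Finset.range par.N, ((Finset.range par.M).filter fun c : ℕ =>
    ((c + 1 : ℕ) : ℝ) * T ≤ par.M * oracle v i (thr (fun j => par.tau (s * m + j)) y)).card

/-- The factor by which the potential of an agent shrinks when its estimate grows by one. -/
noncomputable def Par.rho (par : Par) : ℝ := par.D / ((par.D + 1 : ℕ) : ℝ)

/-- The levels in array `aY`. -/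
def levels (m : ℕ) (s : State) : Fin m → ℕ := fun j => s.arr aY j

/-- The matrix in array `aX`. -/
def mat (m : ℕ) (s : State) : ℕ → Fin m → ℕ := fun i j => s.arr aX (i * m + j)

variable (v : Fin n → Finset (Fin m) → ℝ)

theorem markP_spec (hc : Ctx n m par T s) :
    (markP.run v s).itemSet m aB =
      thr (fun j => par.tau (s.reg rs * m + j)) (levels m s) := by
  have key := run_loop_inv v (x := rb) (p := rm) (c := .ite (.lt (.arr aTau (idx (.reg rs)
      (.reg rb))) (.arr aY (.reg rb))) (.setArr aB (.reg rb) (.const 1))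
      (.setArr aB (.reg rb) (.const 0))) (s := s)
    (fun i st => ∀ j < i, st.arr aB j ≠ 0 ↔ par.tau (s.reg rs * m + j) < s.arr aY j)
    (by simp) ?_
  · ext j
    have := key j (by rw [hc.m_eq]; exact j.2)
    rw [State.itemSet, thr, Finset.mem_filter, Finset.mem_filter]
    simp only [Finset.mem_univ, true_and, levels]
    exact this
  · intro i hi st hst hA hI j hj
    have e1 := hA.reg rs (by decide)
    have e2 := hA.arr aY (by decide)
    have hc' := hc.agree hA (by decide)
    have e4 := hc'.tau_eq
    have e5 := hc'.m_eq
    simp only [Prog.run, BTest.lt, BTest.holds, NExp.eval, idx, e1, e2, e4, e5, hst]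
    rcases Nat.lt_succ_iff_lt_or_eq.mp hj with hj' | rfl
    · have := hI j hj'
      have hne : j ≠ i := hj'.ne
      split_ifs <;> simp [hne, this]
    · split_ifs with h <;> simp <;> omega

theorem countP_spec (hc : Ctx n m par T s) :
    (countP.run v s).reg rg = s.reg rg + ((Finset.range par.M).filter fun c : ℕ =>
      ((c + 1 : ℕ) : ℝ) * T ≤ par.M * s.real lVal 0).card ∧
    (countP.run v s).real lLam 0 = s.real lLam 0 * par.rho ^ ((Finset.range par.M).filter
      fun c : ℕ => ((c + 1 : ℕ) : ℝ) * T ≤ par.M * s.real lVal 0).card := by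
  have key := run_loop_inv v (x := rc) (p := rM) (c := .ite (.rle (.scale (.add (.reg rc)
      (.const 1)) (rget lT)) (.scale (.reg rM) (rget lVal)))
    (.setReg rg (.add (.reg rg) (.const 1)) ;;
      rset lLam (.divNat (.scale (.reg rD) (rget lLam)) (.add (.reg rD) (.const 1)))) .skip) (s := s)
    (fun i st => st.reg rg = s.reg rg + ((Finset.range i).filter fun c : ℕ =>
      ((c + 1 : ℕ) : ℝ) * T ≤ par.M * s.real lVal 0).card ∧
      st.real lLam 0 = s.real lLam 0 * par.rho ^ ((Finset.range i).filter
      fun c : ℕ => ((c + 1 : ℕ) : ℝ) * T ≤ par.M * s.real lVal 0).card)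
    (by simp) ?_
  · rw [hc.M_eq] at key
    exact key
  · intro i hi st hst hA ⟨hI, hI'⟩
    have e1 := hA.real lVal (by decide)
    have hc' := hc.agree hA (by decide)
    have e2 := hc'.M_eq
    have e3 := hc'.D_eq
    have e4 := hc'.T_eq
    rw [Finset.range_add_one, Finset.filter_insert]
    simp only [Prog.run, rset, rget, BTest.holds, RExp.eval, NExp.eval, e1, e2, e4, hst]
    split_ifs with h
    · rw [Finset.card_insert_of_notMem (by simp)]
      simp only [reg_setReg, reg_setReal, hI, real_setReg, real_setReal,
        hI', pow_succ, Par.rho]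
      constructor
      · simp; omega
      · simp [e3]; ring
    · simp [hI, hI']

theorem evalP_spec (hc : Ctx n m par T s) :
    (evalP.run v s).reg rg = Gh v par T (s.reg re) (levels m s) ∧
    (evalP.run v s).real lLam 0 = par.rho ^ Gh v par T (s.reg re) (levels m s) := by
  set s₁ := (rset lLam (.ofNat (.const 1))).run v ((Prog.setReg rg (.const 0)).run v s) with hs₁
  have hc₁ : Ctx n m par T s₁ := (hc.run v (by decide)).run v (by decide)
  have key := run_loop_inv v (x := rs) (p := rN)
    (c := markP ;; .query lVal (.const 0) (.reg re) aB ;; countP) (s := s₁)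
    (fun i st => st.reg rg = (∑ s' ∈ Finset.range i, ((Finset.range par.M).filter fun c : ℕ =>
      ((c + 1 : ℕ) : ℝ) * T ≤ par.M * oracle v (s.reg re) (thr (fun j => par.tau (s' * m + j))
        (levels m s))).card) ∧
      st.real lLam 0 = par.rho ^ (∑ s' ∈ Finset.range i, ((Finset.range par.M).filter fun c : ℕ =>
      ((c + 1 : ℕ) : ℝ) * T ≤ par.M * oracle v (s.reg re) (thr (fun j => par.tau (s' * m + j))
        (levels m s))).card))
    (by simp [hs₁, Prog.run, rset, NExp.eval, RExp.eval]) ?_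
  · rw [hc₁.N_eq] at key
    exact key
  · intro i hi st hst hA ⟨hI, hI'⟩
    have hre : s₁.reg re = s.reg re := by simp [hs₁, Prog.run, rset]
    have hY : s₁.arr aY = s.arr aY := by simp [hs₁, Prog.run, rset]
    have e1 := (hA.reg re (by decide)).trans hre
    have e2 := (hA.arr aY (by decide)).trans hY
    have hcst := hc₁.agree hA (by decide)
    have hmark := markP_spec v hcst
    have hAm := run_agree v markP st
    have hcm := hcst.run v (P := markP) (by decide)
    set st₁ := markP.run v st
    have e3 := (hAm.reg re (by decide)).trans e1
    set st₂ := (Prog.query lVal (.const 0) (.reg re) aB).run v st₁ with hst₂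
    have hcq : Ctx n m par T st₂ := hcm.run v (by decide)
    have hcount := countP_spec v hcq
    have e4 : st₂.real lVal 0 = oracle v (s.reg re) (thr (fun j => par.tau (i * m + j))
        (levels m s)) := by
      have : levels m st = levels m s := by unfold levels; rw [e2]
      rw [hst₂, ← hst, ← this, ← hmark]
      simp [Prog.run, NExp.eval, e3]
    have e5 : st₂.reg rg = st.reg rg := by
      have := hAm.reg rg (by decide)
      simpa [hst₂, Prog.run] using this
    have e6 : st₂.real lLam 0 = st.real lLam 0 := by
      have := congrFun (hAm.real lLam (by decide)) 0
      simpa [hst₂, Prog.run] using this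
    rw [e4, e5, e6, hI, hI'] at hcount
    have e7 : (markP ;; Prog.query lVal (.const 0) (.reg re) aB ;; countP).run v st =
      countP.run v st₂ := rfl
    rw [e7, Finset.sum_range_succ, pow_add]
    simpa using hcount

theorem loadP_spec (hc : Ctx n m par T s) :
    levels m (loadP.run v s) = mat m s (s.reg re) := by
  have key := run_loop_inv v (x := rl) (p := rm)
    (c := .setArr aY (.reg rl) (entry (.reg re) (.reg rl))) (s := s)
    (fun i st => ∀ j < i, st.arr aY j = s.arr aX (s.reg re * m + j))
    (by simp) ?_
  · funext j
    exact key j (by rw [hc.m_eq]; exact j.2)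
  · intro i hi st hst hA hI j hj
    have e1 := hA.reg re (by decide)
    have e2 := hA.arr aX (by decide)
    have hc' := hc.agree hA (by decide)
    simp only [Prog.run, entry, idx, NExp.eval, e1, e2, hc'.m_eq, hst, arr_setReg, arr_setArr,
      if_true]
    rcases Nat.lt_succ_iff_lt_or_eq.mp hj with hj' | rfl
    · rw [Function.update_of_ne hj'.ne, hI j hj']
    · rw [Function.update_self]

/-- Writing a matrix entry. -/
theorem mat_setArr (s : State) (i : ℕ) (j : Fin m) (w : ℕ) :
    mat m (s.setArr aX (i * m + j) w) =
      Function.update (mat m s) i (Function.update (mat m s i) j w) := by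
  funext i' j'
  simp only [mat, arr_setArr, if_true]
  by_cases hi : i' = i
  · subst hi
    rw [Function.update_self]
    by_cases hj : j' = j
    · subst hj; simp
    · have : i' * m + (j' : ℕ) ≠ i' * m + j := fun h => hj (Fin.ext (by omega))
      rw [Function.update_of_ne this, Function.update_of_ne hj]
      rfl
  · rw [Function.update_of_ne hi, Function.update_of_ne]
    · rfl
    intro h
    apply hi
    have h1 : (i' * m + (j' : ℕ)) / m = i' := by
      rw [mul_comm, Nat.mul_add_div (by have := j.2; omega), Nat.div_eq_of_lt j'.2, add_zero]
    have h2 : (i * m + (j : ℕ)) / m = i := by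
      rw [mul_comm, Nat.mul_add_div (by have := j.2; omega), Nat.div_eq_of_lt j.2, add_zero]
    rw [← h1, ← h2, h]

theorem mat_congr {s s' : State} (h : s'.arr aX = s.arr aX) : mat m s' = mat m s := by
  unfold mat; rw [h]

/-- The agent in `rBest` has the largest gain. -/
theorem pickP_spec (hc : Ctx n m par T s) {j : Fin m} (hj : s.reg rj = j) (hn : 0 < n) :
    (pickP.run v s).reg rBest < n ∧ ∀ i < n,
      gain (Gh v par T i) par.rho (mat m s i) j ≤
        gain (Gh v par T ((pickP.run v s).reg rBest)) par.rho
          (mat m s ((pickP.run v s).reg rBest)) j := by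
  have key := run_loop_inv v (x := re) (p := rn)
    (c := loadP ;; evalP ;; rset lLam0 (rget lLam) ;;
    .setArr aY (.reg rj) (.add (.arr aY (.reg rj)) (.const 1)) ;; evalP ;;
    .ite (.and (.rle (.sub (rget lLam0) (rget lLam)) (rget lGain)) (.le (.const 1) (.reg re)))
      .skip (rset lGain (.sub (rget lLam0) (rget lLam)) ;; .setReg rBest (.reg re))) (s := s)
    (fun c st => 0 < c → st.reg rBest < c ∧
      st.real lGain 0 = gain (Gh v par T (st.reg rBest)) par.rho (mat m s (st.reg rBest)) j ∧
      ∀ i < c, gain (Gh v par T i) par.rho (mat m s i) j ≤ st.real lGain 0)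
    (by simp) ?_
  · rw [hc.n_eq] at key
    obtain ⟨h1, h2, h3⟩ := key hn
    exact ⟨h1, fun i hi => (h3 i hi).trans h2.le⟩
  · intro i hi st hst hA hI
    have hcst := hc.agree hA (by decide)
    have hX : mat m st = mat m s := mat_congr (hA.arr aX (by decide))
    have hjst := (hA.reg rj (by decide)).trans hj
    -- the estimate before the unit is added
    have hl := loadP_spec v hcst
    have hAl := run_agree v loadP st
    have hcl := hcst.run v (P := loadP) (by decide)
    set st₁ := loadP.run v st
    have hre₁ : st₁.reg re = i := (hAl.reg re (by decide)).trans hst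
    have he := evalP_spec v hcl
    have hAe := run_agree v evalP st₁
    have hce := hcl.run v (P := evalP) (by decide)
    set st₂ := evalP.run v st₁
    rw [hre₁, hl, hst, hX] at he
    set st₃ := (rset lLam0 (rget lLam)).run v st₂ with hst₃
    have hjs₃ : st₃.reg rj = j := by
      have h1 := hAe.reg rj (by decide)
      have h2 := hAl.reg rj (by decide)
      simp only [hst₃, Prog.run, rset, reg_setReal]
      rw [h1, h2, hjst]
    -- the estimate afterwards
    set st₄ := (Prog.setArr aY (.reg rj) (.add (.arr aY (.reg rj)) (.const 1))).run v st₃ with hst₄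
    have hlev : levels m st₄ = bumpRow (mat m s i) j := by
      have h1 : levels m st₃ = mat m s i := by
        rw [← hX, ← hst, ← hl]
        have := hAe.arr aY (by decide)
        unfold levels
        simp only [hst₃, Prog.run, rset, arr_setReal]
        rw [this]
      rw [← h1]
      funext j'
      simp only [hst₄, Prog.run, NExp.eval, levels, bumpRow, hjs₃, arr_setArr, if_true]
      by_cases hjj : j' = j
      · subst hjj; simp
      · have : (j' : ℕ) ≠ j := fun h => hjj (Fin.ext h)
        rw [Function.update_of_ne this, Function.update_of_ne hjj]
        rfl
    have hre₄ : st₄.reg re = i := by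
      have h1 := hAe.reg re (by decide)
      simp only [hst₄, hst₃, Prog.run, rset, reg_setReal, reg_setArr]
      rw [h1, hre₁]
    have hc₄ : Ctx n m par T st₄ := (hce.run v (P := rset lLam0 (rget lLam)) (by decide)).run v
      (by decide)
    have he' := evalP_spec v hc₄
    have hAe' := run_agree v evalP st₄
    set st₅ := evalP.run v st₄
    rw [hre₄, hlev] at he'
    have hlam0 : st₅.real lLam0 0 = par.rho ^ Gh v par T i (mat m s i) := by
      rw [hAe'.real lLam0 (by decide), ← he.2]
      simp [hst₄, hst₃, Prog.run, rset, rget, RExp.eval, NExp.eval]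
    have hgain : st₅.real lLam0 0 - st₅.real lLam 0 =
        gain (Gh v par T i) par.rho (mat m s i) j := by
      rw [hlam0, he'.2]; rfl
    have hre₅ : st₅.reg re = i := (hAe'.reg re (by decide)).trans hre₄
    have hbest : st₅.reg rBest = st.reg rBest := by
      rw [hAe'.reg rBest (by decide), ← hAl.reg rBest (by decide), ← hAe.reg rBest (by decide)]
      rfl
    have hg0 : st₅.real lGain 0 = st.real lGain 0 := by
      rw [hAe'.real lGain (by decide), ← hAl.real lGain (by decide), ← hAe.real lGain (by decide)]
      simp [hst₄, hst₃, Prog.run, rset]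
    have e7 : (loadP ;; evalP ;; rset lLam0 (rget lLam) ;;
        .setArr aY (.reg rj) (.add (.arr aY (.reg rj)) (.const 1)) ;; evalP ;;
        .ite (.and (.rle (.sub (rget lLam0) (rget lLam)) (rget lGain))
          (.le (.const 1) (.reg re)))
          .skip (rset lGain (.sub (rget lLam0) (rget lLam)) ;; .setReg rBest (.reg re))).run v st =
        (Prog.ite (.and (.rle (.sub (rget lLam0) (rget lLam)) (rget lGain))
          (.le (.const 1) (.reg re)))
          .skip (rset lGain (.sub (rget lLam0) (rget lLam)) ;; .setReg rBest (.reg re))).run v st₅ :=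
      rfl
    rw [e7]
    intro _
    simp only [Prog.run, BTest.holds, rset, rget, RExp.eval, NExp.eval, hgain, hg0, hre₅]
    split_ifs with h
    · obtain ⟨h1, h2, h3⟩ := hI (by omega)
      have e : (st₅.setReg re (i + 1)).reg rBest = st.reg rBest := by simp [hbest]
      rw [e]
      refine ⟨by omega, by simp [hg0, h2], fun i' hi' => ?_⟩
      have e' : (st₅.setReg re (i + 1)).real lGain 0 = st.real lGain 0 := by simp [hg0]
      rw [e']
      rcases Nat.lt_succ_iff_lt_or_eq.mp hi' with h4 | rfl
      · exact h3 i' h4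
      · exact h.1
    · simp only [reg_setReg, real_setReg, real_setReal, if_true, Function.update_self,
        reg_setReal]
      refine ⟨by simp [hre₅], by simp [hre₅], fun i' hi' => ?_⟩
      rcases Nat.lt_succ_iff_lt_or_eq.mp hi' with h4 | rfl
      · obtain ⟨h1, h2, h3⟩ := hI (by omega)
        refine (h3 i' h4).trans ?_
        by_contra hcon
        push Not at hcon
        exact h ⟨hcon.le, by omega⟩
      · exact le_rfl

end

section

variable {n m : ℕ} {par : Par} {T : ℝ} {s s' : State} {P : Prog}
variable (v : Fin n → Finset (Fin m) → ℝ)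

theorem run_seq (P P' : Prog) (s : State) : (P ;; P').run v s = P'.run v (P.run v s) := rfl

theorem run_ite_pos {b : BTest} {P P' : Prog} {s : State} (h : b.holds s) :
    (Prog.ite b P P').run v s = P.run v s := if_pos h

theorem run_ite_neg {b : BTest} {P P' : Prog} {s : State} (h : ¬ b.holds s) :
    (Prog.ite b P P').run v s = P'.run v s := if_neg h

theorem clearP_spec (hc : Ctx n m par T s) :
    ∀ i < n, ∀ j : Fin m, mat m (clearP.run v s) i j = 0 := by
  have key := run_loop_inv v (x := rt) (p := rn)
    (c := .loop rj rm (.setArr aX (idx (.reg rt) (.reg rj)) (.const 0))) (s := s)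
    (fun i st => ∀ i' < i, ∀ j : Fin m, mat m st i' j = 0) (by simp) ?_
  · rw [hc.n_eq] at key
    exact key
  · intro i hi st hst hA hI
    have hcst := hc.agree hA (by decide)
    have key' := run_loop_inv v (x := rj) (p := rm)
      (c := .setArr aX (idx (.reg rt) (.reg rj)) (.const 0)) (s := st)
      (fun c st' => (∀ i' < i, ∀ j : Fin m, mat m st' i' j = 0) ∧
        ∀ j : Fin m, (j : ℕ) < c → mat m st' i j = 0) ⟨hI, by simp⟩ ?_
    · rw [hcst.m_eq] at key'
      intro i' hi' j
      rcases Nat.lt_succ_iff_lt_or_eq.mp hi' with h | rfl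
      · exact key'.1 i' h j
      · exact key'.2 j j.2
    · intro c hcm st' hst' hA' ⟨h1, h2⟩
      have hc' := hcst.agree hA' (by decide)
      have hrt : st'.reg rt = i := (hA'.reg rt (by decide)).trans hst
      rw [hcst.m_eq] at hcm
      have hm : mat m ((Prog.run v (.setArr aX (idx (.reg rt) (.reg rj)) (.const 0)) st').setReg
          rj (c + 1)) = Function.update (mat m st') i
            (Function.update (mat m st' i) ⟨c, hcm⟩ 0) := by
        rw [← mat_setArr]
        simp only [Prog.run, idx, NExp.eval, hrt, hc'.m_eq, hst']
        rfl
      rw [hm]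
      constructor
      · intro i' hi' j
        rw [Function.update_of_ne hi'.ne]
        exact h1 i' hi' j
      · intro j hj
        rw [Function.update_self]
        by_cases hjc : j = ⟨c, hcm⟩
        · rw [hjc, Function.update_self]
        · rw [Function.update_of_ne hjc]
          have : (j : ℕ) ≠ c := fun h => hjc (Fin.ext h)
          exact h2 j (by omega)

end

/-- The matrix in array `aX`, restricted to the first `n` rows. -/
def rows (n m : ℕ) (s : State) : ℕ → Fin m → ℕ := fun i => if i < n then mat m s i else 0

section

variable {n m : ℕ} {par : Par} {T : ℝ} {s s' : State} {P : Prog}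
variable (v : Fin n → Finset (Fin m) → ℝ)

theorem itemsP_spec (hc : Ctx n m par T s) (hn : 0 < n) :
    ItemsDone n (Gh v par T) par.rho m (rows n m s) (rows n m (itemsP.run v s)) := by
  have key := run_loop_inv v (x := rj) (p := rm) (c := pickP ;; .setArr aX (idx (.reg rBest)
      (.reg rj)) (.add (entry (.reg rBest) (.reg rj)) (.const 1))) (s := s)
    (fun c st => ItemsDone n (Gh v par T) par.rho c (rows n m s) (rows n m st)) rfl ?_
  · rw [hc.m_eq] at key
    exact key
  · intro c hcm st hst hA hI
    rw [hc.m_eq] at hcm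
    have hcst := hc.agree hA (by decide)
    have hp := pickP_spec v hcst (j := ⟨c, hcm⟩) hst hn
    have hAp := run_agree v pickP st
    have hcp := hcst.run v (P := pickP) (by decide)
    have hX : mat m (pickP.run v st) = mat m st := mat_congr (hAp.arr aX (by decide))
    have hrj := hAp.reg rj (by decide)
    rw [run_seq]
    set st₁ := pickP.run v st
    have hm : mat m ((Prog.run v (.setArr aX (idx (.reg rBest) (.reg rj))
        (.add (entry (.reg rBest) (.reg rj)) (.const 1))) st₁).setReg rj (c + 1)) =
        bump (mat m st) (st₁.reg rBest) ⟨c, hcm⟩ := by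
      rw [← hX, bump, bumpRow, ← mat_setArr]
      simp only [Prog.run, idx, entry, NExp.eval, hcp.m_eq, hrj, hst]
      rfl
    refine ⟨_, hI, hcm, st₁.reg rBest, hp.1, ?_, fun i' hi' => ?_⟩
    · funext i
      have hi := hp.1
      simp only [rows, hm, bump]
      by_cases h : i = st₁.reg rBest
      · subst h; simp [hi]
      · simp [h, rows]
    · have := hp.2 i' hi'
      simpa [rows, hi', hp.1] using this

theorem greedyP_spec (hc : Ctx n m par T s) (hn : 0 < n) :
    RoundsDone n (Gh v par T) par.rho par.Q (rows n m (greedyP.run v s)) := by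
  have h0 := clearP_spec v hc
  have hc0 := hc.run v (P := clearP) (by decide)
  have key := run_loop_inv v (x := rt) (p := rQ) (c := itemsP) (s := clearP.run v s)
    (fun t st => RoundsDone n (Gh v par T) par.rho t (rows n m st)) ?_ ?_
  · rw [hc0.Q_eq] at key
    exact key
  · funext i j
    simp only [rows]
    split_ifs with hi
    · exact h0 i hi j
    · rfl
  · intro t ht st hst hA hI
    have hcst := hc0.agree hA (by decide)
    exact ⟨_, hI, itemsP_spec v hcst hn⟩

end

/-! ### Searching and filling arrays -/

/-- Store in `y` the last `x < p` that passes the test. -/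
def searchP (x y p : ℕ) (b : BTest) : Prog := .loop x p (.ite b (.setReg y (.reg x)) .skip)

/-- Fill the first entries of an array. -/
def fillP (x p a : ℕ) (e : NExp) : Prog := .loop x p (.setArr a (.reg x) e)

section

variable {n m : ℕ} (v : Fin n → Finset (Fin m) → ℝ) {s : State}

theorem searchP_spec {x y p : ℕ} {b : BTest} (hxy : x ≠ y) (Pr : ℕ → Prop)
    (h : ∀ i < s.reg p, ∀ st : State, st.reg x = i → Agree (searchP x y p b) s st →
      (b.holds st ↔ Pr i)) :
    (∃ i < s.reg p, Pr i ∧ ((searchP x y p b).run v s).reg y = i) ∨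
      ((∀ i < s.reg p, ¬ Pr i) ∧ ((searchP x y p b).run v s).reg y = s.reg y) := by
  refine run_loop_inv v (x := x) (p := p) (c := .ite b (.setReg y (.reg x)) .skip) (s := s)
    (fun i st => (∃ i' < i, Pr i' ∧ st.reg y = i') ∨
      ((∀ i' < i, ¬ Pr i') ∧ st.reg y = s.reg y)) (by simp [hxy.symm]) ?_
  intro i hi st hst hA hI
  have hiff := h i hi st hst hA
  simp only [Prog.run]
  split_ifs with hPr <;> rw [hiff] at hPr
  · exact Or.inl ⟨i, by omega, hPr, by simp [hxy.symm, NExp.eval, hst]⟩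
  · rcases hI with ⟨i', h1, h2, h3⟩ | ⟨h1, h2⟩
    · exact Or.inl ⟨i', by omega, h2, by simp [hxy.symm, h3]⟩
    · refine Or.inr ⟨fun i' hi' => ?_, by simp [hxy.symm, h2]⟩
      rcases Nat.lt_succ_iff_lt_or_eq.mp hi' with h | rfl
      exacts [h1 i' h, hPr]

theorem fillP_spec {x p a : ℕ} {e : NExp} (E : ℕ → ℕ)
    (h : ∀ i < s.reg p, ∀ st : State, st.reg x = i → Agree (fillP x p a e) s st →
      e.eval st = E i) : ∀ i < s.reg p, ((fillP x p a e).run v s).arr a i = E i := by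
  refine run_loop_inv v (x := x) (p := p) (c := .setArr a (.reg x) e) (s := s)
    (fun i st => ∀ i' < i, st.arr a i' = E i') (by simp) ?_
  intro i hi st hst hA hI i' hi'
  simp only [Prog.run, NExp.eval, h i hi st hst hA, hst, arr_setReg, arr_setArr, if_true]
  rcases Nat.lt_succ_iff_lt_or_eq.mp hi' with h | rfl
  · rw [Function.update_of_ne h.ne, hI i' h]
  · rw [Function.update_self]

end

/-! ### Looking for an agent with one split item, or for a closed walk -/

/-- The test for a split entry. -/
def fracT (e f : NExp) : BTest := .and (.le (.const 1) (entry e f)) (.lt (entry e f) (.reg rQ))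

/-- Update `rLeaf` and `rLeafItem` if agent `ri` has exactly one split item, and `rStart` if it has
some split item. The registers `rLeaf` and `rStart` remain `n` if there is no such agent. -/
def scanBodyP : Prog :=
  .setReg rLast (.reg rm) ;; searchP rh rLast rm (fracT (.reg ri) (.reg rh)) ;;
    .setReg rCnt (.reg rm) ;; searchP rh rCnt rm (.and (fracT (.reg ri) (.reg rh))
      (.not (.eq (.reg rh) (.reg rLast)))) ;;
    .ite (.lt (.reg rLast) (.reg rm)) (.setReg rStart (.reg ri) ;;
      .ite (.le (.reg rm) (.reg rCnt)) (.setReg rLeaf (.reg ri) ;;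
        .setReg rLeafItem (.reg rLast)) .skip) .skip

/-- Scan all agents for split items. -/
def scanP : Prog :=
  .setReg rLeaf (.reg rn) ;; .setReg rStart (.reg rn) ;; .loop ri rn scanBodyP

/-- Agent `rLeaf` gives its part of `rLeafItem` to another owner. -/
def leafP : Prog :=
  searchP rh rOwner rn (.and (.le (.const 1) (entry (.reg rh) (.reg rLeafItem)))
    (.not (.eq (.reg rh) (.reg rLeaf)))) ;;
  .setArr aX (idx (.reg rOwner) (.reg rLeafItem)) (.add (entry (.reg rOwner) (.reg rLeafItem))
    (entry (.reg rLeaf) (.reg rLeafItem))) ;;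
  .setArr aX (idx (.reg rLeaf) (.reg rLeafItem)) (.const 0)

/-- Extend the walk to a split item of the current agent other than the last one, and to another
owner of this item. -/
def walkBodyP : Prog :=
  searchP rh rNextItem rm (.and (fracT (.arr aW (.reg rw1)) (.reg rh))
    (.not (.eq (.reg rh) (.arr aWI (.reg rw1))))) ;;
  .setArr aWI (.add (.reg rw1) (.const 1)) (.reg rNextItem) ;;
  searchP ri rNextAgent rn (.and (.le (.const 1) (entry (.reg ri) (.reg rNextItem)))
    (.not (.eq (.reg ri) (.arr aW (.reg rw1))))) ;;
  .setArr aW (.add (.reg rw1) (.const 1)) (.reg rNextAgent)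

/-- Walk `n` steps from `rStart` along split items. The entry `m` of `aWI` stands for no item. -/
def walkP : Prog :=
  .setArr aW (.const 0) (.reg rStart) ;; .setArr aWI (.const 0) (.reg rm) ;;
    .loop rw1 rn walkBodyP

/-- Check whether the walk returns to an agent at position `n - rx`. Positions are scanned downwards,
so that the first return is found last. -/
def returnBodyP : Prog :=
  .setReg rCnt (.reg rn1) ;;
  searchP ry rCnt rn1 (.and (.lt (.reg ry) (.sub (.reg rn) (.reg rx)))
    (.eq (.arr aW (.reg ry)) (.arr aW (.sub (.reg rn) (.reg rx))))) ;;
  .ite (.lt (.reg rCnt) (.reg rn1)) (.setReg rHi (.sub (.reg rn) (.reg rx)) ;;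
    .setReg rLo (.reg rCnt)) .skip

/-- Cut a closed walk out of the walk: agents `rLo, …, rHi = rLo + rPer`. If the first and the last
item coincide, its first agent is skipped. -/
def closeP : Prog :=
  .loop rx rn1 returnBodyP ;;
  .ite (.eq (.arr aWI (.add (.reg rLo) (.const 1))) (.arr aWI (.reg rHi)))
    (.setReg rLo (.add (.reg rLo) (.const 1)) ;; .setArr aW (.reg rHi) (.arr aW (.reg rLo))) .skip ;;
  .setReg rPer (.sub (.reg rHi) (.reg rLo))

section

variable {n m : ℕ} {par : Par} {T : ℝ} {s s' : State} {P : Prog}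
variable (v : Fin n → Finset (Fin m) → ℝ)

theorem entry_eval (hc : Ctx n m par T s) {e f : NExp} {i : ℕ} {j : Fin m} (he : e.eval s = i)
    (hf : f.eval s = j) : (entry e f).eval s = mat m s i j := by
  simp only [entry, idx, NExp.eval, he, hf, hc.m_eq]
  rfl

theorem fracT_holds (hc : Ctx n m par T s) {e f : NExp} {i : ℕ} {j : Fin m} (he : e.eval s = i)
    (hf : f.eval s = j) : (fracT e f).holds s ↔ Frac par.Q (mat m s) i j := by
  simp only [fracT, BTest.holds, BTest.lt, NExp.eval, entry_eval hc he hf, hc.Q_eq, Frac]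
  omega

theorem eq_holds {e f : NExp} : (BTest.eq e f).holds s ↔ e.eval s = f.eval s := by
  simp only [BTest.eq, BTest.holds]
  omega

theorem lt_holds {e f : NExp} : (BTest.lt e f).holds s ↔ e.eval s < f.eval s := Iff.rfl

/-- `rLeaf` is `n`, or an agent with exactly one split item, and then `n` only if no agent
with a number less than `i` has exactly one split item. -/
def LeafFound (n Q : ℕ) (x : ℕ → Fin m → ℕ) (i : ℕ) (s : State) : Prop :=
  (s.reg rLeaf = n ∧ ∀ i' < i, ∀ j, Frac Q x i' j → ∃ j', j' ≠ j ∧ Frac Q x i' j') ∨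
    (s.reg rLeaf < n ∧ ∃ j : Fin m, s.reg rLeafItem = j ∧ Frac Q x (s.reg rLeaf) j ∧
      ∀ j', j' ≠ j → ¬ Frac Q x (s.reg rLeaf) j')

/-- The analogue of `LeafFound` for agents with some split item. -/
def StartFound (n Q : ℕ) (x : ℕ → Fin m → ℕ) (i : ℕ) (s : State) : Prop :=
  (s.reg rStart = n ∧ ∀ i' < i, ∀ j, ¬ Frac Q x i' j) ∨
    (s.reg rStart < n ∧ ∃ j : Fin m, Frac Q x (s.reg rStart) j)

theorem scanBodyP_spec (hc : Ctx n m par T s) {i : ℕ} (hi : i < n) (hri : s.reg ri = i)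
    (h1 : LeafFound n par.Q (mat m s) i s) (h2 : StartFound n par.Q (mat m s) i s) :
    LeafFound n par.Q (mat m s) (i + 1) (scanBodyP.run v s) ∧
      StartFound n par.Q (mat m s) (i + 1) (scanBodyP.run v s) := by
  set s₁ := (Prog.setReg rLast (.reg rm)).run v s with hs₁
  have hc₁ : Ctx n m par T s₁ := hc.run v (by decide)
  have k₁ := searchP_spec v (s := s₁) (x := rh) (y := rLast) (p := rm)
    (b := fracT (.reg ri) (.reg rh)) (by decide)
    (fun k => ∃ h : k < m, Frac par.Q (mat m s) i ⟨k, h⟩) (by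
      intro k hk st hst hA
      rw [hc₁.m_eq] at hk
      have hcst := hc₁.agree hA (by decide)
      have hX : mat m st = mat m s := mat_congr (hA.arr aX (by decide))
      have e1 : (NExp.reg ri).eval st = i := (hA.reg ri (by decide)).trans hri
      rw [fracT_holds hcst (f := .reg rh) (j := ⟨k, hk⟩) e1 hst, hX]
      exact ⟨fun h => ⟨hk, h⟩, fun ⟨_, h⟩ => h⟩)
  have A₂ := run_agree v (searchP rh rLast rm (fracT (.reg ri) (.reg rh))) s₁
  have hc₂ : Ctx n m par T _ := hc₁.agree A₂ (by decide)
  set s₂ := (searchP rh rLast rm (fracT (.reg ri) (.reg rh))).run v s₁ with hs₂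
  set s₃ := (Prog.setReg rCnt (.reg rm)).run v s₂ with hs₃
  have hc₃ : Ctx n m par T s₃ := hc₂.run v (by decide)
  have hlast₃ : s₃.reg rLast = s₂.reg rLast := by simp [hs₃, Prog.run]
  have hri₃ : s₃.reg ri = i := by
    rw [← hri]
    have := A₂.reg ri (by decide)
    simpa [hs₃, Prog.run, hs₁] using this
  have hX₃ : s₃.arr aX = s.arr aX := A₂.arr aX (by decide)
  have k₂ := searchP_spec v (s := s₃) (x := rh) (y := rCnt) (p := rm)
    (b := .and (fracT (.reg ri) (.reg rh)) (.not (.eq (.reg rh) (.reg rLast)))) (by decide)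
    (fun k => ∃ h : k < m, Frac par.Q (mat m s) i ⟨k, h⟩ ∧ k ≠ s₂.reg rLast) (by
      intro k hk st hst hA
      rw [hc₃.m_eq] at hk
      have hcst := hc₃.agree hA (by decide)
      have hX : mat m st = mat m s := mat_congr ((hA.arr aX (by decide)).trans hX₃)
      have e1 : (NExp.reg ri).eval st = i := (hA.reg ri (by decide)).trans hri₃
      have e2 : st.reg rLast = s₂.reg rLast := (hA.reg rLast (by decide)).trans hlast₃
      simp only [BTest.holds, eq_holds, fracT_holds hcst (f := .reg rh) (j := ⟨k, hk⟩) e1 hst, hX, NExp.eval, hst,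
        e2]
      exact ⟨fun ⟨h, h'⟩ => ⟨hk, h, h'⟩, fun ⟨_, h, h'⟩ => ⟨h, h'⟩⟩)
  have A₄ := run_agree v (searchP rh rCnt rm (.and (fracT (.reg ri) (.reg rh))
    (.not (.eq (.reg rh) (.reg rLast))))) s₃
  have hc₄ : Ctx n m par T _ := hc₃.agree A₄ (by decide)
  set s₄ := (searchP rh rCnt rm (.and (fracT (.reg ri) (.reg rh))
    (.not (.eq (.reg rh) (.reg rLast))))).run v s₃ with hs₄
  have hlast₄ : s₄.reg rLast = s₂.reg rLast := (A₄.reg rLast (by decide)).trans hlast₃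
  have hri₄ : s₄.reg ri = i := (A₄.reg ri (by decide)).trans hri₃
  have hother : ∀ r ∈ [rLeaf, rLeafItem, rStart], s₄.reg r = s.reg r := by
    intro r hr
    have b1 := A₂.reg r
    have b2 := A₄.reg r
    fin_cases hr <;>
    · have b1 := b1 (by decide)
      have b2 := b2 (by decide)
      rw [b2]
      simpa [hs₃, hs₁, Prog.run] using b1
  have f1 := hother rLeaf (by simp)
  have f2 := hother rLeafItem (by simp)
  have f3 := hother rStart (by simp)
  rw [hc₁.m_eq] at k₁
  rw [hc₃.m_eq] at k₂
  have hcnt₃ : s₃.reg rCnt = m := by simp [hs₃, Prog.run, NExp.eval, hc₂.m_eq]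
  have hlast₁ : s₁.reg rLast = m := by simp [hs₁, Prog.run, NExp.eval, hc.m_eq]
  rw [hcnt₃] at k₂
  rw [hlast₁] at k₁
  have erun : scanBodyP.run v s = (Prog.ite (.lt (.reg rLast) (.reg rm)) (.setReg rStart (.reg ri) ;;
      .ite (.le (.reg rm) (.reg rCnt)) (.setReg rLeaf (.reg ri) ;;
        .setReg rLeafItem (.reg rLast)) .skip) .skip).run v s₄ := rfl
  have hb1 : (BTest.lt (.reg rLast) (.reg rm)).holds s₄ ↔ s₂.reg rLast < m := by
    rw [lt_holds]; simp only [NExp.eval, hlast₄, hc₄.m_eq]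
  have hb2 : (BTest.le (.reg rm) (.reg rCnt)).holds
      ((Prog.setReg rStart (.reg ri)).run v s₄) ↔ m ≤ s₄.reg rCnt := by
    simp [BTest.holds, NExp.eval, Prog.run, hc₄.m_eq]
  rw [erun]
  rcases k₁ with ⟨j, hj, ⟨hj', hfr⟩, hjr⟩ | ⟨hno, hjr⟩
  · rw [run_ite_pos v (hb1.mpr (by omega)), run_seq]
    have hst : StartFound n par.Q (mat m s) (i + 1)
        ((Prog.setReg rStart (.reg ri)).run v s₄) := by
      refine Or.inr ?_
      simp only [Prog.run, NExp.eval, hri₄, reg_setReg, if_true]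
      exact ⟨hi, _, hfr⟩
    rcases k₂ with ⟨j2, hj2, ⟨hj2', hfr2, hne⟩, hjr2⟩ | ⟨hno2, hjr2⟩
    · rw [run_ite_neg v (by rw [hb2]; omega)]
      refine ⟨?_, hst⟩
      rcases h1 with ⟨a1, a2⟩ | ⟨a1, j3, a2, a3, a4⟩
      · refine Or.inl ⟨by simp [Prog.run, f1, a1], fun i' hi' j₀ hf₀ => ?_⟩
        rcases Nat.lt_succ_iff_lt_or_eq.mp hi' with h | rfl
        · exact a2 i' h j₀ hf₀
        · by_cases hjj : j₀ = ⟨j, hj'⟩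
          · refine ⟨⟨j2, hj2'⟩, fun h => hne ?_, hfr2⟩
            rw [hjj] at h
            rw [hjr]
            exact congrArg Fin.val h
          · exact ⟨_, fun h => hjj h.symm, hfr⟩
      · refine Or.inr ?_
        have e : (Prog.skip.run v ((Prog.setReg rStart (.reg ri)).run v s₄)).reg rLeaf =
            s.reg rLeaf := by
          simp [Prog.run, f1]
        rw [e]
        exact ⟨a1, j3, by simp [Prog.run, f2, a2], a3, a4⟩
    · rw [run_ite_pos v (by rw [hb2]; omega)]
      refine ⟨Or.inr ?_, ?_⟩
      · have e : ((Prog.setReg rLeaf (.reg ri) ;; .setReg rLeafItem (.reg rLast)).run v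
            ((Prog.setReg rStart (.reg ri)).run v s₄)).reg rLeaf = i := by
          simp [Prog.run, NExp.eval, hri₄]
        rw [e]
        refine ⟨hi, ⟨j, hj'⟩, by simp [Prog.run, NExp.eval, hlast₄, hjr], hfr, fun j' hj'' hfr' => ?_⟩
        refine hno2 j' j'.2 ⟨j'.2, hfr', fun h => hj'' (Fin.ext ?_)⟩
        rw [h, hjr]
      · simpa [StartFound, Prog.run] using hst
  · rw [run_ite_neg v (by rw [hb1]; omega), Prog.run]
    have hnof : ∀ j, ¬ Frac par.Q (mat m s) i j := fun j hj => hno j j.2 ⟨j.2, hj⟩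
    constructor
    · rcases h1 with ⟨a1, a2⟩ | h1
      · refine Or.inl ⟨f1.trans a1, fun i' hi' j₀ hf₀ => ?_⟩
        rcases Nat.lt_succ_iff_lt_or_eq.mp hi' with h | rfl
        · exact a2 i' h j₀ hf₀
        · exact absurd hf₀ (hnof j₀)
      · right; rw [f1, f2]; exact h1
    · rcases h2 with ⟨a1, a2⟩ | h2
      · refine Or.inl ⟨f3.trans a1, fun i' hi' j₀ hf₀ => ?_⟩
        rcases Nat.lt_succ_iff_lt_or_eq.mp hi' with h | rfl
        · exact a2 i' h j₀ hf₀
        · exact absurd hf₀ (hnof j₀)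
      · right; rw [f3]; exact h2

theorem scanP_spec (hc : Ctx n m par T s) :
    LeafFound n par.Q (mat m s) n (scanP.run v s) ∧
      StartFound n par.Q (mat m s) n (scanP.run v s) := by
  set s₁ := (Prog.setReg rStart (.reg rn)).run v ((Prog.setReg rLeaf (.reg rn)).run v s) with hs₁
  have hc₁ : Ctx n m par T s₁ := (hc.run v (by decide)).run v (by decide)
  have key := run_loop_inv v (x := ri) (p := rn) (c := scanBodyP) (s := s₁)
    (fun i st => LeafFound n par.Q (mat m s) i st ∧ StartFound n par.Q (mat m s) i st) ?_ ?_
  · rw [hc₁.n_eq] at key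
    exact key
  · constructor
    · left; simp [hs₁, Prog.run, NExp.eval, hc.n_eq]
    · left; simp [hs₁, Prog.run, NExp.eval, hc.n_eq]
  · intro i hi st hst hA ⟨h1, h2⟩
    have hcst := hc₁.agree hA (by decide)
    have hX : mat m st = mat m s := mat_congr (hA.arr aX (by decide))
    rw [hc₁.n_eq] at hi
    rw [← hX] at h1 h2 ⊢
    have := scanBodyP_spec v hcst hi hst h1 h2
    simpa [LeafFound, StartFound] using this

theorem leafP_spec (hc : Ctx n m par T s) (hcol : ColSum n par.Q (mat m s))
    {j : Fin m} (hj : s.reg rLeafItem = j)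
    (hf : Frac par.Q (mat m s) (s.reg rLeaf) j) :
    ∃ i' < n, i' ≠ s.reg rLeaf ∧ 0 < mat m s i' j ∧
      mat m (leafP.run v s) = leafMove (mat m s) (s.reg rLeaf) j i' := by
  have k := searchP_spec v (s := s) (x := rh) (y := rOwner) (p := rn)
    (b := .and (.le (.const 1) (entry (.reg rh) (.reg rLeafItem)))
      (.not (.eq (.reg rh) (.reg rLeaf)))) (by decide)
    (fun k => 0 < mat m s k j ∧ k ≠ s.reg rLeaf) (by
      intro k hk st hst hA
      have hcst := hc.agree hA (by decide)
      have hX : mat m st = mat m s := mat_congr (hA.arr aX (by decide))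
      have e1 : (NExp.reg rLeafItem).eval st = j := (hA.reg rLeafItem (by decide)).trans hj
      have e2 : st.reg rLeaf = s.reg rLeaf := hA.reg rLeaf (by decide)
      simp only [BTest.holds, eq_holds, entry_eval hcst (e := .reg rh) hst e1, hX, NExp.eval, hst, e2]
      omega)
  have A := run_agree v (searchP rh rOwner rn (.and (.le (.const 1) (entry (.reg rh)
    (.reg rLeafItem))) (.not (.eq (.reg rh) (.reg rLeaf))))) s
  have hc₁ : Ctx n m par T _ := hc.agree A (by decide)
  set s₁ := (searchP rh rOwner rn (.and (.le (.const 1) (entry (.reg rh)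
    (.reg rLeafItem))) (.not (.eq (.reg rh) (.reg rLeaf))))).run v s with hs₁
  rw [hc.n_eq] at k
  rcases k with ⟨i', hi', ⟨hpos, hne⟩, hown⟩ | ⟨hno, -⟩
  · refine ⟨i', hi', hne, hpos, ?_⟩
    have hX : mat m s₁ = mat m s := mat_congr (A.arr aX (by decide))
    have e1 : s₁.reg rLeafItem = j := (A.reg rLeafItem (by decide)).trans hj
    have e2 : s₁.reg rLeaf = s.reg rLeaf := A.reg rLeaf (by decide)
    have e3 := entry_eval hc₁ (e := .reg rOwner) (f := .reg rLeafItem) hown e1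
    have e4 := entry_eval hc₁ (e := .reg rLeaf) (f := .reg rLeafItem) e2 e1
    have erun : mat m (leafP.run v s) = mat m ((s₁.setArr aX (i' * m + j)
        (mat m s i' j + mat m s (s.reg rLeaf) j)).setArr aX (s.reg rLeaf * m + j) 0) := by
      rw [leafP, run_seq, ← hs₁]
      simp only [Prog.run, idx, NExp.eval, hown, e1, e3, e4, hX, e2, hc₁.m_eq, reg_setArr]
    rw [erun, mat_setArr, mat_setArr, hX, leafMove, Function.update_of_ne hne.symm]
  · obtain ⟨i', h1, h2, h3⟩ := hcol.exists_other hf.2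
    exact absurd ⟨h3, h2⟩ (hno i' h1)

/-- The first `l` steps of a walk along split items. -/
structure Trail (n Q : ℕ) (x : ℕ → Fin m → ℕ) (W I : ℕ → ℕ) (l : ℕ) : Prop where
  lt : ∀ k ≤ l, W k < n
  step : ∀ k < l, ∃ j : Fin m, I (k + 1) = j ∧ Frac Q x (W k) j ∧ Frac Q x (W (k + 1)) j ∧
    I (k + 1) ≠ I k ∧ W (k + 1) ≠ W k
  last : ∃ j, Frac Q x (W l) j

theorem Trail.congr {Q : ℕ} {x : ℕ → Fin m → ℕ} {W I W' I' : ℕ → ℕ} {l : ℕ}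
    (h : Trail n Q x W I l) (hW : ∀ k ≤ l, W' k = W k) (hI : ∀ k ≤ l, I' k = I k) :
    Trail n Q x W' I' l := by
  refine ⟨fun k hk => by rw [hW k hk]; exact h.lt k hk, fun k hk => ?_, ?_⟩
  · rw [hW k hk.le, hW (k + 1) hk, hI k hk.le, hI (k + 1) hk]
    exact h.step k hk
  · rw [hW l le_rfl]; exact h.last

theorem Trail.succ {Q : ℕ} {x : ℕ → Fin m → ℕ} {W I : ℕ → ℕ} {l : ℕ}
    (h : Trail n Q x W I l) (hlt : W (l + 1) < n) {j : Fin m} (hj : I (l + 1) = j)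
    (h1 : Frac Q x (W l) j) (h2 : Frac Q x (W (l + 1)) j) (h3 : I (l + 1) ≠ I l)
    (h4 : W (l + 1) ≠ W l) : Trail n Q x W I (l + 1) := by
  refine ⟨fun k hk => ?_, fun k hk => ?_, ⟨j, h2⟩⟩
  · rcases Nat.le_succ_iff.mp hk with h' | rfl
    exacts [h.lt k h', hlt]
  · rcases Nat.lt_succ_iff_lt_or_eq.mp hk with h' | rfl
    exacts [h.step k h', ⟨j, hj, h1, h2, h3, h4⟩]

theorem walkBodyP_spec (hc : Ctx n m par T s) (hcol : ColSum n par.Q (mat m s)) {l : ℕ}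
    (hl : s.reg rw1 = l)
    (hno : ∀ i < n, ∀ j, Frac par.Q (mat m s) i j → ∃ j', j' ≠ j ∧ Frac par.Q (mat m s) i j')
    (hI : Trail n par.Q (mat m s) (s.arr aW) (s.arr aWI) l) :
    Trail n par.Q (mat m s) ((walkBodyP.run v s).arr aW) ((walkBodyP.run v s).arr aWI) (l + 1) := by
  -- the next item
  set b₁ : BTest := .and (fracT (.arr aW (.reg rw1)) (.reg rh))
    (.not (.eq (.reg rh) (.arr aWI (.reg rw1)))) with hb₁
  have k₁ := searchP_spec v (s := s) (x := rh) (y := rNextItem) (p := rm) (b := b₁) (by decide)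
    (fun k => ∃ h : k < m, Frac par.Q (mat m s) (s.arr aW l) ⟨k, h⟩ ∧ k ≠ s.arr aWI l) (by
      intro k hk st hst hA
      rw [hc.m_eq] at hk
      have hcst := hc.agree hA (by decide)
      have hX : mat m st = mat m s := mat_congr (hA.arr aX (by decide))
      have e0 : st.reg rw1 = l := (hA.reg rw1 (by decide)).trans hl
      have e1 : (NExp.arr aW (.reg rw1)).eval st = s.arr aW l := by
        simp only [NExp.eval, e0]
        rw [hA.arr aW (by decide)]
      have e2 : st.arr aWI = s.arr aWI := hA.arr aWI (by decide)
      simp only [hb₁, BTest.holds, eq_holds, fracT_holds hcst (f := .reg rh) (j := ⟨k, hk⟩) e1 hst,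
        hX, NExp.eval, hst, e0, e2]
      exact ⟨fun ⟨h, h'⟩ => ⟨hk, h, h'⟩, fun ⟨_, h, h'⟩ => ⟨h, h'⟩⟩)
  have A₁ := run_agree v (searchP rh rNextItem rm b₁) s
  have hc₁ : Ctx n m par T _ := hc.agree A₁ (by decide)
  set s₁ := (searchP rh rNextItem rm b₁).run v s with hs₁
  rw [hc.m_eq] at k₁
  obtain ⟨j, hfj, hjne, hj⟩ : ∃ j : Fin m, Frac par.Q (mat m s) (s.arr aW l) j ∧
      (j : ℕ) ≠ s.arr aWI l ∧ s₁.reg rNextItem = j := by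
    rcases k₁ with ⟨i, hi, ⟨h1, h2, h3⟩, h4⟩ | ⟨h1, -⟩
    · exact ⟨⟨i, hi⟩, h2, h3, h4⟩
    · obtain ⟨j, hj⟩ := hI.last
      obtain ⟨j', hne, hj'⟩ := hno _ (hI.lt l le_rfl) j hj
      by_cases h : (j : ℕ) = s.arr aWI l
      · exact absurd ⟨j'.2, hj', fun h' => hne (Fin.ext (h'.trans h.symm))⟩ (h1 j' j'.2)
      · exact absurd ⟨j.2, hj, h⟩ (h1 j j.2)
  set s₂ := (Prog.setArr aWI (.add (.reg rw1) (.const 1)) (.reg rNextItem)).run v s₁ with hs₂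
  have hc₂ : Ctx n m par T s₂ := hc₁.run v (by decide)
  have hw₁ : s₁.reg rw1 = l := (A₁.reg rw1 (by decide)).trans hl
  have hX₂ : s₂.arr aX = s.arr aX := by
    rw [← A₁.arr aX (by decide)]; simp [hs₂, Prog.run]
  have hW₂ : s₂.arr aW = s.arr aW := by
    rw [← A₁.arr aW (by decide)]; simp [hs₂, Prog.run]
  have hI₂ : s₂.arr aWI = Function.update (s.arr aWI) (l + 1) j := by
    rw [← A₁.arr aWI (by decide)]; simp [hs₂, Prog.run, NExp.eval, hw₁, hj]
  have hw₂ : s₂.reg rw1 = l := hw₁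
  have hj₂ : s₂.reg rNextItem = j := hj
  -- the next agent
  set b₂ : BTest := .and (.le (.const 1) (entry (.reg ri) (.reg rNextItem)))
    (.not (.eq (.reg ri) (.arr aW (.reg rw1)))) with hb₂
  have k₂ := searchP_spec v (s := s₂) (x := ri) (y := rNextAgent) (p := rn) (b := b₂) (by decide)
    (fun k => 0 < mat m s k j ∧ k ≠ s.arr aW l) (by
      intro k hk st hst hA
      have hcst := hc₂.agree hA (by decide)
      have hX : mat m st = mat m s := mat_congr ((hA.arr aX (by decide)).trans hX₂)
      have e0 : st.reg rw1 = l := (hA.reg rw1 (by decide)).trans hw₂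
      have e1 : (NExp.reg rNextItem).eval st = j := (hA.reg rNextItem (by decide)).trans hj₂
      have e2 : st.arr aW = s.arr aW := (hA.arr aW (by decide)).trans hW₂
      simp only [hb₂, BTest.holds, eq_holds, entry_eval hcst (e := .reg ri) hst e1, hX, NExp.eval,
        hst, e0, e2]
      omega)
  have A₃ := run_agree v (searchP ri rNextAgent rn b₂) s₂
  set s₃ := (searchP ri rNextAgent rn b₂).run v s₂ with hs₃
  rw [hc₂.n_eq] at k₂
  obtain ⟨i, hi, hpos, hine, hia⟩ : ∃ i < n, 0 < mat m s i j ∧ i ≠ s.arr aW l ∧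
      s₃.reg rNextAgent = i := by
    rcases k₂ with ⟨i, hi, ⟨h1, h2⟩, h4⟩ | ⟨h1, -⟩
    · exact ⟨i, hi, h1, h2, h4⟩
    · obtain ⟨i, h2, h3, h4⟩ := hcol.exists_other hfj.2
      exact absurd ⟨h4, h3⟩ (h1 i h2)
  have hw₃ : s₃.reg rw1 = l := (A₃.reg rw1 (by decide)).trans hw₂
  have hWf : (walkBodyP.run v s).arr aW = Function.update (s.arr aW) (l + 1) i := by
    have : s₃.arr aW = s.arr aW := (A₃.arr aW (by decide)).trans hW₂
    have e : walkBodyP.run v s =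
      (Prog.setArr aW (.add (.reg rw1) (.const 1)) (.reg rNextAgent)).run v s₃ := rfl
    rw [e, ← this]
    simp [Prog.run, NExp.eval, hw₃, hia]
  have hIf : (walkBodyP.run v s).arr aWI = Function.update (s.arr aWI) (l + 1) j := by
    have : s₃.arr aWI = Function.update (s.arr aWI) (l + 1) j :=
      (A₃.arr aWI (by decide)).trans hI₂
    have e : walkBodyP.run v s =
      (Prog.setArr aW (.add (.reg rw1) (.const 1)) (.reg rNextAgent)).run v s₃ := rfl
    rw [e, ← this]
    simp [Prog.run]
  have hlW : (walkBodyP.run v s).arr aW l = s.arr aW l := by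
    rw [hWf, Function.update_of_ne (by omega)]
  have hlI : (walkBodyP.run v s).arr aWI l = s.arr aWI l := by
    rw [hIf, Function.update_of_ne (by omega)]
  have hlW' : (walkBodyP.run v s).arr aW (l + 1) = i := by rw [hWf, Function.update_self]
  have hlI' : (walkBodyP.run v s).arr aWI (l + 1) = j := by rw [hIf, Function.update_self]
  refine (hI.congr (fun k hk => ?_) (fun k hk => ?_)).succ (j := j) ?_ ?_ ?_ ?_ ?_ ?_
  · rw [hWf, Function.update_of_ne (by omega)]
  · rw [hIf, Function.update_of_ne (by omega)]
  · rw [hlW']; exact hi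
  · exact hlI'
  · rw [hlW]; exact hfj
  · rw [hlW']
    have h1 := hcol.add_le hi (hI.lt l le_rfl) hine j
    exact ⟨hpos, by have := hfj.1; omega⟩
  · rw [hlI', hlI]; exact hjne
  · rw [hlW', hlW]; exact hine

theorem walkP_spec (hc : Ctx n m par T s) (hcol : ColSum n par.Q (mat m s))
    (hno : ∀ i < n, ∀ j, Frac par.Q (mat m s) i j → ∃ j', j' ≠ j ∧ Frac par.Q (mat m s) i j')
    (hs : s.reg rStart < n) (hf : ∃ j : Fin m, Frac par.Q (mat m s) (s.reg rStart) j) :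
    Trail n par.Q (mat m s) ((walkP.run v s).arr aW) ((walkP.run v s).arr aWI) n := by
  set s₁ := (Prog.setArr aWI (.const 0) (.reg rm)).run v
    ((Prog.setArr aW (.const 0) (.reg rStart)).run v s) with hs₁
  have hc₁ : Ctx n m par T s₁ := (hc.run v (by decide)).run v (by decide)
  have hX₁ : s₁.arr aX = s.arr aX := by simp [hs₁, Prog.run]
  have key := run_loop_inv v (x := rw1) (p := rn) (c := walkBodyP) (s := s₁)
    (fun l st => Trail n par.Q (mat m s) (st.arr aW) (st.arr aWI) l) ?_ ?_
  · rw [hc₁.n_eq] at key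
    exact key
  · have e : s₁.arr aW 0 = s.reg rStart := by simp [hs₁, Prog.run, NExp.eval]
    refine ⟨fun k hk => ?_, fun k hk => absurd hk (Nat.not_lt_zero _), ?_⟩
    · obtain rfl : k = 0 := by omega
      rw [arr_setReg, e]; exact hs
    · rw [arr_setReg, e]; exact hf
  · intro l hl st hst hA hI
    have hcst := hc₁.agree hA (by decide)
    have hX : mat m st = mat m s := mat_congr ((hA.arr aX (by decide)).trans hX₁)
    rw [← hX] at hI hcol hno ⊢
    exact walkBodyP_spec v hcst hcol hst hno hI

/-- Pigeonhole: `n + 1` visits to `n` agents. -/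
theorem Trail.exists_return {Q : ℕ} {x : ℕ → Fin m → ℕ} {W I : ℕ → ℕ}
    (h : Trail n Q x W I n) : ∃ a b, a < b ∧ b ≤ n ∧ W a = W b := by
  obtain ⟨a, ha, b, hb, hne, he⟩ := Finset.exists_ne_map_eq_of_card_lt_of_maps_to
    (s := Finset.range (n + 1)) (t := Finset.range n) (f := W) (by simp)
    (fun k hk => by
      have := h.lt k (by simpa [Nat.lt_succ_iff] using hk)
      simpa using this)
  simp only [Finset.mem_range] at ha hb
  rcases lt_or_gt_of_ne hne with h' | h'
  · exact ⟨a, b, h', by omega, he⟩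
  · exact ⟨b, a, h', by omega, he.symm⟩

/-- The item with a given number (any item if there is none). -/
def toItem (j₀ : Fin m) (k : ℕ) : Fin m := if h : k < m then ⟨k, h⟩ else j₀

theorem toItem_val (j₀ j : Fin m) : toItem j₀ j = j := by simp [toItem]

/-- The closed walk between two visits to an agent, if its first and last items differ. -/
theorem Trail.walk {Q : ℕ} {x : ℕ → Fin m → ℕ} {W I : ℕ → ℕ} (h : Trail n Q x W I n) (j₀ : Fin m)
    {lo hi : ℕ} (h1 : lo < hi) (h2 : hi ≤ n) {W' : ℕ → ℕ} (hW : ∀ l < hi, W' l = W l)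
    (hhi : W' hi = W lo) (hpos : ∃ j : Fin m, I hi = j ∧ 0 < x (W lo) j)
    (hinj : ∀ a b, a < b → b < hi → W a ≠ W b) (hne : I (lo + 1) ≠ I hi) :
    Walk n x (hi - lo) (fun l => W' (lo + l)) (fun l => toItem j₀ (I (lo + l + 1))) where
  L_pos := by omega
  closed := by
    show W' (lo + (hi - lo)) = W' (lo + 0)
    rw [Nat.add_sub_cancel' h1.le, hhi, Nat.add_zero, hW _ h1]
  lt l hl := by
    show W' (lo + l) < n
    rcases Nat.lt_or_ge (lo + l) hi with h' | h'
    · rw [hW _ h']; exact h.lt _ (by omega)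
    · obtain h'' : lo + l = hi := by omega
      rw [h'', hhi]; exact h.lt _ (by omega)
  inj l l' h3 h4 := by
    show W' (lo + l) ≠ W' (lo + l')
    rw [hW _ (by omega), hW _ (by omega)]
    exact hinj _ _ (by omega) (by omega)
  ne l h3 := by
    show toItem j₀ (I (lo + l + 1)) ≠ toItem j₀ (I (lo + l + 1 + 1))
    obtain ⟨j, e1, -⟩ := h.step (lo + l) (by omega)
    obtain ⟨j', e2, -, -, e3, -⟩ := h.step (lo + l + 1) (by omega)
    rw [e1, e2, toItem_val, toItem_val]
    rw [e1, e2] at e3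
    exact fun h => e3 (by rw [h])
  ne_last := by
    show toItem j₀ (I (lo + (hi - lo - 1) + 1)) ≠ toItem j₀ (I (lo + 0 + 1))
    have e : lo + (hi - lo - 1) + 1 = hi := by omega
    obtain ⟨j, e1, -⟩ := h.step lo (by omega)
    obtain ⟨j', e2, -⟩ := h.step (hi - 1) (by omega)
    rw [Nat.sub_add_cancel (by omega)] at e2
    rw [e, Nat.add_zero, e1, e2, toItem_val, toItem_val]
    rw [e1, e2] at hne
    exact fun h => hne (by rw [h])
  pos_left l h3 := by
    show 0 < x (W' (lo + l)) (toItem j₀ (I (lo + l + 1)))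
    obtain ⟨j, e1, e2, -⟩ := h.step (lo + l) (by omega)
    rw [hW _ (by omega), e1, toItem_val]
    exact e2.1
  pos_right l h3 := by
    show 0 < x (W' (lo + l + 1)) (toItem j₀ (I (lo + l + 1)))
    rcases Nat.lt_or_ge (lo + l + 1) hi with h' | h'
    · obtain ⟨j, e1, -, e2, -⟩ := h.step (lo + l) (by omega)
      rw [hW _ h', e1, toItem_val]
      exact e2.1
    · obtain h'' : lo + l + 1 = hi := by omega
      obtain ⟨j, e1, e2⟩ := hpos
      rw [h'', hhi, e1, toItem_val]
      exact e2

/-- The registers `rLo` and `rHi` contain the first return of the walk `W`. -/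
theorem returnP_spec (hc : Ctx n m par T s) (hret : ∃ a b, a < b ∧ b ≤ n ∧ s.arr aW a = s.arr aW b) :
    let s' := (Prog.loop rx rn1 returnBodyP).run v s
    s'.reg rLo < s'.reg rHi ∧ s'.reg rHi ≤ n ∧ s.arr aW (s'.reg rLo) = s.arr aW (s'.reg rHi) ∧
      ∀ a b, a < b → b < s'.reg rHi → s.arr aW a ≠ s.arr aW b := by
  have key := run_loop_inv v (x := rx) (p := rn1) (c := returnBodyP) (s := s)
    (fun i st => (∀ a b, a < b → b ≤ n → n < b + i → s.arr aW a ≠ s.arr aW b) ∨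
      (st.reg rLo < st.reg rHi ∧ st.reg rHi ≤ n ∧ s.arr aW (st.reg rLo) = s.arr aW (st.reg rHi) ∧
        ∀ a b, a < b → b < st.reg rHi → n < b + i → s.arr aW a ≠ s.arr aW b))
    (Or.inl fun a b _ _ _ => by omega) ?_
  · rw [hc.n1_eq] at key
    rcases key with h | ⟨h1, h2, h3, h4⟩
    · obtain ⟨a, b, h1, h2, h3⟩ := hret
      exact absurd h3 (h a b h1 h2 (by omega))
    · exact ⟨h1, h2, h3, fun a b h5 h6 => h4 a b h5 h6 (by omega)⟩
  · intro i hi st hst hA hI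
    rw [hc.n1_eq] at hi
    have hcst := hc.agree hA (by decide)
    have hW := hA.arr aW (by decide)
    set s₁ := (Prog.setReg rCnt (.reg rn1)).run v st with hs₁
    have hc₁ : Ctx n m par T s₁ := hcst.run v (by decide)
    set b : BTest := .and (.lt (.reg ry) (.sub (.reg rn) (.reg rx)))
      (.eq (.arr aW (.reg ry)) (.arr aW (.sub (.reg rn) (.reg rx)))) with hb
    have k := searchP_spec v (s := s₁) (x := ry) (y := rCnt) (p := rn1) (b := b) (by decide)
      (fun k => k < n - i ∧ s.arr aW k = s.arr aW (n - i)) (by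
        intro k hk st' hst' hA'
        have hc' := hc₁.agree hA' (by decide)
        have e1 : st'.reg rx = i := (hA'.reg rx (by decide)).trans (by simpa [hs₁, Prog.run] using hst)
        have e2 : st'.arr aW = s.arr aW := (hA'.arr aW (by decide)).trans hW
        simp only [hb, BTest.holds, eq_holds, lt_holds, NExp.eval, hst', e1, e2, hc'.n_eq])
    have A₂ := run_agree v (searchP ry rCnt rn1 b) s₁
    have hc₂ : Ctx n m par T _ := hc₁.agree A₂ (by decide)
    set s₂ := (searchP ry rCnt rn1 b).run v s₁ with hs₂
    have hx₂ : s₂.reg rx = i := (A₂.reg rx (by decide)).trans (by simpa [hs₁, Prog.run] using hst)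
    have hlo₂ : s₂.reg rLo = st.reg rLo := by
      rw [A₂.reg rLo (by decide)]; simp [hs₁, Prog.run]
    have hhi₂ : s₂.reg rHi = st.reg rHi := by
      rw [A₂.reg rHi (by decide)]; simp [hs₁, Prog.run]
    have hcnt₁ : s₁.reg rCnt = n + 1 := by simp [hs₁, Prog.run, NExp.eval, hcst.n1_eq]
    rw [hc₁.n1_eq, hcnt₁] at k
    have hbt : (BTest.lt (.reg rCnt) (.reg rn1)).holds s₂ ↔ s₂.reg rCnt < n + 1 := by
      rw [lt_holds]; simp only [NExp.eval, hc₂.n1_eq]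
    have erun : returnBodyP.run v st = (Prog.ite (.lt (.reg rCnt) (.reg rn1))
      (.setReg rHi (.sub (.reg rn) (.reg rx)) ;; .setReg rLo (.reg rCnt)) .skip).run v s₂ := rfl
    rw [erun]
    rcases k with ⟨a, ha, ⟨ha1, ha2⟩, ha3⟩ | ⟨hno, hcnt⟩
    · rw [run_ite_pos v (hbt.mpr (by omega))]
      right
      have e1 : (((Prog.setReg rHi (.sub (.reg rn) (.reg rx)) ;; .setReg rLo (.reg rCnt)).run v
          s₂).setReg rx (i + 1)).reg rLo = a := by simp [Prog.run, NExp.eval, ha3]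
      have e2 : (((Prog.setReg rHi (.sub (.reg rn) (.reg rx)) ;; .setReg rLo (.reg rCnt)).run v
          s₂).setReg rx (i + 1)).reg rHi = n - i := by simp [Prog.run, NExp.eval, hx₂, hc₂.n_eq]
      rw [e1, e2]
      refine ⟨ha1, by omega, ha2, fun a' b' h1 h2 h3 => ?_⟩
      omega
    · rw [run_ite_neg v (by rw [hbt]; omega)]
      have hnew : ∀ a b, a < b → b ≤ n → n = b + i → s.arr aW a ≠ s.arr aW b := by
        intro a b h1 h2 h3 h4
        obtain rfl : b = n - i := by omega
        exact hno a (by omega) ⟨h1, h4⟩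
      rcases hI with h | ⟨h1, h2, h3, h4⟩
      · left
        intro a b h1 h2 h3
        rcases Nat.lt_or_ge n (b + i) with h' | h'
        · exact h a b h1 h2 h'
        · exact hnew a b h1 h2 (by omega)
      · right
        have e1 : ((Prog.skip.run v s₂).setReg rx (i + 1)).reg rLo = st.reg rLo := by
          simp [Prog.run, hlo₂]
        have e2 : ((Prog.skip.run v s₂).setReg rx (i + 1)).reg rHi = st.reg rHi := by
          simp [Prog.run, hhi₂]
        rw [e1, e2]
        refine ⟨h1, h2, h3, fun a b h5 h6 h7 => ?_⟩
        rcases Nat.lt_or_ge n (b + i) with h' | h'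
        · exact h4 a b h5 h6 h'
        · exact hnew a b h5 (by omega) (by omega)

theorem closeP_spec (hc : Ctx n m par T s) {Q : ℕ} {x : ℕ → Fin m → ℕ} (j₀ : Fin m)
    (ht : Trail n Q x (s.arr aW) (s.arr aWI) n) :
    let s' := closeP.run v s
    Walk n x (s'.reg rPer) (fun l => s'.arr aW (s'.reg rLo + l))
      (fun l => toItem j₀ (s'.arr aWI (s'.reg rLo + l + 1))) ∧
      s'.reg rHi = s'.reg rLo + s'.reg rPer ∧ s'.reg rHi ≤ n ∧
      ∀ l < s'.reg rPer, s'.arr aWI (s'.reg rLo + l + 1) < m := by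
  obtain ⟨h1, h2, h3, h4⟩ := returnP_spec v hc ht.exists_return
  have A₁ := run_agree v (.loop rx rn1 returnBodyP) s
  set s₁ := (Prog.loop rx rn1 returnBodyP).run v s with hs₁
  set lo := s₁.reg rLo with hlo
  set hi := s₁.reg rHi with hhi
  have hW := A₁.arr aW (by decide)
  have hI := A₁.arr aWI (by decide)
  have hlt : ∀ k, 0 < k → k ≤ n → s.arr aWI k < m := by
    intro k hk hk'
    obtain ⟨j, e, -⟩ := ht.step (k - 1) (by omega)
    rw [Nat.sub_add_cancel hk] at e
    rw [e]; exact j.2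
  have hbt : (BTest.eq (.arr aWI (.add (.reg rLo) (.const 1))) (.arr aWI (.reg rHi))).holds s₁ ↔
      s.arr aWI (lo + 1) = s.arr aWI hi := by
    rw [eq_holds]; simp only [NExp.eval, hI, ← hlo, ← hhi]
  have erun : closeP.run v s = (Prog.setReg rPer (.sub (.reg rHi) (.reg rLo))).run v
    ((Prog.ite (.eq (.arr aWI (.add (.reg rLo) (.const 1))) (.arr aWI (.reg rHi)))
      (.setReg rLo (.add (.reg rLo) (.const 1)) ;; .setArr aW (.reg rHi) (.arr aW (.reg rLo)))
      .skip).run v s₁) := rfl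
  rw [erun]
  by_cases hb : s.arr aWI (lo + 1) = s.arr aWI hi
  · rw [run_ite_pos v (hbt.mpr hb)]
    set s' := (Prog.setReg rPer (.sub (.reg rHi) (.reg rLo))).run v
      ((Prog.setReg rLo (.add (.reg rLo) (.const 1)) ;;
        .setArr aW (.reg rHi) (.arr aW (.reg rLo))).run v s₁) with hs'
    have e1 : s'.reg rLo = lo + 1 := by simp [hs', Prog.run, NExp.eval, ← hlo]
    have e2 : s'.reg rHi = hi := by simp [hs', Prog.run, ← hhi]
    have e3 : s'.reg rPer = hi - (lo + 1) := by simp [hs', Prog.run, NExp.eval, ← hlo, ← hhi]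
    have e4 : s'.arr aWI = s.arr aWI := by simp [hs', Prog.run, hI]
    have e5 : s'.arr aW = Function.update (s.arr aW) hi (s.arr aW (lo + 1)) := by
      simp [hs', Prog.run, NExp.eval, hW, ← hlo, ← hhi]
    -- consecutive items differ, so that the walk does not return after two steps
    obtain ⟨j, f1, f2, f3, f4, f5⟩ := ht.step lo (by omega)
    have hne1 : hi ≠ lo + 1 := by
      intro h
      rw [h] at h3
      exact f5 h3.symm
    obtain ⟨j', g1, g2, g3, g4, g5⟩ := ht.step (lo + 1) (by omega)
    have hne2 : s.arr aWI (lo + 1 + 1) ≠ s.arr aWI hi := by rw [← hb]; exact g4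
    dsimp only
    rw [e1, e2, e3, e4]
    refine ⟨ht.walk j₀ (by omega) h2 (fun l hl => ?_) ?_ ⟨j, ?_, f3.1⟩ h4 hne2, by omega, h2,
      fun l hl => hlt _ (by omega) (by omega)⟩
    · rw [e5, Function.update_of_ne hl.ne]
    · rw [e5, Function.update_self]
    · rw [← hb, f1]
  · rw [run_ite_neg v (by rw [hbt]; exact hb)]
    set s' := (Prog.setReg rPer (.sub (.reg rHi) (.reg rLo))).run v (Prog.skip.run v s₁) with hs'
    have e1 : s'.reg rLo = lo := by simp [hs', Prog.run, ← hlo]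
    have e2 : s'.reg rHi = hi := by simp [hs', Prog.run, ← hhi]
    have e3 : s'.reg rPer = hi - lo := by simp [hs', Prog.run, NExp.eval, ← hlo, ← hhi]
    have e4 : s'.arr aWI = s.arr aWI := by simp [hs', Prog.run, hI]
    have e5 : s'.arr aW = s.arr aW := by simp [hs', Prog.run, hW]
    obtain ⟨j, f1, f2, f3, -⟩ := ht.step (hi - 1) (by omega)
    rw [Nat.sub_add_cancel (by omega)] at f1 f3
    dsimp only
    rw [e1, e2, e3, e4, e5]
    exact ⟨ht.walk j₀ h1 h2 (fun l _ => rfl) h3.symm ⟨j, f1, by rw [h3]; exact f3.1⟩ h4 hb,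
      by omega, h2, fun l hl => hlt _ (by omega) (by omega)⟩

end

/-! ### Transfers along a closed walk -/

/-- The remainder of a division. -/
def modE (e f : NExp) : NExp := .sub e (.mul f (.div e f))

/-- Load the closed walk, repeated periodically, into `aC` and `aCI`. -/
def forwardP : Prog :=
  fillP rl rn2 aC (.arr aW (.add (.reg rLo) (modE (.reg rl) (.reg rPer)))) ;;
  fillP rl rn2 aCI (.arr aWI (.add (.add (.reg rLo) (modE (.reg rl) (.reg rPer))) (.const 1)))

/-- Load the reversed closed walk. -/
def backwardP : Prog :=
  fillP rl rn2 aC (.arr aW (.sub (.reg rHi) (modE (.reg rl) (.reg rPer)))) ;;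
  fillP rl rn2 aCI (.arr aWI (.sub (.reg rHi) (modE (.reg rl) (.reg rPer))))

/-- Test whether the agent `re` can afford to give `ru` units of the next item. -/
def affordP : Prog :=
  .ite (.le (.reg ru) (entry (.reg re) (.arr aCI (.add (.reg rx) (.const 1)))))
    (loadP ;;
      .setArr aY (.arr aCI (.reg rx)) (.add (.arr aY (.arr aCI (.reg rx))) (.arr aS (.reg rx))) ;;
      .setArr aY (.arr aCI (.add (.reg rx) (.const 1)))
        (.sub (.arr aY (.arr aCI (.add (.reg rx) (.const 1)))) (.reg ru)) ;;
      evalP ;; .ite (.le (.reg rG0) (.add (.reg rg) (.reg rTol))) (.setReg rMax (.reg ru)) .skip)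
    .skip

/-- Compute the next maximal transfer. -/
def transferP : Prog :=
  .setReg re (.arr aC (.add (.reg rx) (.const 1))) ;; loadP ;; evalP ;; .setReg rG0 (.reg rg) ;;
  .setReg rMax (.const 0) ;; .loop ru rQ1 affordP ;;
  .setArr aS (.add (.reg rx) (.const 1)) (.reg rMax)

/-- Compute the transfers for two turns. -/
def chainP : Prog :=
  .setArr aS (.const 0) (entry (.arr aC (.const 0)) (.arr aCI (.const 0))) ;;
  .loop rx rK transferP

/-- Look for a turn of transfers that starts and ends with the whole part of an agent. -/
def findP : Prog :=
  .setReg rFull (.reg rPer) ;;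
  searchP rx rFull rn (.and (.lt (.reg rx) (.reg rPer))
    (.and (.eq (.arr aS (.reg rx)) (entry (.arr aC (.reg rx)) (.arr aCI (.reg rx))))
      (.eq (.arr aS (.add (.reg rx) (.reg rPer)))
        (entry (.arr aC (.reg rx)) (.arr aCI (.reg rx))))))

/-- Carry out one turn of transfers. -/
def applyP : Prog :=
  .loop rx rn (.ite (.lt (.reg rx) (.reg rPer))
    (.setReg re (.arr aC (.add (.add (.reg rFull) (.reg rx)) (.const 1))) ;;
      .setArr aX (idx (.reg re) (.arr aCI (.add (.reg rFull) (.reg rx))))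
        (.add (entry (.reg re) (.arr aCI (.add (.reg rFull) (.reg rx))))
          (.arr aS (.add (.reg rFull) (.reg rx)))) ;;
      .setArr aX (idx (.reg re) (.arr aCI (.add (.add (.reg rFull) (.reg rx)) (.const 1))))
        (.sub (entry (.reg re) (.arr aCI (.add (.add (.reg rFull) (.reg rx)) (.const 1))))
          (.arr aS (.add (.add (.reg rFull) (.reg rx)) (.const 1))))) .skip)

/-- Find transfers in one of the two directions, and carry them out. -/
def turnP : Prog :=
  forwardP ;; chainP ;; findP ;; .ite (.lt (.reg rFull) (.reg rPer)) applyP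
    (backwardP ;; chainP ;; findP ;; .ite (.lt (.reg rFull) (.reg rPer)) applyP .skip)

/-- One rounding step. -/
def roundP : Prog :=
  scanP ;; .ite (.lt (.reg rLeaf) (.reg rn)) leafP
    (.ite (.lt (.reg rStart) (.reg rn)) (walkP ;; closeP ;; turnP) .skip)

section

variable {n m : ℕ} {par : Par} {T : ℝ} {s s' : State} {P : Prog}
variable (v : Fin n → Finset (Fin m) → ℝ)

/-- The walk `a`, `b` is loaded, for indices up to `2 * n`. -/
structure Loaded (n : ℕ) (a : ℕ → ℕ) (b : ℕ → Fin m) (s : State) : Prop where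
  agent : ∀ l ≤ 2 * n, s.arr aC l = a l
  item : ∀ l ≤ 2 * n, s.arr aCI l = b l

theorem Loaded.congr {a : ℕ → ℕ} {b : ℕ → Fin m} (h : Loaded n a b s)
    (h1 : s'.arr aC = s.arr aC) (h2 : s'.arr aCI = s.arr aCI) : Loaded n a b s' :=
  ⟨fun l hl => by rw [h1]; exact h.agent l hl, fun l hl => by rw [h2]; exact h.item l hl⟩

theorem idx_eval (hc : Ctx n m par T s) {e f : NExp} {i j : ℕ} (he : e.eval s = i)
    (hf : f.eval s = j) : (idx e f).eval s = i * m + j := by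
  simp only [idx, NExp.eval, he, hf, hc.m_eq]

theorem modE_eval {e f : NExp} : (modE e f).eval s = e.eval s % f.eval s := by
  simp only [modE, NExp.eval]
  have := Nat.div_add_mod (e.eval s) (f.eval s)
  omega

theorem forwardP_spec (hc : Ctx n m par T s) (j₀ : Fin m) (hL : 0 < s.reg rPer)
    (hI : ∀ l < s.reg rPer, s.arr aWI (s.reg rLo + l + 1) < m) :
    Loaded n (fun l => s.arr aW (s.reg rLo + l % s.reg rPer))
      (fun l => toItem j₀ (s.arr aWI (s.reg rLo + l % s.reg rPer + 1))) (forwardP.run v s) := by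
  set e₁ : NExp := .arr aW (.add (.reg rLo) (modE (.reg rl) (.reg rPer))) with he₁
  set e₂ : NExp := .arr aWI (.add (.add (.reg rLo) (modE (.reg rl) (.reg rPer))) (.const 1)) with he₂
  have k₁ := fillP_spec v (s := s) (x := rl) (p := rn2) (a := aC) (e := e₁)
    (fun l => s.arr aW (s.reg rLo + l % s.reg rPer)) (by
      intro i hi st hst hA
      simp only [he₁, NExp.eval, modE_eval, hst, hA.reg rLo (by simp [fillP, Prog.wr]),
        hA.reg rPer (by simp [fillP, Prog.wr]), hA.arr aW (by simp [fillP, Prog.wa])])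
  have A₁ := run_agree v (fillP rl rn2 aC e₁) s
  have hc₁ : Ctx n m par T _ := hc.agree A₁ (by decide)
  set s₁ := (fillP rl rn2 aC e₁).run v s with hs₁
  have k₂ := fillP_spec v (s := s₁) (x := rl) (p := rn2) (a := aCI) (e := e₂)
    (fun l => s.arr aWI (s.reg rLo + l % s.reg rPer + 1)) (by
      intro i hi st hst hA
      simp only [he₂, NExp.eval, modE_eval, hst, hA.reg rLo (by simp [fillP, Prog.wr]),
        hA.reg rPer (by simp [fillP, Prog.wr]), hA.arr aWI (by simp [fillP, Prog.wa]),
        A₁.reg rLo (by simp [fillP, Prog.wr]), A₁.reg rPer (by simp [fillP, Prog.wr]),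
        A₁.arr aWI (by simp [fillP, Prog.wa])])
  have A₂ := run_agree v (fillP rl rn2 aCI e₂) s₁
  rw [hc.n2_eq] at k₁
  rw [hc₁.n2_eq] at k₂
  refine ⟨fun l hl => ?_, fun l hl => ?_⟩
  · have : (forwardP.run v s).arr aC = s₁.arr aC := A₂.arr aC (by decide)
    rw [this, k₁ l (by omega)]
  · have := hI _ (Nat.mod_lt l hL)
    have e : (forwardP.run v s).arr aCI l = _ := k₂ l (by omega)
    rw [e]
    simp only [toItem]
    rw [dif_pos this]

theorem backwardP_spec (hc : Ctx n m par T s) (j₀ : Fin m) (hL : 0 < s.reg rPer)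
    (hhi : s.reg rHi = s.reg rLo + s.reg rPer)
    (hI : ∀ l < s.reg rPer, s.arr aWI (s.reg rLo + l + 1) < m) :
    Loaded n (fun l => s.arr aW (s.reg rLo + (s.reg rPer - l % s.reg rPer)))
      (fun l => toItem j₀ (s.arr aWI (s.reg rLo + (s.reg rPer - 1 - l % s.reg rPer) + 1)))
      (backwardP.run v s) := by
  have hmod : ∀ l, l % s.reg rPer < s.reg rPer := fun l => Nat.mod_lt l hL
  set e₁ : NExp := .arr aW (.sub (.reg rHi) (modE (.reg rl) (.reg rPer))) with he₁
  set e₂ : NExp := .arr aWI (.sub (.reg rHi) (modE (.reg rl) (.reg rPer))) with he₂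
  have k₁ := fillP_spec v (s := s) (x := rl) (p := rn2) (a := aC) (e := e₁)
    (fun l => s.arr aW (s.reg rLo + (s.reg rPer - l % s.reg rPer))) (by
      intro i hi st hst hA
      have := hmod i
      simp only [he₁, NExp.eval, modE_eval, hst, hA.reg rHi (by simp [fillP, Prog.wr]),
        hA.reg rPer (by simp [fillP, Prog.wr]), hA.arr aW (by simp [fillP, Prog.wa]), hhi]
      congr 1
      omega)
  have A₁ := run_agree v (fillP rl rn2 aC e₁) s
  have hc₁ : Ctx n m par T _ := hc.agree A₁ (by decide)
  set s₁ := (fillP rl rn2 aC e₁).run v s with hs₁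
  have k₂ := fillP_spec v (s := s₁) (x := rl) (p := rn2) (a := aCI) (e := e₂)
    (fun l => s.arr aWI (s.reg rLo + (s.reg rPer - 1 - l % s.reg rPer) + 1)) (by
      intro i hi st hst hA
      have := hmod i
      simp only [he₂, NExp.eval, modE_eval, hst, hA.reg rHi (by simp [fillP, Prog.wr]),
        hA.reg rPer (by simp [fillP, Prog.wr]), hA.arr aWI (by simp [fillP, Prog.wa]),
        A₁.reg rHi (by simp [fillP, Prog.wr]), A₁.reg rPer (by simp [fillP, Prog.wr]),
        A₁.arr aWI (by simp [fillP, Prog.wa]), hhi]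
      congr 1
      omega)
  have A₂ := run_agree v (fillP rl rn2 aCI e₂) s₁
  rw [hc.n2_eq] at k₁
  rw [hc₁.n2_eq] at k₂
  refine ⟨fun l hl => ?_, fun l hl => ?_⟩
  · have : (backwardP.run v s).arr aC = s₁.arr aC := A₂.arr aC (by decide)
    rw [this, k₁ l (by omega)]
  · have h1 := hmod l
    have := hI (s.reg rPer - 1 - l % s.reg rPer) (by omega)
    have e : (backwardP.run v s).arr aCI l = _ := k₂ l (by omega)
    rw [e]
    simp only [toItem]
    rw [dif_pos this]

theorem levels_setArr (s : State) (j : Fin m) (w : ℕ) :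
    levels m (s.setArr aY j w) = Function.update (levels m s) j w := by
  funext j'
  simp only [levels, arr_setArr, if_true]
  by_cases hj : j' = j
  · subst hj; simp
  · have : (j' : ℕ) ≠ j := fun h => hj (Fin.ext h)
    rw [Function.update_of_ne this, Function.update_of_ne hj]
    rfl

variable {a : ℕ → ℕ} {b : ℕ → Fin m}

theorem affordP_spec (hc : Ctx n m par T s) (hl : Loaded n a b s) {l : ℕ} (hl' : l + 1 ≤ 2 * n)
    (hx : s.reg rx = l) (he : s.reg re = a (l + 1)) (hne : b l ≠ b (l + 1))
    (hG : s.reg rG0 = Gh v par T (a (l + 1)) (mat m s (a (l + 1)))) :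
    (Affords (Gh v par T) par.tol (mat m s) a b (s.arr aS l) l (s.reg ru) ∧
      (affordP.run v s).reg rMax = s.reg ru) ∨
    (¬ Affords (Gh v par T) par.tol (mat m s) a b (s.arr aS l) l (s.reg ru) ∧
      (affordP.run v s).reg rMax = s.reg rMax) := by
  have hi0 := hl.item l (by omega)
  have hi1 := hl.item (l + 1) hl'
  have e1 : (NExp.arr aCI (.add (.reg rx) (.const 1))).eval s = b (l + 1) := by
    simp only [NExp.eval, hx, hi1]
  have hb1 : (BTest.le (.reg ru) (entry (.reg re) (.arr aCI (.add (.reg rx) (.const 1))))).holds s ↔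
      s.reg ru ≤ mat m s (a (l + 1)) (b (l + 1)) := by
    simp only [BTest.holds, entry_eval hc (e := .reg re) he e1]
    rfl
  by_cases h1 : s.reg ru ≤ mat m s (a (l + 1)) (b (l + 1))
  · have hlev := loadP_spec v hc
    have A₁ := run_agree v loadP s
    have hc₁ : Ctx n m par T _ := hc.agree A₁ (by decide)
    set s₁ := loadP.run v s with hs₁
    have x₁ : s₁.reg rx = l := (A₁.reg rx (by decide)).trans hx
    have u₁ : s₁.reg ru = s.reg ru := A₁.reg ru (by decide)
    have S₁ : s₁.arr aS = s.arr aS := A₁.arr aS (by decide)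
    have I₁ : s₁.arr aCI = s.arr aCI := A₁.arr aCI (by decide)
    set s₂ := (Prog.setArr aY (.arr aCI (.add (.reg rx) (.const 1)))
        (.sub (.arr aY (.arr aCI (.add (.reg rx) (.const 1)))) (.reg ru))).run v
      ((Prog.setArr aY (.arr aCI (.reg rx)) (.add (.arr aY (.arr aCI (.reg rx)))
        (.arr aS (.reg rx)))).run v s₁) with hs₂
    have hc₂ : Ctx n m par T s₂ := (hc₁.run v (by decide)).run v (by decide)
    have hlev₂ : levels m s₂ = shift (mat m s (a (l + 1))) (b l) (s.arr aS l) (b (l + 1))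
        (s.reg ru) := by
      have hne' : (b (l + 1) : ℕ) ≠ b l := fun h => hne (Fin.ext h.symm)
      have e : s₂ = (s₁.setArr aY (b l) (s₁.arr aY (b l) + s.arr aS l)).setArr aY (b (l + 1))
          (s₁.arr aY (b (l + 1)) - s.reg ru) := by
        simp [hs₂, Prog.run, NExp.eval, x₁, u₁, S₁, I₁, hi0, hi1, hne']
      rw [e, levels_setArr, levels_setArr, shift, ← he, ← hlev]
      rfl
    have re₂ : s₂.reg re = a (l + 1) := by
      rw [← he, ← A₁.reg re (by decide)]; rfl
    have hev := (evalP_spec v hc₂).1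
    rw [hlev₂, re₂] at hev
    have A₃ := run_agree v evalP s₂
    have hc₃ : Ctx n m par T _ := hc₂.agree A₃ (by decide)
    set s₃ := evalP.run v s₂ with hs₃
    have erun : affordP.run v s = (Prog.ite (.le (.reg rG0) (.add (.reg rg) (.reg rTol)))
        (.setReg rMax (.reg ru)) .skip).run v s₃ := by
      rw [affordP, run_ite_pos v (hb1.mpr h1)]; rfl
    have g₃ : s₃.reg rG0 = s.reg rG0 := by
      rw [A₃.reg rG0 (by decide), ← A₁.reg rG0 (by decide)]; rfl
    have u₃ : s₃.reg ru = s.reg ru := by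
      rw [A₃.reg ru (by decide), ← u₁]; rfl
    have m₃ : s₃.reg rMax = s.reg rMax := by
      rw [A₃.reg rMax (by decide), ← A₁.reg rMax (by decide)]; rfl
    have hb2 : (BTest.le (.reg rG0) (.add (.reg rg) (.reg rTol))).holds s₃ ↔
        Affords (Gh v par T) par.tol (mat m s) a b (s.arr aS l) l (s.reg ru) := by
      simp only [BTest.holds, NExp.eval, g₃, hev, hc₃.tol_eq, hG, Affords, h1, true_and]
    rw [erun]
    by_cases h2 : Affords (Gh v par T) par.tol (mat m s) a b (s.arr aS l) l (s.reg ru)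
    · rw [run_ite_pos v (hb2.mpr h2)]
      exact Or.inl ⟨h2, by simp [Prog.run, NExp.eval, u₃]⟩
    · rw [run_ite_neg v (by rw [hb2]; exact h2)]
      exact Or.inr ⟨h2, by simp [Prog.run, m₃]⟩
  · right
    refine ⟨fun h => h1 h.1, ?_⟩
    rw [affordP, run_ite_neg v (by rw [hb1]; exact h1)]
    rfl

theorem le_shift_zero (y : Fin m → ℕ) (p : Fin m) (u : ℕ) (q : Fin m) (hpq : p ≠ q) :
    y ≤ shift y p u q 0 := by
  intro j
  unfold shift
  by_cases hq : j = q
  · subst hq; simp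
  · rw [Function.update_of_ne hq]
    by_cases hp : j = p
    · subst hp; simp
    · rw [Function.update_of_ne hp]

/-- The search over `u = 0, …, Q` finds the largest affordable transfer. -/
theorem transferP_spec (hc : Ctx n m par T s) (hl : Loaded n a b s) {l : ℕ}
    (hl' : l + 1 ≤ 2 * n) (hx : s.reg rx = l) (hne : b l ≠ b (l + 1)) (hlt : a (l + 1) < n)
    (hcol : ColSum n par.Q (mat m s))
    (hmono : ∀ i < n, ∀ y y' : Fin m → ℕ, y ≤ y' → Gh v par T i y ≤ Gh v par T i y') :
    ∃ w, (transferP.run v s).arr aS = Function.update (s.arr aS) (l + 1) w ∧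
      Affords (Gh v par T) par.tol (mat m s) a b (s.arr aS l) l w ∧
      ∀ u, Affords (Gh v par T) par.tol (mat m s) a b (s.arr aS l) l u → u ≤ w := by
  set s₁ := (Prog.setReg re (.arr aC (.add (.reg rx) (.const 1)))).run v s with hs₁
  have hc₁ : Ctx n m par T s₁ := hc.run v (by decide)
  have re₁ : s₁.reg re = a (l + 1) := by
    simp [hs₁, Prog.run, NExp.eval, hx, hl.agent (l + 1) hl']
  have hlev := loadP_spec v hc₁
  have A₂ := run_agree v loadP s₁
  have hc₂ : Ctx n m par T _ := hc₁.agree A₂ (by decide)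
  set s₂ := loadP.run v s₁ with hs₂
  have hev := (evalP_spec v hc₂).1
  have re₂ : s₂.reg re = a (l + 1) := (A₂.reg re (by decide)).trans re₁
  rw [re₂, hlev, re₁] at hev
  have A₃ := run_agree v evalP s₂
  have hc₃ : Ctx n m par T _ := hc₂.agree A₃ (by decide)
  set s₃ := evalP.run v s₂ with hs₃
  set s₄ := (Prog.setReg rMax (.const 0)).run v ((Prog.setReg rG0 (.reg rg)).run v s₃) with hs₄
  have hc₄ : Ctx n m par T s₄ := (hc₃.run v (by decide)).run v (by decide)
  have arr₄ : ∀ r, r ∉ loadP.wa → r ∉ evalP.wa → s₄.arr r = s.arr r := by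
    intro r h1 h2
    have e1 : s₄.arr r = s₃.arr r := rfl
    rw [e1, A₃.arr r h2, A₂.arr r h1]
    rfl
  have hX₄ : mat m s₄ = mat m s := mat_congr (arr₄ aX (by decide) (by decide))
  have hX₁ : mat m s₁ = mat m s := rfl
  have G₄ : s₄.reg rG0 = Gh v par T (a (l + 1)) (mat m s (a (l + 1))) := by
    rw [← hX₁, ← hev]; simp [hs₄, Prog.run, NExp.eval]
  have re₄ : s₄.reg re = a (l + 1) := by
    rw [← re₂, ← A₃.reg re (by decide)]; simp [hs₄, Prog.run]
  have x₄ : s₄.reg rx = l := by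
    have h1 := A₃.reg rx (by decide)
    have h2 := A₂.reg rx (by decide)
    have h3 : s₁.reg rx = l := by simp [hs₁, Prog.run, hx]
    rw [← h3, ← h2, ← h1]; simp [hs₄, Prog.run]
  have key := run_loop_inv v (x := ru) (p := rQ1) (c := affordP) (s := s₄)
    (fun i st => Affords (Gh v par T) par.tol (mat m s) a b (s.arr aS l) l (st.reg rMax) ∧
      ∀ u < i, Affords (Gh v par T) par.tol (mat m s) a b (s.arr aS l) l u → u ≤ st.reg rMax)
    ?_ ?_
  · have A₅ := run_agree v (.loop ru rQ1 affordP) s₄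
    have x₅ : ((Prog.loop ru rQ1 affordP).run v s₄).reg rx = l := (A₅.reg rx (by decide)).trans x₄
    have S₅ : ((Prog.loop ru rQ1 affordP).run v s₄).arr aS = s.arr aS :=
      (A₅.arr aS (by decide)).trans (arr₄ aS (by decide) (by decide))
    have erun : transferP.run v s = (Prog.setArr aS (.add (.reg rx) (.const 1)) (.reg rMax)).run v
      ((Prog.loop ru rQ1 affordP).run v s₄) := rfl
    rw [hc₄.Q1_eq] at key
    refine ⟨_, ?_, key.1, fun u hu => key.2 u ?_ hu⟩
    · rw [erun]
      simp only [Prog.run, NExp.eval, arr_setArr, if_true]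
      rw [← S₅, ← x₅]
      rfl
    · have := hcol.le hlt (b (l + 1))
      have := hu.1
      omega
  · have e : (s₄.setReg ru 0).reg rMax = 0 := by simp [hs₄, Prog.run, NExp.eval]
    rw [e]
    exact ⟨⟨Nat.zero_le _, (hmono _ hlt _ _ (le_shift_zero _ _ _ _ hne)).trans
      (Nat.le_add_right _ _)⟩, fun u hu => absurd hu (Nat.not_lt_zero _)⟩
  · intro i hi st hst hA ⟨hI1, hI2⟩
    have hcst := hc₄.agree hA (by decide)
    have hX : mat m st = mat m s := by
      rw [mat_congr (hA.arr aX (by decide)), hX₄]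
    have hS : st.arr aS = s.arr aS :=
      (hA.arr aS (by decide)).trans (arr₄ aS (by decide) (by decide))
    have hld : Loaded n a b st := hl.congr
      ((hA.arr aC (by decide)).trans (arr₄ aC (by decide) (by decide)))
      ((hA.arr aCI (by decide)).trans (arr₄ aCI (by decide) (by decide)))
    have hsp := affordP_spec v hcst hld hl' ((hA.reg rx (by decide)).trans x₄)
      ((hA.reg re (by decide)).trans re₄) hne
      (by rw [hX]; exact (hA.reg rG0 (by decide)).trans G₄)
    rw [hX, hS, hst] at hsp
    have e : ((affordP.run v st).setReg ru (i + 1)).reg rMax = (affordP.run v st).reg rMax := by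
      simp
    rw [e]
    rcases hsp with ⟨h1, h2⟩ | ⟨h1, h2⟩
    · rw [h2]
      exact ⟨h1, fun u hu _ => by omega⟩
    · rw [h2]
      refine ⟨hI1, fun u hu hu' => ?_⟩
      rcases Nat.lt_succ_iff_lt_or_eq.mp hu with h | rfl
      exacts [hI2 u h hu', absurd hu' h1]

theorem chainP_spec (hc : Ctx n m par T s) (hl : Loaded n a b s)
    (hne : ∀ l, b l ≠ b (l + 1)) (hlt : ∀ l, a l < n) (hcol : ColSum n par.Q (mat m s))
    (hmono : ∀ i < n, ∀ y y' : Fin m → ℕ, y ≤ y' → Gh v par T i y ≤ Gh v par T i y') :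
    Chain (Gh v par T) par.tol (mat m s) a b (2 * n) ((chainP.run v s).arr aS) := by
  set s₁ := (Prog.setArr aS (.const 0) (entry (.arr aC (.const 0)) (.arr aCI (.const 0)))).run v s
    with hs₁
  have hc₁ : Ctx n m par T s₁ := hc.run v (by decide)
  have hX₁ : mat m s₁ = mat m s := rfl
  have hl₁ : Loaded n a b s₁ := hl.congr rfl rfl
  have key := run_loop_inv v (x := rx) (p := rK) (c := transferP) (s := s₁)
    (fun i st => Chain (Gh v par T) par.tol (mat m s) a b i (st.arr aS)) ?_ ?_
  · rw [hc₁.K_eq] at key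
    exact key
  · refine ⟨?_, fun l hl => absurd hl (Nat.not_lt_zero _), fun l hl => absurd hl (Nat.not_lt_zero _)⟩
    have e1 : (NExp.arr aC (.const 0)).eval s = a 0 := by simp [NExp.eval, hl.agent 0]
    have e2 : (NExp.arr aCI (.const 0)).eval s = b 0 := by simp [NExp.eval, hl.item 0]
    simp [hs₁, Prog.run, NExp.eval, entry_eval hc e1 e2]
  · intro l hlK st hst hA hI
    rw [hc₁.K_eq] at hlK
    have hcst := hc₁.agree hA (by decide)
    have hX : mat m st = mat m s := by
      rw [mat_congr (hA.arr aX (by decide)), hX₁]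
    have hld : Loaded n a b st := hl₁.congr (hA.arr aC (by decide)) (hA.arr aCI (by decide))
    obtain ⟨w, h1, h2, h3⟩ := transferP_spec v hcst hld (by omega) hst (hne l) (hlt _)
      (by rw [hX]; exact hcol) hmono
    rw [hX] at h2 h3
    rw [arr_setReg, h1]
    refine ⟨?_, fun k hk => ?_, fun k hk => ?_⟩
    · rw [Function.update_of_ne (by omega)]; exact hI.zero
    · rcases Nat.lt_succ_iff_lt_or_eq.mp hk with h | rfl
      · rw [Function.update_of_ne (by omega), Function.update_of_ne (by omega)]
        exact hI.affords k h
      · rw [Function.update_of_ne (by omega), Function.update_self]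
        exact h2
    · rcases Nat.lt_succ_iff_lt_or_eq.mp hk with h | rfl
      · rw [Function.update_of_ne (by omega), Function.update_of_ne (by omega)]
        exact hI.max k h
      · rw [Function.update_of_ne (by omega), Function.update_self]
        exact h3

theorem findP_spec (hc : Ctx n m par T s) (hl : Loaded n a b s) (hL : s.reg rPer ≤ n) :
    ((findP.run v s).reg rFull < s.reg rPer ∧
      s.arr aS ((findP.run v s).reg rFull) =
        mat m s (a ((findP.run v s).reg rFull)) (b ((findP.run v s).reg rFull)) ∧
      s.arr aS ((findP.run v s).reg rFull + s.reg rPer) =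
        mat m s (a ((findP.run v s).reg rFull)) (b ((findP.run v s).reg rFull))) ∨
    ((findP.run v s).reg rFull = s.reg rPer ∧ ¬ ∃ p < s.reg rPer,
      s.arr aS p = mat m s (a p) (b p) ∧ s.arr aS (p + s.reg rPer) = mat m s (a p) (b p)) := by
  set s₁ := (Prog.setReg rFull (.reg rPer)).run v s with hs₁
  have hc₁ : Ctx n m par T s₁ := hc.run v (by decide)
  set bt : BTest := .and (.lt (.reg rx) (.reg rPer))
    (.and (.eq (.arr aS (.reg rx)) (entry (.arr aC (.reg rx)) (.arr aCI (.reg rx))))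
      (.eq (.arr aS (.add (.reg rx) (.reg rPer)))
        (entry (.arr aC (.reg rx)) (.arr aCI (.reg rx))))) with hbt
  have per₁ : s₁.reg rPer = s.reg rPer := by simp [hs₁, Prog.run]
  have k := searchP_spec v (s := s₁) (x := rx) (y := rFull) (p := rn) (b := bt) (by decide)
    (fun p => p < s.reg rPer ∧ s.arr aS p = mat m s (a p) (b p) ∧
      s.arr aS (p + s.reg rPer) = mat m s (a p) (b p)) (by
      intro p hp st hst hA
      rw [hc₁.n_eq] at hp
      have hcst := hc₁.agree hA (by decide)
      have hX : mat m st = mat m s := mat_congr (hA.arr aX (by decide))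
      have hS : st.arr aS = s.arr aS := hA.arr aS (by decide)
      have hP : st.reg rPer = s.reg rPer := (hA.reg rPer (by decide)).trans per₁
      have hld : Loaded n a b st := hl.congr (hA.arr aC (by decide)) (hA.arr aCI (by decide))
      have e1 : (NExp.arr aC (.reg rx)).eval st = a p := by
        simp only [NExp.eval, hst]; exact hld.agent p (by omega)
      have e2 : (NExp.arr aCI (.reg rx)).eval st = b p := by
        simp only [NExp.eval, hst]; exact hld.item p (by omega)
      simp only [hbt, BTest.holds, eq_holds, lt_holds, entry_eval hcst e1 e2, hX]
      simp only [NExp.eval, hst, hP, hS])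
  have e : findP.run v s = (searchP rx rFull rn bt).run v s₁ := rfl
  rw [e]
  rw [hc₁.n_eq] at k
  rcases k with ⟨p, hp, h1, h2⟩ | ⟨h1, h2⟩
  · left; rw [h2]; exact h1
  · right
    refine ⟨by rw [h2]; simp [hs₁, Prog.run, NExp.eval], fun ⟨p, hp, hp'⟩ => ?_⟩
    exact h1 p (by omega) ⟨hp, hp'⟩

theorem applyP_spec (hc : Ctx n m par T s) (hl : Loaded n a b s) (hL : s.reg rPer ≤ n)
    (hp : s.reg rFull < s.reg rPer) (hne : ∀ l, b l ≠ b (l + 1)) :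
    mat m (applyP.run v s) =
      applyChain (mat m s) a b (s.arr aS) (s.reg rFull) (s.reg rPer) := by
  set c : Prog := .ite (.lt (.reg rx) (.reg rPer))
    (.setReg re (.arr aC (.add (.add (.reg rFull) (.reg rx)) (.const 1))) ;;
      .setArr aX (idx (.reg re) (.arr aCI (.add (.reg rFull) (.reg rx))))
        (.add (entry (.reg re) (.arr aCI (.add (.reg rFull) (.reg rx))))
          (.arr aS (.add (.reg rFull) (.reg rx)))) ;;
      .setArr aX (idx (.reg re) (.arr aCI (.add (.add (.reg rFull) (.reg rx)) (.const 1))))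
        (.sub (entry (.reg re) (.arr aCI (.add (.add (.reg rFull) (.reg rx)) (.const 1))))
          (.arr aS (.add (.add (.reg rFull) (.reg rx)) (.const 1))))) .skip with hcdef
  have key := run_loop_inv v (x := rx) (p := rn) (c := c) (s := s)
    (fun i st => mat m st = applyChain (mat m s) a b (s.arr aS) (s.reg rFull)
      (min i (s.reg rPer))) ?_ ?_
  · rw [hc.n_eq, min_eq_right hL] at key
    exact key
  · rw [Nat.zero_min]; rfl
  · intro i hi st hst hA hI
    rw [hc.n_eq] at hi
    have hcst := hc.agree hA (by decide)
    have hP : st.reg rPer = s.reg rPer := hA.reg rPer (by decide)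
    have hF : st.reg rFull = s.reg rFull := hA.reg rFull (by decide)
    have hS : st.arr aS = s.arr aS := hA.arr aS (by decide)
    have hld : Loaded n a b st := hl.congr (hA.arr aC (by decide)) (hA.arr aCI (by decide))
    have hbt : (BTest.lt (.reg rx) (.reg rPer)).holds st ↔ i < s.reg rPer := by
      rw [lt_holds]; simp only [NExp.eval, hst, hP]
    by_cases hiL : i < s.reg rPer
    · rw [hcdef, run_ite_pos v (hbt.mpr hiL)]
      rw [min_eq_left hiL.le] at hI
      rw [min_eq_left (by omega : i + 1 ≤ s.reg rPer), applyChain, ← hI]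
      set p := s.reg rFull
      have i0 := hld.item (p + i) (by omega)
      have i1 := hld.item (p + i + 1) (by omega)
      have a1 := hld.agent (p + i + 1) (by omega)
      have hne' : b (p + i + 1) ≠ b (p + i) := (hne _).symm
      set st₁ := (Prog.setReg re (.arr aC (.add (.add (.reg rFull) (.reg rx)) (.const 1)))).run v st
        with hst₁
      have hc₁ : Ctx n m par T st₁ := hcst.run v (by decide)
      have re₁ : st₁.reg re = a (p + i + 1) := by
        simp [hst₁, Prog.run, NExp.eval, hF, hst, a1]
      have F₁ : st₁.reg rFull = p := by simp [hst₁, Prog.run, hF]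
      have x₁ : st₁.reg rx = i := by simp [hst₁, Prog.run, hst]
      have f1 : (NExp.arr aCI (.add (.reg rFull) (.reg rx))).eval st₁ = b (p + i) := by
        simp only [NExp.eval, F₁, x₁]; exact i0
      have f2 : (NExp.arr aS (.add (.reg rFull) (.reg rx))).eval st₁ = s.arr aS (p + i) := by
        simp only [NExp.eval, F₁, x₁, ← hS]; rfl
      set st₂ := (Prog.setArr aX (idx (.reg re) (.arr aCI (.add (.reg rFull) (.reg rx))))
        (.add (entry (.reg re) (.arr aCI (.add (.reg rFull) (.reg rx))))
          (.arr aS (.add (.reg rFull) (.reg rx))))).run v st₁ with hst₂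
      have hc₂ : Ctx n m par T st₂ := hc₁.run v (by decide)
      have hm₂ : mat m st₂ = Function.update (mat m st) (a (p + i + 1))
          (Function.update (mat m st (a (p + i + 1))) (b (p + i))
            (mat m st (a (p + i + 1)) (b (p + i)) + s.arr aS (p + i))) := by
        have e3 := entry_eval hc₁ (e := .reg re) re₁ f1
        have : st₂ = st₁.setArr aX (a (p + i + 1) * m + b (p + i))
            (mat m st₁ (a (p + i + 1)) (b (p + i)) + s.arr aS (p + i)) := by
          simp only [hst₂, Prog.run]
          rw [NExp.eval, e3, f2, idx_eval hc₁ (e := .reg re) re₁ f1]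
        rw [this, mat_setArr]
        rfl
      have re₂ : st₂.reg re = a (p + i + 1) := re₁
      have f3 : (NExp.arr aCI (.add (.add (.reg rFull) (.reg rx)) (.const 1))).eval st₂ =
          b (p + i + 1) := by
        have : st₂.arr aCI = st.arr aCI := by simp [hst₂, hst₁, Prog.run]
        have h1 : st₂.reg rFull = p := F₁
        have h2 : st₂.reg rx = i := x₁
        simp only [NExp.eval, this, h1, h2]; exact i1
      have f4 : (NExp.arr aS (.add (.add (.reg rFull) (.reg rx)) (.const 1))).eval st₂ =
          s.arr aS (p + i + 1) := by
        have : st₂.arr aS = s.arr aS := by rw [← hS]; simp [hst₂, hst₁, Prog.run]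
        have h1 : st₂.reg rFull = p := F₁
        have h2 : st₂.reg rx = i := x₁
        simp only [NExp.eval, this, h1, h2]
      have e3 := entry_eval hc₂ (e := .reg re) re₂ f3
      have : (Prog.run v (.setArr aX (idx (.reg re) (.arr aCI (.add (.add (.reg rFull) (.reg rx))
          (.const 1)))) (.sub (entry (.reg re) (.arr aCI (.add (.add (.reg rFull) (.reg rx))
          (.const 1)))) (.arr aS (.add (.add (.reg rFull) (.reg rx)) (.const 1))))) st₂) =
          st₂.setArr aX (a (p + i + 1) * m + b (p + i + 1))
            (mat m st₂ (a (p + i + 1)) (b (p + i + 1)) - s.arr aS (p + i + 1)) := by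
        simp only [Prog.run]
        rw [NExp.eval, e3, f4, idx_eval hc₂ (e := .reg re) re₂ f3]
      change mat m ((Prog.run v (.setArr aX (idx (.reg re) (.arr aCI (.add (.add (.reg rFull)
          (.reg rx)) (.const 1)))) (.sub (entry (.reg re) (.arr aCI (.add (.add (.reg rFull)
          (.reg rx)) (.const 1)))) (.arr aS (.add (.add (.reg rFull) (.reg rx))
          (.const 1))))) st₂)) = _
      rw [this, mat_setArr, hm₂, Function.update_idem, Function.update_self, shift,
        Function.update_of_ne hne']
    · rw [hcdef, run_ite_neg v (by rw [hbt]; exact hiL)]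
      rw [min_eq_right (by omega)] at hI ⊢
      exact hI

variable {g : ℕ → Finset (Fin m) → ℝ} {W δ e d : ℝ}

/-- In one direction the walk does not lose value, and there transfers are found. If they are found in
the first direction, it does not matter which one this is. -/
theorem turnP_spec (ha : Approx n m par.Q g (Gh v par T) W δ) (hδ : 0 ≤ δ)
    (hd : par.tol / W + 2 * δ ≤ d) (htol : W * (2 * δ + 1 / par.Q) ≤ par.tol)
    (hc : Ctx n m par T s) (hcol : ColSum n par.Q (mat m s)) (j₀ : Fin m)
    (hw : Walk n (mat m s) (s.reg rPer) (fun l => s.arr aW (s.reg rLo + l))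
      (fun l => toItem j₀ (s.arr aWI (s.reg rLo + l + 1))))
    (hhi : s.reg rHi = s.reg rLo + s.reg rPer) (hhin : s.reg rHi ≤ n)
    (hI : ∀ l < s.reg rPer, s.arr aWI (s.reg rLo + l + 1) < m) :
    RoundStep n par.Q g e d (mat m s) (mat m (turnP.run v s)) := by
  have hL := hw.L_pos
  have hn : 0 < n := by omega
  have hLn : s.reg rPer ≤ n := by omega
  -- one direction
  have dir : ∀ (st : State) (a : ℕ → ℕ) (b : ℕ → Fin m), Ctx n m par T st → mat m st = mat m s →
      st.reg rPer = s.reg rPer → Loaded n a b st → Cyc n (mat m s) (s.reg rPer) a b →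
      let st' := findP.run v (chainP.run v st)
      Agree (chainP ;; findP) st st' ∧
      ((st'.reg rFull < st'.reg rPer ∧ RoundStep n par.Q g e d (mat m s) (mat m (applyP.run v st'))) ∨
      (¬ st'.reg rFull < st'.reg rPer ∧
        ¬ ∏ l ∈ Finset.range (s.reg rPer), give par.Q g (mat m s) a b l ≤
          ∏ l ∈ Finset.range (s.reg rPer), recv par.Q g (mat m s) a b l)) := by
    intro st a b hcst hX hP hld hcyc st'
    have hA : Agree (chainP ;; findP) st st' := run_agree v (chainP ;; findP) st
    refine ⟨hA, ?_⟩
    have hS := chainP_spec v hcst hld hcyc.b_ne hcyc.a_lt (by rw [hX]; exact hcol) ha.mono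
    rw [hX] at hS
    have A₁ := run_agree v chainP st
    have hc₁ : Ctx n m par T _ := hcst.agree A₁ (by decide)
    set st₁ := chainP.run v st with hst₁
    have hX₁ : mat m st₁ = mat m s := (mat_congr (A₁.arr aX (by decide))).trans hX
    have hP₁ : st₁.reg rPer = s.reg rPer := (A₁.reg rPer (by decide)).trans hP
    have hld₁ : Loaded n a b st₁ := hld.congr (A₁.arr aC (by decide)) (A₁.arr aCI (by decide))
    have hf := findP_spec v hc₁ hld₁ (by rw [hP₁]; exact hLn)
    have A₂ := run_agree v findP st₁
    have hc₂ : Ctx n m par T _ := hc₁.agree A₂ (by decide)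
    rw [hX₁, hP₁] at hf
    have hP₂ : st'.reg rPer = s.reg rPer := (A₂.reg rPer (by decide)).trans hP₁
    have hX₂ : mat m st' = mat m s := (mat_congr (A₂.arr aX (by decide))).trans hX₁
    have hld₂ : Loaded n a b st' := hld₁.congr (A₂.arr aC (by decide)) (A₂.arr aCI (by decide))
    have hS₂ : st'.arr aS = st₁.arr aS := A₂.arr aS (by decide)
    rw [hP₂]
    rcases hf with ⟨h1, h2, h3⟩ | ⟨h1, h2⟩
    · left
      refine ⟨h1, ?_⟩
      rw [applyP_spec v hc₂ hld₂ (by rw [hP₂]; exact hLn) (by rw [hP₂]; exact h1) hcyc.b_ne, hX₂,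
        hP₂, hS₂]
      exact applyChain_step ha hδ hd hcol hcyc hS h1 (by omega) h2 h3
    · right
      refine ⟨?_, fun hprod => h2 (hcyc.exists_full ha htol hcol hS (by omega) hprod)⟩
      have : st'.reg rFull = s.reg rPer := h1
      omega
  have hld₁ := forwardP_spec v hc j₀ hL hI
  have A₁ := run_agree v forwardP s
  have hc₁ : Ctx n m par T _ := hc.agree A₁ (by decide)
  set s₁ := forwardP.run v s with hs₁
  obtain ⟨A₂, h₂⟩ := dir s₁ _ _ hc₁ (mat_congr (A₁.arr aX (by decide))) (A₁.reg rPer (by decide))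
    hld₁ hw.cyc
  set s₂ := findP.run v (chainP.run v s₁) with hs₂
  have hbt : ∀ st : State, (BTest.lt (.reg rFull) (.reg rPer)).holds st ↔
      st.reg rFull < st.reg rPer := fun st => Iff.rfl
  have erun : turnP.run v s = (Prog.ite (.lt (.reg rFull) (.reg rPer)) applyP
    (backwardP ;; chainP ;; findP ;; .ite (.lt (.reg rFull) (.reg rPer)) applyP .skip)).run v s₂ := rfl
  rw [erun]
  rcases h₂ with ⟨h1, h2⟩ | ⟨h1, h2⟩
  · rw [run_ite_pos v ((hbt _).mpr h1)]
    exact h2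
  · rw [run_ite_neg v (by rw [hbt]; exact h1)]
    have hprod := (hw.prod_le_or (Q := par.Q) (g := g)).resolve_left h2
    have hc₂ : Ctx n m par T s₂ := hc₁.agree A₂ (by decide)
    have q1 : s₂.reg rPer = s.reg rPer :=
      (A₂.reg rPer (by decide)).trans (A₁.reg rPer (by decide))
    have q2 : s₂.reg rLo = s.reg rLo := (A₂.reg rLo (by decide)).trans (A₁.reg rLo (by decide))
    have q3 : s₂.reg rHi = s.reg rHi := (A₂.reg rHi (by decide)).trans (A₁.reg rHi (by decide))
    have q4 : s₂.arr aW = s.arr aW := (A₂.arr aW (by decide)).trans (A₁.arr aW (by decide))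
    have q5 : s₂.arr aWI = s.arr aWI := (A₂.arr aWI (by decide)).trans (A₁.arr aWI (by decide))
    have q6 : mat m s₂ = mat m s :=
      (mat_congr (A₂.arr aX (by decide))).trans (mat_congr (A₁.arr aX (by decide)))
    have hld₃ := backwardP_spec v hc₂ j₀ (by rw [q1]; exact hL) (by rw [q1, q2, q3]; exact hhi)
      (by rw [q1, q2, q5]; exact hI)
    rw [q1, q2, q4, q5] at hld₃
    have A₃ := run_agree v backwardP s₂
    have hc₃ : Ctx n m par T _ := hc₂.agree A₃ (by decide)
    set s₃ := backwardP.run v s₂ with hs₃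
    obtain ⟨-, h₄⟩ := dir s₃ _ _ hc₃ ((mat_congr (A₃.arr aX (by decide))).trans q6)
      ((A₃.reg rPer (by decide)).trans q1) hld₃ hw.reverse.cyc
    set s₄ := findP.run v (chainP.run v s₃) with hs₄
    have erun' : (backwardP ;; chainP ;; findP ;; .ite (.lt (.reg rFull) (.reg rPer)) applyP
      .skip).run v s₂ = (Prog.ite (.lt (.reg rFull) (.reg rPer)) applyP .skip).run v s₄ := rfl
    rw [erun']
    rcases h₄ with ⟨h3, h4⟩ | ⟨h3, h4⟩
    · rw [run_ite_pos v ((hbt _).mpr h3)]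
      exact h4
    · exact absurd hprod h4

theorem roundP_spec (ha : Approx n m par.Q g (Gh v par T) W δ) (hδ : 0 ≤ δ)
    (hd : par.tol / W + 2 * δ ≤ d) (htol : W * (2 * δ + 1 / par.Q) ≤ par.tol)
    (he : ∀ i < n, ∀ j, g i {j} ≤ e)
    (hc : Ctx n m par T s) (hcol : ColSum n par.Q (mat m s)) :
    RoundStep n par.Q g e d (mat m s) (mat m (roundP.run v s)) := by
  have hd0 : 0 ≤ d := le_trans (by have := ha.W_pos; positivity) hd
  obtain ⟨h1, h2⟩ := scanP_spec v hc
  have A₁ := run_agree v scanP s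
  have hc₁ : Ctx n m par T _ := hc.agree A₁ (by decide)
  set s₁ := scanP.run v s with hs₁
  have hX₁ : mat m s₁ = mat m s := mat_congr (A₁.arr aX (by decide))
  rw [← hX₁] at h1 h2 hcol ⊢
  have erun : roundP.run v s = (Prog.ite (.lt (.reg rLeaf) (.reg rn)) leafP
    (.ite (.lt (.reg rStart) (.reg rn)) (walkP ;; closeP ;; turnP) .skip)).run v s₁ := rfl
  have hb1 : (BTest.lt (.reg rLeaf) (.reg rn)).holds s₁ ↔ s₁.reg rLeaf < n := by
    rw [lt_holds]; simp only [NExp.eval, hc₁.n_eq]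
  have hb2 : (BTest.lt (.reg rStart) (.reg rn)).holds s₁ ↔ s₁.reg rStart < n := by
    rw [lt_holds]; simp only [NExp.eval, hc₁.n_eq]
  rw [erun]
  rcases h1 with ⟨h1, hno⟩ | ⟨h1, j, hj, hf, honly⟩
  · rw [run_ite_neg v (by rw [hb1]; omega)]
    rcases h2 with ⟨h2, hnof⟩ | ⟨h2, hf⟩
    · rw [run_ite_neg v (by rw [hb2]; omega)]
      refine ⟨hcol, Or.inr ⟨rfl, hnof⟩, fun β hβ i hi => ?_⟩
      rcases hβ i hi with h3 | ⟨h3, h4⟩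
      · exact Or.inl (le_trans (by linarith) h3)
      · exact Or.inr ⟨h3, le_trans (by linarith) h4⟩
    · rw [run_ite_pos v (hb2.mpr h2), run_seq, run_seq]
      obtain ⟨j₀, -⟩ := id hf
      have ht := walkP_spec v hc₁ hcol hno h2 hf
      have A₂ := run_agree v walkP s₁
      have hc₂ : Ctx n m par T _ := hc₁.agree A₂ (by decide)
      set s₂ := walkP.run v s₁ with hs₂
      obtain ⟨k1, k2, k3, k4⟩ := closeP_spec v hc₂ j₀ ht
      have A₃ := run_agree v closeP s₂
      have hc₃ : Ctx n m par T _ := hc₂.agree A₃ (by decide)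
      set s₃ := closeP.run v s₂ with hs₃
      have hX₃ : mat m s₃ = mat m s₁ :=
        (mat_congr (A₃.arr aX (by decide))).trans (mat_congr (A₂.arr aX (by decide)))
      rw [← hX₃] at k1 hcol ⊢
      exact turnP_spec v ha hδ hd htol hc₃ hcol j₀ k1 k2 k3 k4
  · rw [run_ite_pos v (hb1.mpr h1)]
    obtain ⟨i', h3, h4, h5, h6⟩ := leafP_spec v hc₁ hcol hj hf
    rw [h6]
    exact leafMove_step ha.Q_pos ha.val hd0 he hcol h1 h3 h4 hf honly h5

end

/-! ### The candidate allocations -/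

/-- Read the allocation off from an integral assignment. Items without an owner go to agent `0`. -/
def finishP : Prog :=
  .loop rj rm (.setReg rOwner (.const 0) ;;
    searchP rh rOwner rn (.le (.const 1) (entry (.reg rh) (.reg rj))) ;;
    .setArr aA (.reg rj) (.reg rOwner))

/-- Mark in `aB` the items `rb` for which two expressions agree. -/
def markEqP (e f : NExp) : Prog :=
  .loop rb rm (.ite (.eq e f) (.setArr aB (.reg rb) (.const 1)) (.setArr aB (.reg rb) (.const 0)))

/-- Compute the smallest value that an agent has in the allocation `aA`. -/
def valueP : Prog :=
  .loop re rn (markEqP (.arr aA (.reg rb)) (.reg re) ;; .query lVal (.const 0) (.reg re) aB ;;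
    .ite (.and (.rle (rget lMin) (rget lVal)) (.le (.const 1) (.reg re))) .skip
      (rset lMin (rget lVal)))

/-- The allocation for the target value in `lT`. -/
def solveP : Prog := greedyP ;; .loop rStep rSteps roundP ;; finishP ;; valueP

/-- Keep the allocation `aA` in `aOut` if it is better. -/
def keepP : Prog :=
  .ite (.rle (rget lMin) (rget lBest)) .skip
    (rset lBest (rget lMin) ;; fillP rl rm aOut (.arr aA (.reg rl)))

/-- Try the target `(rNum + 1) / rU` times the value in `lBase`. -/
def candP : Prog :=
  rset lT (.divNat (.scale (.add (.reg rNum) (.const 1)) (rget lBase)) (.reg rU)) ;; solveP ;; keepP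

/-- Try multiples of the values of single items, for all agents. -/
def mainP : Prog :=
  .loop rAg rn (.loop rIt rm (markEqP (.reg rb) (.reg rIt) ;;
    .query lBase (.const 0) (.reg rAg) aB ;; .loop rNum rCand candP))

/-- Decode the thresholds from the random bits. -/
def decodeP : Prog :=
  .loop rs rNm (.setArr aTau (.reg rs) (.const 0) ;; .loop rb rq (.setArr aTau (.reg rs)
    (.add (.add (.arr aTau (.reg rs)) (.arr aTau (.reg rs)))
      (.arr aBits (.add (.mul (.reg rs) (.reg rq)) (.reg rb))))))

section

variable {n m : ℕ} {par : Par} {T : ℝ} {s s' : State} {P : Prog}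
variable (v : Fin n → Finset (Fin m) → ℝ)

/-- The allocation is defined for any assignment; an item goes to an agent that has a part of it. -/
theorem finishP_spec (hc : Ctx n m par T s) (hn : 0 < n) :
    ∃ A : Fin m → Fin n, (∀ j : Fin m, (finishP.run v s).arr aA j = A j) ∧
      ∀ j, (∃ i < n, 0 < mat m s i j) → 0 < mat m s (A j) j := by
  have key := run_loop_inv v (x := rj) (p := rm) (c := .setReg rOwner (.const 0) ;;
    searchP rh rOwner rn (.le (.const 1) (entry (.reg rh) (.reg rj))) ;;
    .setArr aA (.reg rj) (.reg rOwner)) (s := s)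
    (fun c st => ∀ j : Fin m, (j : ℕ) < c → st.arr aA j < n ∧
      ((∃ i < n, 0 < mat m s i j) → 0 < mat m s (st.arr aA j) j)) (by simp) ?_
  · rw [hc.m_eq] at key
    exact ⟨fun j => ⟨_, (key j j.2).1⟩, fun j => rfl, fun j => (key j j.2).2⟩
  · intro c hcm st hst hA hI
    rw [hc.m_eq] at hcm
    have hcst := hc.agree hA (by decide)
    set s₁ := (Prog.setReg rOwner (.const 0)).run v st with hs₁
    have hc₁ : Ctx n m par T s₁ := hcst.run v (by decide)
    have hj₁ : s₁.reg rj = c := by simp [hs₁, Prog.run, hst]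
    have hX₁ : s₁.arr aX = s.arr aX := hA.arr aX (by decide)
    have ha₁ : s₁.arr aA = st.arr aA := rfl
    set b : BTest := .le (.const 1) (entry (.reg rh) (.reg rj)) with hb
    have k := searchP_spec v (s := s₁) (x := rh) (y := rOwner) (p := rn) (b := b) (by decide)
      (fun i => 0 < mat m s i ⟨c, hcm⟩) (by
        intro i hi st' hst' hA'
        have hc' := hc₁.agree hA' (by decide)
        have hX : mat m st' = mat m s := mat_congr ((hA'.arr aX (by decide)).trans hX₁)
        have e1 : (NExp.reg rj).eval st' = ((⟨c, hcm⟩ : Fin m) : ℕ) :=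
          (hA'.reg rj (by decide)).trans hj₁
        simp only [hb, BTest.holds, entry_eval hc' (e := .reg rh) hst' e1, hX]
        simp only [NExp.eval]
        omega)
    have A₂ := run_agree v (searchP rh rOwner rn b) s₁
    set s₂ := (searchP rh rOwner rn b).run v s₁ with hs₂
    rw [hc₁.n_eq] at k
    have hj₂ : s₂.reg rj = c := (A₂.reg rj (by decide)).trans hj₁
    have ha₂ : s₂.arr aA = st.arr aA := (A₂.arr aA (by decide)).trans ha₁
    have hown₁ : s₁.reg rOwner = 0 := by simp [hs₁, Prog.run, NExp.eval]
    intro j hj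
    have e : (((Prog.setReg rOwner (.const 0) ;; searchP rh rOwner rn b ;;
        .setArr aA (.reg rj) (.reg rOwner)).run v st).setReg rj (c + 1)).arr aA =
        Function.update (st.arr aA) c (s₂.reg rOwner) := by
      rw [run_seq, run_seq, ← hs₁, ← hs₂]
      simp [Prog.run, NExp.eval, hj₂, ha₂]
    rw [e]
    rcases Nat.lt_succ_iff_lt_or_eq.mp hj with h | h
    · rw [Function.update_of_ne h.ne]
      exact hI j h
    · obtain rfl : j = ⟨c, hcm⟩ := Fin.ext h
      rw [Function.update_self]
      rcases k with ⟨i, hi, h1, h2⟩ | ⟨h1, h2⟩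
      · rw [h2]; exact ⟨hi, fun _ => h1⟩
      · rw [h2, hown₁]
        exact ⟨hn, fun ⟨i, hi, hpos⟩ => absurd hpos (h1 i hi)⟩

theorem markEqP_spec {e f : NExp} (hm : s.reg rm = m) (E F : ℕ → ℕ)
    (h : ∀ i < m, ∀ st : State, st.reg rb = i → Agree (markEqP e f) s st →
      e.eval st = E i ∧ f.eval st = F i) :
    ((markEqP e f).run v s).itemSet m aB = Finset.univ.filter fun j : Fin m => E j = F j := by
  have key := run_loop_inv v (x := rb) (p := rm) (c := .ite (.eq e f)
      (.setArr aB (.reg rb) (.const 1)) (.setArr aB (.reg rb) (.const 0))) (s := s)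
    (fun i st => ∀ j < i, st.arr aB j ≠ 0 ↔ E j = F j) (by simp) ?_
  · ext j
    have := key j (by rw [hm]; exact j.2)
    rw [State.itemSet, Finset.mem_filter, Finset.mem_filter]
    simp only [Finset.mem_univ, true_and]
    exact this
  · intro i hi st hst hA hI j hj
    obtain ⟨h1, h2⟩ := h i (hm ▸ hi) st hst hA
    have hb : (BTest.eq e f).holds st ↔ E i = F i := by rw [eq_holds, h1, h2]
    simp only [Prog.run, NExp.eval, hst]
    rcases Nat.lt_succ_iff_lt_or_eq.mp hj with hj' | rfl
    · have := hI j hj'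
      have hne : j ≠ i := hj'.ne
      split_ifs <;> simp [hne, this]
    · split_ifs with h' <;> rw [hb] at h' <;> simp [h']

theorem valueP_spec (hc : Ctx n m par T s) (hn : 0 < n) (A : Fin m → Fin n)
    (hA : ∀ j : Fin m, s.arr aA j = A j) : (valueP.run v s).real lMin 0 = minValue v A := by
  set d : Prog := .ite (.and (.rle (rget lMin) (rget lVal)) (.le (.const 1) (.reg re))) .skip
      (rset lMin (rget lVal)) with hd
  have key := run_loop_inv v (x := re) (p := rn) (c := markEqP (.arr aA (.reg rb)) (.reg re) ;;
      .query lVal (.const 0) (.reg re) aB ;; d) (s := s)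
    (fun c st => 0 < c → (∃ i : Fin n, (i : ℕ) < c ∧ st.real lMin 0 = v i (bundle A i)) ∧
      ∀ i : Fin n, (i : ℕ) < c → st.real lMin 0 ≤ v i (bundle A i)) (by simp) ?_
  · rw [hc.n_eq] at key
    obtain ⟨⟨i, -, h1⟩, h2⟩ := key hn
    have : Nonempty (Fin n) := ⟨⟨0, hn⟩⟩
    refine le_antisymm (le_ciInf fun i => h2 i i.2) ?_
    have e : (valueP.run v s).real lMin 0 = v i (bundle A i) := h1
    rw [e]
    exact ciInf_le (Set.finite_range _).bddBelow i
  · intro i hi st hst hAg hI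
    rw [hc.n_eq] at hi
    have hcst := hc.agree hAg (by decide)
    have ha : st.arr aA = s.arr aA := hAg.arr aA (by decide)
    have k := markEqP_spec v (s := st) (e := .arr aA (.reg rb)) (f := .reg re) hcst.m_eq
      (fun j => s.arr aA j) (fun _ => i) (by
        intro j hj st' hst' hA'
        simp only [NExp.eval, hst', hA'.arr aA (by decide), hA'.reg re (by decide), ha, hst]
        exact ⟨trivial, trivial⟩)
    have A₁ := run_agree v (markEqP (.arr aA (.reg rb)) (.reg re)) st
    set s₁ := (markEqP (.arr aA (.reg rb)) (.reg re)).run v st with hs₁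
    have he₁ : s₁.reg re = i := (A₁.reg re (by decide)).trans hst
    have hset : s₁.itemSet m aB = bundle A ⟨i, hi⟩ := by
      rw [k, bundle]
      ext j
      simp only [Finset.mem_filter, Finset.mem_univ, true_and, hA, Fin.ext_iff]
    set s₂ := (Prog.query lVal (.const 0) (.reg re) aB).run v s₁ with hs₂
    have hval : s₂.real lVal 0 = v ⟨i, hi⟩ (bundle A ⟨i, hi⟩) := by
      simp [hs₂, Prog.run, NExp.eval, he₁, hset, oracle, hi]
    have hmin : s₂.real lMin 0 = st.real lMin 0 := by
      rw [← A₁.real lMin (by decide)]; simp [hs₂, Prog.run]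
    have he₂ : s₂.reg re = i := he₁
    have erun : (markEqP (.arr aA (.reg rb)) (.reg re) ;; .query lVal (.const 0) (.reg re) aB ;;
      d).run v st = d.run v s₂ := rfl
    have hbt : (BTest.and (.rle (rget lMin) (rget lVal)) (.le (.const 1) (.reg re))).holds s₂ ↔
        st.real lMin 0 ≤ v ⟨i, hi⟩ (bundle A ⟨i, hi⟩) ∧ 1 ≤ i := by
      simp only [BTest.holds, rget, RExp.eval, NExp.eval, hval, hmin, he₂]
    rw [erun]
    intro _
    by_cases hb : st.real lMin 0 ≤ v ⟨i, hi⟩ (bundle A ⟨i, hi⟩) ∧ 1 ≤ i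
    · rw [hd, run_ite_pos v (hbt.mpr hb)]
      have e : ((Prog.skip.run v s₂).setReg re (i + 1)).real lMin 0 = st.real lMin 0 := hmin
      rw [e]
      obtain ⟨⟨i₀, h1, h2⟩, h3⟩ := hI (by omega)
      refine ⟨⟨i₀, by omega, h2⟩, fun i' hi' => ?_⟩
      rcases Nat.lt_succ_iff_lt_or_eq.mp hi' with h | h
      · exact h3 i' h
      · obtain rfl : i' = ⟨i, hi⟩ := Fin.ext h
        exact hb.1
    · rw [hd, run_ite_neg v (by rw [hbt]; exact hb)]
      have e : (((rset lMin (rget lVal)).run v s₂).setReg re (i + 1)).real lMin 0 =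
          v ⟨i, hi⟩ (bundle A ⟨i, hi⟩) := by
        simp [Prog.run, rset, rget, RExp.eval, NExp.eval, hval]
      rw [e]
      refine ⟨⟨⟨i, hi⟩, by simp, rfl⟩, fun i' hi' => ?_⟩
      rcases Nat.lt_succ_iff_lt_or_eq.mp hi' with h | h
      · refine le_trans ?_ ((hI (by omega)).2 i' h)
        by_contra hcon
        push Not at hcon
        exact hb ⟨hcon.le, by omega⟩
      · obtain rfl : i' = ⟨i, hi⟩ := Fin.ext h
        exact le_rfl

/-- Whatever the estimates are, the result is an allocation with its true value. -/
theorem solveP_spec (hc : Ctx n m par T s) (hn : 0 < n) :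
    ∃ A : Fin m → Fin n, (∀ j : Fin m, (solveP.run v s).arr aA j = A j) ∧
      (solveP.run v s).real lMin 0 = minValue v A := by
  have hc₁ := (hc.run v (P := greedyP) (by decide)).run v (P := .loop rStep rSteps roundP)
    (by decide)
  obtain ⟨A, hA, -⟩ := finishP_spec v hc₁ hn
  have hc₂ := hc₁.run v (P := finishP) (by decide)
  have A₃ := run_agree v valueP (finishP.run v ((Prog.loop rStep rSteps roundP).run v
    (greedyP.run v s)))
  refine ⟨A, fun j => ?_, valueP_spec v hc₂ hn A hA⟩
  rw [← hA]
  exact congrFun (A₃.arr aA (by decide)) j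

variable {g : ℕ → Finset (Fin m) → ℝ} {W δ e d : ℝ}

/-- The value of the allocation that is computed for the target `T`, if the estimates are accurate and
the greedy phase reaches the level `b`. -/
theorem solveP_value (hc : Ctx n m par T s) (hn : 0 < n) (hT : 0 < T)
    (hg : ∀ i : Fin n, ∀ S, g i S ≤ v i S / T)
    (ha : Approx n m par.Q g (Gh v par T) W δ) (hδ : 0 ≤ δ)
    (hd : par.tol / W + 2 * δ ≤ d) (htol : W * (2 * δ + 1 / par.Q) ≤ par.tol)
    (he : ∀ i < n, ∀ j, g i {j} ≤ e) (he0 : 0 ≤ e) (hsteps : n * m ≤ s.reg rSteps) {b : ℝ}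
    (hb : ∀ x, RoundsDone n (Gh v par T) par.rho par.Q x → ∀ i < n, b ≤ mext par.Q (g i) (x i)) :
    T * (b - s.reg rSteps * d - e) ≤ (solveP.run v s).real lMin 0 := by
  have hr := greedyP_spec v hc hn
  have hc₁ := hc.run v (P := greedyP) (by decide)
  have hst₁ : (greedyP.run v s).reg rSteps = s.reg rSteps :=
    (run_agree v greedyP s).reg rSteps (by decide)
  set s₁ := greedyP.run v s with hs₁
  have hrow : ∀ i < n, rows n m s₁ i = mat m s₁ i := fun i hi => by simp [rows, hi]
  have hcol : ColSum n par.Q (mat m s₁) := by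
    intro j
    rw [← hr.props.2 j]
    exact Finset.sum_congr rfl fun i hi => by rw [hrow i (Finset.mem_range.mp hi)]
  have hb₁ : ∀ i < n, b ≤ mext par.Q (g i) (mat m s₁ i) := fun i hi => by
    rw [← hrow i hi]; exact hb _ hr i hi
  have hsd := run_loop_inv v (x := rStep) (p := rSteps) (c := roundP) (s := s₁)
    (fun t st => StepsDone n par.Q g e d t (mat m s₁) (mat m st)) rfl (by
      intro t ht st hst hA hI
      exact ⟨_, hI, roundP_spec v ha hδ hd htol he (hc₁.agree hA (by decide)) (hI.final hcol).1⟩)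
  have hc₂ := hc₁.run v (P := .loop rStep rSteps roundP) (by decide)
  set s₂ := (Prog.loop rStep rSteps roundP).run v s₁ with hs₂
  rw [hst₁] at hsd
  obtain ⟨k1, k2, k3⟩ := hsd.integral hcol hsteps he0 hb₁
  obtain ⟨A, hA, hown⟩ := finishP_spec v hc₂ hn
  have hc₃ := hc₂.run v (P := finishP) (by decide)
  have hv := valueP_spec v hc₃ hn A hA
  have erun : (solveP.run v s).real lMin 0 = minValue v A := hv
  rw [erun]
  have : Nonempty (Fin n) := ⟨⟨0, hn⟩⟩
  refine le_ciInf fun i => ?_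
  have h1 := k3 i i.2
  rw [mext_integral ha.Q_pos (k2 i i.2)] at h1
  have h2 : (Finset.univ.filter fun j : Fin m => 0 < mat m s₂ i j) ⊆ bundle A i := by
    intro j hj
    simp only [Finset.mem_filter, Finset.mem_univ, true_and] at hj
    simp only [bundle, Finset.mem_filter, Finset.mem_univ, true_and]
    by_contra hne
    have h3 := hown j ⟨i, i.2, hj⟩
    have h4 := k1.add_le (A j).2 i.2 (fun h => hne (Fin.ext h)) j
    have h5 := (k2 (A j) (A j).2 j).resolve_left h3.ne'
    omega
  have h3 := (h1.trans ((ha.val i i.2).mono _ _ h2)).trans (hg i _)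
  rwa [le_div_iff₀ hT, mul_comm] at h3

/-- The allocation in `aOut` is at least as good as the value in `lBest`. -/
def Kept (s : State) : Prop :=
  ∃ A : Fin m → Fin n, (∀ j : Fin m, s.arr aOut j = A j) ∧ s.real lBest 0 ≤ minValue v A

theorem keepP_spec (hc : Ctx n m par T s) (hk : Kept v s) (A : Fin m → Fin n)
    (hA : ∀ j : Fin m, s.arr aA j = A j) (hv : s.real lMin 0 = minValue v A) :
    Kept v (keepP.run v s) ∧ s.real lBest 0 ≤ (keepP.run v s).real lBest 0 ∧
      s.real lMin 0 ≤ (keepP.run v s).real lBest 0 := by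
  have hbt : (BTest.rle (rget lMin) (rget lBest)).holds s ↔ s.real lMin 0 ≤ s.real lBest 0 := by
    simp only [BTest.holds, rget, RExp.eval, NExp.eval]
  by_cases h : s.real lMin 0 ≤ s.real lBest 0
  · rw [keepP, run_ite_pos v (hbt.mpr h)]
    exact ⟨hk, le_rfl, h⟩
  · rw [keepP, run_ite_neg v (by rw [hbt]; exact h), run_seq]
    set s₁ := (rset lBest (rget lMin)).run v s with hs₁
    have hb₁ : s₁.real lBest 0 = s.real lMin 0 := by
      simp [hs₁, Prog.run, rset, rget, RExp.eval, NExp.eval]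
    have hc₁ : Ctx n m par T s₁ := hc.run v (by decide)
    have k := fillP_spec v (s := s₁) (x := rl) (p := rm) (a := aOut) (e := .arr aA (.reg rl))
      (fun j => s.arr aA j) (by
        intro i hi st hst hAg
        simp only [NExp.eval, hst, hAg.arr aA (by decide)]
        rfl)
    have A₂ := run_agree v (fillP rl rm aOut (.arr aA (.reg rl))) s₁
    rw [A₂.real lBest (by decide), hb₁]
    rw [hc₁.m_eq] at k
    refine ⟨⟨A, fun j => (k j j.2).trans (hA j), ?_⟩, (not_le.mp h).le, le_rfl⟩
    rw [A₂.real lBest (by decide), hb₁, hv]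

theorem candP_spec (hc : Ctx n m par T s) (hn : 0 < n) (hk : Kept v s) {T' : ℝ}
    (hT' : T' = ((s.reg rNum + 1 : ℕ) : ℝ) * s.real lBase 0 / s.reg rU) :
    Kept v (candP.run v s) ∧ s.real lBest 0 ≤ (candP.run v s).real lBest 0 ∧
      ∃ s₁, Ctx n m par T' s₁ ∧ s₁.reg rSteps = s.reg rSteps ∧
        (solveP.run v s₁).real lMin 0 ≤ (candP.run v s).real lBest 0 := by
  set s₁ := (rset lT (.divNat (.scale (.add (.reg rNum) (.const 1)) (rget lBase)) (.reg rU))).run v s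
    with hs₁
  have hT₁ : s₁.real lT 0 = T' := by
    rw [hT']
    simp [hs₁, Prog.run, rset, rget, RExp.eval, NExp.eval]
  have hc₁ : Ctx n m par T' s₁ :=
    ⟨hc.n_eq, hc.m_eq, hc.Q_eq, hc.N_eq, hc.M_eq, hc.D_eq, hc.tol_eq, hc.Q1_eq, hc.n1_eq,
      hc.n2_eq, hc.K_eq, hc.tau_eq, hT₁⟩
  obtain ⟨A, hA, hv⟩ := solveP_spec v hc₁ hn
  have A₂ := run_agree v solveP s₁
  have hc₂ := hc₁.run v (P := solveP) (by decide)
  have hb₁ : s₁.real lBest 0 = s.real lBest 0 := by simp [hs₁, Prog.run, rset]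
  have hb₂ : (solveP.run v s₁).real lBest 0 = s.real lBest 0 := by
    rw [A₂.real lBest (by decide), hb₁]
  have hk₂ : Kept v (solveP.run v s₁) := by
    obtain ⟨B, hB, hB'⟩ := hk
    refine ⟨B, fun j => ?_, by rw [hb₂]; exact hB'⟩
    rw [A₂.arr aOut (by decide)]
    exact hB j
  obtain ⟨k1, k2, k3⟩ := keepP_spec v hc₂ hk₂ A hA hv
  rw [hb₂] at k2
  exact ⟨k1, k2, s₁, hc₁, rfl, k3⟩

/-- The output is an allocation that is at least as good as all candidates. -/
theorem mainP_spec (hc : Ctx n m par T s) (hn : 0 < n) (hk : Kept v s) :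
    Kept v (mainP.run v s) ∧ ∀ (i : Fin n) (j : Fin m), ∀ c < s.reg rCand,
      ∃ s₁, Ctx n m par (((c + 1 : ℕ) : ℝ) * v i {j} / s.reg rU) s₁ ∧ s₁.reg rSteps = s.reg rSteps ∧
        (solveP.run v s₁).real lMin 0 ≤ (mainP.run v s).real lBest 0 := by
  -- the candidates found so far
  let F : ℝ → ℝ → ℕ → State → Prop := fun V U c st => ∀ c' < c, ∃ s₁,
    Ctx n m par (((c' + 1 : ℕ) : ℝ) * V / U) s₁ ∧ s₁.reg rSteps = s.reg rSteps ∧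
      (solveP.run v s₁).real lMin 0 ≤ st.real lBest 0
  have Fmono : ∀ V U c st st', st.real lBest 0 ≤ st'.real lBest 0 → F V U c st → F V U c st' := by
    intro V U c st st' h hF c' hc'
    obtain ⟨s₁, h1, h2, h3⟩ := hF c' hc'
    exact ⟨s₁, h1, h2, h3.trans h⟩
  -- all parameters except for the target
  have ctx : ∀ {P : Prog} {st st' : State} {T' : ℝ}, Ctx n m par T' st → Agree P st st' →
      P.safe = true ∨ (∀ r ∈ [rn, rm, rQ, rN, rM, rD, rTol, rQ1, rn1, rn2, rK], r ∉ P.wr) ∧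
        aTau ∉ P.wa → Ctx n m par (st'.real lT 0) st' := by
    intro P st st' T' h hA hP
    rcases hP with hP | ⟨hP, hP'⟩
    · have := h.agree hA hP
      rw [this.T_eq]; exact this
    · exact ⟨(hA.reg _ (hP _ (by simp))).trans h.n_eq, (hA.reg _ (hP _ (by simp))).trans h.m_eq,
        (hA.reg _ (hP _ (by simp))).trans h.Q_eq, (hA.reg _ (hP _ (by simp))).trans h.N_eq,
        (hA.reg _ (hP _ (by simp))).trans h.M_eq, (hA.reg _ (hP _ (by simp))).trans h.D_eq,
        (hA.reg _ (hP _ (by simp))).trans h.tol_eq, (hA.reg _ (hP _ (by simp))).trans h.Q1_eq,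
        (hA.reg _ (hP _ (by simp))).trans h.n1_eq, (hA.reg _ (hP _ (by simp))).trans h.n2_eq,
        (hA.reg _ (hP _ (by simp))).trans h.K_eq, (hA.arr _ hP').trans h.tau_eq, rfl⟩
  have key := run_loop_inv v (x := rAg) (p := rn) (c := .loop rIt rm (markEqP (.reg rb) (.reg rIt) ;;
      .query lBase (.const 0) (.reg rAg) aB ;; .loop rNum rCand candP)) (s := s)
    (fun a st => Kept v st ∧ ∀ i : Fin n, (i : ℕ) < a → ∀ j,
      F (v i {j}) (s.reg rU) (s.reg rCand) st) ⟨hk, by simp⟩ ?_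
  · rw [hc.n_eq] at key
    exact ⟨key.1, fun i j c hc' => key.2 i i.2 j c hc'⟩
  intro a ha st hst hA ⟨hI1, hI2⟩
  rw [hc.n_eq] at ha
  have hcst := ctx hc hA (Or.inr (by decide))
  have key' := run_loop_inv v (x := rIt) (p := rm) (c := markEqP (.reg rb) (.reg rIt) ;;
      .query lBase (.const 0) (.reg rAg) aB ;; .loop rNum rCand candP) (s := st)
    (fun c st' => Kept v st' ∧ st.real lBest 0 ≤ st'.real lBest 0 ∧ ∀ j : Fin m, (j : ℕ) < c →
      F (v ⟨a, ha⟩ {j}) (s.reg rU) (s.reg rCand) st') ⟨hI1, le_rfl, by simp⟩ ?_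
  · rw [hcst.m_eq] at key'
    obtain ⟨h1, h2, h3⟩ := key'
    refine ⟨h1, fun i hi j => ?_⟩
    rcases Nat.lt_succ_iff_lt_or_eq.mp hi with h | h
    · exact Fmono _ _ _ _ _ h2 (hI2 i h j)
    · obtain rfl : i = ⟨a, ha⟩ := Fin.ext h
      exact h3 j j.2
  intro c hcm st' hst' hA' ⟨hJ1, hJ2, hJ3⟩
  rw [hcst.m_eq] at hcm
  have hc' := ctx hcst hA' (Or.inr (by decide))
  have k := markEqP_spec v (s := st') (e := .reg rb) (f := .reg rIt) hc'.m_eq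
    (fun j => j) (fun _ => c) (by
      intro j hj st'' hst'' hA''
      simp only [NExp.eval, hst'', hA''.reg rIt (by decide), hst']
      exact ⟨trivial, trivial⟩)
  have A₁ := run_agree v (markEqP (.reg rb) (.reg rIt)) st'
  set s₁ := (markEqP (.reg rb) (.reg rIt)).run v st' with hs₁
  have hset : s₁.itemSet m aB = {⟨c, hcm⟩} := by
    rw [k]
    ext j
    simp only [Finset.mem_filter, Finset.mem_univ, true_and, Finset.mem_singleton, Fin.ext_iff]
  have hag₁ : s₁.reg rAg = a :=
    (A₁.reg rAg (by decide)).trans ((hA'.reg rAg (by decide)).trans hst)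
  set s₂ := (Prog.query lBase (.const 0) (.reg rAg) aB).run v s₁ with hs₂
  have hbase : s₂.real lBase 0 = v ⟨a, ha⟩ {⟨c, hcm⟩} := by
    simp [hs₂, Prog.run, NExp.eval, hag₁, hset, oracle, ha]
  have A₂ : Agree (markEqP (.reg rb) (.reg rIt) ;; .query lBase (.const 0) (.reg rAg) aB) st' s₂ :=
    run_agree v _ st'
  have hc₂ := ctx hc' A₂ (Or.inr (by decide))
  have hreg₂ : ∀ r ∈ [rU, rCand, rSteps], s₂.reg r = s.reg r := by
    intro r hr
    have a1 := A₂.reg r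
    have a2 := hA'.reg r
    have a3 := hA.reg r
    fin_cases hr <;>
    · exact (a1 (by decide)).trans ((a2 (by decide)).trans (a3 (by decide)))
  have hU₂ := hreg₂ rU (by simp)
  have hC₂ := hreg₂ rCand (by simp)
  have hS₂ := hreg₂ rSteps (by simp)
  have hb₂ : s₂.real lBest 0 = st'.real lBest 0 := by rw [A₂.real lBest (by decide)]
  have hk₂ : Kept v s₂ := by
    obtain ⟨B, hB, hB'⟩ := hJ1
    exact ⟨B, fun j => by rw [A₂.arr aOut (by decide)]; exact hB j, by rw [hb₂]; exact hB'⟩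
  have key'' := run_loop_inv v (x := rNum) (p := rCand) (c := candP) (s := s₂)
    (fun c' st'' => Kept v st'' ∧ st'.real lBest 0 ≤ st''.real lBest 0 ∧
      F (v ⟨a, ha⟩ {⟨c, hcm⟩}) (s.reg rU) c' st'') ⟨hk₂, hb₂.ge, fun c' hc' => by omega⟩ ?_
  · rw [hC₂] at key''
    obtain ⟨h1, h2, h3⟩ := key''
    refine ⟨h1, hJ2.trans h2, fun j hj => ?_⟩
    rcases Nat.lt_succ_iff_lt_or_eq.mp hj with h | h
    · exact Fmono _ _ _ _ _ h2 (hJ3 j h)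
    · obtain rfl : j = ⟨c, hcm⟩ := Fin.ext h
      exact h3
  intro c' hcc st'' hst'' hA'' ⟨hK1, hK2, hK3⟩
  have hc'' := ctx hc₂ hA'' (Or.inr (by decide))
  have hb'' : st''.real lBase 0 = v ⟨a, ha⟩ {⟨c, hcm⟩} := by
    rw [hA''.real lBase (by decide), hbase]
  have hU'' : st''.reg rU = s.reg rU := (hA''.reg rU (by decide)).trans hU₂
  have hS'' : st''.reg rSteps = s.reg rSteps := (hA''.reg rSteps (by decide)).trans hS₂
  obtain ⟨h1, h2, s₃, h3, h4, h5⟩ := candP_spec v hc'' hn hK1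
    (T' := ((c' + 1 : ℕ) : ℝ) * v ⟨a, ha⟩ {⟨c, hcm⟩} / s.reg rU) (by rw [hb'', hU'', hst''])
  refine ⟨h1, hK2.trans h2, fun c₀ hc₀ => ?_⟩
  rcases Nat.lt_succ_iff_lt_or_eq.mp hc₀ with h | rfl
  · obtain ⟨s₄, g1, g2, g3⟩ := hK3 c₀ h
    exact ⟨s₄, g1, g2, g3.trans h2⟩
  · exact ⟨s₃, h3, h4.trans hS'', h5⟩

theorem decodeP_spec : ∀ i < s.reg rNm,
    (decodeP.run v s).arr aTau i = dec (s.arr aBits) (i * s.reg rq) (s.reg rq) := by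
  refine run_loop_inv v (x := rs) (p := rNm) (c := .setArr aTau (.reg rs) (.const 0) ;; .loop rb rq
    (.setArr aTau (.reg rs) (.add (.add (.arr aTau (.reg rs)) (.arr aTau (.reg rs)))
      (.arr aBits (.add (.mul (.reg rs) (.reg rq)) (.reg rb)))))) (s := s)
    (fun i st => ∀ i' < i, st.arr aTau i' = dec (s.arr aBits) (i' * s.reg rq) (s.reg rq))
    (by simp) ?_
  intro i hi st hst hA hI
  set s₁ := (Prog.setArr aTau (.reg rs) (.const 0)).run v st with hs₁
  have hq₁ : s₁.reg rq = s.reg rq := hA.reg rq (by decide)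
  have hs₁' : s₁.reg rs = i := hst
  have key := run_loop_inv v (x := rb) (p := rq) (c := .setArr aTau (.reg rs)
    (.add (.add (.arr aTau (.reg rs)) (.arr aTau (.reg rs)))
      (.arr aBits (.add (.mul (.reg rs) (.reg rq)) (.reg rb))))) (s := s₁)
    (fun c st' => st'.arr aTau i = dec (s.arr aBits) (i * s.reg rq) c ∧
      ∀ i' < i, st'.arr aTau i' = dec (s.arr aBits) (i' * s.reg rq) (s.reg rq)) ?_ ?_
  · rw [hq₁] at key
    intro i' hi'
    rcases Nat.lt_succ_iff_lt_or_eq.mp hi' with h | rfl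
    exacts [key.2 i' h, key.1]
  · refine ⟨by simp [hs₁, Prog.run, NExp.eval, hst, dec], fun i' hi' => ?_⟩
    rw [← hI i' hi']
    simp [hs₁, Prog.run, NExp.eval, hst, hi'.ne]
  · intro c hcq st' hst' hA' ⟨h1, h2⟩
    have e1 : st'.reg rs = i := (hA'.reg rs (by decide)).trans hs₁'
    have e2 : st'.reg rq = s.reg rq := (hA'.reg rq (by decide)).trans hq₁
    have e3 : st'.arr aBits = s.arr aBits :=
      (hA'.arr aBits (by decide)).trans (hA.arr aBits (by decide))
    constructor
    · simp [Prog.run, NExp.eval, e1, e2, e3, hst', h1, dec]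
    · intro i' hi'
      rw [← h2 i' hi']
      simp [Prog.run, NExp.eval, e1, hi'.ne]

end

/-! ### The complete algorithm and its running time -/

/-- Assign values to registers, one after the other. -/
def setsCmd : List (ℕ × NExp) → Cmd
  | [] => .skip
  | (x, e) :: l => .seq (.setReg x e) (setsCmd l)

/-- The memory after `setsCmd`. -/
def setsState : List (ℕ × NExp) → State → State
  | [], s => s
  | (x, e) :: l, s => setsState l (s.setReg x (e.eval s))

/-- A power with fixed exponent. -/
def powE (e : NExp) : ℕ → NExp
  | 0 => .const 1
  | d + 1 => .mul (powE e d) e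

theorem powE_eval (e : NExp) (d : ℕ) (s : State) : (powE e d).eval s = e.eval s ^ d := by
  induction d with
  | zero => rfl
  | succ d ih => rw [powE, NExp.eval, ih, pow_succ]

/-- Straight-line assignments may multiply numbers, since there are boundedly many of them. -/
theorem setsCmd_exec (l : List (ℕ × NExp)) : ∃ E, ∀ {n m : ℕ} (v : Fin n → Finset (Fin m) → ℝ)
    (s : State) (S : ℕ), s.Bits S →
      (∃ t, Exec v (setsCmd l) s [] (setsState l s) t ∧ t ≤ E * (S + 1)) ∧
        (setsState l s).Bits (E * (S + 1)) := by
  induction l with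
  | nil =>
    exact ⟨1, fun v s S h => ⟨⟨1, Exec.skip s, by omega⟩, h.mono (by omega)⟩⟩
  | cons a l ih =>
    obtain ⟨x, e⟩ := a
    obtain ⟨E, hE⟩ := ih
    obtain ⟨F, hF⟩ := e.exists_bound
    refine ⟨E * (F + 2) + F + 2, fun {n m} v s S h => ?_⟩
    obtain ⟨h1, h2⟩ := hF s S h
    have h3 : (s.setReg x (e.eval s)).Bits ((F + 1) * (S + 1)) :=
      (h.mono (by nlinarith)).setReg (h1.trans (by nlinarith))
    obtain ⟨⟨t, ht, hle⟩, hb⟩ := hE v _ _ h3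
    have h4 : E * ((F + 1) * (S + 1) + 1) ≤ E * (F + 2) * (S + 1) := by
      rw [mul_assoc]
      gcongr
      nlinarith
    exact ⟨⟨_, Exec.seq (Exec.setReg s x e) ht, by nlinarith⟩, hb.mono (by nlinarith)⟩

/-- Compute the least power of two that is at least `rQ0`. -/
def doubleP : Prog :=
  .setReg rQ (.const 1) ;; .setReg rq (.const 0) ;;
    .loop rs rQ0 (.ite (.lt (.reg rQ) (.reg rQ0))
      (.setReg rQ (.add (.reg rQ) (.reg rQ)) ;; .setReg rq (.add (.reg rq) (.const 1))) .skip)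

theorem doubleP_spec {n m : ℕ} (v : Fin n → Finset (Fin m) → ℝ) (s : State) (h : 0 < s.reg rQ0) :
    (doubleP.run v s).reg rQ = 2 ^ (doubleP.run v s).reg rq ∧
      s.reg rQ0 ≤ (doubleP.run v s).reg rQ ∧ (doubleP.run v s).reg rQ < 2 * s.reg rQ0 := by
  set s₁ := (Prog.setReg rq (.const 0)).run v ((Prog.setReg rQ (.const 1)).run v s) with hs₁
  have hQ₁ : s₁.reg rQ0 = s.reg rQ0 := by simp [hs₁, Prog.run]
  have key := run_loop_inv v (x := rs) (p := rQ0) (c := .ite (.lt (.reg rQ) (.reg rQ0))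
      (.setReg rQ (.add (.reg rQ) (.reg rQ)) ;; .setReg rq (.add (.reg rq) (.const 1))) .skip)
    (s := s₁) (fun i st => st.reg rQ = 2 ^ st.reg rq ∧ st.reg rQ < 2 * s.reg rQ0 ∧
      (i < st.reg rQ ∨ s.reg rQ0 ≤ st.reg rQ)) ?_ ?_
  · rw [hQ₁] at key
    obtain ⟨h1, h2, h3⟩ := key
    exact ⟨h1, h3.elim le_of_lt id, h2⟩
  · have e1 : (s₁.setReg rs 0).reg rQ = 1 := by simp [hs₁, Prog.run, NExp.eval]
    have e2 : (s₁.setReg rs 0).reg rq = 0 := by simp [hs₁, Prog.run, NExp.eval]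
    rw [e1, e2]
    exact ⟨rfl, by omega, Or.inl one_pos⟩
  · intro i hi st hst hA ⟨h1, h2, h3⟩
    have hQ : st.reg rQ0 = s.reg rQ0 := (hA.reg rQ0 (by decide)).trans hQ₁
    have hbt : (BTest.lt (.reg rQ) (.reg rQ0)).holds st ↔ st.reg rQ < s.reg rQ0 := by
      rw [lt_holds]; simp only [NExp.eval, hQ]
    by_cases hb : st.reg rQ < s.reg rQ0
    · rw [run_ite_pos v (hbt.mpr hb)]
      simp only [Prog.run, NExp.eval, reg_setReg]
      norm_num
      rw [pow_succ]
      omega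
    · rw [run_ite_neg v (by rw [hbt]; exact hb)]
      have e : ∀ r, r ≠ rs → ((Prog.skip.run v st).setReg rs (i + 1)).reg r = st.reg r := by
        intro r hr; simp [Prog.run, hr]
      rw [e rQ (by decide), e rq (by decide)]
      exact ⟨h1, h2, Or.inr (by omega)⟩

/-- The body of `sampleCmd`. -/
def sampleLoop : Cmd :=
  .while (.natLe (.add (.reg re) (.const 1)) (.reg rLen))
    (.seq (.flip rg) (.seq (.setArr aBits (.reg re) (.reg rg))
      (.setReg re (.add (.reg re) (.const 1)))))

/-- Store `rLen` random bits in `aBits`. -/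
def sampleCmd : Cmd := .seq (.setReg re (.const 0)) sampleLoop

/-- The loop reads exactly the bits `l`, and leaves everything but `aBits` and two registers alone. -/
theorem sampleLoop_exec {n m : ℕ} (v : Fin n → Finset (Fin m) → ℝ) (l : List Bool) :
    ∀ (s : State) (S : ℕ), s.Bits S → s.reg rLen = s.reg re + l.length → 1 ≤ S →
      ∃ s' t, Exec v sampleLoop s l s' t ∧ t ≤ (l.length + 1) * (20 * (S + 1)) ∧ s'.Bits S ∧
        (∀ r, r ≠ re → r ≠ rg → s'.reg r = s.reg r) ∧ (∀ a, a ≠ aBits → s'.arr a = s.arr a) ∧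
        s'.real = s.real ∧ (∀ b < s.reg re, s'.arr aBits b = s.arr aBits b) ∧
        ∀ b (h : b < l.length), s'.arr aBits (s.reg re + b) = (l[b]).toNat := by
  have size1 : Nat.size 1 = 1 := by decide
  induction l with
  | nil =>
    intro s S hS hlen h1
    have c1 := hS.1 re
    have c2 := hS.1 rLen
    have c3 := size_add_le (s.reg re) 1 c1 (size1.le.trans h1)
    rw [max_self] at c3
    refine ⟨s, _, Exec.while_false ?_, ?_, hS, fun _ _ _ => rfl, fun _ _ => rfl, rfl,
      fun _ _ => rfl, by simp⟩
    · simp only [Test.holds, NExp.eval, hlen, List.length_nil]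
      omega
    · simp only [Test.cost, NExp.cost, NExp.eval, List.length_nil, size1]
      omega
  | cons x l ih =>
    intro s S hS hlen h1
    rw [List.length_cons] at hlen
    have c1 := hS.1 re
    have c2 := hS.1 rLen
    have hx : Nat.size x.toNat ≤ S := by
      refine (Nat.size_le_size (Bool.toNat_le x)).trans ?_
      rw [size1]; exact h1
    set s₁ := s.setReg rg x.toNat with hs₁
    set s₂ := s₁.setArr aBits (s.reg re) x.toNat with hs₂
    set s₃ := s₂.setReg re (s.reg re + 1) with hs₃
    have b₁ : s₁.Bits S := hS.setReg hx
    have b₂ : s₂.Bits S := b₁.setArr hx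
    have hsz : Nat.size (s.reg re + 1) ≤ S := (Nat.size_le_size (by omega)).trans c2
    have b₃ : s₃.Bits S := b₂.setReg hsz
    have re₁ : s₁.reg re = s.reg re := by simp [hs₁]
    have rg₁ : s₁.reg rg = x.toNat := by simp [hs₁]
    have re₂ : s₂.reg re = s.reg re := by simp [hs₂, re₁]
    have re₃ : s₃.reg re = s.reg re + 1 := by simp [hs₃]
    have len₃ : s₃.reg rLen = s.reg rLen := by simp [hs₃, hs₂, hs₁]
    obtain ⟨s', t, h2, h3, h4, h5, h6, h7, h8, h9⟩ := ih s₃ S b₃ (by rw [len₃, re₃]; omega) h1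
    have e1 := Exec.flip (v := v) s rg x
    have e2 : Exec v (.setArr aBits (.reg re) (.reg rg)) s₁ [] s₂
        ((NExp.reg re).cost s₁ + (NExp.reg rg).cost s₁ + 1) := by
      have := Exec.setArr (v := v) s₁ aBits (.reg re) (.reg rg)
      simpa only [NExp.eval, re₁, rg₁] using this
    have e3 : Exec v (.setReg re (.add (.reg re) (.const 1))) s₂ [] s₃
        ((NExp.add (.reg re) (.const 1)).cost s₂ + 1) := by
      have := Exec.setReg (v := v) s₂ re (.add (.reg re) (.const 1))
      simpa only [NExp.eval, re₂] using this
    have e4 := Exec.while_true (v := v) (b := .natLe (.add (.reg re) (.const 1)) (.reg rLen))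
      (by simp only [Test.holds, NExp.eval]; omega) (Exec.seq e1 (Exec.seq e2 e3)) h2
    refine ⟨s', _, e4, ?_, h4, fun r hr hr' => ?_, fun a ha => ?_, ?_, fun b hb => ?_,
      fun b hb => ?_⟩
    · simp only [Test.cost, NExp.cost, NExp.eval, re₁, re₂, rg₁, size1]
      rw [List.length_cons, Nat.succ_mul (l.length + 1)]
      omega
    · rw [h5 r hr hr']; simp [hs₃, hs₂, hs₁, hr, hr']
    · rw [h6 a ha]; simp [hs₃, hs₂, hs₁, ha]
    · rw [h7]; simp [hs₃, hs₂, hs₁]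
    · rw [h8 b (by omega)]
      simp [hs₃, hs₂, hs₁, hb.ne]
    · rcases b with _ | b
      · have := h8 (s.reg re) (by omega)
        rw [Nat.add_zero, this]
        simp [hs₃, hs₂]
      · have := h9 b (by simpa using hb)
        rw [re₃] at this
        rw [← add_assoc, add_right_comm, this]
        rfl

/-- The scale, and the lower bound for the grid size. -/
def scaleSets : List (ℕ × NExp) :=
  [(rz, .add (.add (.reg rn) (.reg rm)) (.reg rk)), (rQ0, powE (.reg rz) 24)]

/-- The remaining parameters, see `parOf`. -/
def paramSets : List (ℕ × NExp) :=
  [(rN, powE (.reg rz) 120), (rM, powE (.reg rz) 41), (rD, powE (.reg rz) 151),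
    (rTol, powE (.reg rz) 154), (rQ1, .add (.reg rQ) (.const 1)), (rn1, .add (.reg rn) (.const 1)),
    (rn2, .add (.mul (.const 2) (.reg rn)) (.const 1)), (rK, .mul (.const 2) (.reg rn)),
    (rSteps, powE (.reg rz) 2), (rNm, .mul (.reg rN) (.reg rm)), (rU, powE (.reg rz) 5),
    (rCand, powE (.reg rz) 6), (rLen, .mul (.mul (.reg rN) (.reg rm)) (.reg rq))]

/-- The algorithm: compute the parameters, draw the samples, and try all targets. -/
def alg : Cmd :=
  .seq (setsCmd scaleSets) (.seq doubleP.toCmd (.seq (setsCmd paramSets)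
    (.seq sampleCmd (decodeP ;; mainP).toCmd)))

/-- A function bounded by a polynomial. -/
def PolyGrowth (f : ℕ → ℕ) : Prop := ∃ C d, ∀ z, 1 ≤ z → f z ≤ C * z ^ d

namespace PolyGrowth

variable {f g : ℕ → ℕ}

theorem const (c : ℕ) : PolyGrowth fun _ => c := ⟨c, 0, fun z _ => by simp⟩

theorem id : PolyGrowth fun z => z := ⟨1, 1, fun z _ => by simp⟩

theorem add (hf : PolyGrowth f) (hg : PolyGrowth g) : PolyGrowth fun z => f z + g z := by
  obtain ⟨C, d, h⟩ := hf
  obtain ⟨C', d', h'⟩ := hg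
  refine ⟨C + C', d + d', fun z hz => ?_⟩
  have h1 : z ^ d ≤ z ^ (d + d') := Nat.pow_le_pow_right hz (by omega)
  have h2 : z ^ d' ≤ z ^ (d + d') := Nat.pow_le_pow_right hz (by omega)
  calc f z + g z ≤ C * z ^ d + C' * z ^ d' := add_le_add (h z hz) (h' z hz)
    _ ≤ C * z ^ (d + d') + C' * z ^ (d + d') := by gcongr
    _ = _ := by ring

theorem mul (hf : PolyGrowth f) (hg : PolyGrowth g) : PolyGrowth fun z => f z * g z := by
  obtain ⟨C, d, h⟩ := hf
  obtain ⟨C', d', h'⟩ := hg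
  refine ⟨C * C', d + d', fun z hz => ?_⟩
  calc f z * g z ≤ C * z ^ d * (C' * z ^ d') := Nat.mul_le_mul (h z hz) (h' z hz)
    _ = _ := by ring

theorem pow (hf : PolyGrowth f) (k : ℕ) : PolyGrowth fun z => f z ^ k := by
  induction k with
  | zero => simpa using const 1
  | succ k ih => simpa only [pow_succ] using ih.mul hf

theorem mono (hg : PolyGrowth g) (h : ∀ z, f z ≤ g z) : PolyGrowth f := by
  obtain ⟨C, d, h'⟩ := hg
  exact ⟨C, d, fun z hz => (h z).trans (h' z hz)⟩

theorem stat (hf : PolyGrowth f) (P : Prog) : PolyGrowth fun z => P.stat (f z) := by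
  obtain ⟨K, hK⟩ := P.exists_stat_le
  exact ((const K).mul ((hf.add (const 1)).pow K)).mono fun z => hK (f z)

end PolyGrowth

/-- The parameters for the scale `z`. The samples have accuracy about `z ^ (-40)`, which is small
compared to the unit `1 / Q ≈ z ^ (-24)` of the assignment even after multiplication by the number
`η ≈ z ^ 10` in the exponent of the potential. The tolerance is `z ^ (-7)`, in units of the integer
estimates, which are multiples of `z ^ (-161)`. -/
def parOf (z q : ℕ) (tau : ℕ → ℕ) : Par := ⟨2 ^ q, z ^ 120, z ^ 41, z ^ 151, z ^ 154, tau⟩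

/-- The memory before the deterministic main part, for the random bits `β`. -/
structure Ready (n m z q : ℕ) (β : ℕ → ℕ) (s : State) : Prop where
  ctx : Ctx n m (parOf z q (s.arr aTau)) 0 s
  steps : s.reg rSteps = z ^ 2
  unit : s.reg rU = z ^ 5
  cand : s.reg rCand = z ^ 6
  tau : ∀ i < z ^ 120 * m, s.arr aTau i = dec β (i * q) q
  out : ∀ j, s.arr aOut j = 0
  best : s.real lBest 0 = 0

theorem dec_congr {β β' : ℕ → ℕ} {st q : ℕ} (h : ∀ b < q, β (st + b) = β' (st + b)) :
    dec β st q = dec β' st q := by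
  induction q with
  | zero => rfl
  | succ q ih => rw [dec, dec, ih fun b hb => h b (by omega), h q (by omega)]

theorem size_le_self (x : ℕ) : Nat.size x ≤ x := Nat.size_le.mpr Nat.lt_two_pow_self

theorem two_mul_pow_le {z : ℕ} (hz : 2 ≤ z) (a : ℕ) : 2 * z ^ a ≤ z ^ (a + 1) := by
  rw [pow_succ, mul_comm]
  gcongr

theorem two_mul_add_one_le_pow {z : ℕ} (hz : 2 ≤ z) : 2 * z + 1 ≤ z ^ 3 := by
  have h : 4 ≤ z * z := Nat.mul_le_mul hz hz
  calc 2 * z + 1 ≤ 4 * z := by omega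
    _ ≤ z * z * z := by gcongr
    _ = z ^ 3 := by ring

theorem timeBound_mono_items {E u S m m' : ℕ} (h : m ≤ m') :
    timeBound E u S m ≤ timeBound E u S m' := by
  unfold timeBound
  gcongr

/-- If the loop bounds are polynomial in `z`, the number of steps is polynomial in `z`. -/
theorem Prog.exec_poly (bd : List ℕ) (P : Prog) (hP : P.okIn bd = true) (a : ℕ) :
    ∃ (E : ℕ) (u : ℕ → ℕ), PolyGrowth u ∧ ∀ {n m : ℕ} (v : Fin n → Finset (Fin m) → ℝ)
      (z S : ℕ) (s : State), (∀ p ∈ bd, s.reg p ≤ z ^ a) → s.Bits S →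
        (∃ t, Exec v P.toCmd s [] (P.run v s) t ∧ t ≤ timeBound E (u z) S m) ∧
          (P.run v s).Bits (S + E * u z) := by
  obtain ⟨E, hE⟩ := P.exec bd hP
  exact ⟨E, _, (PolyGrowth.id.pow a).stat P, fun v z S s h h' => hE v _ S s h h'⟩

set_option maxHeartbeats 1000000 in
/-- For all random bits the algorithm halts in polynomial time, and before its main part the thresholds
are the numbers that the bits encode. -/
theorem alg_exec : ∃ C d, ∀ (n m k : ℕ), 0 < n → 0 < k → ∀ v : Fin n → Finset (Fin m) → ℝ,
    ∃ q, (n + m + k) ^ 24 ≤ 2 ^ q ∧ 2 ^ q < 2 * (n + m + k) ^ 24 ∧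
      (n + m + k) ^ 120 * m * q ≤ C * (n + m + k) ^ d ∧
      ∀ r : Fin (C * (n + m + k) ^ d) → Bool, ∃ l s t, l <+: List.ofFn r ∧
        t ≤ C * (n + m + k) ^ d ∧ Exec v alg (initState n m k) l (mainP.run v s) t ∧
        Ready n m (n + m + k) q (bitsOf r) s := by
  obtain ⟨E₁, h₁⟩ := setsCmd_exec scaleSets
  obtain ⟨E₂, u₂, p₂, h₂⟩ := doubleP.exec_poly [rQ0] (by decide) 24
  obtain ⟨E₃, h₃⟩ := setsCmd_exec paramSets
  obtain ⟨E₅, u₅, p₅, h₅⟩ := (decodeP ;; mainP).exec_poly (List.range 20) (by decide) 200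
  -- numbers of bits after the first stages, and the total time
  let S₁ : ℕ → ℕ := fun z => E₁ * (z + 1)
  let S₂ : ℕ → ℕ := fun z => S₁ z + E₂ * u₂ z
  let S₃ : ℕ → ℕ := fun z => E₃ * (S₂ z + 1) + 1
  let f : ℕ → ℕ := fun z => S₁ z + (timeBound E₂ (u₂ z) (S₁ z) z + (E₃ * (S₂ z + 1) +
    (1 + 1 + (z ^ 146 + 1) * (20 * (S₃ z + 1)) + timeBound E₅ (u₅ z) (S₃ z) z)))
  have hf : PolyGrowth f := by
    have p146 := PolyGrowth.id.pow 146
    have hS₁ : PolyGrowth S₁ := (PolyGrowth.const E₁).mul (PolyGrowth.id.add (PolyGrowth.const 1))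
    have hS₂ : PolyGrowth S₂ := hS₁.add ((PolyGrowth.const E₂).mul p₂)
    have hS₃' : PolyGrowth fun z => E₃ * (S₂ z + 1) :=
      (PolyGrowth.const E₃).mul (hS₂.add (PolyGrowth.const 1))
    have hS₃ : PolyGrowth S₃ := hS₃'.add (PolyGrowth.const 1)
    have htb : ∀ (E : ℕ) {u S : ℕ → ℕ}, PolyGrowth u → PolyGrowth S →
        PolyGrowth fun z => timeBound E (u z) (S z) z := fun E u S hu hS =>
      ((PolyGrowth.const E).mul hu).mul
        (((hS.add ((PolyGrowth.const E).mul hu)).add PolyGrowth.id).add (PolyGrowth.const 1))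
    exact hS₁.add ((htb E₂ p₂ hS₁).add (hS₃'.add (((PolyGrowth.const (1 + 1)).add
      ((p146.add (PolyGrowth.const 1)).mul ((PolyGrowth.const 20).mul
        (hS₃.add (PolyGrowth.const 1))))).add (htb E₅ p₅ hS₃))))
  obtain ⟨C, d, hCd⟩ := hf
  refine ⟨C, d, fun n m k hn hk v => ?_⟩
  obtain ⟨z, hz⟩ : ∃ z, z = n + m + k := ⟨_, rfl⟩
  rw [← hz]
  have hz2 : 2 ≤ z := by omega
  have hpow : ∀ a b, a ≤ b → z ^ a ≤ z ^ b := fun a b h => Nat.pow_le_pow_right (by omega) h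
  have hpow1 : ∀ a, 1 ≤ z ^ a := fun a => Nat.one_le_pow _ _ (by omega)
  have hT := hCd z (by omega)
  -- the parameters
  have hb₀ : (initState n m k).Bits z := by
    refine ⟨fun x => (size_le_self _).trans ?_, fun a i => by simp [initState]⟩
    simp only [initState]
    split_ifs <;> omega
  obtain ⟨⟨t₁, x₁, l₁⟩, b₁⟩ := h₁ v _ _ hb₀
  set s₁ := setsState scaleSets (initState n m k) with hs₁
  have r₁ : ∀ x, s₁.reg x = if x = rQ0 then z ^ 24 else if x = rz then z else
      (initState n m k).reg x := by
    intro x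
    simp only [hs₁, setsState, scaleSets, reg_setReg, powE_eval, NExp.eval]
    simp [initState, hz]
  have hQ0 : s₁.reg rQ0 = z ^ 24 := by simp [r₁]
  obtain ⟨⟨t₂, x₂, l₂⟩, b₂⟩ := h₂ v z _ s₁ (by simp [hQ0]) b₁
  have hq := doubleP_spec v s₁ (by rw [hQ0]; exact hpow1 24)
  have A₂ := run_agree v doubleP s₁
  set s₂ := doubleP.run v s₁ with hs₂
  obtain ⟨q, hqdef⟩ : ∃ q, q = s₂.reg rq := ⟨_, rfl⟩
  rw [← hqdef] at hq
  rw [hQ0] at hq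
  obtain ⟨hq1, hq2, hq3⟩ := hq
  have hqz : q ≤ z ^ 25 := by
    have : q < 2 ^ q := Nat.lt_two_pow_self
    have h3 : 2 * z ^ 24 ≤ z ^ 25 := two_mul_pow_le hz2 24
    omega
  have hlen : z ^ 120 * m * q ≤ z ^ 146 := by
    calc z ^ 120 * m * q ≤ z ^ 120 * z * z ^ 25 := by gcongr; omega
      _ = z ^ 146 := by ring
  have hS3 : 1 ≤ S₃ z := Nat.le_add_left _ _
  have h146 : z ^ 146 ≤ f z := by
    have : z ^ 146 + 1 ≤ (z ^ 146 + 1) * (20 * (S₃ z + 1)) := Nat.le_mul_of_pos_right _ (by omega)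
    simp only [f]
    omega
  refine ⟨q, by rw [← hq1]; exact hq2, by rw [← hq1]; exact hq3, hlen.trans (h146.trans hT),
    fun r => ?_⟩
  obtain ⟨⟨t₃, x₃, l₃⟩, b₃⟩ := h₃ v s₂ _ b₂
  set s₃ := setsState paramSets s₂ with hs₃
  have n₂ : s₂.reg rn = n := by rw [A₂.reg rn (by decide), r₁]; simp [initState]
  have m₂ : s₂.reg rm = m := by rw [A₂.reg rm (by decide), r₁]; simp [initState]
  have k₂ : s₂.reg rk = k := by rw [A₂.reg rk (by decide), r₁]; simp [initState]
  have z₂ : s₂.reg rz = z := by rw [A₂.reg rz (by decide), r₁]; simp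
  have Q0₂ : s₂.reg rQ0 = z ^ 24 := by rw [A₂.reg rQ0 (by decide), hQ0]
  have Q₂ : s₂.reg rQ = 2 ^ q := hq1
  have q₂ : s₂.reg rq = q := hqdef.symm
  have r₃ : s₃.reg rn = n ∧ s₃.reg rm = m ∧ s₃.reg rk = k ∧ s₃.reg rz = z ∧ s₃.reg rQ = 2 ^ q ∧
      s₃.reg rq = q ∧ s₃.reg rN = z ^ 120 ∧ s₃.reg rM = z ^ 41 ∧ s₃.reg rD = z ^ 151 ∧
      s₃.reg rTol = z ^ 154 ∧ s₃.reg rQ1 = 2 ^ q + 1 ∧ s₃.reg rn1 = n + 1 ∧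
      s₃.reg rn2 = 2 * n + 1 ∧ s₃.reg rK = 2 * n ∧ s₃.reg rSteps = z ^ 2 ∧
      s₃.reg rNm = z ^ 120 * m ∧ s₃.reg rU = z ^ 5 ∧ s₃.reg rCand = z ^ 6 ∧
      s₃.reg rLen = z ^ 120 * m * q ∧ s₃.reg rQ0 = z ^ 24 := by
    simp only [hs₃, setsState, paramSets, reg_setReg, powE_eval, NExp.eval]
    norm_num [n₂, m₂, k₂, z₂, Q0₂, Q₂, q₂]
  obtain ⟨g0, g1, g2, g3, g4, g5, g6, g7, g8, g9, g10, g11, g12, g13, g14, g15, g16, g17, g18,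
    g19⟩ := r₃
  have arr₃ : s₃.arr = s₂.arr := rfl
  have real₃ : s₃.real = s₂.real := rfl
  -- sampling
  set Len := z ^ 120 * m * q with hLen
  have hLT : Len ≤ C * z ^ d := hlen.trans (h146.trans hT)
  set l := (List.ofFn r).take Len with hl
  have hll : l.length = Len := by rw [hl, List.length_take, List.length_ofFn]; omega
  have b₃' : (s₃.setReg re 0).Bits (S₃ z) := (b₃.mono (Nat.le_succ _)).setReg (by simp)
  obtain ⟨s₄, t₄, x₄, l₄, b₄, c1, c2, c3, -, c5⟩ := sampleLoop_exec v l (s₃.setReg re 0) (S₃ z) b₃'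
    (by simp [g18, hll]) hS3
  have x₄' : Exec v sampleCmd s₃ l s₄ _ := Exec.seq (Exec.setReg s₃ re (.const 0)) x₄
  rw [hll] at l₄
  have reg₄ : ∀ x < 20, s₄.reg x = s₃.reg x := by
    intro x hx
    rw [c1 x (by omega) (by omega)]
    simp [show x ≠ re by omega]
  have bits₄ : ∀ b < Len, s₄.arr aBits b = bitsOf r b := by
    intro b hb
    have := c5 b (by omega)
    simp only [reg_setReg, if_true, zero_add] at this
    rw [this, bitsOf, dif_pos (by omega)]
    simp [hl]
  -- the main part
  have hB : ∀ p ∈ List.range 20, s₄.reg p ≤ z ^ 200 := by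
    intro p hp
    rw [List.mem_range] at hp
    rw [reg₄ p hp]
    have hz200 : z ≤ z ^ 200 := by simpa using hpow 1 200 (by norm_num)
    have h25 : 2 * z ^ 24 ≤ z ^ 25 := two_mul_pow_le hz2 24
    have h25' := hpow 25 200 (by norm_num)
    have h2z : 2 * z + 1 ≤ z ^ 200 := (two_mul_add_one_le_pow hz2).trans (hpow 3 200 (by norm_num))
    have h121 : z ^ 120 * m ≤ z ^ 121 :=
      (Nat.mul_le_mul_left _ (by omega)).trans (pow_succ z 120).ge
    rw [hq1] at hq3
    interval_cases p
    · rw [g0]; omega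
    · rw [g1]; omega
    · rw [g2]; omega
    · rw [g3]; omega
    · rw [g4]; omega
    · rw [g5]; omega
    · rw [g6]; exact hpow _ _ (by norm_num)
    · rw [g7]; exact hpow _ _ (by norm_num)
    · rw [g8]; exact hpow _ _ (by norm_num)
    · rw [g9]; exact hpow _ _ (by norm_num)
    · rw [g10]; omega
    · rw [g11]; omega
    · rw [g12]; omega
    · rw [g13]; omega
    · rw [g14]; exact hpow _ _ (by norm_num)
    · rw [g15]; exact h121.trans (hpow _ _ (by norm_num))
    · rw [g16]; exact hpow _ _ (by norm_num)
    · rw [g17]; exact hpow _ _ (by norm_num)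
    · rw [g18]; exact hlen.trans (hpow _ _ (by norm_num))
    · rw [g19]; exact hpow _ _ (by norm_num)
  obtain ⟨⟨t₅, x₅, l₅⟩, -⟩ := h₅ v z _ s₄ hB b₄
  have A₅ := run_agree v decodeP s₄
  set s₅ := decodeP.run v s₄ with hs₅
  have hexec := Exec.seq x₁ (Exec.seq x₂ (Exec.seq x₃ (Exec.seq x₄' x₅)))
  simp only [List.nil_append, List.append_nil] at hexec
  refine ⟨l, s₅, _, List.take_prefix _ _, ?_, hexec, ?_⟩
  · refine le_trans ?_ hT
    have mle : m ≤ z := by omega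
    have q1 : t₂ ≤ timeBound E₂ (u₂ z) (S₁ z) z :=
      l₂.trans (timeBound_mono_items mle)
    have q2 : t₅ ≤ timeBound E₅ (u₅ z) (S₃ z) z :=
      l₅.trans (timeBound_mono_items mle)
    have q3 : (Len + 1) * (20 * (S₃ z + 1)) ≤ (z ^ 146 + 1) * (20 * (S₃ z + 1)) :=
      Nat.mul_le_mul_right _ (Nat.succ_le_succ hlen)
    have q4 : (NExp.const 0).cost s₃ = 1 := by simp [NExp.cost]
    have q5 : t₁ ≤ S₁ z := l₁
    have q6 : t₃ ≤ E₃ * (S₂ z + 1) := l₃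
    rw [q4]
    exact add_le_add q5 (add_le_add q1 (add_le_add q6 (add_le_add
      (Nat.add_le_add_left (l₄.trans q3) _) q2)))
  · have reg₅ : ∀ x < 20, s₅.reg x = s₃.reg x := by
      intro x hx
      rw [← reg₄ x hx]
      refine A₅.reg x ?_
      have : ∀ y < 20, y ∉ decodeP.wr := by decide
      exact this x hx
    have hreal : s₅.real = fun _ _ => 0 := by
      have h1 : ∀ a, s₅.real a = s₄.real a := fun a => A₅.real a (by simp [decodeP, Prog.wl])
      have h2 : ∀ a, s₂.real a = s₁.real a := fun a => A₂.real a (by simp [doubleP, Prog.wl])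
      funext a
      rw [h1, c3]
      change s₂.real a = _
      rw [h2]
      rfl
    have hout : s₅.arr aOut = fun _ => 0 := by
      rw [A₅.arr aOut (by decide), c2 aOut (by decide)]
      change s₂.arr aOut = _
      rw [A₂.arr aOut (by decide)]
      rfl
    refine ⟨⟨?_, ?_, ?_, ?_, ?_, ?_, ?_, ?_, ?_, ?_, ?_, rfl, by rw [hreal]⟩, ?_, ?_, ?_,
      fun i hi => ?_, fun j => by rw [hout], by rw [hreal]⟩
    · rw [reg₅ _ (by norm_num), g0]
    · rw [reg₅ _ (by norm_num), g1]
    · rw [reg₅ _ (by norm_num), g4]; rfl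
    · rw [reg₅ _ (by norm_num), g6]; rfl
    · rw [reg₅ _ (by norm_num), g7]; rfl
    · rw [reg₅ _ (by norm_num), g8]; rfl
    · rw [reg₅ _ (by norm_num), g9]; rfl
    · rw [reg₅ _ (by norm_num), g10]; rfl
    · rw [reg₅ _ (by norm_num), g11]
    · rw [reg₅ _ (by norm_num), g12]
    · rw [reg₅ _ (by norm_num), g13]
    · rw [reg₅ _ (by norm_num), g14]
    · rw [reg₅ _ (by norm_num), g16]
    · rw [reg₅ _ (by norm_num), g17]
    · have h1 := decodeP_spec v (s := s₄) i (by rw [reg₄ _ (by norm_num), g15]; exact hi)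
      rw [reg₄ rq (by norm_num), g5] at h1
      rw [h1]
      refine dec_congr fun b hb => bits₄ _ ?_
      calc i * q + b < i * q + q := by omega
        _ = (i + 1) * q := by ring
        _ ≤ z ^ 120 * m * q := by gcongr; omega

/-! ### Choice of the parameters -/

section Numbers

variable {Z x : ℝ}

theorem pow_mul_inv_pow (h : Z * x = 1) (a b : ℕ) : Z ^ a * x ^ (a + b) = x ^ b := by
  rw [pow_add, ← mul_assoc, ← mul_pow, h, one_pow, one_mul]

theorem pow_add_le (h0 : 0 ≤ x) (h3 : x ≤ 1 / 3) (a b : ℕ) : x ^ (a + b) ≤ (1 / 3) ^ a * x ^ b := by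
  rw [pow_add]
  gcongr

/-- The conditions of the greedy phase hold for `Q ∈ [Z ^ 24, 2 * Z ^ 24]`, `η ≤ Z ^ 10`,
`δ = Z ^ (-40)` and `κ = 9 * Z ^ (-13)`. -/
theorem greedy_params (hZ : 3 ≤ Z) (h : Z * x = 1) {Q η m : ℝ} (hQ : Z ^ 24 ≤ Q)
    (hQ' : Q ≤ 2 * Z ^ 24) (hη0 : 0 ≤ η) (hη : η ≤ Z ^ 10) (hm : m ≤ Z) :
    η * (1 / Q + 2 * x ^ 40) ≤ 1 / 3 ∧
      x ^ 40 + m * (2 * x ^ 40 * Q + η * Q * (1 / Q + 2 * x ^ 40) ^ 2) ≤ 9 * x ^ 13 ∧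
      9 * x ^ 13 ≤ 1 ∧ η * (9 * x ^ 13) + η ^ 2 / Q ≤ 1 := by
  have hZ0 : 0 < Z := by linarith
  have hx0 : 0 < x := by
    by_contra hcon
    push Not at hcon
    nlinarith
  have hx3 : x ≤ 1 / 3 := by nlinarith
  have hQ0 : 0 < Q := lt_of_lt_of_le (by positivity) hQ
  have small := pow_add_le hx0.le hx3
  have cancel := pow_mul_inv_pow h
  -- bounds for `1 / Q`
  obtain ⟨u, hu⟩ : ∃ u, u = 1 / Q := ⟨_, rfl⟩
  have huQ : u * Q = 1 := by rw [hu]; field_simp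
  have hu0 : 0 < u := by rw [hu]; positivity
  have hu1 : u ≤ x ^ 24 := by
    have := cancel 24 0
    rw [pow_zero, add_zero] at this
    rw [hu, div_le_iff₀ hQ0, ← this, mul_comm]
    gcongr
  have hu2 : 2 * x ^ 40 ≤ u := by
    have h1 := cancel 24 16
    have h2 := small 16 0
    norm_num at h1 h2
    rw [hu, le_div_iff₀ hQ0]
    calc 2 * x ^ 40 * Q ≤ 2 * x ^ 40 * (2 * Z ^ 24) := by gcongr
      _ = 4 * (Z ^ 24 * x ^ 40) := by ring
      _ = 4 * x ^ 16 := by rw [h1]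
      _ ≤ 1 := by linarith
  have s1 : Z ^ 10 * x ^ 24 = x ^ 14 := cancel 10 14
  have e1 : η * u ≤ x ^ 14 := by
    rw [← s1]
    gcongr
  have x1 := small 14 0
  have x13 := small 13 0
  have x3 := small 3 0
  have x4 := small 4 0
  have x40 := small 27 13
  have x15 := small 2 13
  norm_num at x1 x13 x3 x4 x40 x15
  rw [← hu]
  have hηu : η * (2 * u) ≤ 2 * x ^ 14 := by linarith
  refine ⟨?_, ?_, by linarith, ?_⟩
  · calc η * (u + 2 * x ^ 40) ≤ η * (2 * u) := by gcongr; linarith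
      _ ≤ 1 / 3 := by linarith
  · have e2 : 2 * x ^ 40 * Q ≤ 4 * x ^ 16 := by
      calc 2 * x ^ 40 * Q ≤ 2 * x ^ 40 * (2 * Z ^ 24) := by gcongr
        _ = 4 * (Z ^ 24 * x ^ 40) := by ring
        _ = 4 * x ^ 16 := by rw [cancel 24 16]
    have e3 : η * Q * (u + 2 * x ^ 40) ^ 2 ≤ 4 * x ^ 14 := by
      calc η * Q * (u + 2 * x ^ 40) ^ 2 ≤ η * Q * (2 * u) ^ 2 := by gcongr; linarith
        _ = 4 * (η * u) * (u * Q) := by ring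
        _ ≤ 4 * x ^ 14 := by rw [huQ]; linarith
    have e4 : m * (2 * x ^ 40 * Q + η * Q * (u + 2 * x ^ 40) ^ 2) ≤
        Z * (4 * x ^ 16 + 4 * x ^ 14) := by gcongr
    have e5 : Z * (4 * x ^ 16 + 4 * x ^ 14) = (Z * x) * (4 * x ^ 15 + 4 * x ^ 13) := by ring
    rw [e5, h] at e4
    linarith [pow_pos hx0 13]
  · have e6 : η * (9 * x ^ 13) ≤ 9 * x ^ 3 := by
      calc η * (9 * x ^ 13) ≤ Z ^ 10 * (9 * x ^ 13) := by gcongr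
        _ = 9 * (Z ^ 10 * x ^ 13) := by ring
        _ = 9 * x ^ 3 := by rw [cancel 10 3]
    have e7 : η ^ 2 / Q ≤ x ^ 4 := by
      rw [div_eq_mul_one_div, ← hu]
      calc η ^ 2 * u = η * (η * u) := by ring
        _ ≤ Z ^ 10 * x ^ 14 := by gcongr
        _ = x ^ 4 := cancel 10 4
    linarith

/-- The losses of the greedy phase, of the sampling, of `Z ^ 2` rounding steps and of the choice of the
target together are at most `1 / Z`. -/
theorem error_le (hZ : 3 ≤ Z) (h : Z * x = 1) {Q η n : ℝ} (hQ : Z ^ 24 ≤ Q) (hη : Z ^ 10 / 2 ≤ η)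
    (hn : 1 ≤ n) (hn' : n ≤ Z) :
    1 / Q + Real.log (9 * n) / η + x ^ 40 + Z ^ 2 * (x ^ 7 + 2 * x ^ 40) + x ^ 5 ≤ x := by
  have hZ0 : 0 < Z := by linarith
  have hx0 : 0 < x := by
    by_contra hcon
    push Not at hcon
    nlinarith
  have hx3 : x ≤ 1 / 3 := by nlinarith
  have hQ0 : 0 < Q := lt_of_lt_of_le (by positivity) hQ
  have hη0 : 0 < η := lt_of_lt_of_le (by positivity) hη
  have small := pow_add_le hx0.le hx3
  have cancel := pow_mul_inv_pow h
  have hu1 : 1 / Q ≤ x ^ 24 := by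
    have := cancel 24 0
    rw [pow_zero, add_zero] at this
    rw [div_le_iff₀ hQ0, ← this, mul_comm]
    gcongr
  have hlog : Real.log (9 * n) / η ≤ 18 * x ^ 9 := by
    have h1 : Real.log (9 * n) ≤ 9 * Z := by
      have := Real.log_le_sub_one_of_pos (show 0 < 9 * n by linarith)
      linarith
    rw [div_le_iff₀ hη0]
    calc Real.log (9 * n) ≤ 9 * Z := h1
      _ = 9 * Z * (Z ^ 9 * x ^ (9 + 0)) := by rw [cancel 9 0]; ring
      _ = 18 * x ^ 9 * (Z ^ 10 / 2) := by ring
      _ ≤ 18 * x ^ 9 * η := by gcongr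
  have e1 : Z ^ 2 * (x ^ 7 + 2 * x ^ 40) = x ^ 5 + 2 * x ^ 38 := by
    rw [mul_add, cancel 2 5, mul_left_comm, cancel 2 38]
  rw [e1]
  have x24 := small 23 1
  have x9 := small 8 1
  have x40 := small 39 1
  have x5 := small 4 1
  have x38 := small 37 1
  norm_num at x24 x9 x40 x5 x38
  linarith

/-- The number of grid points is small compared to the concentration of the estimates. -/
theorem failure_le {z : ℕ} (hz : 3 ≤ z) {n m k : ℕ} (hn : n ≤ z) (hm : m ≤ z) (hk : 0 < k)
    (hk' : k ≤ z) {Q : ℝ} (hQ0 : 0 ≤ Q) (hQ : Q ≤ 2 * (z : ℝ) ^ 24) :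
    n * (Q + 1) ^ m * (2 * Real.exp (-((z : ℝ) ^ 120 * ((1 / (z : ℝ)) ^ 40 / 2) ^ 2 / 4))) ≤
      1 / k := by
  obtain ⟨Z, hZ⟩ : ∃ Z : ℝ, Z = z := ⟨_, rfl⟩
  rw [← hZ] at hQ ⊢
  have hZ3 : 3 ≤ Z := by rw [hZ]; exact_mod_cast hz
  have hnZ : (n : ℝ) ≤ Z := by rw [hZ]; exact_mod_cast hn
  have hkZ : (k : ℝ) ≤ Z := by rw [hZ]; exact_mod_cast hk'
  have hk0 : (0 : ℝ) < k := by exact_mod_cast hk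
  have hZ0 : 0 < Z := by linarith
  have e1 : Z ^ 120 * ((1 / Z) ^ 40 / 2) ^ 2 / 4 = Z ^ 40 / 16 := by
    field_simp
    norm_num
  rw [e1]
  -- everything is compared to powers of `exp Z`
  have hexp : Z ≤ Real.exp Z := by linarith [Real.add_one_le_exp Z]
  have hZ25 : Q + 1 ≤ Z ^ 25 := by
    have h1 : Z ^ 25 = Z * Z ^ 24 := by ring
    have h2 : 1 ≤ Z ^ 24 := one_le_pow₀ (by linarith)
    rw [h1]
    nlinarith
  have hQm : (Q + 1) ^ m ≤ Real.exp Z ^ (25 * z) := by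
    calc (Q + 1) ^ m ≤ (Z ^ 25) ^ m := by gcongr
      _ ≤ (Z ^ 25) ^ z := pow_le_pow_right₀ (one_le_pow₀ (by linarith)) hm
      _ = Z ^ (25 * z) := by rw [← pow_mul]
      _ ≤ Real.exp Z ^ (25 * z) := by gcongr
  have h2 : (2 : ℝ) ≤ Real.exp Z := by linarith
  rw [le_div_iff₀ hk0]
  calc n * (Q + 1) ^ m * (2 * Real.exp (-(Z ^ 40 / 16))) * k
      ≤ Real.exp Z * Real.exp Z ^ (25 * z) * (Real.exp Z * Real.exp (-(Z ^ 40 / 16))) *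
        Real.exp Z := by
        gcongr
        · linarith
        · linarith
    _ = Real.exp Z ^ (25 * z + 3) * Real.exp (-(Z ^ 40 / 16)) := by ring
    _ = Real.exp (((25 * z + 3 : ℕ) : ℝ) * Z - Z ^ 40 / 16) := by
        rw [← Real.exp_nat_mul, ← Real.exp_add, sub_eq_add_neg]
    _ ≤ 1 := by
        rw [Real.exp_le_one_iff]
        push_cast
        rw [← hZ]
        have h3 : (3 : ℝ) ^ 38 ≤ Z ^ 38 := by gcongr
        have h4 : Z ^ 40 = Z ^ 38 * Z ^ 2 := by ring
        have h5 : 448 * Z ^ 2 ≤ Z ^ 38 * Z ^ 2 := by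
          gcongr
          refine le_trans ?_ h3
          norm_num
        nlinarith

end Numbers

/-! ### Estimates of the truncated valuations -/

/-- The number of units that fit into a value, in closed form. -/
theorem count_eq {M : ℕ} {T x : ℝ} (hT : 0 < T) (hx : 0 ≤ x) :
    ((Finset.range M).filter fun c : ℕ => ((c + 1 : ℕ) : ℝ) * T ≤ M * x).card =
      min M ⌊M * (x / T)⌋₊ := by
  have h : ((Finset.range M).filter fun c : ℕ => ((c + 1 : ℕ) : ℝ) * T ≤ M * x) =
      Finset.range (min M ⌊M * (x / T)⌋₊) := by
    ext c
    rw [Finset.mem_filter, Finset.mem_range, Finset.mem_range, lt_min_iff]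
    refine and_congr_right fun _ => ?_
    rw [← Nat.succ_le_iff, Nat.le_floor_iff (by positivity), mul_div_assoc', le_div_iff₀ hT]
  rw [h, Finset.card_range]

/-- Counting in units of `T / M` estimates the truncated value `x / T` up to `1 / M`. -/
theorem count_close {M : ℕ} (hM : 0 < M) {T x : ℝ} (hT : 0 < T) (hx : 0 ≤ x) :
    |(((Finset.range M).filter fun c : ℕ => ((c + 1 : ℕ) : ℝ) * T ≤ M * x).card : ℝ) / M -
      min (x / T) 1| ≤ 1 / M := by
  have hM' : (0 : ℝ) < M := by exact_mod_cast hM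
  have hxT : 0 ≤ x / T := by positivity
  rw [count_eq hT hx]
  rcases le_or_gt M ⌊M * (x / T)⌋₊ with h | h
  · rw [min_eq_left h]
    have h1 : (M : ℝ) ≤ M * (x / T) := (Nat.le_floor_iff (by positivity)).mp h
    have h2 : 1 ≤ x / T := by
      by_contra hcon
      push Not at hcon
      nlinarith
    rw [min_eq_right h2, div_self hM'.ne', sub_self, abs_zero]
    positivity
  · rw [min_eq_right h.le]
    have h1 := Nat.floor_le (show 0 ≤ M * (x / T) by positivity)
    have h2 := Nat.lt_floor_add_one (M * (x / T))
    have h3 : M * (x / T) < M := (Nat.floor_lt (by positivity)).mp h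
    have h4 : x / T ≤ 1 := by
      by_contra hcon
      push Not at hcon
      nlinarith
    rw [min_eq_left h4, abs_le]
    constructor
    · rw [neg_le_sub_iff_le_add, ← add_div, le_div_iff₀ hM']
      linarith
    · have : (⌊M * (x / T)⌋₊ : ℝ) / M ≤ x / T := by
        rw [div_le_iff₀ hM']; linarith
      have h5 : (0 : ℝ) ≤ 1 / M := by positivity
      linarith

section

variable {n m : ℕ}

theorem mext_close {Q : ℕ} (hQ : 0 < Q) {h g : Finset (Fin m) → ℝ} {ε : ℝ}
    (hε : ∀ S, |h S - g S| ≤ ε) (y : Fin m → ℕ) : |mext Q h y - mext Q g y| ≤ ε := by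
  have hQ' : (0 : ℝ) < (Q : ℝ) ^ m := by positivity
  unfold mext
  rw [← sub_div, ← Finset.sum_sub_distrib, abs_div, abs_of_pos hQ', div_le_iff₀ hQ']
  refine (Finset.abs_sum_le_sum_abs _ _).trans ?_
  refine (Finset.sum_le_card_nsmul _ _ ε fun τ _ => hε _).trans ?_
  simp [mul_comm]

variable (v : Fin n → Finset (Fin m) → ℝ)

/-- The valuation of agent `i`, in units of `T` and truncated at `1`. -/
noncomputable def truncVal (T : ℝ) (i : ℕ) (S : Finset (Fin m)) : ℝ := min (oracle v i S / T) 1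

/-- The value of agent `i` rounded down to a multiple of `1 / M`, as counted by the program. -/
noncomputable def countVal (M : ℕ) (T : ℝ) (i : ℕ) (S : Finset (Fin m)) : ℝ :=
  (((Finset.range M).filter fun c : ℕ => ((c + 1 : ℕ) : ℝ) * T ≤ M * oracle v i S).card : ℝ) / M

variable {v} {T : ℝ}

theorem oracle_nonneg (hv : ∀ i, IsValuation (v i)) (i : ℕ) (S : Finset (Fin m)) :
    0 ≤ oracle v i S := by
  unfold oracle
  split_ifs
  exacts [(hv _).nonneg S, le_rfl]

theorem countVal_nonneg (M : ℕ) (i : ℕ) (S : Finset (Fin m)) : 0 ≤ countVal v M T i S := by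
  unfold countVal
  positivity

theorem countVal_le_one (M : ℕ) (i : ℕ) (S : Finset (Fin m)) : countVal v M T i S ≤ 1 := by
  unfold countVal
  refine div_le_one_of_le₀ ?_ (by positivity)
  exact_mod_cast (Finset.card_filter_le _ _).trans (Finset.card_range M).le

/-- If the samples estimate the multilinear extensions, the integer estimates of the program
approximate those of the truncated valuations. -/
theorem approx_Gh (hv : ∀ i, IsValuation (v i)) (hT : 0 < T) {par : Par} (hQ : 0 < par.Q)
    (hN : 0 < par.N) (hM : 0 < par.M) {τ : ℕ → ℕ → ℕ}
    (htau : ∀ s < par.N, ∀ j : Fin m, par.tau (s * m + j) = τ s j) {δ₀ δ : ℝ}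
    (hδ : δ₀ + 1 / par.M ≤ δ)
    (hs : ∀ i < n, ∀ y : Fin m → ℕ, (∀ j, y j ≤ par.Q) →
      |(∑ s ∈ Finset.range par.N, countVal v par.M T i (thr (fun j => τ s j) y)) / par.N -
        mext par.Q (countVal v par.M T i) y| ≤ δ₀) :
    Approx n m par.Q (truncVal v T) (Gh v par T) ((par.N * par.M : ℕ) : ℝ) δ where
  Q_pos := hQ
  W_pos := by
    have := Nat.mul_pos hN hM
    exact_mod_cast this
  val i hi := by
    have : truncVal v T i = fun S => min (v ⟨i, hi⟩ S / T) 1 := by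
      funext S; simp [truncVal, oracle, hi]
    rw [this]
    exact (hv _).div_min_one hT
  le_one i _ S := min_le_right _ _
  mono i hi y y' hyy := by
    refine Finset.sum_le_sum fun s _ => Finset.card_le_card fun c hc => ?_
    rw [Finset.mem_filter] at hc ⊢
    refine ⟨hc.1, hc.2.trans ?_⟩
    have h1 := thr_mono (fun j : Fin m => par.tau (s * m + j)) hyy
    have h2 : oracle v i (thr (fun j => par.tau (s * m + j)) y) ≤
        oracle v i (thr (fun j => par.tau (s * m + j)) y') := by
      simp only [oracle, dif_pos hi]
      exact (hv _).mono _ _ h1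
    gcongr
  close i hi y hy := by
    have hN' : (0 : ℝ) < par.N := by exact_mod_cast hN
    have hM' : (0 : ℝ) < par.M := by exact_mod_cast hM
    have e1 : (Gh v par T i y : ℝ) / ((par.N * par.M : ℕ) : ℝ) =
        (∑ s ∈ Finset.range par.N, countVal v par.M T i (thr (fun j => τ s j) y)) / par.N := by
      unfold Gh countVal
      rw [← Finset.sum_div, div_div]
      push_cast
      rw [mul_comm (par.N : ℝ)]
      congr 1
      refine Finset.sum_congr rfl fun s hs => ?_
      have : (fun j : Fin m => par.tau (s * m + j)) = fun j : Fin m => τ s j :=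
        funext fun j => htau s (Finset.mem_range.mp hs) j
      rw [this]
    have e2 := mext_close hQ (h := countVal v par.M T i) (g := truncVal v T i)
      (fun S => count_close hM hT (oracle_nonneg hv i S)) y
    rw [e1]
    exact (abs_sub_le _ _ _).trans ((add_le_add (hs i hi y hy) e2).trans hδ)

end

/-! ### The guarantee -/

section

variable {n m : ℕ} {v : Fin n → Finset (Fin m) → ℝ}

/-- The number `η` in the exponent of the potential lies within a factor two of `z ^ 10`. -/
theorem eta_bounds {z : ℕ} (hz : 0 < z) (q : ℕ) (tau : ℕ → ℕ) :
    0 < (parOf z q tau).rho ∧ (parOf z q tau).rho < 1 ∧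
      (z : ℝ) ^ 10 / 2 ≤ -Real.log (parOf z q tau).rho * ((z ^ 120 * z ^ 41 : ℕ) : ℝ) ∧
      -Real.log (parOf z q tau).rho * ((z ^ 120 * z ^ 41 : ℕ) : ℝ) ≤ (z : ℝ) ^ 10 := by
  have hZ : (1 : ℝ) ≤ z := by exact_mod_cast hz
  obtain ⟨D, hD⟩ : ∃ D : ℝ, D = (z : ℝ) ^ 151 := ⟨_, rfl⟩
  have hD1 : 1 ≤ D := by rw [hD]; exact one_le_pow₀ hZ
  have hrho : (parOf z q tau).rho = D / (D + 1) := by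
    simp [Par.rho, parOf, hD]
  have hW : ((z ^ 120 * z ^ 41 : ℕ) : ℝ) = D * (z : ℝ) ^ 10 := by
    rw [hD]; push_cast; ring
  have h10 : 0 < (z : ℝ) ^ 10 := by positivity
  rw [hrho, hW]
  have hpos : 0 < D / (D + 1) := by positivity
  refine ⟨hpos, by rw [div_lt_one (by linarith)]; linarith, ?_, ?_⟩
  · have h1 := Real.log_le_sub_one_of_pos hpos
    have h2 : D / (D + 1) - 1 = -(1 / (D + 1)) := by field_simp; ring
    have h3 : 1 / 2 ≤ 1 / (D + 1) * D := by
      rw [one_div_mul_eq_div, div_le_div_iff₀ (by norm_num) (by linarith)]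
      linarith
    calc (z : ℝ) ^ 10 / 2 = 1 / 2 * (z : ℝ) ^ 10 := by ring
      _ ≤ 1 / (D + 1) * D * (z : ℝ) ^ 10 := by gcongr
      _ ≤ -Real.log (D / (D + 1)) * D * (z : ℝ) ^ 10 := by
          gcongr
          linarith
      _ = _ := by ring
  · have h1 := Real.one_sub_inv_le_log_of_pos hpos
    have h2 : 1 - (D / (D + 1))⁻¹ = -(1 / D) := by
      have : D ≠ 0 := by linarith
      field_simp
      ring
    calc -Real.log (D / (D + 1)) * (D * (z : ℝ) ^ 10)
        ≤ 1 / D * (D * (z : ℝ) ^ 10) := by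
          gcongr
          linarith
      _ = (z : ℝ) ^ 10 := by
          have : D ≠ 0 := by linarith
          field_simp

/-- The samples estimate the multilinear extensions of the counted valuations for the target `T`
at all grid points. -/
def GoodBits (v : Fin n → Finset (Fin m) → ℝ) (z q : ℕ) (T : ℝ) (β : ℕ → ℕ) : Prop :=
  ∀ i < n, ∀ y : Fin m → ℕ, (∀ j, y j ≤ 2 ^ q) →
    |(∑ s ∈ Finset.range (z ^ 120),
        countVal v (z ^ 41) T i (thr (fun j => threshold β m q s j) y)) / ((z ^ 120 : ℕ) : ℝ) -
      mext (2 ^ q) (countVal v (z ^ 41) T i) y| ≤ (1 / (z : ℝ)) ^ 40 / 2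

/-- For a target that some allocation reaches, greedy rounds and rounding lose little more than a
fraction `1 / e` and the value of one item. -/
theorem GoodBits.solveP_value (hv : ∀ i, IsValuation (v i)) {z q : ℕ} (hz : 3 ≤ z) (hn : 0 < n)
    (hnz : n ≤ z) (hmz : m ≤ z) (hnm : n * m ≤ z ^ 2) (hq : z ^ 24 ≤ 2 ^ q)
    (hq' : 2 ^ q < 2 * z ^ 24) {T : ℝ} (hT : 0 < T) {β tau : ℕ → ℕ} (hg : GoodBits v z q T β)
    (htau : ∀ i < z ^ 120 * m, tau i = dec β (i * q) q) {s : State}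
    (hc : Ctx n m (parOf z q tau) T s) (hsteps : s.reg rSteps = z ^ 2) {A : Fin m → Fin n}
    (hA : ∀ i, T ≤ v i (bundle A i)) {e : ℝ} (he0 : 0 ≤ e) (he : ∀ i j, v i {j} ≤ e) :
    T * (1 - 1 / Real.exp 1 - (1 / (z : ℝ) - (1 / (z : ℝ)) ^ 5)) - e ≤
      (solveP.run v s).real lMin 0 := by
  obtain ⟨h0, h1, hη1, hη2⟩ := eta_bounds (show 0 < z by omega) q tau
  obtain ⟨η, hη⟩ : ∃ η, η = -Real.log (parOf z q tau).rho * ((z ^ 120 * z ^ 41 : ℕ) : ℝ) :=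
    ⟨_, rfl⟩
  rw [← hη] at hη1 hη2
  obtain ⟨Z, hZ⟩ : ∃ Z : ℝ, Z = z := ⟨_, rfl⟩
  obtain ⟨x, hx⟩ : ∃ x : ℝ, x = 1 / (z : ℝ) := ⟨_, rfl⟩
  have hZ3 : 3 ≤ Z := by rw [hZ]; exact_mod_cast hz
  have hZx : Z * x = 1 := by rw [hx, ← hZ]; field_simp
  have hx0 : 0 < x := by rw [hx, ← hZ]; positivity
  have hx3 : x ≤ 1 / 3 := by nlinarith
  have hQ1 : Z ^ 24 ≤ ((2 ^ q : ℕ) : ℝ) := by rw [hZ]; exact_mod_cast hq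
  have hQ2 : ((2 ^ q : ℕ) : ℝ) ≤ 2 * Z ^ 24 := by rw [hZ]; exact_mod_cast hq'.le
  have hQ0 : (0 : ℝ) < ((2 ^ q : ℕ) : ℝ) := by positivity
  have hnR : (1 : ℝ) ≤ n := by exact_mod_cast hn
  have hnZ : (n : ℝ) ≤ Z := by rw [hZ]; exact_mod_cast hnz
  have hmZ : (m : ℝ) ≤ Z := by rw [hZ]; exact_mod_cast hmz
  rw [← hZ] at hη1 hη2
  have hη0 : 0 ≤ η := le_trans (by positivity) hη1
  obtain ⟨g1, g2, g3, g4⟩ :=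
    greedy_params hZ3 hZx hQ1 hQ2 hη0 hη2 hmZ
  have hM : 1 / ((z ^ 41 : ℕ) : ℝ) = x ^ 41 := by
    rw [hx]; push_cast; rw [one_div_pow]
  have ha : Approx n m (2 ^ q) (truncVal v T) (Gh v (parOf z q tau) T)
      ((z ^ 120 * z ^ 41 : ℕ) : ℝ) (x ^ 40) := by
    refine approx_Gh (par := parOf z q tau) (τ := threshold β m q) hv hT (by simp [parOf]) (by
      simp only [parOf]; positivity) (by simp only [parOf]; positivity) (fun s hs j => ?_)
      (δ₀ := x ^ 40 / 2) ?_ (fun i hi y hy => ?_)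
    · simp only [parOf] at hs ⊢
      refine htau _ ?_
      calc s * m + j < s * m + m := by have := j.2; omega
        _ = (s + 1) * m := by ring
        _ ≤ z ^ 120 * m := Nat.mul_le_mul_right _ hs
    · simp only [parOf]
      rw [hM, pow_succ]
      nlinarith [pow_pos hx0 40]
    · rw [hx]
      exact hg i hi y hy
  have hAtr : ∀ i : Fin n, truncVal v T i (bundle A i) = 1 := by
    intro i
    simp only [truncVal, oracle, i.2, dif_pos, Fin.eta]
    refine min_eq_right ?_
    rw [one_le_div hT]
    exact hA i
  have key := MaxMin.solveP_value v hc hn hT (g := truncVal v T)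
    (W := ((z ^ 120 * z ^ 41 : ℕ) : ℝ)) (δ := x ^ 40) (d := x ^ 7 + 2 * x ^ 40) (e := e / T)
    (b := 1 - 1 / Real.exp 1 - 1 / ((2 ^ q : ℕ) : ℝ) - Real.log (9 * n) / η - x ^ 40)
    (fun i S => by
      simp only [truncVal, oracle, i.2, dif_pos, Fin.eta]
      exact min_le_left _ _) ha (by positivity)
    (by
      refine add_le_add_left (le_of_eq ?_) _
      simp only [parOf]
      push_cast
      rw [← hZ, ← pow_add, div_eq_iff (by positivity)]
      have := pow_mul_inv_pow hZx 7 0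
      norm_num at this
      calc Z ^ 154 = Z ^ 154 * (Z ^ 7 * x ^ 7) := by rw [this, mul_one]
        _ = x ^ 7 * Z ^ (120 + 41) := by ring)
    (by
      simp only [parOf]
      have h5 : 1 / ((2 ^ q : ℕ) : ℝ) ≤ x ^ 24 := by
        rw [div_le_iff₀ hQ0]
        have := pow_mul_inv_pow hZx 24 0
        norm_num at this
        calc (1 : ℝ) = x ^ 24 * Z ^ 24 := by rw [mul_comm, this]
          _ ≤ _ := by gcongr
      have h6 := pow_add_le hx0.le hx3 33 7
      have h7 := pow_add_le hx0.le hx3 17 7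
      norm_num at h6 h7
      have h8 : 2 * x ^ 40 + 1 / ((2 ^ q : ℕ) : ℝ) ≤ x ^ 7 := by
        linarith [pow_pos hx0 7]
      have := pow_mul_inv_pow hZx 7 0
      norm_num at this
      push_cast at h8 ⊢
      rw [← hZ]
      calc Z ^ 120 * Z ^ 41 * (2 * x ^ 40 + 1 / 2 ^ q) ≤ Z ^ 120 * Z ^ 41 * x ^ 7 := by gcongr
        _ = Z ^ 154 * (Z ^ 7 * x ^ 7) := by ring
        _ = Z ^ 154 := by rw [this, mul_one])
    (fun i hi j => by
      simp only [truncVal, oracle, hi, dif_pos]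
      refine (min_le_left _ _).trans ?_
      have := he ⟨i, hi⟩ j
      gcongr)
    (by positivity) (by rw [hsteps]; exact hnm)
    (fun y hy i hi => by
      have h5 := hy.estimate_ge ha h0 h1 hη A hAtr (by positivity) g1 g2 g3 g4 hi
      have h6 := ha.close i hi (y i) (fun j => hy.props.1 i j)
      simp only [parOf] at h5 h6 ⊢
      have h7 := (abs_le.mp h6).2
      linarith)
  have herr := error_le hZ3 hZx hQ1 hη1 hnR hnZ
  rw [hsteps] at key
  push_cast at key herr
  rw [← hZ] at key
  rw [← hx]
  refine le_trans ?_ key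
  have e1 : T * (e / T) = e := by field_simp
  rw [mul_sub T _ (e / T), e1]
  have : 1 - 1 / Real.exp 1 - (x - x ^ 5) ≤ 1 - 1 / Real.exp 1 - 1 / 2 ^ q -
      Real.log (9 * n) / η - x ^ 40 - Z ^ 2 * (x ^ 7 + 2 * x ^ 40) := by linarith
  have := mul_le_mul_of_nonneg_left this hT.le
  linarith

/-- Some multiple of the value of a single item, in units of `z ^ 5`, lies just below `f S`: the
largest item of `S` has value at most `f S`, and at least `f S / m`. -/
theorem IsValuation.exists_target {f : Finset (Fin m) → ℝ} (hf : IsValuation f)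
    {S : Finset (Fin m)} (hS : 0 < f S) {z : ℕ} (hz : 0 < z) (hm : m ≤ z) :
    ∃ j, ∃ c < z ^ 6, 0 < ((c + 1 : ℕ) : ℝ) * f {j} / ((z ^ 5 : ℕ) : ℝ) ∧
      ((c + 1 : ℕ) : ℝ) * f {j} / ((z ^ 5 : ℕ) : ℝ) ≤ f S ∧
      f S - f S * (1 / (z : ℝ)) ^ 5 ≤ ((c + 1 : ℕ) : ℝ) * f {j} / ((z ^ 5 : ℕ) : ℝ) := by
  have hne : S.Nonempty := by
    rw [Finset.nonempty_iff_ne_empty]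
    rintro rfl
    exact hS.ne' hf.empty
  obtain ⟨j, hj, hmax⟩ := S.exists_max_image (fun j => f {j}) hne
  have h1 : f S ≤ m * f {j} := by
    have h2 := (hf.le_sum S).trans (Finset.sum_le_card_nsmul S _ _ hmax)
    rw [nsmul_eq_mul] at h2
    refine h2.trans (mul_le_mul_of_nonneg_right ?_ (hf.nonneg _))
    exact_mod_cast (Finset.card_le_univ S).trans (Fintype.card_fin m).le
  have hV : 0 < f {j} := by
    refine lt_of_le_of_ne (hf.nonneg _) fun h => ?_
    rw [← h, mul_zero] at h1
    linarith
  have hVS : f {j} ≤ f S := hf.mono _ _ (Finset.singleton_subset_iff.mpr hj)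
  have hZ : (1 : ℝ) ≤ z := by exact_mod_cast hz
  have hU : 1 ≤ (z : ℝ) ^ 5 := one_le_pow₀ hZ
  have hU0 : 0 < (z : ℝ) ^ 5 := by linarith
  have hx0 : 0 ≤ f S * (z : ℝ) ^ 5 / f {j} := by positivity
  have hx1 : 1 ≤ f S * (z : ℝ) ^ 5 / f {j} := by
    rw [le_div_iff₀ hV]
    nlinarith
  have hfl : 1 ≤ ⌊f S * (z : ℝ) ^ 5 / f {j}⌋₊ := (Nat.one_le_floor_iff _).mpr hx1
  have hle := Nat.floor_le hx0
  have hlt := Nat.lt_floor_add_one (f S * (z : ℝ) ^ 5 / f {j})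
  rw [le_div_iff₀ hV] at hle
  rw [div_lt_iff₀ hV] at hlt
  refine ⟨j, ⌊f S * (z : ℝ) ^ 5 / f {j}⌋₊ - 1, ?_, ?_⟩
  · have h3 : f S * (z : ℝ) ^ 5 / f {j} ≤ ((z ^ 6 : ℕ) : ℝ) := by
      rw [div_le_iff₀ hV]
      have hmZ : (m : ℝ) ≤ z := by exact_mod_cast hm
      push_cast
      calc f S * (z : ℝ) ^ 5 ≤ m * f {j} * (z : ℝ) ^ 5 := by gcongr
        _ ≤ z * f {j} * (z : ℝ) ^ 5 := by gcongr
        _ = (z : ℝ) ^ 6 * f {j} := by ring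
    have h4 := Nat.floor_le_of_le h3
    omega
  · rw [Nat.sub_add_cancel hfl]
    have h5 : (0 : ℝ) < ⌊f S * (z : ℝ) ^ 5 / f {j}⌋₊ := by exact_mod_cast hfl
    push_cast
    refine ⟨by positivity, by rwa [div_le_iff₀ hU0], ?_⟩
    rw [le_div_iff₀ hU0, one_div_pow, sub_mul, mul_assoc, one_div_mul_cancel hU0.ne', mul_one]
    linarith

theorem minValue_nonneg (hv : ∀ i, IsValuation (v i)) (A : Fin m → Fin n) : 0 ≤ minValue v A :=
  Real.iInf_nonneg fun i => (hv i).nonneg _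

/-- The optimum is the value of the worst-off agent in some allocation. -/
theorem exists_eq_OPT (v : Fin n → Finset (Fin m) → ℝ) (hn : 0 < n) :
    ∃ (A : Fin m → Fin n) (i : Fin n), OPT v = v i (bundle A i) ∧
      ∀ i', OPT v ≤ v i' (bundle A i') := by
  have : Nonempty (Fin n) := ⟨⟨0, hn⟩⟩
  obtain ⟨A, hA⟩ := exists_eq_ciSup_of_finite (f := fun A : Fin m → Fin n => minValue v A)
  obtain ⟨i, hi⟩ := exists_eq_ciInf_of_finite (f := fun i : Fin n => v i (bundle A i))
  have h : OPT v = minValue v A := hA.symm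
  refine ⟨A, i, h.trans hi.symm, fun i' => ?_⟩
  rw [h]
  exact ciInf_le (Set.finite_range _).bddBelow i'

/-- The complement of an event with few outcomes has high probability. -/
theorem coinProb_ge {T : ℕ} {E B : Set (Fin T → Bool)} {p : ℝ} (hB : (B.ncard : ℝ) ≤ p * 2 ^ T)
    (h : ∀ r, r ∉ B → r ∈ E) : 1 - p ≤ coinProb E := by
  have h1 : (Set.univ : Set (Fin T → Bool)).ncard ≤ (E ∪ B).ncard :=
    Set.ncard_le_ncard (fun r _ => by
      by_cases hr : r ∈ B
      exacts [Or.inr hr, Or.inl (h r hr)]) (Set.toFinite _)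
  have h2 := h1.trans (Set.ncard_union_le E B)
  rw [Set.ncard_univ, Nat.card_eq_fintype_card, Fintype.card_fun, Fintype.card_bool,
    Fintype.card_fin] at h2
  have h3 : (2 : ℝ) ^ T ≤ E.ncard + B.ncard := by exact_mod_cast h2
  have h4 : (0 : ℝ) < 2 ^ T := by positivity
  unfold coinProb
  rw [le_div_iff₀ h4]
  linarith

/-- For good random bits, the run on the right target reaches the guarantee. -/
theorem Ready.guarantee (hv : ∀ i, IsValuation (v i)) {z q : ℕ} (hz : 3 ≤ z) (hn : 0 < n)
    (hnz : n ≤ z) (hmz : m ≤ z) (hnm : n * m ≤ z ^ 2) (hq : z ^ 24 ≤ 2 ^ q)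
    (hq' : 2 ^ q < 2 * z ^ 24) {T : ℝ} (hT : 0 < T) (hTO : T ≤ OPT v)
    (hOT : OPT v - OPT v * (1 / (z : ℝ)) ^ 5 ≤ T) {i : Fin n} {j : Fin m} {c : ℕ} (hc : c < z ^ 6)
    (hTc : T = ((c + 1 : ℕ) : ℝ) * v i {j} / ((z ^ 5 : ℕ) : ℝ)) {β : ℕ → ℕ}
    (hg : GoodBits v z q T β) {s : State} (hr : Ready n m z q β s) (hk : Kept v s) {ε : ℝ}
    (hε : 0 ≤ ε) (hsmall : ∀ i j, v i {j} ≤ ε * OPT v) :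
    (1 - 1 / Real.exp 1 - ε - 1 / (z : ℝ)) * OPT v ≤ (mainP.run v s).real lBest 0 := by
  obtain ⟨A, -, -, hA⟩ := exists_eq_OPT v hn
  obtain ⟨s₁, hc₁, hst, hle⟩ := (mainP_spec v hr.ctx hn hk).2 i j c (by rw [hr.cand]; exact hc)
  rw [hr.unit, ← hTc] at hc₁
  have hO : 0 ≤ OPT v := hT.le.trans hTO
  have h1 := hg.solveP_value hv hz hn hnz hmz hnm hq hq' hT hr.tau hc₁ (hst.trans hr.steps)
    (fun i => hTO.trans (hA i)) (mul_nonneg hε hO) hsmall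
  refine le_trans ?_ (h1.trans hle)
  obtain ⟨x, hx⟩ : ∃ x : ℝ, x = 1 / (z : ℝ) := ⟨_, rfl⟩
  obtain ⟨w, hw⟩ : ∃ w : ℝ, w = 1 - 1 / Real.exp 1 := ⟨_, rfl⟩
  rw [← hx] at hOT ⊢
  rw [← hw]
  have hZ3 : (3 : ℝ) ≤ z := by exact_mod_cast hz
  have hx0 : 0 < x := by rw [hx]; positivity
  have hx3 : x ≤ 1 / 3 := by
    rw [hx]
    gcongr
  have hw0 : 0 ≤ w := by
    have : 1 / Real.exp 1 ≤ 1 := by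
      rw [div_le_one (Real.exp_pos 1)]
      linarith [Real.add_one_le_exp 1]
    linarith
  have hw1 : w ≤ 1 := by
    have : 0 ≤ 1 / Real.exp 1 := by positivity
    linarith
  have hx5 : x ^ 5 ≤ x := by
    have := pow_add_le hx0.le hx3 4 1
    norm_num at this
    linarith
  have e1 : OPT v * w - OPT v * x ^ 5 ≤ T * w := by
    have h2 := mul_le_mul_of_nonneg_right hOT hw0
    have h3 : OPT v * x ^ 5 * w ≤ OPT v * x ^ 5 * 1 := by gcongr
    linarith
  have e2 : T * (x - x ^ 5) ≤ OPT v * (x - x ^ 5) :=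
    mul_le_mul_of_nonneg_right hTO (by linarith)
  linarith

end

end MaxMin

theorem mainTheorem3 :
    ∃ (alg : MaxMin.Cmd) (C d : ℕ), ∀ (n m k : ℕ), 0 < n → 0 < k →
      ∀ v : Fin n → Finset (Fin m) → ℝ, (∀ i, MaxMin.IsValuation (v i)) →
        (∀ r : Fin (C * (n + m + k) ^ d) → Bool,
          ∃ A : Fin m → Fin n, MaxMin.Outputs alg k v r A) ∧
        ∀ ε : ℝ, 0 ≤ ε → (∀ i j, v i {j} ≤ ε * MaxMin.OPT v) →
          1 - 1 / (k : ℝ) ≤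
            MaxMin.coinProb {r : Fin (C * (n + m + k) ^ d) → Bool |
              ∃ A : Fin m → Fin n, MaxMin.Outputs alg k v r A ∧
                (1 - 1 / Real.exp 1 - ε - 1 / (k : ℝ)) * MaxMin.OPT v ≤
                  MaxMin.minValue v A} := by
  obtain ⟨C, d, halg⟩ := MaxMin.alg_exec
  refine ⟨MaxMin.alg, C, d, fun n m k hn hk v hv => ?_⟩
  obtain ⟨q, hq, hq', hbits, hrun⟩ := halg n m k hn hk v
  have hkept : ∀ s β, MaxMin.Ready n m (n + m + k) q β s → MaxMin.Kept v s := fun s β hr =>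
    ⟨fun _ => ⟨0, hn⟩, fun j => hr.out j, hr.best.le.trans (MaxMin.minValue_nonneg hv _)⟩
  -- every run produces an allocation at least as good as the best value found, in real array `6`
  have hout : ∀ r : Fin (C * (n + m + k) ^ d) → Bool, ∃ s A,
      MaxMin.Ready n m (n + m + k) q (MaxMin.bitsOf r) s ∧ MaxMin.Outputs MaxMin.alg k v r A ∧
        (MaxMin.mainP.run v s).real 6 0 ≤ MaxMin.minValue v A := by
    intro r
    obtain ⟨l, s, t, hl, ht, he, hr⟩ := hrun r
    obtain ⟨A, hA, hle⟩ := (MaxMin.mainP_spec v hr.ctx hn (hkept s _ hr)).1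
    exact ⟨s, A, hr, ⟨l, _, t, hl, ht, he, hA⟩, hle⟩
  refine ⟨fun r => by obtain ⟨s, A, -, h, -⟩ := hout r; exact ⟨A, h⟩, fun ε hε hsmall => ?_⟩
  have hk1 : (0 : ℝ) < k := by exact_mod_cast hk
  obtain ⟨A₀, i, hi, -⟩ := MaxMin.exists_eq_OPT v hn
  rcases ((hv i).nonneg (MaxMin.bundle A₀ i)).eq_or_lt with h0 | h0
  · -- for optimum zero every allocation will do
    refine MaxMin.coinProb_ge (B := ∅) (by simp) fun r _ => ?_
    obtain ⟨s, A, -, h, -⟩ := hout r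
    refine ⟨A, h, ?_⟩
    rw [hi, ← h0, mul_zero]
    exact MaxMin.minValue_nonneg hv A
  · have hm : 0 < m := by
      rw [Nat.pos_iff_ne_zero]
      rintro rfl
      rw [Finset.eq_empty_of_isEmpty (MaxMin.bundle A₀ i), (hv i).empty] at h0
      exact h0.false
    obtain ⟨z, hz⟩ : ∃ z, z = n + m + k := ⟨_, rfl⟩
    obtain ⟨j, c, hc, hT, hTO, hOT⟩ := (hv i).exists_target h0 (show 0 < z by omega)
      (show m ≤ z by omega)
    rw [← hi] at hTO hOT
    obtain ⟨T, hTc⟩ : ∃ T : ℝ, T = ((c + 1 : ℕ) : ℝ) * v i {j} / ((z ^ 5 : ℕ) : ℝ) := ⟨_, rfl⟩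
    rw [← hTc] at hT hTO hOT
    rw [← hz] at hq hq'
    refine MaxMin.coinProb_ge
      (B := {r | ¬ MaxMin.GoodBits v z q T (MaxMin.bitsOf r)}) ?_ fun r hr => ?_
    · have hZ : (0 : ℝ) < z := by exact_mod_cast (show 0 < z by omega)
      have hx : (1 / (z : ℝ)) ^ 40 ≤ 1 := by
        refine pow_le_one₀ (by positivity) ?_
        rw [div_le_one hZ]
        exact_mod_cast (show 1 ≤ z by omega)
      have h1 := MaxMin.card_bad_le (n := n) (q := q) (N := z ^ 120) (T := C * (n + m + k) ^ d)
        (MaxMin.countVal v (z ^ 41) T) (MaxMin.countVal_nonneg _) (MaxMin.countVal_le_one _)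
        (Nat.pow_pos (by omega)) (by rw [hz]; exact hbits) (δ := (1 / (z : ℝ)) ^ 40 / 2)
        (by positivity) (by linarith)
      refine h1.trans (mul_le_mul_of_nonneg_right ?_ (by positivity))
      have h2 := MaxMin.failure_le (z := z) (n := n) (m := m) (k := k) (by omega) (by omega)
        (by omega) hk (by omega) (Q := 2 ^ q) (by positivity) (by exact_mod_cast hq'.le)
      push_cast
      exact h2
    · obtain ⟨s, A, hrd, h, hle⟩ := hout r
      refine ⟨A, h, le_trans ?_ hle⟩
      have hkeep := hkept s _ hrd
      have hrd' : MaxMin.Ready n m z q (MaxMin.bitsOf r) s := by rw [hz]; exact hrd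
      have hgood : MaxMin.GoodBits v z q T (MaxMin.bitsOf r) := by
        by_contra hcon
        exact hr hcon
      have hnm : n * m ≤ z ^ 2 := by
        rw [pow_two]
        exact Nat.mul_le_mul (by omega) (by omega)
      refine le_trans ?_ (hrd'.guarantee hv (by omega) hn (by omega) (by omega) hnm hq hq' hT hTO hOT
        hc hTc hgood hkeep hε hsmall)
      have hkz : 1 / (z : ℝ) ≤ 1 / k := by
        gcongr
        omega
      have hO : 0 ≤ MaxMin.OPT v := hT.le.trans hTO
      gcongr
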